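/- **Strings.** A wildcard string over a finite nonempty alphabet $\Sigma$ is a string $S$ of length $n$ over $\Sigma\cup\{\phi\}$, where the wildcard $\phi\notin\Sigma$ matches every character; two characters mismatch if both are letters and they differ. $H(S,T)$ is the number of mismatching positions of two strings of equal length, and $S^R$ is the reverse of $S$. For $k\in\mathbb N$, a string $X$ is a $k$-palindrome if $\frac12 H(X,X^R)\le k$. An interval $[i..j]$ of positions of $S$ is a maximal $k$-palindrome of $S$ if $S[i..j]$ is a $k$-palindrome and $[i-1..j+1]$ is not contained in $[1..n]$ or $S[i-1..j+1]$ is not a $k$-palindrome; its center is $\frac{i+j}2$ and its radius is $\lceil\frac{j-i}2\rceil$ (the empty interval $j=i-1$ is allowed, with radius $0$). For each of the $2n-1$ centers $c\in\{1,\frac32,2,\dots,n\}$, let $r_c$ be the radius of the maximal $k$-palindrome with center $c$. The counting self-convolution of $S$ is the array $C[1..2n-1]$ with $C[i]=H(S[1..i],\,S^R[n-i+1..n])$ for $i\le n$ and $C[i]=H(S[i-n+1..n],\,S^R[1..2n-i])$ for $i>n$. Write $$f_S(n)=n\cdot\min\bigl(|\Sigma|\log n,\ \sqrt{n\log n}\bigr).$$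 **Model.** Deterministic algorithms on a unit-cost word RAM (addition, truncated subtraction, multiplication, integer division with remainder, comparisons, indirect addressing) whose words have at least $C\log_2(n+2)$ bits, for a constant $C$ of the algorithm, and are large enough to hold every letter and number of the input. Space is counted in words and includes input and output. In the time bounds below, $O(g)$ means at most $C\,(1+g)$, with an absolute constant $C$ that does not depend on $S$, $n$, $\Sigma$, $k$, $\epsilon$ or the word size (the additive $1$ matters only for $n\le 1$). **Theorem.** 1. *(Counting convolution.)* There is an algorithm that, given $S$, computes the counting self-convolution of $S$ in $O(f_S(n))$ time and $O(n)$ space. 2. *(Precise algorithm.)* There is an algorithm that, given $S$ and $k$, computes $r_c$ for every center $c$ in $O(n)$ space and $O\bigl(n\sqrt{f_S(n)}\bigr)$ time, and hence in $O\bigl(n^{7/4}\log^{1/4}n\bigr)$ time for every alphabet. For alphabets of constant size, the same algorithm runs in $O_{|\Sigma|}\bigl(n\sqrt{n\log n}\bigr)$ time, the bound that holds for palindromes without mismatches. 3. *($(1+\epsilon)$-approximation.)* There is an algorithm that, given $S$, $k$ and a rational $0<\epsilon\le\frac12$ as a fraction of two positive integers, computes for every center $c$ a natural number $\tilde R[c]$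 with $\tilde R[c]\le r_c\le(1+\epsilon)\tilde R[c]$, in $O(n)$ space and $O\bigl(\frac1\epsilon f_S(n)\log n\bigr)$ time. For alphabets of constant size, the same algorithm runs in $O_{|\Sigma|}\bigl(\frac1\epsilon n\log^2 n\bigr)$ time, the bound that holds for palindromes without mismatches. None of the algorithms is given $\Sigma$; the bounds hold for every nonempty $\Sigma$ that contains the letters of $S$. The constant in $O_{|\Sigma|}$ depends on $|\Sigma|$ only. -/

import Mathlib

/-! ### Wildcard strings, Hamming distance, counting convolution -/

/-- A wildcard string: `some a` is the letter `a`, `none` is the wildcard.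
Letters are natural numbers. -/
abbrev WString := List (Option ℕ)

/-- `S` is a wildcard string over the alphabet `A` (the wildcard is not a member of `A`). -/
def WString.Over (S : WString) (A : Finset ℕ) : Prop := ∀ a : ℕ, some a ∈ S → a ∈ A

/-- Two characters mismatch when both are letters and they differ. -/
def mismatch : Option ℕ → Option ℕ → Bool
  | some a, some b => a != b
  | _, _ => false

/-- Hamming distance of two strings of equal length: the number of mismatching positions. -/
def hamming (S T : WString) : ℕ := (S.zip T).countP fun p => mismatch p.1 p.2

/-- The counting convolution of `T` and `P`, where `P.length ≤ T.length`, at the 1-based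
index `i`, for `1 ≤ i ≤ T.length + P.length - 1`. -/
def cconv (T P : WString) (i : ℕ) : ℕ :=
  if i < P.length then hamming (T.take i) (P.drop (P.length - i))
  else if i ≤ T.length then hamming ((T.drop (i - P.length)).take P.length) P
  else hamming (T.drop (i - P.length)) (P.take (T.length + P.length - i))

/-! ### Maximal `k`-palindromes -/

/-- Palindromic mismatch count: half the Hamming distance between a string and its reverse. -/
def palMismatchCount (S : WString) : ℚ := (hamming S S.reverse : ℚ) / 2

def IsKPalindrome (k : ℕ) (S : WString) : Prop := palMismatchCount S ≤ k

/-- The factor at the 0-based positions `a, …, b - 1`, that is `S[a+1 .. b]` with 1-based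
positions. -/
def WString.factor (S : WString) (a b : ℕ) : WString := (S.drop a).take (b - a)

/-- `S[a+1 .. b]` is a `k`-palindrome, and the interval with one more position on either side
leaves `S` or is not a `k`-palindrome. -/
def IsMaximalKPalindrome (S : WString) (k a b : ℕ) : Prop :=
  a ≤ b ∧ b ≤ S.length ∧ IsKPalindrome k (S.factor a b) ∧
    ¬ (1 ≤ a ∧ b + 1 ≤ S.length ∧ IsKPalindrome k (S.factor (a - 1) (b + 1)))

/-- `r` is the radius of the maximal `k`-palindrome of `S` at the center number `c`.
The `2 * S.length - 1` centers, in 1-based positions, are `1, 3/2, 2, …, S.length`, and they are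
numbered from `0`: center number `c` is `1 + c / 2`. The interval `[a+1 .. b]` has center
`(a + 1 + b) / 2` and radius `⌈(b - a - 1) / 2⌉`, which is `⌊(b - a) / 2⌋`. -/
def IsMaxRadius (S : WString) (k c r : ℕ) : Prop :=
  ∃ a b : ℕ, a + b = c + 1 ∧ IsMaximalKPalindrome S k a b ∧ r = (b - a) / 2

/-! ### Word RAM

Structured programs over finitely many registers and a random access memory of words. There is
no wrap-around: a run in which a value `≥ W` arises, or in which an address `≥ M` is accessed, is
not a run. Thus `W` is the capacity of a word, and `M` is the number of memory cells in use. -/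

namespace RAM

inductive Op
  | add | sub | mul | div | mod | lt | eq

/-- Truncated subtraction, integer quotient and remainder; comparisons return `0` or `1`. -/
def Op.apply : Op → ℕ → ℕ → ℕ
  | .add, x, y => x + y
  | .sub, x, y => x - y
  | .mul, x, y => x * y
  | .div, x, y => x / y
  | .mod, x, y => x % y
  | .lt, x, y => if x < y then 1 else 0
  | .eq, x, y => if x = y then 1 else 0

inductive Expr
  | const (c : ℕ)
  | reg (i : ℕ)
  | load (e : Expr)
  | bin (o : Op) (e f : Expr)

structure State where
  reg : ℕ → ℕ
  mem : ℕ → ℕ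

def Expr.eval (W M : ℕ) (s : State) : Expr → Option ℕ
  | .const c => if c < W then some c else none
  | .reg i => some (s.reg i)
  | .load e => (e.eval W M s).bind fun a => if a < M then some (s.mem a) else none
  | .bin o e f => (e.eval W M s).bind fun x => (f.eval W M s).bind fun y =>
      if o.apply x y < W then some (o.apply x y) else none

/-- Every constant, register access, memory access and operation takes one step. -/
def Expr.cost : Expr → ℕ
  | .const _ => 1
  | .reg _ => 1
  | .load e => e.cost + 1
  | .bin _ e f => e.cost + f.cost + 1

inductive Prog
  | skip
  | assign (i : ℕ) (e : Expr)
  | store (e f : Expr)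
  | seq (p q : Prog)
  | ite (e : Expr) (p q : Prog)
  | while (e : Expr) (p : Prog)

/-- `Exec W M p s t s'`: with words of capacity `W` and with `M` memory cells, the program `p`
started in the state `s` halts after `t` steps in the state `s'`. -/
inductive Exec (W M : ℕ) : Prog → State → ℕ → State → Prop
  | skip (s : State) : Exec W M .skip s 1 s
  | assign (s : State) (i : ℕ) (e : Expr) (v : ℕ) (he : e.eval W M s = some v) :
      Exec W M (.assign i e) s (e.cost + 1) { s with reg := Function.update s.reg i v }
  | store (s : State) (e f : Expr) (a v : ℕ) (he : e.eval W M s = some a)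
      (hf : f.eval W M s = some v) (ha : a < M) :
      Exec W M (.store e f) s (e.cost + f.cost + 1) { s with mem := Function.update s.mem a v }
  | seq (s s₁ s₂ : State) (p q : Prog) (t₁ t₂ : ℕ) (hp : Exec W M p s t₁ s₁)
      (hq : Exec W M q s₁ t₂ s₂) : Exec W M (.seq p q) s (t₁ + t₂) s₂
  | ite_true (s s₁ : State) (e : Expr) (p q : Prog) (v t : ℕ) (he : e.eval W M s = some v)
      (hv : v ≠ 0) (hp : Exec W M p s t s₁) : Exec W M (.ite e p q) s (e.cost + 1 + t) s₁
  | ite_false (s s₁ : State) (e : Expr) (p q : Prog) (t : ℕ) (he : e.eval W M s = some 0)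
      (hq : Exec W M q s t s₁) : Exec W M (.ite e p q) s (e.cost + 1 + t) s₁
  | while_false (s : State) (e : Expr) (p : Prog) (he : e.eval W M s = some 0) :
      Exec W M (.while e p) s (e.cost + 1) s
  | while_true (s s₁ s₂ : State) (e : Expr) (p : Prog) (v t₁ t₂ : ℕ)
      (he : e.eval W M s = some v) (hv : v ≠ 0) (hp : Exec W M p s t₁ s₁)
      (hw : Exec W M (.while e p) s₁ t₂ s₂) :
      Exec W M (.while e p) s (e.cost + 1 + t₁ + t₂) s₂

/-- The word that represents a character: `0` is the wildcard, `a + 1` is the letter `a`. -/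
def encode : Option ℕ → ℕ
  | none => 0
  | some a => a + 1

/-- The input `S`, with numbers `args`: the memory holds the characters of `S` in the cells
`0, …, S.length - 1`; register `0` holds `S.length`, the next registers hold `args`; everything
else is `0`. -/
def input (S : WString) (args : List ℕ) : State where
  reg := fun i => (S.length :: args).getD i 0
  mem := fun i => encode (S.getD i none)

/-- On the input `S` with the numbers `args`, the program `p` halts with
`post out t`, where `t` is the number of steps and `out` is the final content of the memory, and
it uses at most `C * (S.length + 1)` memory cells (input and output included). This is required for
every word capacity `W` that admits the input words and is at least `(S.length + 2) ^ C`, that is,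
words of `C * log₂ (S.length + 2)` bits suffice as soon as the input fits into them. -/
def Prog.RunsOn (p : Prog) (C : ℕ) (S : WString) (args : List ℕ)
    (post : (ℕ → ℕ) → ℕ → Prop) : Prop :=
  ∀ W : ℕ, (S.length + 2) ^ C ≤ W → (∀ x ∈ S, encode x < W) → (∀ x ∈ args, x < W) →
    ∃ (t : ℕ) (s' : State),
      Exec W (C * (S.length + 1)) p (input S args) t s' ∧ post s'.mem t

end RAM

/-- `f_S(n) = n · min(|Σ| log n, √(n log n))`, for an alphabet of size `σ`. -/
noncomputable def fS (σ n : ℕ) : ℝ :=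
  n * min (σ * Real.log n) (Real.sqrt (n * Real.log n))

/-! ### A virtual machine with several arrays on top of the word RAM -/

/-! Comparing `S` with its reverse at a fixed shift means looking at the pairs of positions with a
fixed sum. A pair of non-wildcards either mismatches or carries one common letter. So the mismatches
are the self-convolution of the indicator of all non-wildcards, minus the self-convolutions of the
indicators of the single letters (`Merge.conv_sel_zero`). A letter with `x` occurrences is treated
in time `O(min (x ^ 2) T)`: either its pairs are listed, or a fast Fourier transform is run in time
`T`, of order `n log n`. The sum of `min (x ^ 2) T` is at most `|Σ| T`, and also at most the sum of
`x √T`, which is `n √T` (`letterCost_le_card_mul`, `letterCost_le_mul_sqrt`); this is the bound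
`f_S(n)`. Sorting the positions by letter brings equal letters together, so the alphabet need not be
known.

The self-convolution of a factor gives, for each center, twice the palindromic mismatch count of the
largest interval around that center inside the factor (`Pal.mism_eq_half`). Moreover a
`k`-palindrome stays one when it shrinks around its center. Precise algorithm: convolve the prefixes
that end at multiples of `B`. Each recorded radius is then within `B` of the optimum
(`best_le_of_covered`), and the rest is found character by character. If the whole string costs `G`,
this takes about `(n / B) G + n B` steps, balanced at `B` near `√G`. The value `G` is read off from
a first run, so no knowledge of `Σ` enters.

Approximation: for each scale `m = 2 ^ j`, convolve the windows of length `4 m` that end at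
multiples of some `B` of order `ε m`. Radii between `m` and `2 m` lose at most `B - 1`, a relative
error below `ε` (`best_le_of_covered_scale`, `le_of_near`). A window costs `O(m H)` with `H` a cost
per character, so one scale costs `O(n H / ε)`, and there are `O(log n)` scales.

The transform works with fixed point complex numbers in words. Each level multiplies the error by a
constant, so the total loss is polynomial in `N`, and a scale of `N ^ 64` suffices to round to the
exact integers (`FFT.Precise.round`). The roots of unity come from the half-angle formulas and
integer square roots. Correctness, running time and word size are proved together by Hoare triples
with time bounds (`Tri`) for a machine with several arrays, whose programs compile to the RAM. -/

namespace VM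

/-- Registers, and arrays: `0, …, 15` are work arrays, `16` is the start of the memory. -/
structure State where
  reg : ℕ → ℕ
  arr : ℕ → ℕ → ℕ

namespace State

def set (v : State) (i x : ℕ) : State := { v with reg := Function.update v.reg i x }

def put (v : State) (a i x : ℕ) : State :=
  { v with arr := Function.update v.arr a (Function.update (v.arr a) i x) }

@[simp] theorem set_reg (v : State) (i x j : ℕ) :
    (v.set i x).reg j = if j = i then x else v.reg j := by
  simp [set, Function.update_apply]

@[simp] theorem set_arr (v : State) (i x : ℕ) : (v.set i x).arr = v.arr := rfl

@[simp] theorem put_reg (v : State) (a i x : ℕ) : (v.put a i x).reg = v.reg := rfl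

@[simp] theorem put_arr (v : State) (a i x b j : ℕ) :
    (v.put a i x).arr b j = if b = a ∧ j = i then x else v.arr b j := by
  simp only [put, Function.update_apply]
  split_ifs <;> simp_all

end State

inductive Expr
  | const (c : ℕ)
  | reg (i : ℕ)
  | load (a : ℕ) (e : Expr)
  | bin (o : RAM.Op) (e f : Expr)

inductive Prog
  | skip
  | asg (i : ℕ) (e : Expr)
  | put (a : ℕ) (e f : Expr)
  | seq (p q : Prog)
  | ite (e : Expr) (p q : Prog)
  | while (e : Expr) (p : Prog)

/-- Number of accessible cells of the array `a`, for inputs of length `n`. -/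
def lim (n a : ℕ) : ℕ := if a < 16 then 4 * n + 4 else 2 * n

/-- Address of cell `i` of the array `a`. -/
def addr (n a i : ℕ) : ℕ := if a < 16 then (n + n) + (16 * i + a) else i

namespace Expr

instance (c : ℕ) : OfNat Expr c := ⟨.const c⟩
instance : Add Expr := ⟨.bin .add⟩
instance : Sub Expr := ⟨.bin .sub⟩
instance : Mul Expr := ⟨.bin .mul⟩
instance : Div Expr := ⟨.bin .div⟩
instance : Mod Expr := ⟨.bin .mod⟩
def lt (e f : Expr) : Expr := .bin .lt e f
def eq (e f : Expr) : Expr := .bin .eq e f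

def val (v : State) : Expr → ℕ
  | const c => c
  | reg i => v.reg i
  | load a e => v.arr a (e.val v)
  | bin o e f => o.apply (e.val v) (f.val v)

/-- The sums and products that arise are words, and the array accesses are within bounds. -/
def Ok (W n : ℕ) (v : State) : Expr → Prop
  | const c => c < 1000
  | reg _ => True
  | load a e => e.Ok W n v ∧ a ≤ 16 ∧ e.val v < lim n a
  | bin .add e f => e.Ok W n v ∧ f.Ok W n v ∧ e.val v + f.val v < W
  | bin .mul e f => e.Ok W n v ∧ f.Ok W n v ∧ e.val v * f.val v < W
  | bin _ e f => e.Ok W n v ∧ f.Ok W n v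

def compile : Expr → RAM.Expr
  | const c => .const c
  | reg i => .reg i
  | load a e => .load <| if a < 16 then
      .bin .add (.bin .add (.reg 0) (.reg 0)) (.bin .add (.bin .mul (.const 16) e.compile) (.const a))
      else e.compile
  | bin o e f => .bin o e.compile f.compile

def cost (e : Expr) : ℕ := e.compile.cost

variable (W n : ℕ) (v : State) (e f : Expr)

@[simp] theorem val_ofNat (c : ℕ) : (no_index (OfNat.ofNat c) : Expr).val v = c := rfl
@[simp] theorem val_reg (i : ℕ) : (reg i).val v = v.reg i := rfl
@[simp] theorem val_load (a : ℕ) : (load a e).val v = v.arr a (e.val v) := rfl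
@[simp] theorem val_add : (e + f).val v = e.val v + f.val v := rfl
@[simp] theorem val_sub : (e - f).val v = e.val v - f.val v := rfl
@[simp] theorem val_mul : (e * f).val v = e.val v * f.val v := rfl
@[simp] theorem val_div : (e / f).val v = e.val v / f.val v := rfl
@[simp] theorem val_mod : (e % f).val v = e.val v % f.val v := rfl
@[simp] theorem val_lt : (e.lt f).val v = if e.val v < f.val v then 1 else 0 := rfl
@[simp] theorem val_eq : (e.eq f).val v = if e.val v = f.val v then 1 else 0 := rfl
@[simp] theorem ok_ofNat (c : ℕ) : (no_index (OfNat.ofNat c) : Expr).Ok W n v ↔ c < 1000 := Iff.rfl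
@[simp] theorem ok_reg (i : ℕ) : (reg i).Ok W n v ↔ True := Iff.rfl
@[simp] theorem ok_load (a : ℕ) :
    (load a e).Ok W n v ↔ e.Ok W n v ∧ a ≤ 16 ∧ e.val v < lim n a := Iff.rfl
@[simp] theorem ok_add : (e + f).Ok W n v ↔ e.Ok W n v ∧ f.Ok W n v ∧ e.val v + f.val v < W := Iff.rfl
@[simp] theorem ok_sub : (e - f).Ok W n v ↔ e.Ok W n v ∧ f.Ok W n v := Iff.rfl
@[simp] theorem ok_mul : (e * f).Ok W n v ↔ e.Ok W n v ∧ f.Ok W n v ∧ e.val v * f.val v < W := Iff.rfl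
@[simp] theorem ok_div : (e / f).Ok W n v ↔ e.Ok W n v ∧ f.Ok W n v := Iff.rfl
@[simp] theorem ok_mod : (e % f).Ok W n v ↔ e.Ok W n v ∧ f.Ok W n v := Iff.rfl
@[simp] theorem ok_lt : (e.lt f).Ok W n v ↔ e.Ok W n v ∧ f.Ok W n v := Iff.rfl
@[simp] theorem ok_eq : (e.eq f).Ok W n v ↔ e.Ok W n v ∧ f.Ok W n v := Iff.rfl

end Expr

/-- Word and memory sizes are large enough. -/
structure Fits (W M n : ℕ) : Prop where
  mem : 66 * n + 64 ≤ M
  word : 66 * n + 64 ≤ W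
  const : 1000 ≤ W

/-- The RAM state `s` represents the state `v` of the virtual machine. -/
structure Rel (W M n : ℕ) (v : State) (s : RAM.State) : Prop where
  fits : Fits W M n
  reg : s.reg = v.reg
  zero : v.reg 0 = n
  reg_lt : ∀ i, v.reg i < W
  arr_lt : ∀ a i, v.arr a i < W
  mem : ∀ a ≤ 16, ∀ i < lim n a, s.mem (addr n a i) = v.arr a i

/-- The last cell of the last work array has address `2 n + 16 (4 n + 3) + 15 = 66 n + 63`; the
constants in `Fits` come from here. -/
theorem addr_lt {n a i : ℕ} (ha : a ≤ 16) (hi : i < lim n a) : addr n a i < 66 * n + 64 := by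
  unfold addr lim at *; split_ifs at * <;> omega

/-- The work arrays are interleaved with period 16 behind the first `2 n` cells, so quotient and
remainder by 16 recover index and array. -/
theorem addr_inj {n a i b j : ℕ} (ha : a ≤ 16) (hi : i < lim n a) (hb : b ≤ 16) (hj : j < lim n b)
    (h : addr n a i = addr n b j) : a = b ∧ i = j := by
  unfold addr lim at *; split_ifs at * <;> omega

theorem Expr.eval_compile {W M n : ℕ} {v : State} {s : RAM.State} (h : Rel W M n v s) (e : Expr)
    (he : e.Ok W n v) : e.compile.eval W M s = some (e.val v) ∧ e.val v < W := by
  have hf := h.fits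
  have := hf.mem; have := hf.word; have := hf.const
  induction e with
  | const c =>
    have : c < W := lt_of_lt_of_le he hf.const
    simp [compile, RAM.Expr.eval, val, this]
  | reg i => simp [compile, RAM.Expr.eval, val, h.reg, h.reg_lt]
  | load a e ih =>
    obtain ⟨h1, h2, h3⟩ := he
    obtain ⟨ih1, ih2⟩ := ih h1
    refine ⟨?_, h.arr_lt _ _⟩
    have h4 := addr_lt h2 h3
    have h5 := h.mem a h2 _ h3
    have h6 : s.reg 0 = n := by rw [h.reg, h.zero]
    unfold addr at h4 h5
    by_cases ha : a < 16
    · rw [if_pos ha] at h4 h5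
      have e1 : n + n < W := by omega
      have e2 : 16 < W := by omega
      have e3 : 16 * e.val v < W := by omega
      have e4 : a < W := by omega
      have e5 : 16 * e.val v + a < W := by omega
      have e6 : n + n + (16 * e.val v + a) < W := by omega
      have e7 : n + n + (16 * e.val v + a) < M := by omega
      simp [compile, ha, RAM.Expr.eval, h6, RAM.Op.apply, ih1, e1, e2, e3, e4, e5, e6, e7, h5, val]
    · rw [if_neg ha] at h4 h5
      have e7 : e.val v < M := by omega
      simp [compile, ha, RAM.Expr.eval, ih1, e7, h5, val]
  | bin o e f ihe ihf =>
    have hef : e.Ok W n v ∧ f.Ok W n v := by cases o <;> exact ⟨he.1, by first | exact he.2.1 | exact he.2⟩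
    obtain ⟨a1, a2⟩ := ihe hef.1
    obtain ⟨b1, b2⟩ := ihf hef.2
    -- Only sums and products can leave the range of words. A difference, quotient or remainder is
    -- at most its first operand, and a comparison gives 0 or 1.
    have key : o.apply (e.val v) (f.val v) < W := by
      cases o
      · exact he.2.2
      · exact lt_of_le_of_lt (Nat.sub_le _ _) a2
      · exact he.2.2
      · exact lt_of_le_of_lt (Nat.div_le_self _ _) a2
      · exact lt_of_le_of_lt (Nat.mod_le _ _) a2
      all_goals simp only [RAM.Op.apply]; split_ifs <;> omega
    simp [compile, RAM.Expr.eval, a1, b1, key, val]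

def Prog.compile : Prog → RAM.Prog
  | skip => .skip
  | asg i e => .assign i e.compile
  | put a e f => .store (if a < 16 then
      .bin .add (.bin .add (.reg 0) (.reg 0)) (.bin .add (.bin .mul (.const 16) e.compile) (.const a))
      else e.compile) f.compile
  | seq p q => .seq p.compile q.compile
  | ite e p q => .ite e.compile p.compile q.compile
  | .while e p => .while e.compile p.compile

/-- Started in the state `v`, the program halts within `T` steps in a state with property `Q`. -/
def Tri (W M n : ℕ) (p : Prog) (v : State) (T : ℕ) (Q : State → Prop) : Prop :=
  ∀ s, Rel W M n v s → ∃ t s' v', RAM.Exec W M p.compile s t s' ∧ t ≤ T ∧ Rel W M n v' s' ∧ Q v'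

infixr:60 " ;; " => Prog.seq
infix:62 " ≔ " => Prog.asg

/-! ### Proof rules for running times -/

section Rules

variable {W M n : ℕ} {p q : Prog} {v : State} {T T₁ T₂ : ℕ} {Q R : State → Prop} {e f : Expr}

theorem Tri.mono (h : Tri W M n p v T Q) {T' : ℕ} (hT : T ≤ T') {Q' : State → Prop}
    (hQ : ∀ v, Q v → Q' v) : Tri W M n p v T' Q' := by
  intro s hs
  obtain ⟨t, s', v', h1, h2, h3, h4⟩ := h s hs
  exact ⟨t, s', v', h1, h2.trans hT, h3, hQ _ h4⟩

theorem Tri.imp (h : Tri W M n p v T Q) {Q' : State → Prop}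
    (hQ : ∀ v, Q v → Q' v) : Tri W M n p v T Q' := h.mono le_rfl hQ

/-- A triple only concerns states that some RAM state represents, so the facts recorded in `Rel` may
be assumed: register 0 holds `n`, and all contents are words. -/
theorem Tri.of_bounds (h : Fits W M n → v.reg 0 = n → (∀ i, v.reg i < W) → (∀ a i, v.arr a i < W) →
    Tri W M n p v T Q) : Tri W M n p v T Q :=
  fun s hs => h hs.fits hs.zero hs.reg_lt hs.arr_lt s hs

theorem Tri.skip (hQ : Q v) : Tri W M n .skip v 1 Q :=
  fun s hs => ⟨1, s, v, .skip s, le_rfl, hs, hQ⟩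

theorem Tri.asg {i : ℕ} (hi : i ≠ 0) (he : e.Ok W n v) (hQ : Q (v.set i (e.val v))) :
    Tri W M n (i ≔ e) v (e.cost + 1) Q := by
  intro s hs
  obtain ⟨h1, h2⟩ := e.eval_compile hs he
  refine ⟨_, _, v.set i (e.val v), .assign s i _ _ h1, le_rfl, ⟨hs.fits, ?_, ?_, ?_, hs.arr_lt, hs.mem⟩, hQ⟩
  · simp [State.set, hs.reg]
  · simp [hi.symm, hs.zero]
  · intro j; simp only [State.set_reg]; split_ifs
    · exact h2
    · exact hs.reg_lt j

/-- Of the 9 extra steps, 8 compute the address in an interleaved array and one is the store itself.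
-/
theorem Tri.put {a : ℕ} (he : e.Ok W n v) (hf : f.Ok W n v) (ha : a ≤ 16) (hl : e.val v < lim n a)
    (hQ : Q (v.put a (e.val v) (f.val v))) :
    Tri W M n (.put a e f) v (e.cost + f.cost + 9) Q := by
  intro s hs
  obtain ⟨h1, h2⟩ := (Expr.load a e).eval_compile hs ⟨he, ha, hl⟩
  obtain ⟨g1, g2⟩ := f.eval_compile hs hf
  have h3 := addr_lt ha hl
  have hM := hs.fits.mem
  have h0 : s.reg 0 = n := by rw [hs.reg, hs.zero]
  obtain ⟨b1, b2⟩ := e.eval_compile hs he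
  have key : (if a < 16 then
      RAM.Expr.bin .add (.bin .add (.reg 0) (.reg 0)) (.bin .add (.bin .mul (.const 16) e.compile) (.const a))
      else e.compile).eval W M s = some (addr n a (e.val v)) := by
    have := hs.fits.word
    unfold addr at h3 ⊢
    by_cases h16 : a < 16
    · rw [if_pos h16] at h3
      have e1 : n + n < W := by omega
      have e2 : 16 < W := by omega
      have e3 : 16 * e.val v < W := by omega
      have e4 : a < W := by omega
      have e5 : 16 * e.val v + a < W := by omega
      have e6 : n + n + (16 * e.val v + a) < W := by omega
      simp [h16, RAM.Expr.eval, h0, RAM.Op.apply, b1, e1, e2, e3, e4, e5, e6]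
    · simp [h16, b1]
  refine ⟨_, _, v.put a (e.val v) (f.val v), .store s _ _ _ _ key g1 (h3.trans_le hM), ?_,
    ⟨hs.fits, hs.reg, hs.zero, hs.reg_lt, ?_, ?_⟩, hQ⟩
  · simp only [Expr.cost]; split_ifs
    · simp only [RAM.Expr.cost]; omega
    · omega
  · intro b j; simp only [State.put_arr]; split_ifs
    · exact g2
    · exact hs.arr_lt b j
  · intro b hb j hj
    simp only [State.put_arr, Function.update_apply]
    by_cases c : addr n b j = addr n a (e.val v)
    · rw [if_pos c, if_pos (addr_inj hb hj ha hl c)]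
    · rw [if_neg c, if_neg (fun h => c (by rw [h.1, h.2])), hs.mem b hb j hj]

theorem Tri.seq (hp : Tri W M n p v T₁ R) (hq : ∀ v, R v → Tri W M n q v T₂ Q) :
    Tri W M n (p ;; q) v (T₁ + T₂) Q := by
  intro s hs
  obtain ⟨t, s', v', h1, h2, h3, h4⟩ := hp s hs
  obtain ⟨t', s'', v'', g1, g2, g3, g4⟩ := hq v' h4 s' h3
  exact ⟨_, _, _, .seq s s' s'' _ _ t t' h1 g1, by omega, g3, g4⟩

theorem Tri.ite (he : e.Ok W n v) (hp : e.val v ≠ 0 → Tri W M n p v T Q)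
    (hq : e.val v = 0 → Tri W M n q v T Q) : Tri W M n (.ite e p q) v (e.cost + 1 + T) Q := by
  intro s hs
  obtain ⟨h1, h2⟩ := e.eval_compile hs he
  by_cases h : e.val v = 0
  · obtain ⟨t, s', v', g1, g2, g3, g4⟩ := hq h s hs
    rw [h] at h1
    exact ⟨_, _, _, .ite_false s s' _ _ _ t h1 g1, by simp only [Expr.cost]; omega, g3, g4⟩
  · obtain ⟨t, s', v', g1, g2, g3, g4⟩ := hp h s hs
    exact ⟨_, _, _, .ite_true s s' _ _ _ _ t h1 h g1, by simp only [Expr.cost]; omega, g3, g4⟩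

/-- A loop with at most `k` iterations; the invariant `I i` holds with `i` iterations left. -/
theorem Tri.while_le (I : ℕ → State → Prop) (B : ℕ → ℕ) (k : ℕ) (h0 : I k v)
    (hok : ∀ i ≤ k, ∀ v, I i v → e.Ok W n v)
    (step : ∀ i ≤ k, ∀ v, I i v → e.val v ≠ 0 → 0 < i ∧
      Tri W M n p v (B (i - 1)) fun v' => I (i - 1) v')
    (exit : ∀ i ≤ k, ∀ v, I i v → e.val v = 0 → Q v) :
    Tri W M n (.while e p) v (∑ i ∈ Finset.range k, (B i + (e.cost + 1)) + (e.cost + 1)) Q := by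
  induction k generalizing v with
  | zero =>
    intro s hs
    obtain ⟨h1, h2⟩ := e.eval_compile hs (hok 0 le_rfl v h0)
    by_cases h : e.val v = 0
    · rw [h] at h1
      exact ⟨_, _, _, .while_false s _ _ h1, by simp [Expr.cost], hs, exit 0 le_rfl v h0 h⟩
    · exact absurd (step 0 le_rfl v h0 h).1 (by simp)
  | succ k ih =>
    intro s hs
    obtain ⟨h1, h2⟩ := e.eval_compile hs (hok _ le_rfl v h0)
    by_cases h : e.val v = 0
    · rw [h] at h1
      exact ⟨_, _, _, .while_false s _ _ h1, by simp [Expr.cost], hs, exit _ le_rfl v h0 h⟩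
    · obtain ⟨t, s', v', g1, g2, g3, g4⟩ := (step _ le_rfl v h0 h).2 s hs
      simp only [Nat.add_sub_cancel] at g2 g4
      obtain ⟨t', s'', v'', f1, f2, f3, f4⟩ := ih g4 (fun i hi => hok i (by omega))
        (fun i hi => step i (by omega)) (fun i hi => exit i (by omega)) s' g3
      refine ⟨_, _, _, .while_true s s' s'' _ _ _ t t' h1 h g1 f1, ?_, f3, f4⟩
      rw [Finset.sum_range_succ]
      simp only [Expr.cost] at *
      omega

/-- A loop with exactly `k` iterations; the invariant `I i` holds after `i` iterations. -/
theorem Tri.while_eq (I : ℕ → State → Prop) (B : ℕ → ℕ) (k : ℕ) (h0 : I 0 v)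
    (step : ∀ i < k, ∀ v, I i v → e.Ok W n v ∧ e.val v ≠ 0 ∧ Tri W M n p v (B i) (I (i + 1)))
    (exit : ∀ v, I k v → e.Ok W n v ∧ e.val v = 0 ∧ Q v) :
    Tri W M n (.while e p) v (∑ i ∈ Finset.range k, (B i + (e.cost + 1)) + (e.cost + 1)) Q := by
  -- Counting the iterations left instead of those done reduces the claim to `Tri.while_le`.
  rw [← Finset.sum_range_reflect]
  refine (Tri.while_le (fun i v => I (k - i) v) (fun i => B (k - 1 - i)) k (by simpa using h0)
    ?_ ?_ ?_)
  · intro i hi v hv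
    rcases Nat.eq_zero_or_pos i with rfl | h
    · exact (exit v (by simpa using hv)).1
    · exact (step (k - i) (by omega) v hv).1
  · intro i hi v hv he
    rcases Nat.eq_zero_or_pos i with rfl | h
    · exact absurd (exit v (by simpa using hv)).2.1 he
    · refine ⟨h, ?_⟩
      have := (step (k - i) (by omega) v hv).2.2
      rwa [show k - i + 1 = k - (i - 1) by omega, show k - i = k - 1 - (i - 1) by omega] at this
  · intro i hi v hv he
    rcases Nat.eq_zero_or_pos i with rfl | h
    · exact (exit v (by simpa using hv)).2.2
    · exact absurd he (step (k - i) (by omega) v hv).2.1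

/-- `for r in [0, b)` -/
def Prog.for (r : ℕ) (b : Expr) (p : Prog) : Prog :=
  r ≔ 0 ;; .while ((Expr.reg r).lt b) (p ;; r ≔ Expr.reg r + 1)

/-- An iteration adds 4 steps for the increment and `b.cost + 3` for the test. The constant 12
leaves room for the initialization and the last test. The body must leave the counter unchanged. -/
theorem Tri.for {r : ℕ} {b : Expr} (I : ℕ → State → Prop) (k T : ℕ) (hr : r ≠ 0)
    (h0 : I 0 (v.set r 0))
    (hI : ∀ i ≤ k, ∀ v, I i v → v.reg r = i ∧ b.Ok W n v ∧ b.val v = k)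
    (step : ∀ i < k, ∀ v, I i v → Tri W M n p v T fun v' => v'.reg r = i ∧ I (i + 1) (v'.set r (i + 1)))
    (hk : k < W) : Tri W M n (.for r b p) v ((T + b.cost + 12) * (k + 1)) (I k) := by
  refine Tri.mono (T := 2 + _) (Tri.seq (R := I 0) (Tri.asg hr (by simp) (by simpa using h0)) fun v hv =>
    Tri.while_eq I (fun _ => T + 4) k hv ?_ ?_) ?_ fun _ h => h
  · intro i hi v hv
    obtain ⟨h1, h2, h3⟩ := hI i hi.le v hv
    refine ⟨by simpa using h2, by simp [h1, h3, hi], ?_⟩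
    refine Tri.seq (T₂ := 4) (step i hi v hv) fun v' hv' => ?_
    refine Tri.asg (e := Expr.reg r + 1) hr ?_ ?_
    · simp [hv'.1]; omega
    · simpa [hv'.1] using hv'.2
  · intro v hv
    obtain ⟨h1, h2, h3⟩ := hI k le_rfl v hv
    exact ⟨by simpa using h2, by simp [h1, h3], hv⟩
  · have : ((Expr.reg r).lt b).cost = b.cost + 2 := by
      simp only [Expr.cost, Expr.lt, Expr.compile, RAM.Expr.cost]; omega
    rw [this, Finset.sum_const, Finset.card_range, smul_eq_mul]
    have h1 : k * (T + 4 + (b.cost + 2 + 1)) + k * 5 = k * (T + b.cost + 12) := by ring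
    have h2 : (T + b.cost + 12) * (k + 1) = k * (T + b.cost + 12) + (T + b.cost + 12) := by ring
    omega

/-- Weakest precondition of a program without loops. -/
def Prog.wp (W n : ℕ) : Prog → (State → Prop) → State → Prop
  | .skip, Q, v => Q v
  | .asg i e, Q, v => i ≠ 0 ∧ e.Ok W n v ∧ Q (v.set i (e.val v))
  | .put a e f, Q, v => e.Ok W n v ∧ f.Ok W n v ∧ a ≤ 16 ∧ e.val v < lim n a ∧
      Q (v.put a (e.val v) (f.val v))
  | .seq p q, Q, v => p.wp W n (q.wp W n Q) v
  | .ite e p q, Q, v => e.Ok W n v ∧ (e.val v ≠ 0 → p.wp W n Q v) ∧ (e.val v = 0 → q.wp W n Q v)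
  | .while _ _, _, _ => False

/-- The value 0 for loops is a dummy: `Prog.wp` is false on them, so `Tri.of_wp` never uses it. -/
def Prog.time : Prog → ℕ
  | .skip => 1
  | .asg _ e => e.cost + 1
  | .put _ e f => e.cost + f.cost + 9
  | .seq p q => p.time + q.time
  | .ite e p q => e.cost + 1 + max p.time q.time
  | .while _ _ => 0

theorem Tri.of_wp (h : p.wp W n Q v) : Tri W M n p v p.time Q := by
  induction p generalizing v Q with
  | skip => exact Tri.skip h
  | asg i e => exact Tri.asg h.1 h.2.1 h.2.2
  | put a e f => exact Tri.put h.1 h.2.1 h.2.2.1 h.2.2.2.1 h.2.2.2.2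
  | seq p q ihp ihq => exact Tri.seq (ihp h) fun v hv => ihq hv
  | ite e p q ihp ihq =>
    exact Tri.ite h.1 (fun he => (ihp (h.2.1 he)).mono (le_max_left _ _) fun _ h => h)
      (fun he => (ihq (h.2.2 he)).mono (le_max_right _ _) fun _ h => h)
  | _ => exact h.elim

end Rules

/-- The states `v` and `v'` agree except on the registers in `R` and the arrays in `A`. -/
structure Frame (R A : Finset ℕ) (v v' : State) : Prop where
  reg : ∀ r ∉ R, v'.reg r = v.reg r
  arr : ∀ a ∉ A, v'.arr a = v.arr a

namespace Frame

variable {R R' A A' : Finset ℕ} {v v' v'' : State}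

theorem refl (R A : Finset ℕ) (v : State) : Frame R A v v := ⟨fun _ _ => rfl, fun _ _ => rfl⟩

theorem trans (h : Frame R A v v') (h' : Frame R A v' v'') : Frame R A v v'' :=
  ⟨fun r hr => (h'.reg r hr).trans (h.reg r hr), fun a ha => (h'.arr a ha).trans (h.arr a ha)⟩

theorem mono (h : Frame R A v v') (hR : R ⊆ R') (hA : A ⊆ A') : Frame R' A' v v' :=
  ⟨fun r hr => h.reg r fun h => hr (hR h), fun a ha => h.arr a fun h => ha (hA h)⟩

theorem set_iff {i x : ℕ} (hi : i ∈ R) : Frame R A v (v'.set i x) ↔ Frame R A v v' := by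
  constructor <;> rintro ⟨h1, h2⟩ <;> refine ⟨fun r hr => ?_, h2⟩
  · have := h1 r hr; rwa [State.set_reg, if_neg (by rintro rfl; exact hr hi)] at this
  · rw [State.set_reg, if_neg (by rintro rfl; exact hr hi)]; exact h1 r hr

theorem put_arr_of_ne {a b i x : ℕ} (h : b ≠ a) : (v.put a i x).arr b = v.arr b :=
  Function.update_of_ne h _ _

theorem put_iff {a i x : ℕ} (ha : a ∈ A) : Frame R A v (v'.put a i x) ↔ Frame R A v v' := by
  constructor <;> rintro ⟨h1, h2⟩ <;> refine ⟨h1, fun b hb => ?_⟩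
  · have := h2 b hb
    rwa [put_arr_of_ne (by rintro rfl; exact hb ha)] at this
  · rw [put_arr_of_ne (by rintro rfl; exact hb ha)]; exact h2 b hb

end Frame

end VM

/-! ### The transform over the complex numbers -/

namespace FFT

open Complex

/-- The bit reversal of `k`, as a binary fraction. -/
noncomputable def rho (k : ℕ) : ℝ :=
  if k = 0 then 0 else rho (k / 2) / 2 + (k % 2 : ℕ) / 2
decreasing_by exact Nat.div_lt_self (Nat.pos_of_ne_zero ‹_›) (by norm_num)

theorem rho_eq (k : ℕ) : rho k = rho (k / 2) / 2 + (k % 2 : ℕ) / 2 := by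
  rcases Nat.eq_zero_or_pos k with rfl | h
  · simp [rho]
  · rw [rho, if_neg h.ne']

theorem rho_zero : rho 0 = 0 := by rw [rho]; simp

theorem rho_two_mul (k : ℕ) : rho (2 * k) = rho k / 2 := by
  rw [rho_eq]; simp

theorem rho_two_mul_add_one (k : ℕ) : rho (2 * k + 1) = rho k / 2 + 1 / 2 := by
  rw [rho_eq]
  have h1 : (2 * k + 1) / 2 = k := by omega
  have h2 : (2 * k + 1) % 2 = 1 := by omega
  rw [h1, h2]; simp

/-- A new leading bit of `k` becomes the last digit of the fraction. Hence the second half of a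
table of size `2 ^ (j + 1)` is its first half times one constant, which is how the table of roots is
built by doubling. -/
theorem rho_two_pow_add (j k : ℕ) (hk : k < 2 ^ j) : rho (2 ^ j + k) = rho k + 1 / 2 ^ (j + 1) := by
  induction j generalizing k with
  | zero =>
    obtain rfl : k = 0 := by simpa using hk
    have := rho_two_mul_add_one 0
    simp [rho_zero] at this ⊢
    exact this
  | succ j ih =>
    have h1 : (2 ^ (j + 1) + k) / 2 = 2 ^ j + k / 2 := by rw [pow_succ]; omega
    have h2 : (2 ^ (j + 1) + k) % 2 = k % 2 := by rw [pow_succ]; omega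
    have h3 : k / 2 < 2 ^ j := by rw [pow_succ] at hk; omega
    rw [rho_eq, h1, h2, ih _ h3, rho_eq k]
    field_simp
    ring

/-- The twiddle factors in bit reversed order. -/
noncomputable def root (k : ℕ) : ℂ := exp ((Real.pi * rho k : ℝ) * I)

theorem norm_root (k : ℕ) : ‖root k‖ = 1 := norm_exp_ofReal_mul_I _

theorem root_zero : root 0 = 1 := by simp [root, rho_zero]

theorem root_two_pow_add (j k : ℕ) (hk : k < 2 ^ j) :
    root (2 ^ j + k) = root k * exp ((Real.pi / 2 ^ (j + 1) : ℝ) * I) := by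
  rw [root, root, ← exp_add, rho_two_pow_add j k hk]
  congr 1
  push_cast
  ring

/-- The squares of the twiddle factors. -/
noncomputable def node (k : ℕ) : ℂ := root k ^ 2

theorem norm_node (k : ℕ) : ‖node k‖ = 1 := by simp [node, norm_root]

/-- The polynomial `X ^ (2 m) - node k` is the product of `X ^ m - root k` and `X ^ m + root k`. In
bit reversed order these factors are the moduli with numbers `2 k` and `2 k + 1`. -/
theorem node_two_mul (k : ℕ) : node (2 * k) = root k := by
  rw [node, root, root, ← exp_nat_mul, rho_two_mul]
  congr 1
  push_cast
  ring

theorem node_two_mul_add_one (k : ℕ) : node (2 * k + 1) = -root k := by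
  rw [node, root, root, ← exp_nat_mul, rho_two_mul_add_one, ← mul_one (-exp _), neg_mul_comm,
    ← exp_pi_mul_I, ← exp_add]
  congr 1
  push_cast
  ring

/-- The residues of the polynomial with coefficients `x` modulo the polynomials `X ^ m - node k`,
for `k < 2 ^ l`. -/
noncomputable def trans (l m : ℕ) (x : ℕ → ℂ) (p : ℕ) : ℂ :=
  ∑ t ∈ Finset.range (2 ^ l), x (p % m + t * m) * node (p / m) ^ t

theorem sum_range_two_mul {M : Type*} [AddCommMonoid M] (f : ℕ → M) (K : ℕ) :
    ∑ t ∈ Finset.range (2 * K), f t = ∑ t ∈ Finset.range K, (f (2 * t) + f (2 * t + 1)) := by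
  induction K with
  | zero => simp
  | succ K ih => rw [mul_add_one, Finset.sum_range_succ, Finset.sum_range_succ, ih,
      Finset.sum_range_succ, add_assoc]

/-- The position of the upper end of butterfly number `q`. -/
def pos (m q : ℕ) : ℕ := 2 * m * (q / m) + q % m

theorem pos_mod' (m q : ℕ) : pos m q % m = q % m := by
  rw [pos, mul_comm 2 m, mul_assoc, Nat.mul_add_mod, Nat.mod_mod]

theorem pos_add_mod' (m q : ℕ) : (pos m q + m) % m = q % m := by
  rw [Nat.add_mod_right, pos_mod']

section pos
variable {m : ℕ} (hm : 0 < m) (q : ℕ)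
include hm

theorem pos_div : pos m q / (2 * m) = q / m := by
  have := Nat.mod_lt q hm
  rw [pos, Nat.mul_add_div (by omega), Nat.div_eq_of_lt (a := q % m) (by omega), add_zero]

theorem pos_mod : pos m q % (2 * m) = q % m := by
  have := Nat.mod_lt q hm
  rw [pos, Nat.mul_add_mod, Nat.mod_eq_of_lt (by omega)]

theorem pos_add_div : (pos m q + m) / (2 * m) = q / m := by
  have := Nat.mod_lt q hm
  rw [pos, add_assoc, Nat.mul_add_div (by omega), Nat.div_eq_of_lt (a := q % m + m) (by omega),
    add_zero]

theorem pos_add_mod : (pos m q + m) % (2 * m) = q % m + m := by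
  have := Nat.mod_lt q hm
  rw [pos, add_assoc, Nat.mul_add_mod, Nat.mod_eq_of_lt (by omega)]

theorem pos_div' : pos m q / m = 2 * (q / m) := by
  have := Nat.mod_lt q hm
  rw [pos, mul_comm 2 m, mul_assoc, Nat.mul_add_div hm, Nat.div_eq_of_lt this, add_zero]

theorem pos_add_div' : (pos m q + m) / m = 2 * (q / m) + 1 := by
  rw [Nat.add_div_right _ hm, pos_div' hm]

theorem pos_inj {q q' : ℕ} (h : pos m q = pos m q') : q = q' := by
  have h1 := pos_div hm q
  have h2 := pos_mod hm q
  rw [h, pos_div hm] at h1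
  rw [h, pos_mod hm] at h2
  rw [← Nat.div_add_mod q m, ← Nat.div_add_mod q' m, h1, h2]

theorem pos_ne {q q' : ℕ} : pos m q ≠ pos m q' + m := by
  intro h
  have h2 := pos_mod hm q
  rw [h, pos_add_mod hm] at h2
  have := Nat.mod_lt q hm
  omega

/-- The butterflies partition the positions: modulo `2 m`, upper ends have residues below `m` and
lower ends the others. -/
theorem exists_pos (p : ℕ) : ∃ q, p = pos m q ∨ p = pos m q + m := by
  refine ⟨p / (2 * m) * m + p % m, ?_⟩
  have h0 := Nat.mod_lt p hm
  have h1 : (p / (2 * m) * m + p % m) / m = p / (2 * m) := by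
    rw [mul_comm, Nat.mul_add_div hm, Nat.div_eq_of_lt h0, add_zero]
  have h2 : (p / (2 * m) * m + p % m) % m = p % m := by
    rw [mul_comm, Nat.mul_add_mod, Nat.mod_mod]
  rw [pos, h1, h2]
  have h3 := Nat.div_add_mod p (2 * m)
  have h4 : p % (2 * m) < 2 * m := Nat.mod_lt _ (by omega)
  have h5 : p % m = p % (2 * m) % m := by rw [Nat.mod_mod_of_dvd _ (dvd_mul_left m 2)]
  rcases lt_or_ge (p % (2 * m)) m with h | h
  · left; rw [h5, Nat.mod_eq_of_lt h, h3]
  · right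
    rw [h5, Nat.mod_eq_sub_mod h, Nat.mod_eq_of_lt (by omega)]
    omega

theorem pos_add_lt_iff {N : ℕ} (hN : 2 * m ∣ N) {q : ℕ} : pos m q + m < N ↔ q < N / 2 := by
  obtain ⟨K, rfl⟩ := hN
  have h1 : 2 * m * K / 2 = m * K := by rw [mul_assoc, Nat.mul_div_cancel_left _ (by norm_num)]
  rw [h1, mul_comm _ K, ← Nat.div_lt_iff_lt_mul (by omega), pos_add_div hm, mul_comm m,
    Nat.div_lt_iff_lt_mul hm]

theorem pos_lt_iff {N : ℕ} (hN : 2 * m ∣ N) {q : ℕ} : pos m q < N ↔ q < N / 2 := by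
  obtain ⟨K, rfl⟩ := hN
  have h1 : 2 * m * K / 2 = m * K := by rw [mul_assoc, Nat.mul_div_cancel_left _ (by norm_num)]
  rw [h1, mul_comm _ K, ← Nat.div_lt_iff_lt_mul (by omega), pos_div hm, mul_comm m,
    Nat.div_lt_iff_lt_mul hm]

end pos

/-- A residue modulo `X ^ (2 m) - node k` has the form `a + b X ^ m`, and it reduces to `a + root k
* b` or `a - root k * b` modulo the two factors. In the defining sum this is the splitting into even
and odd `t`. -/
theorem trans_pos {m : ℕ} (hm : 0 < m) (l : ℕ) (x : ℕ → ℂ) (q : ℕ) :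
    trans (l + 1) m x (pos m q) =
      trans l (2 * m) x (pos m q) + root (q / m) * trans l (2 * m) x (pos m q + m) := by
  simp only [trans]
  rw [pow_succ', sum_range_two_mul, pos_div hm, pos_mod hm, pos_add_div hm, pos_add_mod hm,
    pos_div' hm, pos_mod', Finset.mul_sum, ← Finset.sum_add_distrib]
  refine Finset.sum_congr rfl fun t _ => ?_
  rw [node_two_mul, node, ← pow_mul,
    show q % m + 2 * t * m = q % m + t * (2 * m) by ring,
    show q % m + (2 * t + 1) * m = q % m + m + t * (2 * m) by ring]
  ring

theorem trans_pos_add {m : ℕ} (hm : 0 < m) (l : ℕ) (x : ℕ → ℂ) (q : ℕ) :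
    trans (l + 1) m x (pos m q + m) =
      trans l (2 * m) x (pos m q) - root (q / m) * trans l (2 * m) x (pos m q + m) := by
  simp only [trans]
  rw [pow_succ', sum_range_two_mul, pos_div hm, pos_mod hm, pos_add_div hm, pos_add_mod hm,
    pos_add_div' hm, pos_add_mod', Finset.mul_sum, ← Finset.sum_sub_distrib]
  refine Finset.sum_congr rfl fun t _ => ?_
  rw [node_two_mul_add_one, node, ← pow_mul,
    show q % m + 2 * t * m = q % m + t * (2 * m) by ring,
    show q % m + (2 * t + 1) * m = q % m + m + t * (2 * m) by ring,
    pow_succ, pow_mul, neg_sq, ← pow_mul]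
  ring

theorem trans_zero {N : ℕ} (x : ℕ → ℂ) {p : ℕ} (hp : p < N) : trans 0 N x p = x p := by
  simp [trans, Nat.mod_eq_of_lt hp]

theorem trans_one (L : ℕ) (x : ℕ → ℂ) (p : ℕ) :
    trans L 1 x p = ∑ t ∈ Finset.range (2 ^ L), x t * node p ^ t := by
  simp [trans, Nat.mod_one]

theorem norm_trans_le (l m : ℕ) (x : ℕ → ℂ) (p : ℕ) {X : ℝ} (hX : ∀ i, ‖x i‖ ≤ X) :
    ‖trans l m x p‖ ≤ 2 ^ l * X := by
  refine (norm_sum_le _ _).trans ?_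
  refine (Finset.sum_le_card_nsmul _ _ X fun t _ => ?_).trans_eq (by simp)
  simpa [norm_node] using hX _

/-- Self-convolution. -/
def conv {R : Type*} [Semiring R] (x : ℕ → R) (s : ℕ) : R :=
  ∑ ij ∈ Finset.HasAntidiagonal.antidiagonal s, x ij.1 * x ij.2

/-- For `m = 1` the transform is evaluation at the nodes, which is multiplicative. As the
coefficients vanish from half of `2 ^ L` on, the square of the polynomial has degree below `2 ^ L`,
and its evaluation loses no term. -/
theorem trans_conv (L : ℕ) (x : ℕ → ℂ) (hx : ∀ i, 2 ^ L ≤ 2 * i → x i = 0) (p : ℕ) :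
    trans L 1 (conv x) p = trans L 1 x p ^ 2 := by
  rw [trans_one, trans_one]
  set P : Polynomial ℂ := ∑ t ∈ Finset.range (2 ^ L), Polynomial.monomial t (x t) with hP
  have hco : ∀ i, P.coeff i = x i := by
    intro i
    simp only [hP, Polynomial.finsetSum_coeff, Polynomial.coeff_monomial, Finset.sum_ite_eq',
      Finset.mem_range]
    split_ifs with h
    · rfl
    · rw [hx i (by omega)]
  have h2 : (P * P).natDegree < 2 ^ L := by
    rcases Nat.eq_zero_or_pos L with rfl | hL
    · have : P.natDegree ≤ 0 := by
        rw [Polynomial.natDegree_le_iff_coeff_eq_zero]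
        intro i hi; rw [hco]; exact hx i (by simp at hi ⊢; omega)
      have := Polynomial.natDegree_mul_le (p := P) (q := P)
      simp; omega
    · obtain ⟨K, rfl⟩ : ∃ K, L = K + 1 := ⟨L - 1, by omega⟩
      have : P.natDegree ≤ 2 ^ K - 1 := by
        rw [Polynomial.natDegree_le_iff_coeff_eq_zero]
        intro i hi; rw [hco]; exact hx i (by rw [pow_succ]; omega)
      have := Polynomial.natDegree_mul_le (p := P) (q := P)
      have := Nat.pos_of_ne_zero (pow_ne_zero K (two_ne_zero (α := ℕ)))
      rw [pow_succ]; omega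
  have h1 : P.eval (node p) = ∑ t ∈ Finset.range (2 ^ L), x t * node p ^ t := by
    simp [hP, Polynomial.eval_finsetSum]
  rw [← h1, pow_two, ← Polynomial.eval_mul, Polynomial.eval_eq_sum_range' h2]
  refine Finset.sum_congr rfl fun t _ => ?_
  simp [conv, Polynomial.coeff_mul, hco]

/-! ### Fixed point arithmetic -/

/-- The complex number with fixed point representation `a`, `b`: scale `Q` and offset `H`. -/
noncomputable def dec (H Q a b : ℕ) : ℂ := ⟨((a : ℝ) - H) / Q, ((b : ℝ) - H) / Q⟩

/-- Expansion of `(a - H) (c - H) - (b - H) (d - H)` with the terms sorted by sign, so that a single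
truncated subtraction occurs. The summand `Q * H` becomes the offset `H` again after the division by
`Q`. `mulIm` is built in the same way. -/
def mulRe (H Q a b c d : ℕ) : ℕ := (a * c + H * (b + d) + Q * H - (b * d + H * (a + c))) / Q

def mulIm (H Q a b c d : ℕ) : ℕ :=
  (a * d + b * c + 2 * (H * H) + Q * H - H * (a + b + c + d)) / Q

theorem abs_natCast_div_sub_le (x Q : ℕ) (hQ : 0 < Q) : |((x / Q : ℕ) : ℝ) - x / Q| ≤ 1 := by
  have h1 := Nat.div_add_mod x Q
  have h2 := Nat.mod_lt x hQ
  have hQ' : (0 : ℝ) < Q := by exact_mod_cast hQ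
  have h3 : (x : ℝ) = Q * (x / Q : ℕ) + (x % Q : ℕ) := by exact_mod_cast h1.symm
  have h4 : (x : ℝ) / Q = (x / Q : ℕ) + ((x % Q : ℕ) : ℝ) / Q := by
    rw [div_eq_iff hQ'.ne', add_mul, div_mul_cancel₀ _ hQ'.ne']; linarith
  rw [h4, sub_add_cancel_left, abs_neg, abs_of_nonneg (by positivity), div_le_one hQ']
  exact_mod_cast h2.le

section dec

variable {H Q a b c d : ℕ}

theorem abs_sub_le_of_norm_dec (hQ : 0 < Q) {X : ℝ} (h : ‖dec H Q a b‖ ≤ X) :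
    |(a : ℝ) - H| ≤ X * Q ∧ |(b : ℝ) - H| ≤ X * Q := by
  have hQ' : (0 : ℝ) < Q := by exact_mod_cast hQ
  have h1 := (abs_re_le_norm (dec H Q a b)).trans h
  have h2 := (abs_im_le_norm (dec H Q a b)).trans h
  simp only [dec, abs_div, Nat.abs_cast] at h1 h2
  exact ⟨(div_le_iff₀ hQ').1 h1, (div_le_iff₀ hQ').1 h2⟩

/-- Each of the two integer divisions is off by at most one unit, that is `1 / Q`. The hypothesis
`hXY` makes the truncated subtractions exact. -/
theorem norm_dec_mul_sub_le (hQ : 0 < Q) {X Y : ℝ} (ha : |(a : ℝ) - H| ≤ X)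
    (hb : |(b : ℝ) - H| ≤ X) (hc : |(c : ℝ) - H| ≤ Y) (hd : |(d : ℝ) - H| ≤ Y)
    (hXY : 2 * X * Y ≤ Q * H) :
    ‖dec H Q (mulRe H Q a b c d) (mulIm H Q a b c d) - dec H Q a b * dec H Q c d‖ ≤ 2 / Q := by
  have hQ' : (0 : ℝ) < Q := by exact_mod_cast hQ
  have key : ∀ u v : ℝ, |u| ≤ X → |v| ≤ Y → |u * v| ≤ X * Y := fun u v hu hv => by
    rw [abs_mul]; exact mul_le_mul hu hv (abs_nonneg _) ((abs_nonneg _).trans hu)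
  have k1 := abs_le.1 (key _ _ ha hc)
  have k2 := abs_le.1 (key _ _ hb hd)
  have k3 := abs_le.1 (key _ _ ha hd)
  have k4 := abs_le.1 (key _ _ hb hc)
  have e1 : b * d + H * (a + c) ≤ a * c + H * (b + d) + Q * H := by
    have : ((b * d + H * (a + c) : ℕ) : ℝ) ≤ (a * c + H * (b + d) + Q * H : ℕ) := by
      push_cast; linarith
    exact_mod_cast this
  have e2 : H * (a + b + c + d) ≤ a * d + b * c + 2 * (H * H) + Q * H := by
    have : ((H * (a + b + c + d) : ℕ) : ℝ) ≤ (a * d + b * c + 2 * (H * H) + Q * H : ℕ) := by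
      push_cast; linarith
    exact_mod_cast this
  have f1 := abs_natCast_div_sub_le (a * c + H * (b + d) + Q * H - (b * d + H * (a + c))) Q hQ
  have f2 := abs_natCast_div_sub_le (a * d + b * c + 2 * (H * H) + Q * H - H * (a + b + c + d)) Q hQ
  rw [Nat.cast_sub e1] at f1
  rw [Nat.cast_sub e2] at f2
  refine (norm_le_abs_re_add_abs_im _).trans ?_
  have g1 : (dec H Q (mulRe H Q a b c d) (mulIm H Q a b c d) - dec H Q a b * dec H Q c d).re =
      ((mulRe H Q a b c d : ℝ) - ((a * c + H * (b + d) + Q * H : ℕ) -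
        (b * d + H * (a + c) : ℕ) : ℝ) / Q) / Q := by
    simp only [dec, sub_re, mul_re]; push_cast; field_simp; ring
  have g2 : (dec H Q (mulRe H Q a b c d) (mulIm H Q a b c d) - dec H Q a b * dec H Q c d).im =
      ((mulIm H Q a b c d : ℝ) - ((a * d + b * c + 2 * (H * H) + Q * H : ℕ) -
        (H * (a + b + c + d) : ℕ) : ℝ) / Q) / Q := by
    simp only [dec, sub_im, mul_im]; push_cast; field_simp; ring
  rw [g1, g2, abs_div, abs_div, Nat.abs_cast, ← add_div]
  refine div_le_div_of_nonneg_right ?_ hQ'.le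
  unfold mulRe mulIm
  linarith

theorem dec_add (h : H ≤ a + c) (h' : H ≤ b + d) :
    dec H Q (a + c - H) (b + d - H) = dec H Q a b + dec H Q c d := by
  apply Complex.ext <;> simp only [dec, add_re, add_im] <;> push_cast [h, h'] <;> ring

theorem dec_sub (h : c ≤ a + H) (h' : d ≤ b + H) :
    dec H Q (a + H - c) (b + H - d) = dec H Q a b - dec H Q c d := by
  apply Complex.ext <;> simp only [dec, sub_re, sub_im] <;> push_cast [h, h'] <;> ring

theorem dec_conj (h : d ≤ 2 * H) : dec H Q c (2 * H - d) = (starRingEnd ℂ) (dec H Q c d) := by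
  apply Complex.ext <;> simp only [dec, conj_re, conj_im] <;> push_cast [h] <;> ring

end dec

end FFT

/-! ### Error analysis of the fixed point transform -/

namespace FFT

open Complex

section butterfly

variable {H Q a b c d r i : ℕ} {u v w : ℂ} {X e δ : ℝ}

theorem norm_le_add_of_norm_sub_le (hu : ‖v - u‖ ≤ e) (hX : ‖u‖ ≤ X) : ‖v‖ ≤ X + e := by
  have := norm_add_le (v - u) u
  rw [sub_add_cancel] at this
  linarith

theorem norm_mul_sub_mul_le {u' v' : ℂ} {Y e' : ℝ} (hu : ‖u' - u‖ ≤ e) (hv : ‖v' - v‖ ≤ e')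
    (hX : ‖u‖ ≤ X) (hY : ‖v'‖ ≤ Y) : ‖u' * v' - u * v‖ ≤ e * Y + X * e' := by
  have h : u' * v' - u * v = (u' - u) * v' + u * (v' - v) := by ring
  rw [h]
  refine (norm_add_le _ _).trans ?_
  rw [norm_mul, norm_mul]
  exact add_le_add (mul_le_mul hu hY (norm_nonneg _) ((norm_nonneg _).trans hu))
    (mul_le_mul hX hv (norm_nonneg _) ((norm_nonneg _).trans hX))

theorem norm_dec_mul_sub_mul_le (hQ : 0 < Q) {Y e' : ℝ} (hu : ‖dec H Q a b - u‖ ≤ e)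
    (hv : ‖dec H Q c d - v‖ ≤ e') (hX : ‖u‖ ≤ X) (hY : ‖v‖ ≤ Y) (h : 2 * (X + e) * (Y + e') * Q ≤ H) :
    ‖dec H Q (mulRe H Q a b c d) (mulIm H Q a b c d) - u * v‖ ≤ e * (Y + e') + X * e' + 2 / Q := by
  have hu' := norm_le_add_of_norm_sub_le hu hX
  have hv' := norm_le_add_of_norm_sub_le hv hY
  obtain ⟨h1, h2⟩ := abs_sub_le_of_norm_dec hQ hu'
  obtain ⟨h3, h4⟩ := abs_sub_le_of_norm_dec hQ hv'
  have h5 := norm_dec_mul_sub_le hQ h1 h2 h3 h4 (by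
    have := mul_le_mul_of_nonneg_left h (Nat.cast_nonneg (α := ℝ) Q)
    linarith)
  have h6 := norm_mul_sub_mul_le hu hv hX hv'
  have := norm_add_le (dec H Q (mulRe H Q a b c d) (mulIm H Q a b c d) - dec H Q a b * dec H Q c d)
    (dec H Q a b * dec H Q c d - u * v)
  rw [sub_add_sub_cancel] at this
  linarith

/-- The product has error at most `e (1 + δ) + X δ + 2 / Q`, which is at most `2 e + δ X + 2 / Q`
because `δ ≤ 1`; the other summand contributes one more `e`. The hypothesis `hH` keeps all numbers
so near to the offset that no subtraction truncates. -/
theorem norm_forward_le (hQ : 0 < Q) (hu : ‖dec H Q a b - u‖ ≤ e) (hv : ‖dec H Q c d - v‖ ≤ e)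
    (hw : ‖dec H Q r i - w‖ ≤ δ) (hXu : ‖u‖ ≤ X) (hXv : ‖v‖ ≤ X) (hw1 : ‖w‖ = 1) (hδ : δ ≤ 1)
    (hH : 8 * (X + e + 1) * Q ≤ H) :
    ‖dec H Q (a + mulRe H Q c d r i - H) (b + mulIm H Q c d r i - H) - (u + w * v)‖ ≤
        3 * e + δ * X + 2 / Q ∧
      ‖dec H Q (a + H - mulRe H Q c d r i) (b + H - mulIm H Q c d r i) - (u - w * v)‖ ≤
        3 * e + δ * X + 2 / Q := by
  have hQ' : (1 : ℝ) ≤ Q := by exact_mod_cast hQ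
  have he : 0 ≤ e := (norm_nonneg _).trans hu
  have hX : 0 ≤ X := (norm_nonneg _).trans hXu
  have hδ0 : 0 ≤ δ := (norm_nonneg _).trans hw
  have hUQ : 0 ≤ (X + e) * Q := by positivity
  have h1 := norm_dec_mul_sub_mul_le hQ hv hw hXv hw1.le (by nlinarith)
  set t := mulRe H Q c d r i
  set t' := mulIm H Q c d r i
  have h2 : e * (1 + δ) + X * δ + 2 / Q ≤ 2 * e + δ * X + 2 / Q := by nlinarith
  have h3 : ‖v * w‖ ≤ X := by rw [norm_mul, hw1, mul_one]; exact hXv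
  have h5 : 2 / (Q : ℝ) ≤ 2 := by rw [div_le_iff₀ (by linarith)]; linarith
  have h4 : ‖dec H Q t t'‖ ≤ 2 * X + 2 * e + 2 := by
    have := norm_le_add_of_norm_sub_le (h1.trans h2) h3
    nlinarith
  obtain ⟨k1, k2⟩ := abs_sub_le_of_norm_dec hQ h4
  obtain ⟨k3, k4⟩ := abs_sub_le_of_norm_dec hQ (norm_le_add_of_norm_sub_le hu hXu)
  rw [abs_le] at k1 k2 k3 k4
  have s1 : H ≤ a + t := by
    have : (H : ℝ) ≤ a + t := by nlinarith
    exact_mod_cast this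
  have s2 : H ≤ b + t' := by
    have : (H : ℝ) ≤ b + t' := by nlinarith
    exact_mod_cast this
  have s3 : t ≤ a + H := by
    have : (t : ℝ) ≤ a + H := by nlinarith
    exact_mod_cast this
  have s4 : t' ≤ b + H := by
    have : (t' : ℝ) ≤ b + H := by nlinarith
    exact_mod_cast this
  rw [dec_add s1 s2, dec_sub s3 s4, mul_comm w v]
  constructor
  · rw [add_sub_add_comm]
    refine (norm_add_le _ _).trans ?_
    linarith
  · rw [sub_sub_sub_comm]
    refine (norm_sub_le _ _).trans ?_
    linarith

/-- Inverse butterfly without the division by 2. The difference `u - v` has error `2 e` and size up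
to `2 X`, so the product by the conjugate root has error at most `2 e (1 + δ) + 2 X δ + 2 / Q`. -/
theorem norm_backward_le (hQ : 0 < Q) (hu : ‖dec H Q a b - u‖ ≤ e) (hv : ‖dec H Q c d - v‖ ≤ e)
    (hw : ‖dec H Q r i - w‖ ≤ δ) (hXu : ‖u‖ ≤ X) (hXv : ‖v‖ ≤ X) (hw1 : ‖w‖ = 1) (hδ : δ ≤ 1)
    (hH : 8 * (X + e + 1) * Q ≤ H) :
    ‖dec H Q (a + c - H) (b + d - H) - (u + v)‖ ≤ 4 * e + 2 * δ * X + 2 / Q ∧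
      ‖dec H Q (mulRe H Q (a + H - c) (b + H - d) r (2 * H - i))
        (mulIm H Q (a + H - c) (b + H - d) r (2 * H - i)) - (u - v) * (starRingEnd ℂ) w‖ ≤
        4 * e + 2 * δ * X + 2 / Q := by
  have hQ' : (1 : ℝ) ≤ Q := by exact_mod_cast hQ
  have he : 0 ≤ e := (norm_nonneg _).trans hu
  have hX : 0 ≤ X := (norm_nonneg _).trans hXu
  have hδ0 : 0 ≤ δ := (norm_nonneg _).trans hw
  have hUQ : 0 ≤ (X + e) * Q := by positivity
  obtain ⟨k1, k2⟩ := abs_sub_le_of_norm_dec hQ (norm_le_add_of_norm_sub_le hv hXv)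
  obtain ⟨k3, k4⟩ := abs_sub_le_of_norm_dec hQ (norm_le_add_of_norm_sub_le hu hXu)
  obtain ⟨_, k6⟩ := abs_sub_le_of_norm_dec hQ (norm_le_add_of_norm_sub_le hw hw1.le)
  rw [abs_le] at k1 k2 k3 k4 k6
  have s1 : H ≤ a + c := by
    have : (H : ℝ) ≤ a + c := by nlinarith
    exact_mod_cast this
  have s2 : H ≤ b + d := by
    have : (H : ℝ) ≤ b + d := by nlinarith
    exact_mod_cast this
  have s3 : c ≤ a + H := by
    have : (c : ℝ) ≤ a + H := by nlinarith
    exact_mod_cast this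
  have s4 : d ≤ b + H := by
    have : (d : ℝ) ≤ b + H := by nlinarith
    exact_mod_cast this
  have s5 : i ≤ 2 * H := by
    have : (i : ℝ) ≤ 2 * H := by nlinarith
    exact_mod_cast this
  constructor
  · rw [dec_add s1 s2, add_sub_add_comm]
    refine (norm_add_le _ _).trans ?_
    have : 0 ≤ 2 / (Q : ℝ) := by positivity
    have : 0 ≤ δ * X := by positivity
    linarith
  · have h1 : ‖dec H Q (a + H - c) (b + H - d) - (u - v)‖ ≤ 2 * e := by
      rw [dec_sub s3 s4, sub_sub_sub_comm]
      refine (norm_sub_le _ _).trans ?_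
      linarith
    have h2 : ‖dec H Q r (2 * H - i) - (starRingEnd ℂ) w‖ ≤ δ := by
      rw [dec_conj s5, ← map_sub, norm_conj]; exact hw
    have h3 : ‖u - v‖ ≤ 2 * X := (norm_sub_le _ _).trans (by linarith)
    refine (norm_dec_mul_sub_mul_le hQ h1 h2 h3 (by rw [norm_conj, hw1]) (by nlinarith)).trans ?_
    nlinarith

end butterfly

/-- Fixed point approximation, up to the error `e`, of the values of `f` below `N`. -/
def Approx (H Q N : ℕ) (e : ℝ) (A B : ℕ → ℕ) (f : ℕ → ℂ) : Prop :=
  ∀ p < N, ‖dec H Q (A p) (B p) - f p‖ ≤ e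

/-- The precision needed for a self-convolution of length `N`, with twiddle factors that are known
up to the error `δ`. -/
structure Precise (H Q N : ℕ) (δ : ℝ) : Prop where
  scale_pos : 0 < Q
  two_le : 2 ≤ N
  unit : 2 / (Q : ℝ) ≤ δ
  -- The error at the end is `8 ^ L * (7 N ^ 4 δ) = 7 N ^ 7 δ`; it has to be at most `1 / 4` for the
  -- rounding.
  small : 28 * (N : ℝ) ^ 7 * δ ≤ 1
  range : 8 * ((N : ℝ) + 2) ^ 2 * Q ≤ H

namespace Precise

variable {H Q N : ℕ} {δ : ℝ} (h : Precise H Q N δ)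
include h

theorem delta_pos : 0 < δ :=
  lt_of_lt_of_le (div_pos two_pos (by exact_mod_cast h.scale_pos)) h.unit

theorem two_le' : (2 : ℝ) ≤ N := by exact_mod_cast h.two_le

theorem pow_mul_le {j : ℕ} (hj : j ≤ 7) {c : ℝ} (hc : c ≤ 28) : c * (N : ℝ) ^ j * δ ≤ 1 := by
  refine le_trans ?_ h.small
  refine mul_le_mul_of_nonneg_right ?_ h.delta_pos.le
  have := h.two_le'
  exact mul_le_mul hc (pow_le_pow_right₀ (by linarith) hj) (by positivity) (by norm_num)

theorem delta_le_one : δ ≤ 1 := by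
  have := h.pow_mul_le (j := 0) (c := 1) (by norm_num) (by norm_num)
  simpa using this

/-- All exact values have modulus at most `N ^ 2`, so every stored number differs from the offset by
at most `H / 8`. This excludes truncation and bounds all intermediate words by multiples of `H` and
`H * H`. -/
theorem near {a b : ℕ} {u : ℂ} {X e : ℝ} (hu : ‖dec H Q a b - u‖ ≤ e) (hX : ‖u‖ ≤ X)
    (hb : X + e ≤ N ^ 2 + 1) : (7 * H ≤ 8 * a ∧ 8 * a ≤ 9 * H) ∧ 7 * H ≤ 8 * b ∧ 8 * b ≤ 9 * H := by
  obtain ⟨k1, k2⟩ := abs_sub_le_of_norm_dec h.scale_pos ((norm_le_add_of_norm_sub_le hu hX).trans hb)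
  have h1 := h.range
  have h2 : (0 : ℝ) ≤ Q := Nat.cast_nonneg _
  have h3 := h.two_le'
  have h4 : (0 : ℝ) ≤ N * Q := by positivity
  have h5 : ((N : ℝ) ^ 2 + 1) * Q * 8 ≤ H := by nlinarith
  rw [abs_le] at k1 k2
  have e1 : (7 * H : ℝ) ≤ 8 * a := by linarith
  have e2 : (8 * a : ℝ) ≤ 9 * H := by linarith
  have e3 : (7 * H : ℝ) ≤ 8 * b := by linarith
  have e4 : (8 * b : ℝ) ≤ 9 * H := by linarith
  exact ⟨⟨by exact_mod_cast e1, by exact_mod_cast e2⟩, by exact_mod_cast e3, by exact_mod_cast e4⟩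

theorem root_near {TR TI : ℕ → ℕ} (hT : Approx H Q N δ TR TI root) {p : ℕ} (hp : p < N) :
    (7 * H ≤ 8 * TR p ∧ 8 * TR p ≤ 9 * H) ∧ 7 * H ≤ 8 * TI p ∧ 8 * TI p ≤ 9 * H :=
  h.near (hT p hp) (norm_root p).le (by have := h.delta_le_one; have := h.two_le'; nlinarith)

theorem forward_err {L l : ℕ} (hN : N = 2 ^ L) (hl : l ≤ L) : 4 ^ l * (2 * N * δ) ≤ 1 := by
  have hδ := h.delta_pos
  have hpow : (4 : ℝ) ^ l ≤ N ^ 2 := by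
    rw [hN]; push_cast
    rw [← pow_mul, show (4 : ℝ) = 2 ^ 2 by norm_num, ← pow_mul]
    exact pow_le_pow_right₀ (by norm_num) (by omega)
  have := h.pow_mul_le (j := 3) (c := 2) (by norm_num) (by norm_num)
  have : 4 ^ l * (2 * N * δ) ≤ N ^ 2 * (2 * N * δ) :=
    mul_le_mul_of_nonneg_right hpow (by positivity)
  nlinarith

theorem forward_near {L l m : ℕ} (hN : N = 2 ^ L) (hl : l ≤ L) {x : ℕ → ℂ} (hx : ∀ i, ‖x i‖ ≤ 1)
    {A B : ℕ → ℕ} (hAB : Approx H Q N (4 ^ l * (2 * N * δ)) A B (trans l m x)) {p : ℕ} (hp : p < N) :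
    (7 * H ≤ 8 * A p ∧ 8 * A p ≤ 9 * H) ∧ 7 * H ≤ 8 * B p ∧ 8 * B p ≤ 9 * H := by
  refine h.near (X := N) (hAB p hp) ?_ ?_
  · refine (norm_trans_le _ _ _ _ hx).trans ?_
    rw [hN, mul_one]; push_cast
    exact pow_le_pow_right₀ (by norm_num) hl
  · have := h.forward_err hN hl
    have := h.two_le'
    nlinarith

theorem backward_err {L l : ℕ} (hN : N = 2 ^ L) : 8 ^ (L - l) * (7 * N ^ 4 * δ) ≤ 1 := by
  have hδ := h.delta_pos
  have hpow : (8 : ℝ) ^ (L - l) ≤ N ^ 3 := by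
    rw [hN]; push_cast
    rw [← pow_mul, show (8 : ℝ) = 2 ^ 3 by norm_num, ← pow_mul]
    exact pow_le_pow_right₀ (by norm_num) (by omega)
  have := h.pow_mul_le (j := 7) (c := 7) (by norm_num) (by norm_num)
  have : 8 ^ (L - l) * (7 * N ^ 4 * δ) ≤ N ^ 3 * (7 * N ^ 4 * δ) :=
    mul_le_mul_of_nonneg_right hpow (by positivity)
  nlinarith

theorem backward_near {L l m : ℕ} (hN : N = 2 ^ L) (hl : l ≤ L) {y : ℕ → ℂ} (hy : ∀ i, ‖y i‖ ≤ N)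
    {A B : ℕ → ℕ} (hAB : Approx H Q N (8 ^ (L - l) * (7 * N ^ 4 * δ)) A B
      (fun p => 2 ^ (L - l) * trans l m y p)) {p : ℕ} (hp : p < N) :
    (7 * H ≤ 8 * A p ∧ 8 * A p ≤ 9 * H) ∧ 7 * H ≤ 8 * B p ∧ 8 * B p ≤ 9 * H := by
  refine h.near (X := N ^ 2) (hAB p hp) ?_ (by linarith [h.backward_err (l := l) hN])
  rw [norm_mul, norm_pow, Complex.norm_ofNat]
  refine (mul_le_mul_of_nonneg_left (norm_trans_le _ _ _ _ hy) (by positivity)).trans_eq ?_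
  rw [← mul_assoc, ← pow_add, show L - l + l = L by omega, hN]
  push_cast; ring

/-- A level multiplies the error by at most 4: the butterfly contributes the factor 3, and the
remaining share is at least `2 N δ`, which covers `δ N + 2 / Q`. After all levels the factor is `4 ^
L = N ^ 2`. -/
theorem forward {L l m : ℕ} (hN : N = 2 ^ L) (hl : l < L) (hm : N = 2 ^ (l + 1) * m) {x : ℕ → ℂ}
    (hx : ∀ i, ‖x i‖ ≤ 1) {A B A' B' TR TI : ℕ → ℕ}
    (hAB : Approx H Q N (4 ^ l * (2 * N * δ)) A B (trans l (2 * m) x))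
    (hT : Approx H Q N δ TR TI root)
    (hA' : ∀ q < N / 2,
      A' (pos m q) = A (pos m q) + mulRe H Q (A (pos m q + m)) (B (pos m q + m)) (TR (q / m)) (TI (q / m)) - H ∧
      B' (pos m q) = B (pos m q) + mulIm H Q (A (pos m q + m)) (B (pos m q + m)) (TR (q / m)) (TI (q / m)) - H ∧
      A' (pos m q + m) = A (pos m q) + H - mulRe H Q (A (pos m q + m)) (B (pos m q + m)) (TR (q / m)) (TI (q / m)) ∧
      B' (pos m q + m) = B (pos m q) + H - mulIm H Q (A (pos m q + m)) (B (pos m q + m)) (TR (q / m)) (TI (q / m))) :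
    Approx H Q N (4 ^ (l + 1) * (2 * N * δ)) A' B' (trans (l + 1) m x) := by
  have hm0 : 0 < m := Nat.pos_of_ne_zero fun h0 => by have := h.two_le; simp [h0] at hm; omega
  have hd : 2 * m ∣ N := ⟨2 ^ l, by rw [hm]; ring⟩
  have hδ := h.delta_pos
  have h2 := h.two_le'
  have hX : ∀ p, ‖trans l (2 * m) x p‖ ≤ N := fun p => by
    refine (norm_trans_le _ _ _ _ hx).trans ?_
    rw [hN, mul_one]; push_cast
    exact pow_le_pow_right₀ (by norm_num) hl.le
  have he1 := h.forward_err hN hl.le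
  have hstep : 3 * (4 ^ l * (2 * N * δ)) + δ * N + 2 / Q ≤ 4 ^ (l + 1) * (2 * N * δ) := by
    have h1 : (1 : ℝ) ≤ 4 ^ l := one_le_pow₀ (by norm_num)
    have h3 := h.unit
    have h4 : 2 * N * δ ≤ 4 ^ l * (2 * N * δ) := le_mul_of_one_le_left (by positivity) h1
    rw [pow_succ (4 : ℝ) l]
    nlinarith
  have key : ∀ q < N / 2, ‖dec H Q (A' (pos m q)) (B' (pos m q)) - trans (l + 1) m x (pos m q)‖ ≤
        4 ^ (l + 1) * (2 * N * δ) ∧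
      ‖dec H Q (A' (pos m q + m)) (B' (pos m q + m)) - trans (l + 1) m x (pos m q + m)‖ ≤
        4 ^ (l + 1) * (2 * N * δ) := by
    intro q hq
    obtain ⟨r1, r2, r3, r4⟩ := hA' q hq
    rw [r1, r2, r3, r4, trans_pos hm0, trans_pos_add hm0]
    have hq' : q / m < N := lt_of_le_of_lt (Nat.div_le_self _ _) (by omega)
    have := norm_forward_le h.scale_pos (hAB _ ((pos_lt_iff hm0 hd).2 hq)) (hAB _ ((pos_add_lt_iff hm0 hd).2 hq))
      (hT _ hq') (hX _) (hX _) (norm_root _) h.delta_le_one (by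
        refine le_trans ?_ h.range
        refine mul_le_mul_of_nonneg_right ?_ (Nat.cast_nonneg _)
        nlinarith)
    exact ⟨this.1.trans hstep, this.2.trans hstep⟩
  intro p hp
  obtain ⟨q, rfl | rfl⟩ := exists_pos hm0 p
  · exact (key q ((pos_lt_iff hm0 hd).1 hp)).1
  · exact (key q ((pos_add_lt_iff hm0 hd).1 hp)).2

/-- With error `e = 2 N ^ 3 δ ≤ 1` and modulus at most `N`, the square has error at most `2 N e + e
^ 2 + 2 / Q`. The main term is `4 N ^ 4 δ`, and the others fit into `7 N ^ 4 δ`. -/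
theorem square {L : ℕ} (hN : N = 2 ^ L) {x : ℕ → ℂ} (hx : ∀ i, ‖x i‖ ≤ 1)
    (hx0 : ∀ i, N ≤ 2 * i → x i = 0) {A B A' B' : ℕ → ℕ}
    (hAB : Approx H Q N (4 ^ L * (2 * N * δ)) A B (trans L 1 x))
    (hA' : ∀ p < N, A' p = mulRe H Q (A p) (B p) (A p) (B p) ∧
      B' p = mulIm H Q (A p) (B p) (A p) (B p)) :
    Approx H Q N (7 * N ^ 4 * δ) A' B' (trans L 1 (conv x)) := by
  have hδ := h.delta_pos
  have h2 := h.two_le'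
  intro p hp
  have hX : ‖trans L 1 x p‖ ≤ N := by
    refine (norm_trans_le _ _ _ _ hx).trans ?_
    rw [hN, mul_one]; push_cast; rfl
  have hpow : (4 : ℝ) ^ L = N ^ 2 := by
    rw [hN]; push_cast
    rw [← pow_mul, show (4 : ℝ) = 2 ^ 2 by norm_num, ← pow_mul, mul_comm]
  have he : ‖dec H Q (A p) (B p) - trans L 1 x p‖ ≤ 2 * N ^ 3 * δ := by
    refine (hAB p hp).trans_eq ?_
    rw [hpow]; ring
  have he1 := h.pow_mul_le (j := 3) (c := 2) (by norm_num) (by norm_num)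
  rw [trans_conv _ _ (by rw [← hN]; exact hx0), (hA' p hp).1, (hA' p hp).2, pow_two]
  refine (norm_dec_mul_sub_mul_le h.scale_pos he he hX hX ?_).trans ?_
  · refine le_trans ?_ h.range
    refine mul_le_mul_of_nonneg_right ?_ (Nat.cast_nonneg _)
    have : (N + 2 * N ^ 3 * δ) * (N + 2 * N ^ 3 * δ) ≤ (N + 1) * (N + 1 : ℝ) :=
      mul_le_mul (by linarith) (by linarith) (by positivity) (by positivity)
    nlinarith
  · have h3 := h.unit
    have h4 : 2 * N ^ 3 * δ * (2 * N ^ 3 * δ) ≤ 2 * N ^ 3 * δ :=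
      mul_le_of_le_one_right (by positivity) he1
    have h5 : δ * 1 ≤ δ * N ^ 3 := mul_le_mul_of_nonneg_left (one_le_pow₀ (by linarith)) hδ.le
    have h6 : (2 : ℝ) * (N ^ 3 * δ) ≤ N * (N ^ 3 * δ) := mul_le_mul_of_nonneg_right h2 (by positivity)
    nlinarith

/-- Since the butterflies are not halved, the factor `2 ^ (L - l)` builds up; the values remain
below `2 ^ (L - l) * 2 ^ l * N = N ^ 2`. The error grows by at most 8: a factor 4 from the
butterfly, and as much again for `2 δ N ^ 2 + 2 / Q`. -/
theorem backward {L l m : ℕ} (hN : N = 2 ^ L) (hl : l < L) (hm : N = 2 ^ (l + 1) * m) {y : ℕ → ℂ}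
    (hy : ∀ i, ‖y i‖ ≤ N) {A B A' B' TR TI : ℕ → ℕ}
    (hAB : Approx H Q N (8 ^ (L - (l + 1)) * (7 * N ^ 4 * δ)) A B
      (fun p => 2 ^ (L - (l + 1)) * trans (l + 1) m y p))
    (hT : Approx H Q N δ TR TI root)
    (hA' : ∀ q < N / 2,
      A' (pos m q) = A (pos m q) + A (pos m q + m) - H ∧
      B' (pos m q) = B (pos m q) + B (pos m q + m) - H ∧
      A' (pos m q + m) = mulRe H Q (A (pos m q) + H - A (pos m q + m))
        (B (pos m q) + H - B (pos m q + m)) (TR (q / m)) (2 * H - TI (q / m)) ∧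
      B' (pos m q + m) = mulIm H Q (A (pos m q) + H - A (pos m q + m))
        (B (pos m q) + H - B (pos m q + m)) (TR (q / m)) (2 * H - TI (q / m))) :
    Approx H Q N (8 ^ (L - l) * (7 * N ^ 4 * δ)) A' B'
      (fun p => 2 ^ (L - l) * trans l (2 * m) y p) := by
  have hm0 : 0 < m := Nat.pos_of_ne_zero fun h0 => by have := h.two_le; simp [h0] at hm; omega
  have hd : 2 * m ∣ N := ⟨2 ^ l, by rw [hm]; ring⟩
  have hδ := h.delta_pos
  have h2 := h.two_le'
  obtain ⟨j, hj⟩ : ∃ j, L - (l + 1) = j := ⟨_, rfl⟩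
  have hj' : L - l = j + 1 := by omega
  rw [hj] at hAB
  rw [hj']
  have hX : ∀ p, ‖(2 : ℂ) ^ j * trans (l + 1) m y p‖ ≤ N ^ 2 := fun p => by
    rw [norm_mul, norm_pow, Complex.norm_ofNat]
    refine (mul_le_mul_of_nonneg_left (norm_trans_le _ _ _ _ hy) (by positivity)).trans_eq ?_
    rw [← mul_assoc, ← pow_add, show j + (l + 1) = L by omega, hN]
    push_cast; ring
  have he1 := h.backward_err (l := l + 1) hN
  rw [hj] at he1
  have hstep : 4 * (8 ^ j * (7 * N ^ 4 * δ)) + 2 * δ * N ^ 2 + 2 / Q ≤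
      8 ^ (j + 1) * (7 * N ^ 4 * δ) := by
    have h1 : (1 : ℝ) ≤ 8 ^ j := one_le_pow₀ (by norm_num)
    have h3 := h.unit
    have h4 : 7 * N ^ 4 * δ ≤ 8 ^ j * (7 * N ^ 4 * δ) := le_mul_of_one_le_left (by positivity) h1
    have h5 : δ * 1 ≤ δ * N ^ 2 := mul_le_mul_of_nonneg_left (one_le_pow₀ (by linarith)) hδ.le
    have h6 : δ * N ^ 2 * 1 ≤ δ * N ^ 2 * N ^ 2 :=
      mul_le_mul_of_nonneg_left (one_le_pow₀ (by linarith)) (by positivity)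
    rw [pow_succ (8 : ℝ) j]
    nlinarith
  have key : ∀ q < N / 2,
      ‖dec H Q (A' (pos m q)) (B' (pos m q)) - 2 ^ (j + 1) * trans l (2 * m) y (pos m q)‖ ≤
        8 ^ (j + 1) * (7 * N ^ 4 * δ) ∧
      ‖dec H Q (A' (pos m q + m)) (B' (pos m q + m)) -
          2 ^ (j + 1) * trans l (2 * m) y (pos m q + m)‖ ≤ 8 ^ (j + 1) * (7 * N ^ 4 * δ) := by
    intro q hq
    obtain ⟨r1, r2, r3, r4⟩ := hA' q hq
    rw [r1, r2, r3, r4]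
    have hq' : q / m < N := lt_of_le_of_lt (Nat.div_le_self _ _) (by omega)
    have := norm_backward_le h.scale_pos (hAB _ ((pos_lt_iff hm0 hd).2 hq)) (hAB _ ((pos_add_lt_iff hm0 hd).2 hq))
      (hT _ hq') (hX _) (hX _) (norm_root _) h.delta_le_one (by
        refine le_trans ?_ h.range
        refine mul_le_mul_of_nonneg_right ?_ (Nat.cast_nonneg _)
        nlinarith)
    have hc : root (q / m) * (starRingEnd ℂ) (root (q / m)) = 1 := by
      rw [mul_conj, normSq_eq_norm_sq, norm_root]; simp
    have e1 : (2 : ℂ) ^ j * trans (l + 1) m y (pos m q) + 2 ^ j * trans (l + 1) m y (pos m q + m) =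
        2 ^ (j + 1) * trans l (2 * m) y (pos m q) := by
      rw [trans_pos hm0, trans_pos_add hm0]; ring
    have e2 : ((2 : ℂ) ^ j * trans (l + 1) m y (pos m q) - 2 ^ j * trans (l + 1) m y (pos m q + m)) *
        (starRingEnd ℂ) (root (q / m)) = 2 ^ (j + 1) * trans l (2 * m) y (pos m q + m) := by
      rw [trans_pos hm0, trans_pos_add hm0]
      linear_combination (2 ^ (j + 1) * trans l (2 * m) y (pos m q + m)) * hc
    rw [e1, e2] at this
    exact ⟨this.1.trans hstep, this.2.trans hstep⟩
  intro p hp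
  obtain ⟨q, rfl | rfl⟩ := exists_pos hm0 p
  · exact (key q ((pos_lt_iff hm0 hd).1 hp)).1
  · exact (key q ((pos_add_lt_iff hm0 hd).1 hp)).2

/-- The undivided inverse yields `N * y p` with error at most `1 / 4`. Adding half of `N * Q` turns
the integer division into rounding to the nearest integer. -/
theorem round {L : ℕ} (hN : N = 2 ^ L) {y : ℕ → ℕ} {A B : ℕ → ℕ}
    (hAB : Approx H Q N (8 ^ L * (7 * N ^ 4 * δ)) A B
      (fun p => 2 ^ L * trans 0 N (fun i => (y i : ℂ)) p)) {p : ℕ} (hp : p < N) :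
    (A p + N * Q / 2 - H) / (N * Q) = y p := by
  have h2 := h.two_le'
  have hQ' : (0 : ℝ) < Q := by exact_mod_cast h.scale_pos
  have hpow : (8 : ℝ) ^ L = N ^ 3 := by
    rw [hN]; push_cast
    rw [← pow_mul, show (8 : ℝ) = 2 ^ 3 by norm_num, ← pow_mul, mul_comm]
  have he : ‖dec H Q (A p) (B p) - N * y p‖ ≤ 1 / 4 := by
    have h1 := hAB p hp
    beta_reduce at h1
    rw [trans_zero _ hp] at h1
    have h3 : ((2 : ℂ) ^ L) = N := by rw [hN]; push_cast; rfl
    rw [h3, hpow] at h1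
    refine h1.trans ?_
    have := h.small
    nlinarith
  have hre := (abs_re_le_norm _).trans he
  simp only [sub_re, mul_re, natCast_re, natCast_im, dec, mul_zero, sub_zero] at hre
  have h3 : |(A p : ℝ) - H - N * y p * Q| ≤ 1 / 4 * Q := by
    have h4 : (A p : ℝ) - H - N * y p * Q = (((A p : ℝ) - H) / Q - N * y p) * Q := by
      field_simp
    rw [h4, abs_mul, Nat.abs_cast]
    exact mul_le_mul_of_nonneg_right hre hQ'.le
  rw [abs_le] at h3
  -- As `N` is even, half of `N * Q` is an exact integer.
  obtain ⟨K, hK⟩ : ∃ K, N = 2 * K := by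
    rcases Nat.eq_zero_or_pos L with rfl | hL
    · have := h.two_le; simp [hN] at this
    · exact ⟨2 ^ (L - 1), by rw [hN, ← pow_succ', Nat.sub_add_cancel hL]⟩
  have h5 : N * Q / 2 = K * Q := by rw [hK, mul_assoc, Nat.mul_div_cancel_left _ (by norm_num)]
  have hK1 : (1 : ℝ) ≤ K := by
    have : 1 ≤ K := by have := h.two_le; omega
    exact_mod_cast this
  have hNK : (N : ℝ) = 2 * K := by rw [hK]; push_cast; rfl
  rw [h5]
  rw [hNK] at h3
  have hKQ : (Q : ℝ) ≤ K * Q := le_mul_of_one_le_left hQ'.le hK1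
  have a1 : H + N * Q * y p ≤ A p + K * Q := by
    have : ((H + N * Q * y p : ℕ) : ℝ) ≤ (A p + K * Q : ℕ) := by push_cast; rw [hNK]; nlinarith
    exact_mod_cast this
  have a2 : A p + K * Q < H + N * Q * (y p + 1) := by
    have : ((A p + K * Q : ℕ) : ℝ) < (H + N * Q * (y p + 1) : ℕ) := by
      push_cast; rw [hNK]; nlinarith
    exact_mod_cast this
  apply Nat.div_eq_of_lt_le
  · rw [mul_comm (y p)]; omega
  · rw [mul_comm (y p + 1)]; omega

end Precise

end FFT

/-! ### Programs for the transform and for self-convolution -/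

namespace VM

open VM.Expr FFT

/-- Fixed point product of the numbers in the registers `26`, `27` and `28`, `29`; the offset is in
register `4`, the scale in register `5`. -/
def mulReE : Expr :=
  (reg 26 * reg 28 + reg 4 * (reg 27 + reg 29) + reg 5 * reg 4 -
    (reg 27 * reg 29 + reg 4 * (reg 26 + reg 28))) / reg 5

def mulImE : Expr :=
  (reg 26 * reg 29 + reg 27 * reg 28 + 2 * (reg 4 * reg 4) + reg 5 * reg 4 -
    reg 4 * (reg 26 + reg 27 + reg 28 + reg 29)) / reg 5

@[simp] theorem mulReE_val (v : State) : mulReE.val v =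
    mulRe (v.reg 4) (v.reg 5) (v.reg 26) (v.reg 27) (v.reg 28) (v.reg 29) := rfl

@[simp] theorem mulImE_val (v : State) : mulImE.val v =
    mulIm (v.reg 4) (v.reg 5) (v.reg 26) (v.reg 27) (v.reg 28) (v.reg 29) := rfl

theorem mul_le_of_le_two_mul {H a b : ℕ} (ha : a ≤ 2 * H) (hb : b ≤ 2 * H) : a * b ≤ 4 * (H * H) :=
  (Nat.mul_le_mul ha hb).trans_eq (by ring)

theorem mulReE_ok {W n : ℕ} {v : State} (h26 : v.reg 26 ≤ 2 * v.reg 4) (h27 : v.reg 27 ≤ 2 * v.reg 4)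
    (h28 : v.reg 28 ≤ 2 * v.reg 4) (h29 : v.reg 29 ≤ 2 * v.reg 4) (h5 : v.reg 5 ≤ v.reg 4)
    (hW : 16 * (v.reg 4 * v.reg 4) + 16 * v.reg 4 < W) : mulReE.Ok W n v := by
  have e1 := mul_le_of_le_two_mul h26 h28
  have e2 := mul_le_of_le_two_mul h27 h29
  have e3 : v.reg 4 * (v.reg 27 + v.reg 29) ≤ v.reg 4 * (4 * v.reg 4) :=
    Nat.mul_le_mul_left _ (by omega)
  have e4 : v.reg 4 * (v.reg 26 + v.reg 28) ≤ v.reg 4 * (4 * v.reg 4) :=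
    Nat.mul_le_mul_left _ (by omega)
  have e5 : v.reg 5 * v.reg 4 ≤ v.reg 4 * v.reg 4 := Nat.mul_le_mul_right _ h5
  have e6 : v.reg 4 * (4 * v.reg 4) = 4 * (v.reg 4 * v.reg 4) := by ring
  simp only [mulReE, ok_div, ok_sub, ok_add, ok_mul, ok_reg, val_add, val_mul, val_reg, true_and,
    and_true]
  generalize v.reg 4 * v.reg 4 = HH at *
  refine ⟨⟨⟨?_, ⟨?_, ?_⟩, ?_⟩, ?_, ?_⟩, ?_, ⟨?_, ?_⟩, ?_⟩ <;> omega

theorem mulImE_ok {W n : ℕ} {v : State} (h26 : v.reg 26 ≤ 2 * v.reg 4) (h27 : v.reg 27 ≤ 2 * v.reg 4)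
    (h28 : v.reg 28 ≤ 2 * v.reg 4) (h29 : v.reg 29 ≤ 2 * v.reg 4) (h5 : v.reg 5 ≤ v.reg 4)
    (hW : 16 * (v.reg 4 * v.reg 4) + 16 * v.reg 4 < W) : mulImE.Ok W n v := by
  have e1 := mul_le_of_le_two_mul h26 h29
  have e2 := mul_le_of_le_two_mul h27 h28
  have e3 : v.reg 4 * (v.reg 26 + v.reg 27 + v.reg 28 + v.reg 29) ≤ v.reg 4 * (8 * v.reg 4) :=
    Nat.mul_le_mul_left _ (by omega)
  have e5 : v.reg 5 * v.reg 4 ≤ v.reg 4 * v.reg 4 := Nat.mul_le_mul_right _ h5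
  have e6 : v.reg 4 * (8 * v.reg 4) = 8 * (v.reg 4 * v.reg 4) := by ring
  simp only [mulImE, ok_div, ok_sub, ok_add, ok_mul, ok_reg, val_add, val_mul, val_reg, true_and,
    and_true, ok_ofNat, val_ofNat]
  generalize v.reg 4 * v.reg 4 = HH at *
  refine ⟨⟨⟨⟨?_, ?_, ?_⟩, ⟨?_, ?_, ?_⟩, ?_⟩, ?_, ?_⟩, ⟨⟨?_, ?_⟩, ?_⟩, ?_⟩ <;> omega

theorem mulRe_le {H Q a b c d : ℕ} (ha : a ≤ 2 * H) (hb : b ≤ 2 * H) (hc : c ≤ 2 * H)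
    (hd : d ≤ 2 * H) (h5 : Q ≤ H) : mulRe H Q a b c d ≤ 9 * (H * H) := by
  refine (Nat.div_le_self _ _).trans ((Nat.sub_le _ _).trans ?_)
  have e1 := mul_le_of_le_two_mul ha hc
  have e3 : H * (b + d) ≤ H * (4 * H) := Nat.mul_le_mul_left _ (by omega)
  have e5 : Q * H ≤ H * H := Nat.mul_le_mul_right _ h5
  have e6 : H * (4 * H) = 4 * (H * H) := by ring
  omega

theorem mulIm_le {H Q a b c d : ℕ} (ha : a ≤ 2 * H) (hb : b ≤ 2 * H) (hc : c ≤ 2 * H)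
    (hd : d ≤ 2 * H) (h5 : Q ≤ H) : mulIm H Q a b c d ≤ 11 * (H * H) := by
  refine (Nat.div_le_self _ _).trans ((Nat.sub_le _ _).trans ?_)
  have e1 := mul_le_of_le_two_mul ha hd
  have e2 := mul_le_of_le_two_mul hb hc
  have e5 : Q * H ≤ H * H := Nat.mul_le_mul_right _ h5
  omega

/-- Arrays `0` and `1` hold real and imaginary parts, `2` and `3` the table of roots; register 20 is
the number of the butterfly and register 22 is `m`. The lower end is written first, while the upper
end still has its old value. -/
def forwardBody : Prog :=
  23 ≔ reg 20 / reg 22 ;;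
  24 ≔ 2 * reg 22 * reg 23 + reg 20 % reg 22 ;;
  25 ≔ reg 24 + reg 22 ;;
  26 ≔ load 0 (reg 25) ;;
  27 ≔ load 1 (reg 25) ;;
  28 ≔ load 2 (reg 23) ;;
  29 ≔ load 3 (reg 23) ;;
  30 ≔ mulReE ;;
  31 ≔ mulImE ;;
  .put 0 (reg 25) (load 0 (reg 24) + reg 4 - reg 30) ;;
  .put 1 (reg 25) (load 1 (reg 24) + reg 4 - reg 31) ;;
  .put 0 (reg 24) (load 0 (reg 24) + reg 30 - reg 4) ;;
  .put 1 (reg 24) (load 1 (reg 24) + reg 31 - reg 4)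

/-- Register 29 holds the imaginary part of the conjugate root: reflection at the offset changes the
sign. The factors of the product are saved in registers before the upper end is overwritten. -/
def backwardBody : Prog :=
  23 ≔ reg 20 / reg 22 ;;
  24 ≔ 2 * reg 22 * reg 23 + reg 20 % reg 22 ;;
  25 ≔ reg 24 + reg 22 ;;
  26 ≔ load 0 (reg 24) + reg 4 - load 0 (reg 25) ;;
  27 ≔ load 1 (reg 24) + reg 4 - load 1 (reg 25) ;;
  28 ≔ load 2 (reg 23) ;;
  29 ≔ 2 * reg 4 - load 3 (reg 23) ;;
  .put 0 (reg 24) (load 0 (reg 24) + load 0 (reg 25) - reg 4) ;;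
  .put 1 (reg 24) (load 1 (reg 24) + load 1 (reg 25) - reg 4) ;;
  .put 0 (reg 25) mulReE ;;
  .put 1 (reg 25) mulImE

/-- Registers that the transform overwrites. -/
def fftRegs : Finset ℕ := Finset.Icc 20 31

theorem mem_fftRegs {r : ℕ} : r ∈ fftRegs ↔ 20 ≤ r ∧ r ≤ 31 := Finset.mem_Icc


/-- A loop over all butterflies of a level. -/
theorem butterfly_loop {W M n m N T : ℕ} {p : Prog} {R : Finset ℕ} {v : State} (hm : 0 < m)
    (h9 : v.reg 9 = N) (hR : 9 ∉ R) (hR' : 20 ∈ R) {U0 U1 L0 L1 : ℕ → ℕ} (hW : N < W)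
    (hp : ∀ i < N / 2, ∀ v', Frame R {0, 1} v v' → v'.reg 20 = i →
      (v'.arr 0 (pos m i) = v.arr 0 (pos m i) ∧ v'.arr 1 (pos m i) = v.arr 1 (pos m i) ∧
        v'.arr 0 (pos m i + m) = v.arr 0 (pos m i + m) ∧
        v'.arr 1 (pos m i + m) = v.arr 1 (pos m i + m)) →
      Tri W M n p v' T fun w => Frame R {0, 1} v w ∧ w.reg 20 = i ∧
        (∀ j, w.arr 0 j = if j = pos m i then U0 i else if j = pos m i + m then L0 i else v'.arr 0 j) ∧
        ∀ j, w.arr 1 j = if j = pos m i then U1 i else if j = pos m i + m then L1 i else v'.arr 1 j) :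
    Tri W M n (.for 20 (reg 9 / 2) p) v ((T + 15) * (N / 2 + 1)) fun v' => Frame R {0, 1} v v' ∧
      ∀ q < N / 2, v'.arr 0 (pos m q) = U0 q ∧ v'.arr 1 (pos m q) = U1 q ∧
        v'.arr 0 (pos m q + m) = L0 q ∧ v'.arr 1 (pos m q + m) = L1 q := by
  refine (Tri.for (fun i v' => Frame R {0, 1} v v' ∧ v'.reg 20 = i ∧
    (∀ q < i, v'.arr 0 (pos m q) = U0 q ∧ v'.arr 1 (pos m q) = U1 q ∧
        v'.arr 0 (pos m q + m) = L0 q ∧ v'.arr 1 (pos m q + m) = L1 q) ∧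
    ∀ q, i ≤ q → v'.arr 0 (pos m q) = v.arr 0 (pos m q) ∧ v'.arr 1 (pos m q) = v.arr 1 (pos m q) ∧
      v'.arr 0 (pos m q + m) = v.arr 0 (pos m q + m) ∧ v'.arr 1 (pos m q + m) = v.arr 1 (pos m q + m))
    (N / 2) T (by norm_num) ?_ ?_ ?_ ?_).mono le_rfl fun v' h => ⟨h.1, h.2.2.1⟩
  · simp [Frame.set_iff, hR', Frame.refl]
  · rintro i hi v' ⟨hf, h20, -⟩
    simp [h20, hf.reg, hR, h9]
  · rintro i hi v' ⟨hf, h20, hlt, hge⟩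
    refine (hp i hi v' hf h20 (hge i le_rfl)).imp ?_
    rintro w ⟨hw, w20, w0, w1⟩
    have hne : ∀ q, q ≠ i → pos m q ≠ pos m i := fun q hq h => hq (pos_inj hm h)
    have hne1 : ∀ q q', pos m q ≠ pos m q' + m := fun q q' => pos_ne hm
    have hne2 : ∀ q q', pos m q + m ≠ pos m q' := fun q q' h => pos_ne hm h.symm
    refine ⟨w20, (Frame.set_iff hR').2 hw, by simp, ?_, ?_⟩
    · intro q hq
      rcases Nat.lt_succ_iff_lt_or_eq.1 hq with h | rfl
      · simpa [w0, w1, hne _ h.ne, hne1, hne2] using hlt q h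
      · simp [w0, w1, hm.ne']
    · intro q hq
      have h : q ≠ i := by omega
      simpa [w0, w1, hne _ h, hne1, hne2] using hge q (by omega)
  · omega

/-- Numbers of the sizes that arise in the transforms are words. -/
structure FitsFFT (W n H Q : ℕ) : Prop where
  le : Q ≤ H
  sq : 16 * (H * H) + 16 * H < W
  len : 66 * n + 64 ≤ W

theorem forward_loop {W M n m N H Q : ℕ} {v : State} (hm : 0 < m) (hmN : 2 * m ∣ N)
    (hN : N ≤ 4 * n + 4) (h4 : v.reg 4 = H) (h5 : v.reg 5 = Q) (h9 : v.reg 9 = N)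
    (h22 : v.reg 22 = m) (hW : FitsFFT W n H Q)
    (hA : ∀ p < N, v.arr 0 p ≤ 2 * H ∧ v.arr 1 p ≤ 2 * H)
    (hT : ∀ p < N, v.arr 2 p ≤ 2 * H ∧ v.arr 3 p ≤ 2 * H) :
    Tri W M n (.for 20 (reg 9 / 2) forwardBody) v ((forwardBody.time + 15) * (N / 2 + 1)) fun v' =>
      Frame (fftRegs.erase 22) {0, 1} v v' ∧ ∀ q < N / 2,
        v'.arr 0 (pos m q) = v.arr 0 (pos m q) + mulRe H Q (v.arr 0 (pos m q + m))
          (v.arr 1 (pos m q + m)) (v.arr 2 (q / m)) (v.arr 3 (q / m)) - H ∧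
        v'.arr 1 (pos m q) = v.arr 1 (pos m q) + mulIm H Q (v.arr 0 (pos m q + m))
          (v.arr 1 (pos m q + m)) (v.arr 2 (q / m)) (v.arr 3 (q / m)) - H ∧
        v'.arr 0 (pos m q + m) = v.arr 0 (pos m q) + H - mulRe H Q (v.arr 0 (pos m q + m))
          (v.arr 1 (pos m q + m)) (v.arr 2 (q / m)) (v.arr 3 (q / m)) ∧
        v'.arr 1 (pos m q + m) = v.arr 1 (pos m q) + H - mulIm H Q (v.arr 0 (pos m q + m))
          (v.arr 1 (pos m q + m)) (v.arr 2 (q / m)) (v.arr 3 (q / m)) := by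
  have hWs := hW.sq
  have hWl := hW.len
  refine butterfly_loop hm h9 (by simp [mem_fftRegs]) (by simp [mem_fftRegs]) (by omega) ?_
  intro i hi v' hf h20 ⟨g1, g2, g3, g4⟩
  have r4 : v'.reg 4 = H := by rw [hf.reg 4 (by simp [mem_fftRegs]), h4]
  have r5 : v'.reg 5 = Q := by rw [hf.reg 5 (by simp [mem_fftRegs]), h5]
  have r22 : v'.reg 22 = m := by rw [hf.reg 22 (by simp), h22]
  have a2 : v'.arr 2 = v.arr 2 := hf.arr 2 (by simp)
  have a3 : v'.arr 3 = v.arr 3 := hf.arr 3 (by simp)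
  have p1 := (pos_lt_iff hm hmN).2 hi
  have p2 := (pos_add_lt_iff hm hmN).2 hi
  have hk : i / m < N := lt_of_le_of_lt (Nat.div_le_self _ _) (by omega)
  have hpos : 2 * m * (i / m) + i % m = pos m i := rfl
  have hpos' : 2 * m * (i / m) ≤ pos m i := Nat.le_add_right _ _
  have hmi : 2 * m ≤ N := Nat.le_of_dvd (by omega) hmN
  obtain ⟨b1, b2⟩ := hA _ p1
  obtain ⟨b3, b4⟩ := hA _ p2
  obtain ⟨b5, b6⟩ := hT _ hk
  have b7 := mulRe_le b3 b4 b5 b6 hW.le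
  have b8 := mulIm_le b3 b4 b5 b6 hW.le
  apply Tri.of_wp
  simp [forwardBody, Prog.wp, h20, r22, r4, r5, a2, a3, hpos, g1, g2, g3, g4, hm.ne', lim,
    mulReE_ok, mulImE_ok, b3, b4, b5, b6, hW.le, hWs, hf, Frame.set_iff, Frame.put_iff, mem_fftRegs]
  omega

theorem backward_loop {W M n m N H Q : ℕ} {v : State} (hm : 0 < m) (hmN : 2 * m ∣ N)
    (hN : N ≤ 4 * n + 4) (h4 : v.reg 4 = H) (h5 : v.reg 5 = Q) (h9 : v.reg 9 = N)
    (h22 : v.reg 22 = m) (hW : FitsFFT W n H Q)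
    (hA : ∀ p < N, v.arr 0 p ≤ 2 * H ∧ v.arr 1 p ≤ 2 * H)
    (hA' : ∀ q < N / 2, v.arr 0 (pos m q) + H - v.arr 0 (pos m q + m) ≤ 2 * H ∧
      v.arr 1 (pos m q) + H - v.arr 1 (pos m q + m) ≤ 2 * H)
    (hT : ∀ p < N, v.arr 2 p ≤ 2 * H ∧ v.arr 3 p ≤ 2 * H) :
    Tri W M n (.for 20 (reg 9 / 2) backwardBody) v ((backwardBody.time + 15) * (N / 2 + 1)) fun v' =>
      Frame (fftRegs.erase 22) {0, 1} v v' ∧ ∀ q < N / 2,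
        v'.arr 0 (pos m q) = v.arr 0 (pos m q) + v.arr 0 (pos m q + m) - H ∧
        v'.arr 1 (pos m q) = v.arr 1 (pos m q) + v.arr 1 (pos m q + m) - H ∧
        v'.arr 0 (pos m q + m) = mulRe H Q (v.arr 0 (pos m q) + H - v.arr 0 (pos m q + m))
          (v.arr 1 (pos m q) + H - v.arr 1 (pos m q + m)) (v.arr 2 (q / m)) (2 * H - v.arr 3 (q / m)) ∧
        v'.arr 1 (pos m q + m) = mulIm H Q (v.arr 0 (pos m q) + H - v.arr 0 (pos m q + m))
          (v.arr 1 (pos m q) + H - v.arr 1 (pos m q + m)) (v.arr 2 (q / m))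
          (2 * H - v.arr 3 (q / m)) := by
  have hWs := hW.sq
  have hWl := hW.len
  refine butterfly_loop hm h9 (by simp [mem_fftRegs]) (by simp [mem_fftRegs]) (by omega) ?_
  intro i hi v' hf h20 ⟨g1, g2, g3, g4⟩
  have r4 : v'.reg 4 = H := by rw [hf.reg 4 (by simp [mem_fftRegs]), h4]
  have r5 : v'.reg 5 = Q := by rw [hf.reg 5 (by simp [mem_fftRegs]), h5]
  have r22 : v'.reg 22 = m := by rw [hf.reg 22 (by simp), h22]
  have a2 : v'.arr 2 = v.arr 2 := hf.arr 2 (by simp)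
  have a3 : v'.arr 3 = v.arr 3 := hf.arr 3 (by simp)
  have p1 := (pos_lt_iff hm hmN).2 hi
  have p2 := (pos_add_lt_iff hm hmN).2 hi
  have hk : i / m < N := lt_of_le_of_lt (Nat.div_le_self _ _) (by omega)
  have hpos : 2 * m * (i / m) + i % m = pos m i := rfl
  have hpos' : 2 * m * (i / m) ≤ pos m i := Nat.le_add_right _ _
  have hmi : 2 * m ≤ N := Nat.le_of_dvd (by omega) hmN
  obtain ⟨b1, b2⟩ := hA _ p1
  obtain ⟨b3, b4⟩ := hA _ p2
  obtain ⟨b5, b6⟩ := hT _ hk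
  obtain ⟨b7, b8⟩ := hA' i hi
  have b7' := tsub_le_iff_right.1 b7
  have b8' := tsub_le_iff_right.1 b8
  apply Tri.of_wp
  simp [backwardBody, Prog.wp, h20, r22, r4, r5, a2, a3, hpos, g1, g2, g3, g4, hm.ne', lim,
    mulReE_ok, mulImE_ok, b5, b7', b8', hW.le, hWs, hf, Frame.set_iff, Frame.put_iff, mem_fftRegs]
  and_intros <;> first | omega | (intro j; split_ifs <;> first | rfl | omega)

end VM

namespace VM

open VM.Expr FFT

def forwardProg : Prog :=
  22 ≔ reg 9 ;;
  .while (lt 1 (reg 22)) (22 ≔ reg 22 / 2 ;; .for 20 (reg 9 / 2) forwardBody)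

def squareBody : Prog :=
  26 ≔ load 0 (reg 20) ;;
  27 ≔ load 1 (reg 20) ;;
  28 ≔ reg 26 ;;
  29 ≔ reg 27 ;;
  .put 0 (reg 20) mulReE ;;
  .put 1 (reg 20) mulImE

def backwardProg : Prog :=
  22 ≔ 1 ;;
  .while (lt (reg 22) (reg 9)) (.for 20 (reg 9 / 2) backwardBody ;; 22 ≔ reg 22 + reg 22)

def roundBody : Prog :=
  .put 0 (reg 20) ((load 0 (reg 20) + reg 9 * reg 5 / 2 - reg 4) / (reg 9 * reg 5))

/-- Marks the occurrences of the letter with code `reg 12`; the code `0` stands for all letters. -/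
def initBody : Prog :=
  .ite (lt (reg 20) (reg 8))
    -- The exclusive or of "the code is `a`" and "`a` is 0": for `a ≠ 0` it marks the letter `a`,
    -- for `a = 0` all non-wildcards.
    (21 ≔ 1 - eq (eq (load 16 (reg 7 + reg 20)) (reg 12)) (eq (reg 12) 0)) (21 ≔ 0) ;;
  .put 0 (reg 20) (reg 4 + reg 5 * reg 21) ;;
  .put 1 (reg 20) (reg 4)

def convProg : Prog :=
  .for 20 (reg 9) initBody ;; forwardProg ;; .for 20 (reg 9) squareBody ;; backwardProg ;;
  .for 20 (reg 9) roundBody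

theorem forwardProg_tri {W M n N L H Q : ℕ} {δ : ℝ} {v : State} {x : ℕ → ℂ} (hp : Precise H Q N δ)
    (hNL : N = 2 ^ L) (hN : N ≤ 4 * n + 4) (h4 : v.reg 4 = H) (h5 : v.reg 5 = Q) (h9 : v.reg 9 = N)
    (hW : FitsFFT W n H Q) (hx : ∀ i, ‖x i‖ ≤ 1) (hA : Approx H Q N 0 (v.arr 0) (v.arr 1) x)
    (hT : Approx H Q N δ (v.arr 2) (v.arr 3) root) :
    Tri W M n forwardProg v ((forwardBody.time + 30) * (N * (L + 1))) fun v' =>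
      Frame fftRegs {0, 1} v v' ∧
        Approx H Q N (4 ^ L * (2 * N * δ)) (v'.arr 0) (v'.arr 1) (trans L 1 x) := by
  have h2 := hp.two_le
  have hδ := hp.delta_pos
  refine (Tri.seq (T₁ := 2) (R := fun v' => v' = v.set 22 N) (Tri.asg (by norm_num) (by simp) (by simp [h9]))
    (fun v' hv' => Tri.while_eq (fun l v' => Frame fftRegs {0, 1} v v' ∧ v'.reg 22 = 2 ^ (L - l) ∧
      Approx H Q N (4 ^ l * (2 * N * δ)) (v'.arr 0) (v'.arr 1) (trans l (2 ^ (L - l)) x))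
      (fun _ => 4 + (forwardBody.time + 15) * (N / 2 + 1)) L ?_ ?_ ?_)).mono (Q := fun v' =>
        Frame fftRegs {0, 1} v v' ∧
        Approx H Q N (4 ^ L * (2 * N * δ)) (v'.arr 0) (v'.arr 1) (trans L 1 x)) ?_ fun _ h => h
  · subst hv'
    refine ⟨by simp [Frame.set_iff, mem_fftRegs, Frame.refl], by simp [hNL], fun p hp => ?_⟩
    rw [Nat.sub_zero, ← hNL, trans_zero _ hp]
    refine (hA p hp).trans (by positivity)
  · rintro l hl v' ⟨hf, h22, hap⟩
    have hm : 2 ^ (L - l) = 2 * 2 ^ (L - (l + 1)) := by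
      rw [← pow_succ', show L - l = L - (l + 1) + 1 by omega]
    have hm0 : 0 < 2 ^ (L - (l + 1)) := by positivity
    refine ⟨by simp, by simp [h22, hm]; omega, ?_⟩
    refine Tri.seq (R := fun w => w = v'.set 22 (2 ^ (L - (l + 1))))
      (Tri.asg (by norm_num) (by simp) (by simp [h22, hm])) fun w hw => ?_
    have hfw : Frame fftRegs {0, 1} v w := by simp [hw, Frame.set_iff, mem_fftRegs, hf]
    have hNm : N = 2 ^ (l + 1) * 2 ^ (L - (l + 1)) := by
      rw [hNL, ← pow_add]; congr 1; omega
    have hnear := fun p hp' => hp.forward_near (p := p) hNL hl.le hx hap hp'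
    have ha2 : w.arr 2 = v.arr 2 := hfw.arr 2 (by simp)
    have ha3 : w.arr 3 = v.arr 3 := hfw.arr 3 (by simp)
    refine (forward_loop (m := 2 ^ (L - (l + 1))) (N := N) (H := H) (Q := Q) hm0
      ⟨2 ^ l, by rw [hNm]; ring⟩ hN ?_ ?_ ?_ (by simp [hw]) hW ?_ ?_).imp ?_
    · rw [hfw.reg 4 (by simp [mem_fftRegs]), h4]
    · rw [hfw.reg 5 (by simp [mem_fftRegs]), h5]
    · rw [hfw.reg 9 (by simp [mem_fftRegs]), h9]
    · intro p hp'
      have := hnear p hp'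
      simp only [hw, State.set_arr]; omega
    · intro p hp'
      have := hp.root_near hT hp'
      rw [ha2, ha3]; omega
    · rintro u ⟨hu, hu'⟩
      refine ⟨hfw.trans (hu.mono (Finset.erase_subset _ _) subset_rfl), ?_, ?_⟩
      · rw [hu.reg 22 (by simp), hw]; simp
      · rw [ha2, ha3] at hu'
        refine hp.forward hNL hl hNm hx ?_ hT hu'
        rw [hw, State.set_arr, ← hm]; exact hap
  · rintro v' ⟨hf, h22, hap⟩
    rw [Nat.sub_self, pow_zero] at h22 hap
    exact ⟨by simp, by simp [h22], hf, hap⟩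
  · have hc : (lt 1 (reg 22)).cost = 3 := rfl
    rw [hc, Finset.sum_const, Finset.card_range, smul_eq_mul]
    have e1 : N / 2 + 1 ≤ N := by omega
    have e2 : (forwardBody.time + 15) * (N / 2 + 1) ≤ (forwardBody.time + 15) * N :=
      Nat.mul_le_mul_left _ e1
    have e3 : L * (4 + (forwardBody.time + 15) * (N / 2 + 1) + (3 + 1)) ≤
        L * ((forwardBody.time + 30) * N) := Nat.mul_le_mul_left _ (by nlinarith)
    nlinarith

theorem backwardProg_tri {W M n N L H Q : ℕ} {δ : ℝ} {v : State} {y : ℕ → ℂ} (hp : Precise H Q N δ)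
    (hNL : N = 2 ^ L) (hN : N ≤ 4 * n + 4) (h4 : v.reg 4 = H) (h5 : v.reg 5 = Q) (h9 : v.reg 9 = N)
    (hW : FitsFFT W n H Q) (hy : ∀ i, ‖y i‖ ≤ N)
    (hA : Approx H Q N (7 * N ^ 4 * δ) (v.arr 0) (v.arr 1) (trans L 1 y))
    (hT : Approx H Q N δ (v.arr 2) (v.arr 3) root) :
    Tri W M n backwardProg v ((backwardBody.time + 30) * (N * (L + 1))) fun v' =>
      Frame fftRegs {0, 1} v v' ∧
        Approx H Q N (8 ^ L * (7 * N ^ 4 * δ)) (v'.arr 0) (v'.arr 1)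
          (fun p => 2 ^ L * trans 0 N y p) := by
  have h2 := hp.two_le
  have hδ := hp.delta_pos
  have hWl := hW.len
  refine (Tri.seq (T₁ := 2) (R := fun v' => v' = v.set 22 1) (Tri.asg (by norm_num) (by simp) (by simp))
    (fun v' hv' => Tri.while_eq (fun j v' => Frame fftRegs {0, 1} v v' ∧ v'.reg 22 = 2 ^ j ∧
      Approx H Q N (8 ^ (L - (L - j)) * (7 * N ^ 4 * δ)) (v'.arr 0) (v'.arr 1)
        (fun p => 2 ^ (L - (L - j)) * trans (L - j) (2 ^ j) y p))
      (fun _ => (backwardBody.time + 15) * (N / 2 + 1) + 4) L ?_ ?_ ?_)).mono (Q := fun v' =>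
        Frame fftRegs {0, 1} v v' ∧
        Approx H Q N (8 ^ L * (7 * N ^ 4 * δ)) (v'.arr 0) (v'.arr 1)
          (fun p => 2 ^ L * trans 0 N y p)) ?_ fun _ h => h
  · subst hv'
    refine ⟨by simp [Frame.set_iff, mem_fftRegs, Frame.refl], by simp, ?_⟩
    simpa using hA
  · rintro j hj v' ⟨hf, h22, hap⟩
    have hm0 : 0 < 2 ^ j := by positivity
    have hNm : N = 2 ^ (L - (j + 1) + 1) * 2 ^ j := by
      rw [hNL, ← pow_add]; congr 1; omega
    have hlt : 2 ^ j < N := by rw [hNL]; exact Nat.pow_lt_pow_right (by norm_num) hj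
    have h9' : v'.reg 9 = N := by rw [hf.reg 9 (by simp [mem_fftRegs]), h9]
    refine ⟨by simp, by simp [h22, h9', hlt], ?_⟩
    have hnear := fun p hp' => hp.backward_near (p := p) hNL (Nat.sub_le _ _) hy hap hp'
    have ha2 : v'.arr 2 = v.arr 2 := hf.arr 2 (by simp)
    have ha3 : v'.arr 3 = v.arr 3 := hf.arr 3 (by simp)
    have hd : 2 * 2 ^ j ∣ N := ⟨2 ^ (L - (j + 1)), by rw [hNm]; ring⟩
    refine Tri.seq (backward_loop (m := 2 ^ j) (N := N) (H := H) (Q := Q) hm0 hd hN ?_ ?_ h9' h22 hW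
      ?_ ?_ ?_) ?_
    · rw [hf.reg 4 (by simp [mem_fftRegs]), h4]
    · rw [hf.reg 5 (by simp [mem_fftRegs]), h5]
    · intro p hp'
      have := hnear p hp'
      omega
    · intro q hq
      have := hnear _ ((pos_lt_iff hm0 hd).2 hq)
      have := hnear _ ((pos_add_lt_iff hm0 hd).2 hq)
      omega
    · intro p hp'
      have := hp.root_near hT hp'
      rw [ha2, ha3]; omega
    · rintro u ⟨hu, hu'⟩
      have h22' : u.reg 22 = 2 ^ j := by rw [hu.reg 22 (by simp), h22]
      refine Tri.asg (by norm_num) (by simp [h22']; omega) ⟨?_, ?_, ?_⟩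
      · rw [Frame.set_iff (by simp [mem_fftRegs])]
        exact hf.trans (hu.mono (Finset.erase_subset _ _) subset_rfl)
      · simp [h22', pow_succ, mul_two]
      · rw [ha2, ha3] at hu'
        have e1 : L - (j + 1) + 1 = L - j := by omega
        have := hp.backward hNL (l := L - (j + 1)) (by omega) hNm hy (by rw [e1]; exact hap) hT hu'
        rw [← pow_succ'] at this
        exact this
  · rintro v' ⟨hf, h22, hap⟩
    have h9' : v'.reg 9 = N := by rw [hf.reg 9 (by simp [mem_fftRegs]), h9]
    rw [Nat.sub_self, Nat.sub_zero, ← hNL] at hap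
    exact ⟨by simp, by simp [h22, h9', hNL], hf, hap⟩
  · have hc : (lt (reg 22) (reg 9)).cost = 3 := rfl
    rw [hc, Finset.sum_const, Finset.card_range, smul_eq_mul]
    have e1 : N / 2 + 1 ≤ N := by omega
    have e2 : (backwardBody.time + 15) * (N / 2 + 1) ≤ (backwardBody.time + 15) * N :=
      Nat.mul_le_mul_left _ e1
    have e3 : L * ((backwardBody.time + 15) * (N / 2 + 1) + 4 + (3 + 1)) ≤
        L * ((backwardBody.time + 30) * N) := Nat.mul_le_mul_left _ (by nlinarith)
    nlinarith

/-- A loop that overwrites the cells below `N` of two arrays one after the other. -/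
theorem array_loop {W M n N T r : ℕ} {p : Prog} {b : Expr} {R A : Finset ℕ} {v : State}
    (hr : r ∈ R) (hr0 : r ≠ 0) (hW : N < W) (I : ℕ → State → Prop)
    (hb : ∀ v', Frame R A v v' → b.Ok W n v' ∧ b.val v' = N) (h0 : I 0 (v.set r 0))
    (hp : ∀ i < N, ∀ v', Frame R A v v' → v'.reg r = i → I i v' →
      Tri W M n p v' T fun w => Frame R A v w ∧ w.reg r = i ∧ I (i + 1) (w.set r (i + 1))) :
    Tri W M n (.for r b p) v ((T + b.cost + 12) * (N + 1)) fun v' => Frame R A v v' ∧ I N v' := by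
  refine (Tri.for (fun i v' => Frame R A v v' ∧ v'.reg r = i ∧ I i v') N T hr0 ?_ ?_ ?_ hW).mono le_rfl
    fun v' h => ⟨h.1, h.2.2⟩
  · exact ⟨(Frame.set_iff hr).2 (Frame.refl _ _ _), by simp, h0⟩
  · rintro i hi v' ⟨hf, h20, -⟩
    exact ⟨h20, hb v' hf⟩
  · rintro i hi v' ⟨hf, h20, hI⟩
    refine (hp i hi v' hf h20 hI).imp ?_
    rintro w ⟨hw, w20, hI'⟩
    exact ⟨w20, (Frame.set_iff hr).2 hw, by simp, hI'⟩

end VM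

namespace FFT

/-- Below `N` there are at most `N` pairs with sum `s`, and from `N` on one member of each pair has
value 0. This is the bound that the backward transform requires of its exact values. -/
theorem conv_le {N : ℕ} {x : ℕ → ℕ} (hx : ∀ i, x i ≤ 1) (hx0 : ∀ i, N ≤ 2 * i → x i = 0) (s : ℕ) :
    conv x s ≤ N := by
  rcases lt_or_ge s N with h | h
  · refine (Finset.sum_le_card_nsmul _ _ 1 fun p _ => Nat.mul_le_mul (hx _) (hx _)).trans ?_
    simpa using h
  · refine (Finset.sum_eq_zero fun p hp => ?_).le.trans (Nat.zero_le N)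
    rw [Finset.HasAntidiagonal.mem_antidiagonal] at hp
    rcases le_or_gt N (2 * p.1) with h1 | h1
    · rw [hx0 _ h1, zero_mul]
    · rw [hx0 p.2 (by omega), mul_zero]

theorem natCast_conv (x : ℕ → ℕ) (s : ℕ) :
    ((conv x s : ℕ) : ℂ) = conv (fun i => (x i : ℂ)) s := by
  simp [conv]

theorem Precise.mul_le {H Q N : ℕ} {δ : ℝ} (h : Precise H Q N δ) : N * Q ≤ H := by
  have h1 := h.range
  have h2 : (0 : ℝ) ≤ Q := Nat.cast_nonneg _
  have h3 := h.two_le'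
  have : ((N * Q : ℕ) : ℝ) ≤ H := by
    push_cast
    refine le_trans (mul_le_mul_of_nonneg_right ?_ h2) h1
    nlinarith
  exact_mod_cast this

end FFT

namespace VM

open VM.Expr FFT

/-- Marks the occurrences of the letter with code `a`; the code `0` stands for all letters. -/
def sel (c : ℕ → ℕ) (len a i : ℕ) : ℕ := if i < len ∧ (c i = a ↔ a ≠ 0) then 1 else 0

theorem sel_le_one (c : ℕ → ℕ) (len a i : ℕ) : sel c len a i ≤ 1 := by
  unfold sel; split_ifs <;> simp

theorem sel_of_le (c : ℕ → ℕ) {len i : ℕ} (a : ℕ) (h : len ≤ i) : sel c len a i = 0 :=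
  if_neg fun h' => by omega

theorem square_loop {W M n N H Q : ℕ} {v : State} (hN : N ≤ 4 * n + 4) (h4 : v.reg 4 = H)
    (h5 : v.reg 5 = Q) (h9 : v.reg 9 = N) (hW : FitsFFT W n H Q)
    (hA : ∀ p < N, v.arr 0 p ≤ 2 * H ∧ v.arr 1 p ≤ 2 * H) :
    Tri W M n (.for 20 (reg 9) squareBody) v ((squareBody.time + 13) * (N + 1)) fun v' =>
      Frame fftRegs {0, 1} v v' ∧ ∀ p < N,
        v'.arr 0 p = mulRe H Q (v.arr 0 p) (v.arr 1 p) (v.arr 0 p) (v.arr 1 p) ∧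
        v'.arr 1 p = mulIm H Q (v.arr 0 p) (v.arr 1 p) (v.arr 0 p) (v.arr 1 p) := by
  have hWs := hW.sq
  have hWl := hW.len
  refine (array_loop (N := N) (T := squareBody.time) (R := fftRegs) (A := {0, 1}) (by simp [mem_fftRegs])
    (by norm_num) (by omega) (fun i v' => (∀ p < i,
        v'.arr 0 p = mulRe H Q (v.arr 0 p) (v.arr 1 p) (v.arr 0 p) (v.arr 1 p) ∧
        v'.arr 1 p = mulIm H Q (v.arr 0 p) (v.arr 1 p) (v.arr 0 p) (v.arr 1 p)) ∧
      ∀ p, i ≤ p → v'.arr 0 p = v.arr 0 p ∧ v'.arr 1 p = v.arr 1 p) ?_ ?_ ?_).mono le_rfl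
      fun v' h => ⟨h.1, h.2.1⟩
  · intro v' hf
    simp [hf.reg, mem_fftRegs, h9]
  · simp
  · rintro i hi v' hf h20 ⟨h1, h2⟩
    obtain ⟨g1, g2⟩ := h2 i le_rfl
    obtain ⟨b1, b2⟩ := hA i hi
    have r4 : v'.reg 4 = H := by rw [hf.reg 4 (by simp [mem_fftRegs]), h4]
    have r5 : v'.reg 5 = Q := by rw [hf.reg 5 (by simp [mem_fftRegs]), h5]
    apply Tri.of_wp
    simp [squareBody, Prog.wp, h20, r4, r5, g1, g2, b1, b2, lim, mulReE_ok, mulImE_ok, hW.le, hWs, hf,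
      Frame.set_iff, Frame.put_iff, mem_fftRegs]
    refine ⟨by omega, fun p hp => ?_, fun p hp => ?_⟩
    · rcases hp.lt_or_eq with h | rfl
      · simpa [h.ne] using h1 p h
      · simp
    · have : p ≠ i := by omega
      simpa [this] using h2 p (by omega)

theorem round_loop {W M n N L H Q : ℕ} {δ : ℝ} {v : State} {y : ℕ → ℕ} (hp : Precise H Q N δ)
    (hNL : N = 2 ^ L) (hN : N ≤ 4 * n + 4) (h4 : v.reg 4 = H)
    (h5 : v.reg 5 = Q) (h9 : v.reg 9 = N) (hW : FitsFFT W n H Q)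
    (hb : ∀ p < N, v.arr 0 p ≤ 2 * H)
    (hA : Approx H Q N (8 ^ L * (7 * N ^ 4 * δ)) (v.arr 0) (v.arr 1)
      (fun p => 2 ^ L * trans 0 N (fun i => (y i : ℂ)) p)) :
    Tri W M n (.for 20 (reg 9) roundBody) v ((roundBody.time + 13) * (N + 1)) fun v' =>
      Frame fftRegs {0, 1} v v' ∧ ∀ p < N, v'.arr 0 p = y p := by
  have hWs := hW.sq
  have hWl := hW.len
  have hNQ := hp.mul_le
  refine (array_loop (N := N) (T := roundBody.time) (R := fftRegs) (A := {0, 1}) (by simp [mem_fftRegs])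
    (by norm_num) (by omega) (fun i v' => (∀ p < i, v'.arr 0 p = y p) ∧
      ∀ p, i ≤ p → v'.arr 0 p = v.arr 0 p) ?_ ?_ ?_).mono le_rfl fun v' h => ⟨h.1, h.2.1⟩
  · intro v' hf
    simp [hf.reg, mem_fftRegs, h9]
  · simp
  · rintro i hi v' hf h20 ⟨h1, h2⟩
    have g1 := h2 i le_rfl
    have r4 : v'.reg 4 = H := by rw [hf.reg 4 (by simp [mem_fftRegs]), h4]
    have r5 : v'.reg 5 = Q := by rw [hf.reg 5 (by simp [mem_fftRegs]), h5]
    have r9 : v'.reg 9 = N := by rw [hf.reg 9 (by simp [mem_fftRegs]), h9]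
    have hr := hp.round hNL hA hi
    have hbi := hb i hi
    apply Tri.of_wp
    simp [roundBody, Prog.wp, h20, r4, r5, r9, g1, lim, hf, hr, Frame.put_iff]
    refine ⟨by omega, by omega, fun p hp => ?_, fun p hp => ?_⟩
    · rcases hp.lt_or_eq with h | rfl
      · simpa [h.ne] using h1 p h
      · simp
    · have : p ≠ i := by omega
      simpa [this] using h2 p (by omega)

theorem init_loop {W M n N H Q lo len a : ℕ} {v : State} (hN : N ≤ 4 * n + 4) (h4 : v.reg 4 = H)
    (h5 : v.reg 5 = Q) (h7 : v.reg 7 = lo) (h8 : v.reg 8 = len) (h9 : v.reg 9 = N)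
    (h12 : v.reg 12 = a) (hlen : lo + len ≤ n) (hW : FitsFFT W n H Q) :
    Tri W M n (.for 20 (reg 9) initBody) v ((initBody.time + 13) * (N + 1)) fun v' =>
      Frame fftRegs {0, 1} v v' ∧ ∀ p < N,
        v'.arr 0 p = H + Q * sel (fun i => v.arr 16 (lo + i)) len a p ∧ v'.arr 1 p = H := by
  have hWs := hW.sq
  have hWl := hW.len
  have hWQ := hW.le
  refine (array_loop (N := N) (T := initBody.time) (R := fftRegs) (A := {0, 1}) (by simp [mem_fftRegs])
    (by norm_num) (by omega) (fun i v' => ∀ p < i,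
        v'.arr 0 p = H + Q * sel (fun i => v.arr 16 (lo + i)) len a p ∧ v'.arr 1 p = H)
        ?_ ?_ ?_).mono le_rfl fun v' h => ⟨h.1, h.2⟩
  · intro v' hf
    simp [hf.reg, mem_fftRegs, h9]
  · simp
  · rintro i hi v' hf h20 h1
    have r4 : v'.reg 4 = H := by rw [hf.reg 4 (by simp [mem_fftRegs]), h4]
    have r5 : v'.reg 5 = Q := by rw [hf.reg 5 (by simp [mem_fftRegs]), h5]
    have r7 : v'.reg 7 = lo := by rw [hf.reg 7 (by simp [mem_fftRegs]), h7]
    have r8 : v'.reg 8 = len := by rw [hf.reg 8 (by simp [mem_fftRegs]), h8]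
    have r12 : v'.reg 12 = a := by rw [hf.reg 12 (by simp [mem_fftRegs]), h12]
    have a16 : v'.arr 16 = v.arr 16 := hf.arr 16 (by simp)
    have hfin : ∀ z, z = sel (fun i => v.arr 16 (lo + i)) len a i → ∀ p < i + 1,
        (if p = i then H + Q * z else v'.arr 0 p) = H + Q * sel (fun i => v.arr 16 (lo + i)) len a p ∧
        (if p = i then H else v'.arr 1 p) = H := by
      rintro z rfl p hp
      rcases Nat.lt_succ_iff_lt_or_eq.1 hp with h | rfl
      · simpa [h.ne] using h1 p h
      · simp
    have hz : ∀ {z}, z ≤ 1 → Q * z < W ∧ H + Q * z < W := fun {z} h => by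
      have := Nat.mul_le_mul_left Q h
      omega
    apply Tri.of_wp
    simp [initBody, Prog.wp, h20, r4, r5, r7, r8, r12, a16, lim, hf, Frame.set_iff, Frame.put_iff,
      mem_fftRegs, -mul_ite]
    refine ⟨fun hlt => ?_, fun hle => ?_⟩
    · and_intros
      any_goals first | omega | exact (hz (Nat.sub_le _ _)).1 | exact (hz (Nat.sub_le _ _)).2
      intro p hp
      have := hfin (1 - if (if v.arr 16 (lo + i) = a then 1 else 0) = if a = 0 then 1 else 0 then 1 else 0)
        (by
          unfold sel
          by_cases c1 : v.arr 16 (lo + i) = a <;> by_cases c2 : a = 0 <;> simp [c1, c2, hlt]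
          split_ifs <;> rfl) p (by omega)
      simpa using this
    · and_intros
      any_goals omega
      intro p hp
      have := hfin 0 (by rw [sel_of_le _ _ hle]) p (by omega)
      simpa using this

/-- Running time of a self-convolution of length `N = 2 ^ L`, up to the factor `N * (L + 1)`. -/
def convTime : ℕ := 2 * (initBody.time + 13) + (forwardBody.time + 30) + 2 * (squareBody.time + 13) +
  (backwardBody.time + 30) + 2 * (roundBody.time + 13)

theorem convProg_tri {W M n N L H Q lo len a : ℕ} {δ : ℝ} {v : State} (hp : Precise H Q N δ)
    (hNL : N = 2 ^ L) (hN : N ≤ 4 * n + 4) (h4 : v.reg 4 = H)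
    (h5 : v.reg 5 = Q) (h7 : v.reg 7 = lo) (h8 : v.reg 8 = len) (h9 : v.reg 9 = N)
    (h12 : v.reg 12 = a) (hlen : lo + len ≤ n) (hlenN : 2 * len ≤ N) (hW : FitsFFT W n H Q)
    (hT : Approx H Q N δ (v.arr 2) (v.arr 3) root) :
    Tri W M n convProg v (convTime * (N * (L + 1))) fun v' =>
      Frame fftRegs {0, 1} v v' ∧ ∀ p < N,
        v'.arr 0 p = conv (sel (fun i => v.arr 16 (lo + i)) len a) p := by
  set x := sel (fun i => v.arr 16 (lo + i)) len a with hx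
  have hx1 : ∀ i, x i ≤ 1 := sel_le_one _ _ _
  have hx0 : ∀ i, N ≤ 2 * i → x i = 0 := fun i hi => sel_of_le _ _ (by omega)
  have hy1 : ∀ i, ‖((conv x i : ℕ) : ℂ)‖ ≤ N := fun i => by
    rw [Complex.norm_natCast]; exact_mod_cast conv_le hx1 hx0 i
  have hxc : ∀ i, ‖(x i : ℂ)‖ ≤ 1 := fun i => by
    rw [Complex.norm_natCast]; exact_mod_cast hx1 i
  have hQ : (Q : ℝ) ≠ 0 := by exact_mod_cast hp.scale_pos.ne'
  have hreg : ∀ {v' : State}, Frame fftRegs {0, 1} v v' → v'.reg 4 = H ∧ v'.reg 5 = Q ∧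
      v'.reg 9 = N ∧ v'.arr 2 = v.arr 2 ∧ v'.arr 3 = v.arr 3 := fun hf =>
    ⟨by rw [hf.reg 4 (by simp [mem_fftRegs]), h4], by rw [hf.reg 5 (by simp [mem_fftRegs]), h5],
      by rw [hf.reg 9 (by simp [mem_fftRegs]), h9], hf.arr 2 (by simp), hf.arr 3 (by simp)⟩
  have main : Tri W M n convProg v ((initBody.time + 13) * (N + 1) +
      ((forwardBody.time + 30) * (N * (L + 1)) + ((squareBody.time + 13) * (N + 1) +
      ((backwardBody.time + 30) * (N * (L + 1)) + (roundBody.time + 13) * (N + 1)))))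
      fun v' => Frame fftRegs {0, 1} v v' ∧ ∀ p < N, v'.arr 0 p = conv x p := by
    refine Tri.seq (init_loop hN h4 h5 h7 h8 h9 h12 hlen hW) ?_
    rintro v1 ⟨f1, g1⟩
    obtain ⟨e4, e5, e9, e2, e3⟩ := hreg f1
    have ha : Approx H Q N 0 (v1.arr 0) (v1.arr 1) (fun i => (x i : ℂ)) := by
      intro p hp'
      beta_reduce
      rw [(g1 p hp').1, (g1 p hp').2, ← hx, show (x p : ℂ) = dec H Q (H + Q * x p) H by
        apply Complex.ext <;> simp [dec, hQ]]
      simp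
    refine Tri.seq (forwardProg_tri hp hNL hN e4 e5 e9 hW hxc ha (by rw [e2, e3]; exact hT)) ?_
    rintro v2 ⟨f2', g2⟩
    have f2 := f1.trans f2'
    obtain ⟨e4, e5, e9, e2, e3⟩ := hreg f2
    refine Tri.seq (square_loop hN e4 e5 e9 hW ?_) ?_
    · intro p hp'
      have := hp.forward_near hNL le_rfl hxc g2 hp'
      omega
    rintro v3 ⟨f3', g3⟩
    have f3 := f2.trans f3'
    obtain ⟨e4, e5, e9, e2, e3⟩ := hreg f3
    have hsq := hp.square hNL hxc (fun i hi => by simp [hx0 i hi]) g2 g3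
    have hcast : (conv fun i => (x i : ℂ)) = fun i => ((conv x i : ℕ) : ℂ) :=
      funext fun s => (natCast_conv x s).symm
    rw [hcast] at hsq
    refine Tri.seq (backwardProg_tri hp hNL hN e4 e5 e9 hW hy1 hsq (by rw [e2, e3]; exact hT)) ?_
    rintro v4 ⟨f4', g4⟩
    have f4 := f3.trans f4'
    obtain ⟨e4, e5, e9, e2, e3⟩ := hreg f4
    refine (round_loop hp hNL hN e4 e5 e9 hW ?_ g4).imp ?_
    · intro p hp'
      have := (hp.backward_near (l := 0) hNL (Nat.zero_le _) hy1 (by simpa using g4) hp').1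
      omega
    rintro v5 ⟨f5', g5⟩
    exact ⟨f4.trans f5', g5⟩
  have h2 := hp.two_le
  have key : ∀ t, (t + 13) * (N + 1) ≤ 2 * (t + 13) * (N * (L + 1)) := fun t => by
    rw [mul_comm 2, mul_assoc]
    exact Nat.mul_le_mul_left _ (by nlinarith)
  have total : ∀ t1 t2 t3 t4 t5 : ℕ, (t1 + 13) * (N + 1) + ((t2 + 30) * (N * (L + 1)) +
      ((t3 + 13) * (N + 1) + ((t4 + 30) * (N * (L + 1)) + (t5 + 13) * (N + 1)))) ≤
      (2 * (t1 + 13) + (t2 + 30) + 2 * (t3 + 13) + (t4 + 30) + 2 * (t5 + 13)) * (N * (L + 1)) := by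
    intro t1 t2 t3 t4 t5
    have k1 := key t1
    have k3 := key t3
    have k5 := key t5
    rw [add_mul _ (2 * (t5 + 13)), add_mul _ (t4 + 30), add_mul _ (2 * (t3 + 13)), add_mul _ (t2 + 30)]
    omega
  exact main.mono (total _ _ _ _ _) fun _ h => h

end VM

/-! ### Merge sort -/

namespace Merge

/-- The consecutive blocks of length `h` of `P` are sorted by the keys `c`, below `len`. -/
def Runs (c P : ℕ → ℕ) (len h : ℕ) : Prop :=
  ∀ b u w, h * b ≤ u → u ≤ w → w < h * b + h → w < len → c (P u) ≤ c (P w)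

/-- `P` permutes the numbers below `len`. -/
def IsPerm (P : ℕ → ℕ) (len : ℕ) : Prop :=
  ∀ f : ℕ → ℕ, ∑ u ∈ Finset.range len, f (P u) = ∑ u ∈ Finset.range len, f u

/-- The defining identity is tested with the indicator of the numbers from `len` on, whose sum is 0.
-/
theorem IsPerm.lt {P : ℕ → ℕ} {len : ℕ} (h : IsPerm P len) {u : ℕ} (hu : u < len) : P u < len := by
  by_contra hc
  have h1 := h fun x => if x < len then 0 else 1
  have h2 : ∑ x ∈ Finset.range len, (if x < len then 0 else 1) = 0 :=
    Finset.sum_eq_zero fun x hx => if_pos (Finset.mem_range.1 hx)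
  rw [h2, Finset.sum_eq_zero_iff] at h1
  simpa [hc] using h1 u (Finset.mem_range.2 hu)

/-- State of the merging of two neighbouring runs: the output `T` is complete below `p`; the inputs
`[i, mid)` and `[j, last)` remain. -/
structure Mid (c P T : ℕ → ℕ) (len h β p i mid j last : ℕ) : Prop where
  le : β ≤ i ∧ i ≤ mid ∧ mid ≤ j ∧ j ≤ last ∧ last ≤ len
  mid_eq : mid = min (β + h) len
  last_eq : last = min (β + 2 * h) len
  pos : p + mid = i + j
  perm : ∀ f : ℕ → ℕ, ∑ u ∈ Finset.range p, f (T u) =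
    ∑ u ∈ Finset.range i, f (P u) + ∑ u ∈ Finset.Ico mid j, f (P u)
  low : ∀ u w, β ≤ u → u < p → (i ≤ w ∧ w < mid ∨ j ≤ w ∧ w < last) → c (T u) ≤ c (P w)

/-- Invariant of a pass of merge sort. -/
structure Inv (c P T : ℕ → ℕ) (len h p i mid j last : ℕ) : Prop where
  runs : Runs c T p (2 * h)
  perm : p % (2 * h) = 0 → ∀ f : ℕ → ℕ, ∑ u ∈ Finset.range p, f (T u) = ∑ u ∈ Finset.range p, f (P u)
  mid : p % (2 * h) ≠ 0 → Mid c P T len h (2 * h * (p / (2 * h))) p i mid j last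

variable {c P T T' : ℕ → ℕ} {len h β p i mid j last : ℕ}

theorem Inv.start (hI : Inv c P T len h p i mid j last) (hp : p < len) (h0 : p % (2 * h) = 0) :
    Mid c P T len h (2 * h * (p / (2 * h))) p p (min (p + h) len) (min (p + h) len)
      (min (p + 2 * h) len) := by
  have e : 2 * h * (p / (2 * h)) = p := by have := Nat.div_add_mod p (2 * h); omega
  rw [e]
  refine ⟨by omega, rfl, rfl, rfl, ?_, fun u w h1 h2 => by omega⟩
  intro f; rw [hI.perm h0 f]; simp

theorem Mid.exists (hM : Mid c P T len h β p i mid j last) (hp : p < len) (hp' : p < β + 2 * h)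
    (hi : ¬ i < mid) : j < last := by
  have := hM.le; have := hM.mid_eq; have := hM.last_eq; have := hM.pos
  omega

theorem runs_succ {h b : ℕ} (hr : Runs c T p h) (hb : h * b ≤ p) (hb' : p < h * b + h)
    (hT : ∀ u < p, T' u = T u) (hlow : ∀ u, h * b ≤ u → u < p → c (T u) ≤ c (T' p)) :
    Runs c T' (p + 1) h := by
  intro b' u w h1 h2 h3 h4
  rcases Nat.lt_succ_iff_lt_or_eq.1 h4 with h5 | rfl
  · rw [hT u (by omega), hT w h5]; exact hr b' u w h1 h2 h3 h5
  · rcases h2.lt_or_eq with h6 | rfl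
    · rw [hT u h6]
      have e : b' = b := by
        rw [← Nat.div_eq_of_lt_le (m := w) (n := h) (k := b') (by rw [mul_comm]; omega)
          (by rw [add_mul, mul_comm]; omega), Nat.div_eq_of_lt_le (m := w) (n := h) (k := b)
          (by rw [mul_comm]; omega) (by rw [add_mul, mul_comm]; omega)]
      subst e
      exact hlow u h1 h6
    · exact le_rfl

/-- The heads `P i` and `P j` are minima of what remains of their runs. Writing the smaller head
therefore keeps every written key below all remaining ones, which is the clause `low`; `Mid.right`
is the mirror case. -/
theorem Mid.left {b : ℕ} (hM : Mid c P T len h β p i mid j last) (hP : Runs c P len h) (hi : i < mid)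
    (hβ : β = 2 * h * b) (hT : ∀ u < p, T' u = T u) (hTp : T' p = P i)
    (hc : j < last → c (P i) ≤ c (P j)) :
    Mid c P T' len h β (p + 1) (i + 1) mid j last := by
  have h1 := hM.le; have h2 := hM.mid_eq; have h3 := hM.last_eq; have h4 := hM.pos
  have e1 : h * (2 * b) = β := by rw [hβ]; ring
  have e2 : h * (2 * b + 1) = β + h := by rw [hβ]; ring
  refine ⟨by omega, h2, h3, by omega, ?_, ?_⟩
  · intro f
    rw [Finset.sum_range_succ, Finset.sum_range_succ, hTp, add_right_comm, ← hM.perm f]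
    congr 1
    exact Finset.sum_congr rfl fun u hu => by rw [hT u (Finset.mem_range.1 hu)]
  · intro u w hu hu' hw
    rcases Nat.lt_succ_iff_lt_or_eq.1 hu' with h5 | rfl
    · rw [hT u h5]; exact hM.low u w hu h5 (by omega)
    · rw [hTp]
      rcases hw with hw | hw
      · exact hP (2 * b) i w (by omega) (by omega) (by omega) (by omega)
      · exact (hc (by omega)).trans (hP (2 * b + 1) j w (by omega) (by omega) (by omega) (by omega))

theorem Mid.right {b : ℕ} (hM : Mid c P T len h β p i mid j last) (hP : Runs c P len h) (hj : j < last)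
    (hβ : β = 2 * h * b) (hT : ∀ u < p, T' u = T u) (hTp : T' p = P j)
    (hc : i < mid → c (P j) ≤ c (P i)) :
    Mid c P T' len h β (p + 1) i mid (j + 1) last := by
  have h1 := hM.le; have h2 := hM.mid_eq; have h3 := hM.last_eq; have h4 := hM.pos
  have e1 : h * (2 * b) = β := by rw [hβ]; ring
  have e2 : h * (2 * b + 1) = β + h := by rw [hβ]; ring
  refine ⟨by omega, h2, h3, by omega, ?_, ?_⟩
  · intro f
    rw [Finset.sum_range_succ, Finset.sum_Ico_succ_top (by omega), hTp, ← add_assoc, ← hM.perm f]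
    congr 1
    exact Finset.sum_congr rfl fun u hu => by rw [hT u (Finset.mem_range.1 hu)]
  · intro u w hu hu' hw
    rcases Nat.lt_succ_iff_lt_or_eq.1 hu' with h5 | rfl
    · rw [hT u h5]; exact hM.low u w hu h5 (by omega)
    · rw [hTp]
      rcases hw with hw | hw
      · exact (hc (by omega)).trans (hP (2 * b) i w (by omega) (by omega) (by omega) (by omega))
      · exact hP (2 * b + 1) j w (by omega) (by omega) (by omega) (by omega)

/-- When `p + 1` reaches the end of a block, both runs are used up: `i = mid` and `j = last`. The
counting clause of `Mid` then says that the output is a rearrangement up to `p + 1`. -/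
theorem Mid.inv (hh : 0 < h) (hr : Runs c T' (p + 1) (2 * h))
    (hM : Mid c P T' len h (2 * h * (p / (2 * h))) (p + 1) i mid j last) :
    Inv c P T' len h (p + 1) i mid j last := by
  have h1 := hM.le; have h2 := hM.mid_eq; have h3 := hM.last_eq; have h4 := hM.pos
  have h5 := Nat.div_add_mod p (2 * h)
  have h6 := Nat.mod_lt p (show 0 < 2 * h by omega)
  refine ⟨hr, fun h0 f => ?_, fun h0 => ?_⟩
  · have h7 := Nat.div_add_mod (p + 1) (2 * h)
    rw [h0, add_zero] at h7
    have h8 : (p + 1) / (2 * h) = p / (2 * h) + 1 := by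
      rw [Nat.succ_div, if_pos (Nat.dvd_of_mod_eq_zero h0)]
    rw [h8, mul_add_one] at h7
    have h9 : i = mid := by omega
    rw [hM.perm f, h9, Finset.sum_range_add_sum_Ico _ (show mid ≤ j by omega)]
    congr 2; omega
  · rw [Nat.succ_div, if_neg (fun hd => h0 (Nat.mod_eq_zero_of_dvd hd)), add_zero]
    exact hM

/-- The last block may be incomplete. In that case the clause `mid` still applies at `p = len`,
where both inputs are exhausted too. -/
theorem Inv.perm_final (hI : Inv c P T len h len i mid j last) (hP : IsPerm P len) :
    IsPerm T len := by
  intro f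
  by_cases h0 : len % (2 * h) = 0
  · rw [hI.perm h0 f, hP f]
  · have hM := hI.mid h0
    have h1 := hM.le; have h2 := hM.mid_eq; have h3 := hM.last_eq; have h4 := hM.pos
    rw [← hP f, hM.perm f, show i = mid by omega, Finset.sum_range_add_sum_Ico _ (show mid ≤ j by omega)]
    congr 2; omega

end Merge

/-! ### Merge sort on the machine -/

namespace VM

open VM.Expr Merge

def sortRegs : Finset ℕ := Finset.Icc 40 46

theorem mem_sortRegs {r : ℕ} : r ∈ sortRegs ↔ 40 ≤ r ∧ r ≤ 46 := Finset.mem_Icc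

def mergeBody : Prog :=
  .ite (eq (reg 41 % (2 * reg 40)) 0)
    (42 ≔ reg 41 ;;
     .ite (lt (reg 8) (reg 41 + reg 40)) (43 ≔ reg 8) (43 ≔ reg 41 + reg 40) ;;
     44 ≔ reg 43 ;;
     .ite (lt (reg 8) (reg 41 + 2 * reg 40)) (45 ≔ reg 8) (45 ≔ reg 41 + 2 * reg 40))
    .skip ;;
  46 ≔ 0 ;;
  .ite (lt (reg 42) (reg 43))
    (.ite (lt (reg 44) (reg 45))
      (.ite (lt (load 16 (reg 7 + load 4 (reg 44))) (load 16 (reg 7 + load 4 (reg 42)))) .skip (46 ≔ 1))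
      (46 ≔ 1))
    .skip ;;
  .ite (reg 46)
    (.put 5 (reg 41) (load 4 (reg 42)) ;; 42 ≔ reg 42 + 1)
    (.put 5 (reg 41) (load 4 (reg 44)) ;; 44 ≔ reg 44 + 1)

def copyBody : Prog := .put 4 (reg 41) (load 5 (reg 41))

def identBody : Prog := .put 4 (reg 41) (reg 41)

def sortProg : Prog :=
  .for 41 (reg 8) identBody ;;
  40 ≔ 1 ;;
  .while (lt (reg 40) (reg 8))
    (.for 41 (reg 8) mergeBody ;; .for 41 (reg 8) copyBody ;; 40 ≔ reg 40 + reg 40)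

theorem merge_loop {W M n lo len h : ℕ} {v : State} (hlen : lo + len ≤ n) (hW : 66 * n + 64 ≤ W)
    (h7 : v.reg 7 = lo) (h8 : v.reg 8 = len) (h40 : v.reg 40 = h) (hh : 0 < h) (hhl : h < len)
    (hP : IsPerm (v.arr 4) len) (hR : Runs (fun i => v.arr 16 (lo + i)) (v.arr 4) len h) :
    Tri W M n (.for 41 (reg 8) mergeBody) v ((mergeBody.time + 13) * (len + 1)) fun v' =>
      Frame (sortRegs.erase 40) {5} v v' ∧ IsPerm (v'.arr 5) len ∧
        Runs (fun i => v.arr 16 (lo + i)) (v'.arr 5) len (2 * h) := by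
  set c := fun i => v.arr 16 (lo + i) with hc
  refine (array_loop (N := len) (T := mergeBody.time) (R := sortRegs.erase 40) (A := {5})
    (by simp [mem_sortRegs]) (by norm_num) (by omega)
    (fun p v' => Inv c (v.arr 4) (v'.arr 5) len h p (v'.reg 42) (v'.reg 43) (v'.reg 44) (v'.reg 45))
    ?_ ?_ ?_).mono le_rfl fun v' hv' => ⟨hv'.1, hv'.2.perm_final hP, hv'.2.runs⟩
  · intro v' hf
    simp [hf.reg, mem_sortRegs, h8]
  · refine ⟨fun _ _ _ _ _ _ h => absurd h (by omega), by simp, by simp⟩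
  · rintro p hp v' hf h41 hI
    have r7 : v'.reg 7 = lo := by rw [hf.reg 7 (by simp [mem_sortRegs]), h7]
    have r8 : v'.reg 8 = len := by rw [hf.reg 8 (by simp [mem_sortRegs]), h8]
    have r40 : v'.reg 40 = h := by rw [hf.reg 40 (by simp), h40]
    have a4 : v'.arr 4 = v.arr 4 := hf.arr 4 (by simp)
    have a16 : v'.arr 16 = v.arr 16 := hf.arr 16 (by simp)
    have hmod := Nat.mod_lt p (show 0 < 2 * h by omega)
    have hdiv := Nat.div_add_mod p (2 * h)
    apply Tri.of_wp
    rw [mergeBody, Prog.wp]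
    -- the first statement establishes `Mid`
    have step1 : ∀ Q : State → Prop, (∀ w, Frame (sortRegs.erase 40) {5} v w → w.reg 41 = p →
        Mid c (v.arr 4) (w.arr 5) len h (2 * h * (p / (2 * h))) p (w.reg 42) (w.reg 43) (w.reg 44)
          (w.reg 45) → Runs c (w.arr 5) p (2 * h) → Q w) →
        Prog.wp W n (.ite (eq (reg 41 % (2 * reg 40)) 0)
          (42 ≔ reg 41 ;;
           .ite (lt (reg 8) (reg 41 + reg 40)) (43 ≔ reg 8) (43 ≔ reg 41 + reg 40) ;;
           44 ≔ reg 43 ;;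
           .ite (lt (reg 8) (reg 41 + 2 * reg 40)) (45 ≔ reg 8) (45 ≔ reg 41 + 2 * reg 40))
          .skip) Q v' := by
      intro Q hQ
      simp [Prog.wp, h41, r8, r40]
      refine ⟨by omega, fun h0 => ?_, fun h0 => hQ v' hf h41 (hI.mid h0) hI.runs⟩
      have hM := hI.start hp h0
      have hw : ∀ w : State, w.reg 42 = p → w.reg 43 = min (p + h) len → w.reg 44 = min (p + h) len →
          w.reg 45 = min (p + 2 * h) len → w.arr 5 = v'.arr 5 → w.reg 41 = p →
          Frame (sortRegs.erase 40) {5} v w → Q w := by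
        intro w e1 e2 e3 e4 e5 e6 e7
        refine hQ w e7 e6 ?_ (by rw [e5]; exact hI.runs)
        rw [e1, e2, e3, e4, e5]; exact hM
      refine ⟨by omega, fun h1 => ⟨by omega, fun h2 => ?_, fun h2 => ⟨by omega, ?_⟩⟩,
        fun h1 => ⟨by omega, ⟨by omega, fun h2 => ?_, fun h2 => ⟨by omega, ?_⟩⟩⟩⟩ <;>
      · apply hw <;> simp [Frame.set_iff, mem_sortRegs, hf, h41] <;> omega
    refine step1 _ fun w hfw w41 hM hrun => ?_
    have r7 : w.reg 7 = lo := by rw [hfw.reg 7 (by simp [mem_sortRegs]), h7]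
    have a4 : w.arr 4 = v.arr 4 := hfw.arr 4 (by simp)
    have a16 : w.arr 16 = v.arr 16 := hfw.arr 16 (by simp)
    have hex := hM.exists hp (by omega)
    obtain ⟨l1, l2, l3, l4, l5⟩ := hM.le
    have hkey : ∀ {u}, u < len → lo + v.arr 4 u < n := fun hu => by have := hP.lt hu; omega
    -- the two ways to proceed
    have left : w.reg 42 < w.reg 43 → (w.reg 44 < w.reg 45 → c (v.arr 4 (w.reg 42)) ≤ c (v.arr 4 (w.reg 44))) →
        ∀ u : State, Frame (sortRegs.erase 40) {5} v u → u.reg 42 = w.reg 42 + 1 → u.reg 43 = w.reg 43 →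
        u.reg 44 = w.reg 44 → u.reg 45 = w.reg 45 →
        (∀ x, u.arr 5 x = if x = p then v.arr 4 (w.reg 42) else w.arr 5 x) →
        Inv c (v.arr 4) (u.arr 5) len h (p + 1) (u.reg 42) (u.reg 43) (u.reg 44) (u.reg 45) := by
      intro hlt hle u _ e1 e2 e3 e4 e5
      have hT : ∀ x < p, u.arr 5 x = w.arr 5 x := fun x hx => by rw [e5, if_neg hx.ne]
      have hTp : u.arr 5 p = v.arr 4 (w.reg 42) := by rw [e5, if_pos rfl]
      rw [e1, e2, e3, e4]
      refine Mid.inv hh (runs_succ (b := p / (2 * h)) hrun (by omega) (by omega) hT ?_)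
        (hM.left hR hlt rfl hT hTp hle)
      intro x h1 h2; rw [hTp]; exact hM.low x _ h1 h2 (Or.inl ⟨le_rfl, hlt⟩)
    have right : w.reg 44 < w.reg 45 → (w.reg 42 < w.reg 43 → c (v.arr 4 (w.reg 44)) ≤ c (v.arr 4 (w.reg 42))) →
        ∀ u : State, Frame (sortRegs.erase 40) {5} v u → u.reg 42 = w.reg 42 → u.reg 43 = w.reg 43 →
        u.reg 44 = w.reg 44 + 1 → u.reg 45 = w.reg 45 →
        (∀ x, u.arr 5 x = if x = p then v.arr 4 (w.reg 44) else w.arr 5 x) →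
        Inv c (v.arr 4) (u.arr 5) len h (p + 1) (u.reg 42) (u.reg 43) (u.reg 44) (u.reg 45) := by
      intro hlt hle u _ e1 e2 e3 e4 e5
      have hT : ∀ x < p, u.arr 5 x = w.arr 5 x := fun x hx => by rw [e5, if_neg hx.ne]
      have hTp : u.arr 5 p = v.arr 4 (w.reg 44) := by rw [e5, if_pos rfl]
      rw [e1, e2, e3, e4]
      refine Mid.inv hh (runs_succ (b := p / (2 * h)) hrun (by omega) (by omega) hT ?_)
        (hM.right hR hlt rfl hT hTp hle)
      intro x h1 h2; rw [hTp]; exact hM.low x _ h1 h2 (Or.inr ⟨le_rfl, hlt⟩)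
    simp [Prog.wp, w41, r7, a4, a16, lim]
    refine ⟨fun g1 => ⟨fun g2 => ?_, fun g2 => ?_⟩, fun g1 => ?_⟩
    · have k1 := hkey (u := w.reg 42) (by omega)
      have k2 := hkey (u := w.reg 44) (by omega)
      refine ⟨by omega, fun g3 => ?_, fun g3 => ?_⟩
      · refine ⟨by omega, by omega, by omega, by simp [Frame.set_iff, Frame.put_iff, mem_sortRegs, hfw], ?_⟩
        apply right g2 (fun _ => g3.le) (((w.set 46 0).put 5 p (v.arr 4 (w.reg 44))).set 44 (w.reg 44 + 1)) <;>
          simp [Frame.set_iff, Frame.put_iff, mem_sortRegs, hfw]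
      · refine ⟨by omega, by omega, by omega, by simp [Frame.set_iff, Frame.put_iff, mem_sortRegs, hfw], ?_⟩
        apply left g1 (fun _ => g3) (((w.set 46 1).put 5 p (v.arr 4 (w.reg 42))).set 42 (w.reg 42 + 1)) <;>
          simp [Frame.set_iff, Frame.put_iff, mem_sortRegs, hfw]
    · refine ⟨by omega, by omega, by omega, by simp [Frame.set_iff, Frame.put_iff, mem_sortRegs, hfw], ?_⟩
      apply left g1 (fun h => absurd h (by omega))
        (((w.set 46 1).put 5 p (v.arr 4 (w.reg 42))).set 42 (w.reg 42 + 1)) <;>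
        simp [Frame.set_iff, Frame.put_iff, mem_sortRegs, hfw]
    · have g4 := hex (by omega)
      refine ⟨by omega, by omega, by omega, by simp [Frame.set_iff, Frame.put_iff, mem_sortRegs, hfw], ?_⟩
      apply right g4 (fun h => absurd h (by omega))
        (((w.set 46 0).put 5 p (v.arr 4 (w.reg 44))).set 44 (w.reg 44 + 1)) <;>
        simp [Frame.set_iff, Frame.put_iff, mem_sortRegs, hfw]

theorem ident_loop {W M n len : ℕ} {v : State} (hlen : len ≤ n) (hW : 66 * n + 64 ≤ W)
    (h8 : v.reg 8 = len) :
    Tri W M n (.for 41 (reg 8) identBody) v ((identBody.time + 13) * (len + 1)) fun v' =>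
      Frame {41} {4} v v' ∧ ∀ u < len, v'.arr 4 u = u := by
  refine array_loop (N := len) (T := identBody.time) (R := {41}) (A := {4})
    (by simp) (by norm_num) (by omega) (fun p v' => ∀ u < p, v'.arr 4 u = u) ?_ (by simp) ?_
  · intro v' hf
    simp [hf.reg, h8]
  · rintro p hp v' hf h41 hI
    apply Tri.of_wp
    simp [identBody, Prog.wp, lim, h41, Frame.put_iff, hf]
    refine ⟨by omega, fun u hu => ?_⟩
    split_ifs with h
    · rw [h]
    · exact hI u (by omega)

theorem copy_loop {W M n len : ℕ} {v : State} (hlen : len ≤ n) (hW : 66 * n + 64 ≤ W)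
    (h8 : v.reg 8 = len) :
    Tri W M n (.for 41 (reg 8) copyBody) v ((copyBody.time + 13) * (len + 1)) fun v' =>
      Frame {41} {4} v v' ∧ ∀ u < len, v'.arr 4 u = v.arr 5 u := by
  refine array_loop (N := len) (T := copyBody.time) (R := {41}) (A := {4})
    (by simp) (by norm_num) (by omega) (fun p v' => ∀ u < p, v'.arr 4 u = v.arr 5 u) ?_ (by simp) ?_
  · intro v' hf
    simp [hf.reg, h8]
  · rintro p hp v' hf h41 hI
    have a5 : v'.arr 5 = v.arr 5 := hf.arr 5 (by simp)
    apply Tri.of_wp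
    simp [copyBody, Prog.wp, lim, h41, Frame.put_iff, hf, a5]
    refine ⟨by omega, fun u hu => ?_⟩
    split_ifs with h
    · rw [h]
    · exact hI u (by omega)

end VM

namespace Merge

theorem Runs.congr {c P P' : ℕ → ℕ} {len h : ℕ} (hR : Runs c P len h) (hP : ∀ u < len, P' u = P u) :
    Runs c P' len h := by
  intro b u w h1 h2 h3 h4
  rw [hP u (by omega), hP w h4]
  exact hR b u w h1 h2 h3 h4

theorem IsPerm.congr {P P' : ℕ → ℕ} {len : ℕ} (h : IsPerm P len) (hP : ∀ u < len, P' u = P u) :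
    IsPerm P' len := by
  intro f
  rw [← h f]
  exact Finset.sum_congr rfl fun u hu => by rw [hP u (Finset.mem_range.1 hu)]

end Merge

namespace VM

open VM.Expr Merge

def sortTime : ℕ := mergeBody.time + copyBody.time + identBody.time + 100

theorem sortProg_tri {W M n lo len N L : ℕ} {v : State} (hlen : lo + len ≤ n) (hW : 66 * n + 64 ≤ W)
    (hNL : N = 2 ^ L) (hL : 1 ≤ L) (hN : 2 * len ≤ N)
    (h7 : v.reg 7 = lo) (h8 : v.reg 8 = len) :
    Tri W M n sortProg v (sortTime * (N * (L + 1))) fun v' =>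
      Frame sortRegs {4, 5} v v' ∧ IsPerm (v'.arr 4) len ∧
        ∀ u w, u ≤ w → w < len → v.arr 16 (lo + v'.arr 4 u) ≤ v.arr 16 (lo + v'.arr 4 w) := by
  set c := fun i => v.arr 16 (lo + i) with hc
  have hN2 : 2 ≤ N := by rw [hNL]; exact (pow_one 2).ge.trans (Nat.pow_le_pow_right (by norm_num) hL)
  have main : Tri W M n sortProg v ((identBody.time + 13) * (len + 1) + (2 +
      (∑ i ∈ Finset.range L, (((mergeBody.time + 13) * (len + 1) + ((copyBody.time + 13) * (len + 1) + 4))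
        + (((reg 40).lt (reg 8)).cost + 1)) + (((reg 40).lt (reg 8)).cost + 1)))) fun v' =>
      Frame sortRegs {4, 5} v v' ∧ IsPerm (v'.arr 4) len ∧
        ∀ u w, u ≤ w → w < len → c (v'.arr 4 u) ≤ c (v'.arr 4 w) := by
    refine Tri.seq (ident_loop (by omega) hW h8) fun v₁ hv₁ => ?_
    refine Tri.seq (R := fun v' => Frame sortRegs {4, 5} v v' ∧ IsPerm (v'.arr 4) len ∧
      Runs c (v'.arr 4) len (v'.reg 40) ∧ v'.reg 40 = 2 ^ (L - L)) (Tri.asg (by norm_num) (by simp) ?_) fun v₂ hv₂ => ?_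
    · have hid : IsPerm (fun u => u) len := fun f => rfl
      refine ⟨(Frame.set_iff (by simp [mem_sortRegs])).2 (hv₁.1.mono (by simp [mem_sortRegs]) (by simp)),
        by simpa using hid.congr hv₁.2, ?_, by simp⟩
      simp only [State.set_reg, if_true, val_ofNat, State.set_arr]
      intro b u w h1 h2 h3 h4
      rw [show u = w by omega]
    · refine Tri.while_le (fun i v' => Frame sortRegs {4, 5} v v' ∧ IsPerm (v'.arr 4) len ∧
        Runs c (v'.arr 4) len (v'.reg 40) ∧ v'.reg 40 = 2 ^ (L - i)) _ L hv₂ (by simp) ?_ ?_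
      · rintro i hi v' ⟨hf, hP, hR, h40⟩ hlt
        have r7 : v'.reg 7 = lo := by rw [hf.reg 7 (by simp [mem_sortRegs]), h7]
        have r8 : v'.reg 8 = len := by rw [hf.reg 8 (by simp [mem_sortRegs]), h8]
        have a16 : v'.arr 16 = v.arr 16 := hf.arr 16 (by simp)
        simp [r8, h40] at hlt
        -- After `L` passes the run length `2 ^ L = N` exceeds any run that has to be merged, so the
        -- loop cannot go on.
        have hi0 : 0 < i := by
          by_contra h0
          rw [show L - i = L by omega, ← hNL] at hlt
          omega
        refine ⟨hi0, ?_⟩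
        have hpos : 0 < v'.reg 40 := by rw [h40]; positivity
        refine Tri.seq (merge_loop (lo := lo) hlen hW r7 r8 rfl hpos (by omega) hP
          (by rw [a16]; exact hR)) ?_
        rintro v₃ ⟨hf3, hP3, hR3⟩
        have r8' : v₃.reg 8 = len := by rw [hf3.reg 8 (by simp [mem_sortRegs]), r8]
        refine Tri.seq (copy_loop (by omega) hW r8') ?_
        rintro v₄ ⟨hf4, h4⟩
        have r40 : v₄.reg 40 = 2 ^ (L - i) := by
          rw [hf4.reg 40 (by simp), hf3.reg 40 (by simp), h40]
        refine Tri.asg (by norm_num) (by simp [r40]; omega) ⟨?_, ?_, ?_, ?_⟩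
        · rw [Frame.set_iff (by simp [mem_sortRegs])]
          exact (hf.trans (hf3.mono (Finset.erase_subset _ _) (by simp))).trans
            (hf4.mono (by simp [mem_sortRegs]) (by simp))
        · simpa using hP3.congr h4
        · have := hR3.congr h4
          rw [a16] at this
          simpa [r40, ← two_mul, h40] using this
        · simp [r40, ← two_mul]
          rw [← pow_succ']; congr 1; omega
      · rintro i hi v' ⟨hf, hP, hR, h40⟩ hlt
        have r8 : v'.reg 8 = len := by rw [hf.reg 8 (by simp [mem_sortRegs]), h8]
        simp [r8] at hlt
        exact ⟨hf, hP, fun u w h1 h2 => hR 0 u w (by omega) h1 (by omega) h2⟩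
  refine main.mono ?_ fun _ h => h
  have key : ∀ t1 t2 t3 : ℕ, (t3 + 13) * (len + 1) + (2 + (∑ i ∈ Finset.range L, (((t1 + 13) * (len + 1) +
      ((t2 + 13) * (len + 1) + 4)) + (3 + 1)) + (3 + 1))) ≤ (t1 + t2 + t3 + 100) * (N * (L + 1)) := by
    intro t1 t2 t3
    rw [Finset.sum_const, Finset.card_range, smul_eq_mul]
    have a1 : len + 1 ≤ N := by omega
    calc _ ≤ (t3 + 13) * N + (2 * N + (L * (((t1 + 13) * N + ((t2 + 13) * N + 4 * N)) + 4 * N) + 4 * N)) := by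
          gcongr <;> omega
      _ ≤ _ := by nlinarith [Nat.zero_le (N * L), Nat.zero_le N, Nat.zero_le (t1 * N), Nat.zero_le (t2 * N),
            Nat.zero_le (t3 * (N * L))]
  exact key _ _ _

end VM

/-! ### Groups of equal letters -/

namespace Merge

open VM FFT

/-- Number of occurrences of `a`. -/
def cnt (c : ℕ → ℕ) (len a : ℕ) : ℕ := ∑ i ∈ Finset.range len, if c i = a then 1 else 0

/-- Cost of the letter with code `a`. -/
def weight (c : ℕ → ℕ) (len T a : ℕ) : ℕ := if a = 0 then 0 else min (cnt c len a ^ 2) T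

/-- Total cost of all letters. -/
def letterCost (c : ℕ → ℕ) (len T : ℕ) : ℕ := ∑ a ∈ (Finset.range len).image c, weight c len T a

/-- Contribution of the letter with code `a` to the matching pairs with sum `s`. -/
def matchCount (c : ℕ → ℕ) (len s a : ℕ) : ℕ := if a = 0 then 0 else conv (sel c len a) s

/-- Number of mismatching pairs with sum `s`. -/
def mism (c : ℕ → ℕ) (len s : ℕ) : ℕ :=
  ∑ p ∈ Finset.HasAntidiagonal.antidiagonal s,
    if p.1 < len ∧ p.2 < len ∧ c p.1 ≠ 0 ∧ c p.2 ≠ 0 ∧ c p.1 ≠ c p.2 then 1 else 0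

/-- A pair of two non-wildcards either agrees, and then is counted for exactly one letter, or it
mismatches. Mismatches are thus computed by subtraction, and no pair of different letters is ever
looked at. -/
theorem conv_sel_zero (c : ℕ → ℕ) (len s : ℕ) :
    conv (sel c len 0) s = ∑ a ∈ (Finset.range len).image c, matchCount c len s a + mism c len s := by
  have h1 : ∀ a, matchCount c len s a = ∑ p ∈ Finset.HasAntidiagonal.antidiagonal s,
      if a = 0 then 0 else sel c len a p.1 * sel c len a p.2 := by
    intro a; unfold matchCount conv; split_ifs <;> simp
  simp_rw [h1]
  rw [Finset.sum_comm, mism, conv, ← Finset.sum_add_distrib]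
  refine Finset.sum_congr rfl fun p _ => ?_
  by_cases h2 : p.1 < len
  · by_cases h3 : p.2 < len
    · have h4 : ∑ a ∈ (Finset.range len).image c, (if a = 0 then 0 else sel c len a p.1 * sel c len a p.2) =
          ∑ a ∈ (Finset.range len).image c, if a = c p.1 then (if c p.1 = c p.2 ∧ c p.1 ≠ 0 then 1 else 0) else 0 := by
        refine Finset.sum_congr rfl fun a _ => ?_
        unfold sel
        by_cases h5 : a = 0
        · subst h5; by_cases h6 : 0 = c p.1 <;> simp [h6]
        · by_cases h6 : a = c p.1
          · subst h6; simp [h5, h2, h3]; simp [eq_comm]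
          · simp [h5, h6, Ne.symm h6]
      rw [h4, Finset.sum_ite_eq' , if_pos (Finset.mem_image_of_mem _ (Finset.mem_range.2 h2))]
      unfold sel
      by_cases h5 : c p.1 = 0
      · simp [h5]
      · by_cases h6 : c p.2 = 0
        · simp [h6, h5]
        · by_cases h7 : c p.1 = c p.2 <;> simp [h2, h3, h5, h6, h7]
    · simp [sel_of_le _ _ (not_lt.1 h3), h3]
  · simp [sel_of_le _ _ (not_lt.1 h2), h2]

theorem conv_eq_sum (c : ℕ → ℕ) (len s : ℕ) {a : ℕ} (ha : a ≠ 0) :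
    conv (sel c len a) s = ∑ i ∈ Finset.range len, ∑ j ∈ Finset.range len,
      if c i = a ∧ c j = a ∧ i + j = s then 1 else 0 := by
  rw [← Finset.sum_product', conv]
  have h1 : ∀ p : ℕ × ℕ, sel c len a p.1 * sel c len a p.2 =
      if p.1 < len ∧ p.2 < len ∧ c p.1 = a ∧ c p.2 = a then 1 else 0 := by
    intro p; unfold sel
    simp only [ha, ne_eq, not_false_eq_true, iff_true, mul_ite, mul_one, mul_zero]
    split_ifs <;> first | rfl | omega
  simp_rw [h1]
  rw [← Finset.sum_filter, ← Finset.sum_filter, Finset.sum_const, Finset.sum_const]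
  congr 2
  ext p
  simp only [Finset.mem_filter, Finset.HasAntidiagonal.mem_antidiagonal, Finset.mem_product, Finset.mem_range]
  tauto

variable {c P : ℕ → ℕ} {len : ℕ}

theorem IsPerm.cnt (hP : IsPerm P len) (a : ℕ) : cnt (fun p => c (P p)) len a = cnt c len a :=
  hP fun i => if c i = a then 1 else 0

theorem mem_image_iff {a : ℕ} : a ∈ (Finset.range len).image c ↔ Merge.cnt c len a ≠ 0 := by
  simp only [Merge.cnt, ne_eq, Finset.sum_eq_zero_iff, Finset.mem_image, not_forall]
  constructor
  · rintro ⟨i, h1, h2⟩; exact ⟨i, h1, by simp [h2]⟩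
  · rintro ⟨i, h1, h2⟩; exact ⟨i, h1, by by_contra h; simp [h] at h2⟩

theorem IsPerm.image (hP : IsPerm P len) :
    (Finset.range len).image (fun p => c (P p)) = (Finset.range len).image c := by
  ext a
  rw [mem_image_iff, mem_image_iff, hP.cnt]

theorem sum_cnt (c : ℕ → ℕ) (len : ℕ) : ∑ a ∈ (Finset.range len).image c, Merge.cnt c len a = len := by
  unfold Merge.cnt
  rw [Finset.sum_comm]
  have : ∀ i ∈ Finset.range len, ∑ a ∈ (Finset.range len).image c, (if c i = a then 1 else 0) = 1 := by
    intro i hi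
    rw [Finset.sum_ite_eq, if_pos (Finset.mem_image_of_mem _ hi)]
  rw [Finset.sum_congr rfl this]; simp

theorem cnt_le (c : ℕ → ℕ) (len a : ℕ) : Merge.cnt c len a ≤ len := by
  refine (Finset.sum_le_card_nsmul _ _ 1 fun i _ => by split_ifs <;> simp).trans (by simp)

/-- Keeps the accumulated cost within a word, since `cnt ^ 2 ≤ cnt * len` and the counts add up to
`len`. -/
theorem letterCost_le (c : ℕ → ℕ) (len T : ℕ) : letterCost c len T ≤ len * len := by
  calc letterCost c len T ≤ ∑ a ∈ (Finset.range len).image c, Merge.cnt c len a * len := by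
        refine Finset.sum_le_sum fun a _ => ?_
        unfold weight
        split_ifs
        · exact Nat.zero_le _
        · exact (min_le_left _ _).trans (by rw [sq]; exact Nat.mul_le_mul_left _ (cnt_le _ _ _))
    _ = _ := by rw [← Finset.sum_mul, sum_cnt]

/-- The codes at the positions `g, …, len - 1` of the sorted sequence. -/
def rest (κ : ℕ → ℕ) (len g : ℕ) : Finset ℕ := (Finset.Ico g len).image κ

/-- All codes before `g` are smaller than those from `g` on. -/
def Border (κ : ℕ → ℕ) (len g : ℕ) : Prop := ∀ p p', p < g → g ≤ p' → p' < len → κ p < κ p'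

/-- The positions from `g` to `g' - 1` carry one letter, and by `Border` that letter does not occur
from `g'` on, so it splits off from the sum. -/
theorem sum_rest {κ : ℕ → ℕ} {g g' : ℕ} (hb : Border κ len g') (hg : g < g')
    (hg' : g' ≤ len) (heq : ∀ p, g ≤ p → p < g' → κ p = κ g) (f : ℕ → ℕ) :
    ∑ a ∈ rest κ len g, f a = f (κ g) + ∑ a ∈ rest κ len g', f a := by
  have h1 : rest κ len g = insert (κ g) (rest κ len g') := by
    ext a
    simp only [rest, Finset.mem_image, Finset.mem_Ico, Finset.mem_insert]
    constructor
    · rintro ⟨p, ⟨h1, h2⟩, rfl⟩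
      rcases lt_or_ge p g' with h | h
      · exact Or.inl (heq p h1 h)
      · exact Or.inr ⟨p, ⟨h, h2⟩, rfl⟩
    · rintro (rfl | ⟨p, ⟨h1, h2⟩, rfl⟩)
      · exact ⟨g, by omega, rfl⟩
      · exact ⟨p, by omega, rfl⟩
  rw [h1, Finset.sum_insert]
  simp only [rest, Finset.mem_image, Finset.mem_Ico, not_exists, not_and]
  rintro p ⟨h2, h3⟩ h4
  have := hb g p hg h2 h3
  omega

theorem Border.next {κ : ℕ → ℕ} {g g' : ℕ} (hs : ∀ u w, u ≤ w → w < len → κ u ≤ κ w)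
    (hb : Border κ len g) (hg : g < g') (hg' : g' ≤ len) (heq : ∀ p, g ≤ p → p < g' → κ p = κ g)
    (hne : g' < len → κ g' ≠ κ g) : Border κ len g' := by
  intro p p' h1 h2 h3
  rcases lt_or_ge p g with h | h
  · exact hb p p' h (by omega) h3
  · rw [heq p h h1]
    have := hs g g' (by omega) (by omega)
    have := hs g' p' (by omega) (by omega)
    have := hne (by omega)
    omega

/-- In a sorted sequence the positions of one letter form an interval; the two borders exclude
occurrences before `g` and after `g'`. -/
theorem sum_group {κ : ℕ → ℕ} {g g' : ℕ} (hb : Border κ len g) (hb' : Border κ len g')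
    (hg : g < g') (hg' : g' ≤ len) (heq : ∀ p, g ≤ p → p < g' → κ p = κ g) (f : ℕ → ℕ) :
    ∑ p ∈ Finset.range len, (if κ p = κ g then f p else 0) = ∑ x ∈ Finset.range (g' - g), f (g + x) := by
  rw [← Finset.sum_filter, ← Finset.sum_Ico_eq_sum_range]
  refine Finset.sum_congr ?_ fun _ _ => rfl
  ext p
  simp only [Finset.mem_filter, Finset.mem_range, Finset.mem_Ico]
  constructor
  · rintro ⟨h1, h2⟩
    constructor
    · by_contra h
      have := hb p g (by omega) le_rfl (by omega)
      omega
    · by_contra h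
      have := hb' g p hg (by omega) h1
      omega
  · rintro ⟨h1, h2⟩
    exact ⟨by omega, heq p h1 h2⟩

theorem cnt_group {κ : ℕ → ℕ} {g g' : ℕ} (hb : Border κ len g) (hb' : Border κ len g')
    (hg : g < g') (hg' : g' ≤ len) (heq : ∀ p, g ≤ p → p < g' → κ p = κ g) :
    Merge.cnt κ len (κ g) = g' - g := by
  have := sum_group hb hb' hg hg' heq fun _ => 1
  simpa [Merge.cnt] using this

/-- Among the first `i` pairs of entries of the group of size `m` starting at `g`, those with
sum `s`. -/
def pairCount (P : ℕ → ℕ) (g m i s : ℕ) : ℕ :=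
  ∑ q ∈ Finset.range i, if P (g + q / m) + P (g + q % m) = s then 1 else 0

theorem sum_range_div_mod (f : ℕ → ℕ → ℕ) {m : ℕ} (hm : 0 < m) (k : ℕ) :
    ∑ q ∈ Finset.range (m * k), f (q / m) (q % m) = ∑ x ∈ Finset.range k, ∑ y ∈ Finset.range m, f x y := by
  induction k with
  | zero => simp
  | succ k ih =>
    rw [mul_add_one, Finset.sum_range_add, ih, Finset.sum_range_succ]
    congr 1
    refine Finset.sum_congr rfl fun y hy => ?_
    rw [Finset.mem_range] at hy
    rw [Nat.mul_add_div hm, Nat.div_eq_of_lt hy, Nat.mul_add_mod, Nat.mod_eq_of_lt hy, add_zero]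

/-- The number `q` runs through all pairs `(q / m, q % m)` of entries of the group. Undoing the
sorting permutation in both coordinates turns these into all pairs of occurrences of the letter. -/
theorem pairCount_eq (hP : IsPerm P len) {g g' : ℕ} (hb : Border (fun p => c (P p)) len g)
    (hb' : Border (fun p => c (P p)) len g') (hg : g < g') (hg' : g' ≤ len)
    (heq : ∀ p, g ≤ p → p < g' → c (P p) = c (P g)) (h0 : c (P g) ≠ 0) (s : ℕ) :
    pairCount P g (g' - g) ((g' - g) * (g' - g)) s = conv (sel c len (c (P g))) s := by
  rw [conv_eq_sum _ _ _ h0, pairCount,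
    sum_range_div_mod (fun x y => if P (g + x) + P (g + y) = s then 1 else 0) (by omega)]
  set a := c (P g) with ha
  rw [← hP fun i => ∑ j ∈ Finset.range len, if c i = a ∧ c j = a ∧ i + j = s then 1 else 0]
  have h1 : ∀ p, ∑ j ∈ Finset.range len, (if c (P p) = a ∧ c j = a ∧ P p + j = s then 1 else 0) =
      if c (P p) = a then ∑ y ∈ Finset.range (g' - g), (if P p + P (g + y) = s then 1 else 0) else 0 := by
    intro p
    rw [← hP fun j => if c (P p) = a ∧ c j = a ∧ P p + j = s then 1 else 0]
    by_cases h : c (P p) = a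
    · rw [if_pos h, ← sum_group hb hb' hg hg' heq fun p' => if P p + P p' = s then 1 else 0]
      refine Finset.sum_congr rfl fun p' _ => ?_
      simp [h, ← ha, ite_and]
    · simp [h]
  simp_rw [h1]
  rw [sum_group hb hb' hg hg' heq fun p => ∑ y ∈ Finset.range (g' - g), if P p + P (g + y) = s then 1 else 0]

/-- The matching pairs are among all pairs of non-wildcards, so the partial sums kept in array `6`
stay small. -/
theorem sum_matchCount_le (c : ℕ → ℕ) (len s N : ℕ) (hN : 2 * len ≤ N) :
    ∑ a ∈ (Finset.range len).image c, matchCount c len s a ≤ N := by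
  have h1 := conv_sel_zero c len s
  have h2 := conv_le (N := N) (sel_le_one c len 0) (fun i hi => sel_of_le _ _ (by omega)) s
  omega

theorem pairCount_mono (P : ℕ → ℕ) (g m s : ℕ) {i j : ℕ} (h : i ≤ j) :
    pairCount P g m i s ≤ pairCount P g m j s :=
  Finset.sum_le_sum_of_subset (Finset.range_subset_range.2 h)

end Merge

/-! ### Counting mismatching pairs on the machine -/

namespace VM

/-- A loop with a potential that pays for its iterations. -/
theorem Tri.while_pot {W M n : ℕ} {p : Prog} {v : State} {Q : State → Prop} {e : Expr}
    (I : State → Prop) (Φ : State → ℕ) (h0 : I v) (hok : ∀ v, I v → e.Ok W n v)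
    (step : ∀ v, I v → e.val v ≠ 0 → ∃ T, Tri W M n p v T fun v' => I v' ∧ Φ v' + T + (e.cost + 1) ≤ Φ v)
    (exit : ∀ v, I v → e.val v = 0 → Q v) :
    Tri W M n (.while e p) v (Φ v + (e.cost + 1)) Q := by
  obtain ⟨k, hk⟩ : ∃ k, Φ v = k := ⟨_, rfl⟩
  induction k using Nat.strong_induction_on generalizing v with
  | _ k ih =>
    intro s hs
    obtain ⟨h1, h2⟩ := e.eval_compile hs (hok v h0)
    by_cases h : e.val v = 0
    · rw [h] at h1
      exact ⟨_, _, _, .while_false s _ _ h1, by simp [Expr.cost], hs, exit v h0 h⟩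
    · obtain ⟨T, hT⟩ := step v h0 h
      obtain ⟨t, s', v', g1, g2, g3, g4, g5⟩ := hT s hs
      obtain ⟨t', s'', v'', f1, f2, f3, f4⟩ := ih _ (by omega) g4 rfl s' g3
      refine ⟨_, _, _, .while_true s s' s'' _ _ _ t t' h1 h g1 f1, ?_, f3, f4⟩
      simp only [Expr.cost] at *
      omega

end VM

namespace VM

open VM.Expr FFT Merge

/-- The machine is prepared for convolutions. -/
def Ready (W n : ℕ) (v : State) : Prop :=
  ∃ (K : ℕ) (δ : ℝ), 2 * n ≤ 2 ^ K ∧ 2 ^ K ≤ 4 * n + 4 ∧ Precise (v.reg 4) (v.reg 5) (2 ^ K) δ ∧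
    FitsFFT W n (v.reg 4) (v.reg 5) ∧ Approx (v.reg 4) (v.reg 5) (2 ^ K) δ (v.arr 2) (v.arr 3) root

theorem Ready.of_eq {W n : ℕ} {v v' : State} (h : Ready W n v) (h4 : v'.reg 4 = v.reg 4)
    (h5 : v'.reg 5 = v.reg 5) (a2 : v'.arr 2 = v.arr 2) (a3 : v'.arr 3 = v.arr 3) : Ready W n v' := by
  unfold Ready; rw [h4, h5, a2, a3]; exact h

theorem Ready.frame {W n : ℕ} {v v' : State} {R A : Finset ℕ} (h : Ready W n v) (hf : Frame R A v v')
    (h4 : 4 ∉ R) (h5 : 5 ∉ R) (a2 : 2 ∉ A) (a3 : 3 ∉ A) : Ready W n v' :=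
  h.of_eq (hf.reg 4 h4) (hf.reg 5 h5) (hf.arr 2 a2) (hf.arr 3 a3)

theorem _root_.FFT.Precise.anti {H Q N N' : ℕ} {δ : ℝ} (h : Precise H Q N δ) (h2 : 2 ≤ N') (hN : N' ≤ N) :
    Precise H Q N' δ := by
  have hδ : 0 ≤ δ := le_trans (by positivity) h.unit
  have hc : (N' : ℝ) ≤ N := by exact_mod_cast hN
  refine ⟨h.scale_pos, h2, h.unit, le_trans ?_ h.small, le_trans ?_ h.range⟩
  · gcongr
  · gcongr

/-- Self-convolutions in length `N`. -/
theorem Ready.conv {W M n N L lo len a : ℕ} {v : State} (h : Ready W n v)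
    (hNL : N = 2 ^ L) (hN2 : 2 ≤ N) (h7 : v.reg 7 = lo) (h8 : v.reg 8 = len)
    (h9 : v.reg 9 = N) (h12 : v.reg 12 = a) (hlen : lo + len ≤ n) (hlenN : 2 * len ≤ N) (hlt : N < 4 * len ∨ N = 2) :
    Tri W M n convProg v (convTime * (N * (L + 1))) fun v' =>
      Frame fftRegs {0, 1} v v' ∧ ∀ p < N,
        v'.arr 0 p = FFT.conv (sel (fun i => v.arr 16 (lo + i)) len a) p := by
  obtain ⟨K, δ, h1, h2, h3, h4, h5⟩ := h
  -- From `N < 4 len ≤ 4 n ≤ 2 ^ (K + 1)` the table for length `2 ^ K` is long enough. Being in bit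
  -- reversed order, its beginning serves every shorter power of two.
  have hK : N ≤ 2 ^ K := by
    rcases hlt with h | h
    · rw [hNL]
      have : L < K + 1 := by
        by_contra hc
        have := Nat.pow_le_pow_right (show 0 < 2 by norm_num) (not_lt.1 hc)
        rw [pow_succ] at this
        omega
      exact Nat.pow_le_pow_right (by norm_num) (by omega)
    · have := h3.two_le; omega
  exact convProg_tri (h3.anti hN2 hK) hNL (by omega) rfl rfl h7 h8 h9 h12 hlen hlenN h4
    (fun p hp => h5 p (by omega))

/-- The offset is at least `8 (2 n + 2) ^ 2 = 32 (n + 1) ^ 2`, and 16 times the offset is a word. -/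
theorem Ready.sq {W n : ℕ} {v : State} (h : Ready W n v) : 512 * ((n + 1) * (n + 1)) < W := by
  obtain ⟨K, δ, h1, h2, h3, h4, h5⟩ := h
  have a2 : (1 : ℝ) ≤ v.reg 5 := by exact_mod_cast h3.scale_pos
  have a3 := h4.sq
  have a4 : (2 * n : ℝ) ≤ (2 ^ K : ℕ) := by exact_mod_cast h1
  have a5 : (32 * ((n + 1) * (n + 1)) : ℝ) ≤ v.reg 4 :=
    calc (32 * ((n + 1) * (n + 1)) : ℝ) = 8 * (2 * n + 2) ^ 2 * 1 := by ring
      _ ≤ 8 * ((2 ^ K : ℕ) + 2 : ℝ) ^ 2 * v.reg 5 := by gcongr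
      _ ≤ v.reg 4 := h3.range
  have a6 : 32 * ((n + 1) * (n + 1)) ≤ v.reg 4 := by exact_mod_cast a5
  omega

theorem Ready.le {W n : ℕ} {v : State} (h : Ready W n v) : 66 * n + 64 ≤ W := by
  obtain ⟨K, δ, h1, h2, h3, h4, h5⟩ := h
  exact h4.len

/-- Binary logarithm of the length of the convolutions for strings of length `len`. -/
def lev (len : ℕ) : ℕ := max 1 (Nat.clog 2 (2 * len))

/-- Cost of a convolution for strings of length `len`. -/
def thr (len : ℕ) : ℕ := 2 ^ lev len * (lev len + 1)

theorem two_mul_le_pow_lev (len : ℕ) : 2 * len ≤ 2 ^ lev len :=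
  (Nat.le_pow_clog (by norm_num) _).trans (Nat.pow_le_pow_right (by norm_num) (le_max_right _ _))

theorem one_le_lev (len : ℕ) : 1 ≤ lev len := le_max_left _ _

theorem two_le_pow_lev (len : ℕ) : 2 ≤ 2 ^ lev len :=
  (pow_one 2).ge.trans (Nat.pow_le_pow_right (by norm_num) (one_le_lev _))

theorem pow_lt_of_lt_lev {len l : ℕ} (h1 : 1 ≤ l) (h : l < lev len) : 2 ^ l < 2 * len :=
  (Nat.lt_clog_iff_pow_lt (by norm_num)).1 (by unfold lev at h; omega)

theorem pow_lev_lt (len : ℕ) : 2 ^ lev len < 4 * len ∨ 2 ^ lev len = 2 := by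
  rcases (one_le_lev len).lt_or_eq with h | h
  · left
    have := pow_lt_of_lt_lev (len := len) (l := lev len - 1) (by omega) (by omega)
    have e : 2 ^ lev len = 2 * 2 ^ (lev len - 1) := by rw [← pow_succ']; congr 1; omega
    omega
  · right; rw [← h]; rfl

theorem pow_lev_le (len : ℕ) : 2 ^ lev len ≤ 4 * len + 2 := by
  rcases pow_lev_lt len with h | h <;> omega

def sizeBody : Prog := 9 ≔ reg 9 + reg 9 ;; 61 ≔ reg 61 + 1

/-- Determines the length of the convolutions. -/
def sizeProg : Prog :=
  9 ≔ 2 ;; 61 ≔ 2 ;; .while (lt (reg 9) (2 * reg 8)) sizeBody ;; 10 ≔ reg 9 * reg 61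

theorem lev_le (len : ℕ) : lev len < 2 ^ lev len := Nat.lt_two_pow_self

theorem sizeProg_tri {W M n len : ℕ} {v : State} (hlen : len ≤ n) (hW : 512 * ((n + 1) * (n + 1)) < W)
    (h8 : v.reg 8 = len) :
    Tri W M n sizeProg v ((sizeBody.time + 20) * (lev len + 1)) fun v' =>
      Frame {9, 10, 61} ∅ v v' ∧ v'.reg 9 = 2 ^ lev len ∧ v'.reg 10 = thr len := by
  have h1 := one_le_lev len
  have hW' : 512 * n + 512 < W := by nlinarith
  have main : Tri W M n sizeProg v (2 + (2 + ((∑ i ∈ Finset.range (lev len - 1),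
      (sizeBody.time + ((lt (reg 9) (2 * reg 8)).cost + 1)) + ((lt (reg 9) (2 * reg 8)).cost + 1)) + 4)))
      fun v' => Frame {9, 10, 61} ∅ v v' ∧ v'.reg 9 = 2 ^ lev len ∧ v'.reg 10 = thr len := by
    refine Tri.seq (R := fun w => w = v.set 9 2) (Tri.asg (by norm_num) (by simp) rfl) ?_
    rintro _ rfl
    refine Tri.seq (R := fun w => w = (v.set 9 2).set 61 2) (Tri.asg (by norm_num) (by simp) rfl) ?_
    rintro _ rfl
    refine Tri.seq (R := fun w => Frame {9, 10, 61} ∅ v w ∧ w.reg 9 = 2 ^ lev len ∧ w.reg 61 = lev len + 1)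
      (Tri.while_le (fun i w => Frame {9, 10, 61} ∅ v w ∧ i ≤ lev len - 1 ∧ w.reg 9 = 2 ^ (lev len - i) ∧
        w.reg 61 = lev len - i + 1) _ _ ?_ ?_ ?_ ?_) ?_
    · refine ⟨by simp [Frame.set_iff, Frame.refl], le_rfl, ?_, ?_⟩
      · simp [show lev len - (lev len - 1) = 1 by omega]
      · simp; omega
    · rintro i hi w ⟨hf, -, h9, -⟩
      have r8 : w.reg 8 = len := by rw [hf.reg 8 (by simp), h8]
      simp [r8]; omega
    · rintro i hi w ⟨hf, -, h9, h61⟩ hlt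
      have r8 : w.reg 8 = len := by rw [hf.reg 8 (by simp), h8]
      simp [r8, h9] at hlt
      have hi0 : 0 < i := by
        by_contra h0
        have := two_mul_le_pow_lev len
        rw [show lev len - i = lev len by omega] at hlt
        omega
      have h2 : lev len - i < 2 ^ (lev len - i) := Nat.lt_two_pow_self
      refine ⟨hi0, Tri.of_wp ?_⟩
      have e : 2 ^ (lev len - (i - 1)) = 2 ^ (lev len - i) + 2 ^ (lev len - i) := by
        rw [← two_mul, ← pow_succ']; congr 1; omega
      simp [sizeBody, Prog.wp, h9, h61, Frame.set_iff, hf, e]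
      omega
    · rintro i hi w ⟨hf, hi', h9, h61⟩ hge
      have r8 : w.reg 8 = len := by rw [hf.reg 8 (by simp), h8]
      simp [r8, h9] at hge
      have : i = 0 := by
        by_contra h0
        have := pow_lt_of_lt_lev (len := len) (l := lev len - i) (by omega) (by omega)
        omega
      subst this
      exact ⟨hf, h9, h61⟩
    · rintro w ⟨hf, h9, h61⟩
      refine Tri.asg (by norm_num) ?_ ?_
      · have h2 := pow_lev_le len
        have h3 := lev_le len
        simp [h9, h61]
        have : 2 ^ lev len * (lev len + 1) ≤ (4 * n + 2) * (4 * n + 2) := Nat.mul_le_mul (by omega) (by omega)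
        nlinarith
      · refine ⟨by simp [Frame.set_iff, hf], by simp [h9], by simp [h9, h61, thr]⟩
  refine main.mono ?_ fun _ h => h
  have key : ∀ t : ℕ, 2 + (2 + ((∑ i ∈ Finset.range (lev len - 1), (t + 6) + 6) + 4)) ≤
      (t + 20) * (lev len + 1) := by
    intro t
    rw [Finset.sum_const, Finset.card_range, smul_eq_mul]
    have : (lev len - 1) * (t + 6) ≤ lev len * (t + 6) := Nat.mul_le_mul_right _ (by omega)
    nlinarith
  exact key _

end VM

namespace VM

open VM.Expr FFT Merge

/-- Array `7` keeps the pairs of non-wildcards, from which the matching pairs collected in array `6`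
are subtracted in the end. Array `10` will hold the codes in sorted order. -/
def copyOutBody : Prog := .put 7 (reg 62) (load 0 (reg 62)) ;; .put 6 (reg 62) 0

def keyBody : Prog := .put 10 (reg 62) (load 16 (reg 7 + load 4 (reg 62)))

def subBody : Prog := .put 7 (reg 62) (load 7 (reg 62) - load 6 (reg 62))

def addBody : Prog := .put 6 (reg 62) (load 6 (reg 62) + load 0 (reg 62))

def pairBody : Prog :=
  59 ≔ load 4 (reg 60 + reg 62 / reg 64) + load 4 (reg 60 + reg 62 % reg 64) ;;
  .put 6 (reg 59) (load 6 (reg 59) + 1)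

def scanBody : Prog := 63 ≔ reg 63 + 1

/-- Both factors are always evaluated, so array `10` is also read at index `len`; this is harmless
because arrays have `4 n + 4` cells. -/
def scanCond : VM.Expr := lt (reg 63) (reg 8) * eq (load 10 (reg 63)) (reg 12)

theorem copyOut_loop {W M n N : ℕ} {v : State} (hN : N ≤ 4 * n + 4) (hW : 4 * n + 4 < W)
    (h9 : v.reg 9 = N) :
    Tri W M n (.for 62 (reg 9) copyOutBody) v ((copyOutBody.time + 13) * (N + 1)) fun v' =>
      Frame {62} {6, 7} v v' ∧ ∀ s < N, v'.arr 7 s = v.arr 0 s ∧ v'.arr 6 s = 0 := by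
  refine array_loop (N := N) (T := copyOutBody.time) (R := {62}) (A := {6, 7}) (by simp) (by norm_num)
    (by omega) (fun p v' => ∀ s < p, v'.arr 7 s = v.arr 0 s ∧ v'.arr 6 s = 0) ?_ (by simp) ?_
  · intro v' hf
    simp [hf.reg, h9]
  · rintro p hp v' hf h62 hI
    have a0 : v'.arr 0 = v.arr 0 := hf.arr 0 (by simp)
    apply Tri.of_wp
    simp [copyOutBody, Prog.wp, lim, h62, Frame.put_iff, hf, a0]
    refine ⟨by omega, fun u hu => ?_⟩
    split_ifs with h
    · simp [h]
    · have := hI u (by omega)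
      simp [h, this]

theorem key_loop {W M n lo len : ℕ} {v : State} (hlen : lo + len ≤ n) (hW : 4 * n + 4 < W)
    (h7 : v.reg 7 = lo) (h8 : v.reg 8 = len) (hP : IsPerm (v.arr 4) len) :
    Tri W M n (.for 62 (reg 8) keyBody) v ((keyBody.time + 13) * (len + 1)) fun v' =>
      Frame {62} {10} v v' ∧ ∀ p < len, v'.arr 10 p = v.arr 16 (lo + v.arr 4 p) := by
  refine array_loop (N := len) (T := keyBody.time) (R := {62}) (A := {10}) (by simp) (by norm_num)
    (by omega) (fun p v' => ∀ s < p, v'.arr 10 s = v.arr 16 (lo + v.arr 4 s)) ?_ (by simp) ?_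
  · intro v' hf
    simp [hf.reg, h8]
  · rintro p hp v' hf h62 hI
    have a4 : v'.arr 4 = v.arr 4 := hf.arr 4 (by simp)
    have a16 : v'.arr 16 = v.arr 16 := hf.arr 16 (by simp)
    have r7 : v'.reg 7 = lo := by rw [hf.reg 7 (by simp), h7]
    have hl := hP.lt hp
    apply Tri.of_wp
    simp [keyBody, Prog.wp, lim, h62, Frame.put_iff, hf, a4, a16, r7]
    and_intros
    any_goals omega
    intro u hu
    split_ifs with h
    · simp [h]
    · exact hI u (by omega)

theorem sub_loop {W M n N : ℕ} {v : State} (hN : N ≤ 4 * n + 4) (hW : 4 * n + 4 < W)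
    (h9 : v.reg 9 = N) :
    Tri W M n (.for 62 (reg 9) subBody) v ((subBody.time + 13) * (N + 1)) fun v' =>
      Frame {62} {7} v v' ∧ ∀ s < N, v'.arr 7 s = v.arr 7 s - v.arr 6 s := by
  refine (array_loop (N := N) (T := subBody.time) (R := {62}) (A := {7}) (by simp) (by norm_num)
    (by omega) (fun p v' => ∀ s, v'.arr 7 s = if s < p then v.arr 7 s - v.arr 6 s else v.arr 7 s)
      ?_ (by simp) ?_).mono le_rfl fun v' h => ⟨h.1, fun s hs => by rw [h.2 s, if_pos hs]⟩
  · intro v' hf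
    simp [hf.reg, h9]
  · rintro p hp v' hf h62 hI
    have a6 : v'.arr 6 = v.arr 6 := hf.arr 6 (by simp)
    apply Tri.of_wp
    simp [subBody, Prog.wp, lim, h62, Frame.put_iff, hf, a6, hI]
    refine ⟨by omega, fun u => ?_⟩
    by_cases h : u = p
    · simp [h]
    · simp [h, show u ≤ p ↔ u < p by omega]

theorem add_loop {W M n N : ℕ} {v : State} (hN : N ≤ 4 * n + 4) (hW : 4 * n + 4 < W)
    (h9 : v.reg 9 = N) (hb : ∀ s < N, v.arr 6 s + v.arr 0 s < W) :
    Tri W M n (.for 62 (reg 9) addBody) v ((addBody.time + 13) * (N + 1)) fun v' =>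
      Frame {62} {6} v v' ∧ ∀ s < N, v'.arr 6 s = v.arr 6 s + v.arr 0 s := by
  refine (array_loop (N := N) (T := addBody.time) (R := {62}) (A := {6}) (by simp) (by norm_num)
    (by omega) (fun p v' => ∀ s, v'.arr 6 s = if s < p then v.arr 6 s + v.arr 0 s else v.arr 6 s)
      ?_ (by simp) ?_).mono le_rfl fun v' h => ⟨h.1, fun s hs => by rw [h.2 s, if_pos hs]⟩
  · intro v' hf
    simp [hf.reg, h9]
  · rintro p hp v' hf h62 hI
    have a0 : v'.arr 0 = v.arr 0 := hf.arr 0 (by simp)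
    have := hb p hp
    apply Tri.of_wp
    simp [addBody, Prog.wp, lim, h62, Frame.put_iff, hf, a0, hI, this]
    refine ⟨by omega, fun u => ?_⟩
    by_cases h : u = p
    · simp [h]
    · simp [h, show u ≤ p ↔ u < p by omega]

theorem pair_loop {W M n N g m len : ℕ} {v : State} (hN : N ≤ 4 * n + 4) (hlen : len ≤ n) (hW : 4 * n + 4 < W)
    (hmW : m * m < W) (h60 : v.reg 60 = g) (h64 : v.reg 64 = m) (h65 : v.reg 65 = m * m) (hg : g + m ≤ len)
    (hP : ∀ p < len, v.arr 4 p < len) (hlN : 2 * len ≤ N) (hm : 0 < m)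
    (hb : ∀ s < N, v.arr 6 s + pairCount (v.arr 4) g m (m * m) s < W) :
    Tri W M n (.for 62 (reg 65) pairBody) v ((pairBody.time + 13) * (m * m + 1)) fun v' =>
      Frame {59, 62} {6} v v' ∧ ∀ s < N, v'.arr 6 s = v.arr 6 s + pairCount (v.arr 4) g m (m * m) s := by
  refine array_loop (N := m * m) (T := pairBody.time) (R := {59, 62}) (A := {6}) (by simp) (by norm_num)
    (by omega) (fun i v' => ∀ s < N, v'.arr 6 s = v.arr 6 s + pairCount (v.arr 4) g m i s)
      ?_ (by simp [pairCount]) ?_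
  · intro v' hf
    simp [hf.reg, h65]
  · rintro i hi v' hf h62 hI
    have a4 : v'.arr 4 = v.arr 4 := hf.arr 4 (by simp)
    have r60 : v'.reg 60 = g := by rw [hf.reg 60 (by simp), h60]
    have r64 : v'.reg 64 = m := by rw [hf.reg 64 (by simp), h64]
    have h1 : i / m < m := Nat.div_lt_of_lt_mul hi
    have h2 : i % m < m := Nat.mod_lt _ hm
    have h3 := hP (g + i / m) (by omega)
    have h4 := hP (g + i % m) (by omega)
    have hs : ∀ s, pairCount (v.arr 4) g m (i + 1) s =
        pairCount (v.arr 4) g m i s + if v.arr 4 (g + i / m) + v.arr 4 (g + i % m) = s then 1 else 0 :=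
      fun s => Finset.sum_range_succ _ _
    have h5 : v.arr 4 (g + i / m) + v.arr 4 (g + i % m) < N := by omega
    have h6 := hb _ h5
    have h7 := pairCount_mono (v.arr 4) g m (v.arr 4 (g + i / m) + v.arr 4 (g + i % m)) (show i + 1 ≤ m * m by omega)
    rw [hs, if_pos rfl] at h7
    apply Tri.of_wp
    simp [pairBody, Prog.wp, lim, h62, Frame.put_iff, Frame.set_iff, hf, a4, r60, r64, hI _ h5]
    and_intros
    any_goals omega
    intro s hs'
    rw [hs]
    by_cases h : s = v.arr 4 (g + i / m) + v.arr 4 (g + i % m)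
    · simp [h]; omega
    · simp [h, hI s hs', Ne.symm h]

/-- Each step passes one occurrence of `a`, so the number of occurrences not yet passed is a
potential, and the time is charged to the count of the letter. -/
theorem scan_loop {W M n len g a : ℕ} {v : State} (hlen : len ≤ n) (hW : 4 * n + 4 < W) (hg : g < len)
    (h8 : v.reg 8 = len) (h12 : v.reg 12 = a) (h63 : v.reg 63 = g) (hga : v.arr 10 g = a) :
    Tri W M n (.while scanCond scanBody) v
      ((scanBody.time + scanCond.cost + 1) * cnt (v.arr 10) len a + (scanCond.cost + 1)) fun v' =>
      Frame {63} ∅ v v' ∧ g < v'.reg 63 ∧ v'.reg 63 ≤ len ∧ (∀ p, g ≤ p → p < v'.reg 63 → v.arr 10 p = a) ∧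
        (v'.reg 63 < len → v.arr 10 (v'.reg 63) ≠ a) := by
  have hcnt : ∀ i, g ≤ i → i ≤ len → (∀ p, g ≤ p → p < i → v.arr 10 p = a) →
      i - g ≤ cnt (v.arr 10) len a := by
    intro i h1 h2 h3
    calc i - g = ∑ p ∈ Finset.Ico g i, if v.arr 10 p = a then 1 else 0 := by
          rw [Finset.sum_congr rfl fun p hp => if_pos (h3 p (Finset.mem_Ico.1 hp).1 (Finset.mem_Ico.1 hp).2)]
          simp
      _ ≤ _ := Finset.sum_le_sum_of_subset fun p hp => by
          rw [Finset.mem_Ico] at hp; rw [Finset.mem_range]; omega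
  have key := Tri.while_pot (W := W) (M := M) (n := n) (p := scanBody) (v := v) (e := scanCond)
    (Q := fun v' => Frame {63} ∅ v v' ∧ g < v'.reg 63 ∧ v'.reg 63 ≤ len ∧
      (∀ p, g ≤ p → p < v'.reg 63 → v.arr 10 p = a) ∧ (v'.reg 63 < len → v.arr 10 (v'.reg 63) ≠ a))
    (fun v' => Frame {63} ∅ v v' ∧ g ≤ v'.reg 63 ∧ v'.reg 63 ≤ len ∧
      (∀ p, g ≤ p → p < v'.reg 63 → v.arr 10 p = a))
    (fun v' => (scanBody.time + scanCond.cost + 1) * (cnt (v.arr 10) len a + g - v'.reg 63))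
    ⟨Frame.refl _ _ _, h63.ge, by omega, fun p h1 h2 => by omega⟩ ?_ ?_ ?_
  · refine key.mono ?_ fun _ h => h
    rw [h63, Nat.add_sub_cancel]
  · rintro w ⟨hf, h1, h2, h3⟩
    have r8 : w.reg 8 = len := by rw [hf.reg 8 (by simp), h8]
    have r12 : w.reg 12 = a := by rw [hf.reg 12 (by simp), h12]
    simp [scanCond, r8, r12, lim]
    refine ⟨by omega, ?_⟩
    split_ifs <;> omega
  · rintro w ⟨hf, h1, h2, h3⟩ hne
    have r8 : w.reg 8 = len := by rw [hf.reg 8 (by simp), h8]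
    have r12 : w.reg 12 = a := by rw [hf.reg 12 (by simp), h12]
    have a10 : w.arr 10 = v.arr 10 := hf.arr 10 (by simp)
    simp [scanCond, r8, r12, a10] at hne
    have h3' : ∀ p, g ≤ p → p < w.reg 63 + 1 → v.arr 10 p = a := by
      intro p h4 h5
      rcases Nat.lt_succ_iff_lt_or_eq.1 h5 with h6 | rfl
      · exact h3 p h4 h6
      · exact hne.1
    have h7 := hcnt (w.reg 63 + 1) (by omega) (by omega) h3'
    have hb : ∀ T c C G r : ℕ, r + 1 - G ≤ C → G ≤ r →
        (T + c + 1) * (C + G - (r + 1)) + T + (c + 1) ≤ (T + c + 1) * (C + G - r) := by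
      intro T c C G r e1 e2
      rw [show C + G - r = C + G - (r + 1) + 1 by omega]
      ring_nf; omega
    refine ⟨scanBody.time, (Tri.of_wp (Q := fun w' => w' = w.set 63 (w.reg 63 + 1)) ?_).imp ?_⟩
    · simp [scanBody, Prog.wp]; omega
    · rintro _ rfl
      refine ⟨⟨?_, ?_, ?_, ?_⟩, ?_⟩
      · simp [Frame.set_iff, hf]
      · simp; omega
      · simp; omega
      · simpa using fun p h4 h5 => h3' p h4 (by omega)
      · simp only [State.set_reg, if_true]
        exact hb _ _ _ _ _ h7 h1
  · rintro w ⟨hf, h1, h2, h3⟩ he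
    have r8 : w.reg 8 = len := by rw [hf.reg 8 (by simp), h8]
    have r12 : w.reg 12 = a := by rw [hf.reg 12 (by simp), h12]
    have a10 : w.arr 10 = v.arr 10 := hf.arr 10 (by simp)
    simp [scanCond, r8, r12, a10] at he
    have he' : w.reg 63 < len → v.arr 10 (w.reg 63) ≠ a := fun h h' => by have := he h'; omega
    refine ⟨hf, ?_, h2, h3, he'⟩
    rcases h1.lt_or_eq with h | h
    · exact h
    · exact absurd hga (by rw [h]; exact he' (by omega))

end VM

namespace VM

open VM.Expr FFT Merge

def groupRegs : Finset ℕ := Finset.Icc 11 12 ∪ Finset.Icc 20 65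

theorem mem_groupRegs {r : ℕ} : r ∈ groupRegs ↔ 11 ≤ r ∧ r ≤ 12 ∨ 20 ≤ r ∧ r ≤ 65 := by
  simp [groupRegs]

def groupStart : Prog := 12 ≔ load 10 (reg 60) ;; 63 ≔ reg 60

def groupSize : Prog := 64 ≔ reg 63 - reg 60 ;; 65 ≔ reg 64 * reg 64

/-- Adds the pairs of equal letters with code `reg 12` to the array `6`. -/
def groupAdd : Prog :=
  .ite (reg 12)
    (.ite (lt (reg 10) (reg 65))
      (11 ≔ reg 11 + reg 10 ;; convProg ;; .for 62 (reg 9) addBody)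
      (11 ≔ reg 11 + reg 65 ;; .for 62 (reg 65) pairBody))
    .skip

def groupBody : Prog :=
  groupStart ;; .while scanCond scanBody ;; groupSize ;; groupAdd ;; 60 ≔ reg 63

def groupAddTime : ℕ := convTime + addBody.time + 2 * pairBody.time + 100

/-- The three conjuncts are the budgets of the convolution, of the listing of pairs and of the
wildcard. The lengths of the programs enter as variables, so that only their linear relation
matters. -/
theorem groupAdd_time_le (t t₁ t₂ t₃ N L w T c₁ c₂ c₃ c₄ : ℕ) (ht : t = t₁ + t₂ + 2 * t₃ + 100)
    (hT : N * (L + 1) = T) (hL : 1 ≤ L) (hN : 2 ≤ N) (h1 : c₁ = 1) (h2 : c₂ = 3) (h3 : c₃ = 3) (h4 : c₄ = 3) :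
    (w = T → c₁ + 1 + (c₂ + 1 + (c₃ + 1 + (t₁ * T + (t₂ + 13) * (N + 1)))) ≤ t * (1 + w)) ∧
    c₁ + 1 + (c₂ + 1 + (c₄ + 1 + (t₃ + 13) * (w + 1))) ≤ t * (1 + w) ∧ c₁ + 1 + 1 ≤ t * (1 + w) := by
  subst ht h1 h2 h3 h4
  have e : (t₁ + t₂ + 2 * t₃ + 100) * (1 + w) =
      (t₁ + t₂ + 2 * t₃ + 100) + (t₁ * w + t₂ * w + 2 * (t₃ * w) + 100 * w) := by ring
  rw [e]
  refine ⟨?_, ?_, by omega⟩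
  · rintro rfl
    have h5 : N + 1 ≤ w := by rw [← hT]; nlinarith
    have h6 := Nat.mul_le_mul_left (t₂ + 13) h5
    rw [add_mul t₂ 13 w] at h6
    omega
  · have : (t₃ + 13) * (w + 1) = t₃ * w + t₃ + 13 * w + 13 := by ring
    omega

section

variable {W M n lo len : ℕ} {v : State}

/-- The comparison of `thr len` with `m * m` selects the cheaper method, so the time is proportional
to `weight`. The same number is added to register 11, which later makes the total cost available to
the programs. -/
theorem groupAdd_tri {g m a F : ℕ} {x y : ℕ → ℕ} (hR : Ready W n v) (hlen : lo + len ≤ n) (h7 : v.reg 7 = lo)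
    (h8 : v.reg 8 = len) (h9 : v.reg 9 = 2 ^ lev len) (h10 : v.reg 10 = thr len) (h11 : v.reg 11 = F)
    (h12 : v.reg 12 = a) (h60 : v.reg 60 = g) (h64 : v.reg 64 = m) (h65 : v.reg 65 = m * m)
    (hm : 0 < m) (hg : g + m ≤ len) (hP : ∀ p < len, v.arr 4 p < len)
    (hF : F + weight (fun i => v.arr 16 (lo + i)) len (thr len) a < W)
    (hcnt : cnt (fun i => v.arr 16 (lo + i)) len a = m)
    (hpair : a ≠ 0 → ∀ s, pairCount (v.arr 4) g m (m * m) s = FFT.conv (sel (fun i => v.arr 16 (lo + i)) len a) s)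
    (hx : ∀ s < 2 ^ lev len, v.arr 6 s = x s)
    (hy : ∀ s < 2 ^ lev len, x s + matchCount (fun i => v.arr 16 (lo + i)) len s a = y s)
    (hyW : ∀ s < 2 ^ lev len, y s < W) :
    Tri W M n groupAdd v (groupAddTime * (1 + weight (fun i => v.arr 16 (lo + i)) len (thr len) a)) fun v' =>
      Frame (groupRegs \ {12, 60, 63}) {0, 1, 6} v v' ∧
      v'.reg 11 = F + weight (fun i => v.arr 16 (lo + i)) len (thr len) a ∧
      ∀ s < 2 ^ lev len, v'.arr 6 s = y s := by
  set c := fun i => v.arr 16 (lo + i) with hc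
  have hle := hR.le
  have hsq := hR.sq
  have hN4 := pow_lev_le len
  have hmm : m * m ≤ (n + 1) * (n + 1) := Nat.mul_le_mul (by omega) (by omega)
  obtain ⟨k1, k2, k3⟩ := groupAdd_time_le groupAddTime convTime addBody.time pairBody.time _ _ (weight c len (thr len) a) (thr len)
    (reg 12).cost (lt (reg 10) (reg 65)).cost (reg 11 + reg 10).cost (reg 11 + reg 65).cost rfl rfl
    (one_le_lev len) (two_le_pow_lev len) rfl rfl rfl rfl
  have hsub : ∀ r, r ∈ fftRegs → r ∈ groupRegs \ {12, 60, 63} := fun r hr => by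
    rw [mem_fftRegs] at hr; simp [mem_groupRegs]; omega
  by_cases ha : a = 0
  · refine Tri.mono (T := (reg 12).cost + 1 + 1) ?_ k3 fun _ h => h
    refine Tri.ite (by simp) (fun h => absurd (by simp [h12, ha]) h) fun _ => Tri.skip ?_
    refine ⟨Frame.refl _ _ _, by simp [weight, ha, h11], fun s hs => ?_⟩
    rw [hx s hs, ← hy s hs]; simp [matchCount, ha]
  · by_cases hT : thr len < m * m
    · have hw : weight c len (thr len) a = thr len := by
        rw [weight, if_neg ha, hcnt, min_eq_right]; rw [sq]; exact hT.le
      refine Tri.mono ?_ (k1 hw) fun _ h => h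
      refine Tri.ite (by simp) (fun _ => Tri.ite (by simp) (fun _ => ?_) (fun h => absurd h (by simp [h10, h65, hT])))
        (fun h => absurd h (by simpa [h12] using ha))
      rw [hw] at hF ⊢
      refine Tri.seq (R := fun w => w = v.set 11 (F + thr len)) (Tri.asg (by norm_num) ?_ ?_) ?_
      · simp [h11, h10]; omega
      · simp [h11, h10]
      rintro _ rfl
      refine Tri.seq (R := fun w => Frame fftRegs {0, 1} (v.set 11 (F + thr len)) w ∧ ∀ p < 2 ^ lev len,
        w.arr 0 p = FFT.conv (sel c len a) p) ?_ ?_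
      · refine (Ready.conv (v := v.set 11 (F + thr len)) (lo := lo) (len := len) (a := a)
          (hR.of_eq (by simp) (by simp) (by simp) (by simp)) rfl (two_le_pow_lev _) (by simpa using h7)
          (by simpa using h8) (by simpa using h9) (by simpa using h12) hlen (two_mul_le_pow_lev _)
          (pow_lev_lt _)).imp ?_
        rintro w ⟨h1, h2⟩
        exact ⟨h1, by simpa using h2⟩
      · rintro w ⟨hf, hw0⟩
        have a6 : w.arr 6 = v.arr 6 := by rw [hf.arr 6 (by simp)]; simp
        have hE : ∀ s < 2 ^ lev len, w.arr 6 s + w.arr 0 s = y s := fun s hs => by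
          rw [a6, hx s hs, hw0 s hs, ← hy s hs]; simp [matchCount, ha]
        refine (add_loop (N := 2 ^ lev len) (by omega) (by omega)
          (by rw [hf.reg 9 (by simp [mem_fftRegs])]; simpa using h9)
          (fun s hs => by rw [hE s hs]; exact hyW s hs)).imp ?_
        rintro u ⟨hu, hu6⟩
        have hf' : Frame (groupRegs \ {12, 60, 63}) {0, 1, 6} v w :=
          (((Frame.set_iff (R := groupRegs \ {12, 60, 63}) (A := {0, 1, 6}) (v := v) (by simp [mem_groupRegs])).2
            (Frame.refl _ _ _)).trans
            (hf.mono (fun r hr => hsub r hr) (by decide)))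
        refine ⟨hf'.trans (hu.mono (by simp [mem_groupRegs]) (by decide)), ?_, fun s hs => ?_⟩
        · rw [hu.reg 11 (by simp), hf.reg 11 (by simp [mem_fftRegs])]; simp
        · rw [hu6 s hs, hE s hs]
    · have hw : weight c len (thr len) a = m * m := by
        rw [weight, if_neg ha, hcnt, min_eq_left]; rw [sq]; rw [sq]; omega
      rw [hw] at hF k2 ⊢
      refine Tri.mono ?_ k2 fun _ h => h
      refine Tri.ite (by simp) (fun _ => Tri.ite (by simp) (fun h => absurd h (by simp [h10, h65]; omega)) (fun _ => ?_))
        (fun h => absurd h (by simpa [h12] using ha))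
      refine Tri.seq (R := fun w => w = v.set 11 (F + m * m)) (Tri.asg (by norm_num) ?_ ?_) ?_
      · simp [h11, h65]; omega
      · simp [h11, h65]
      rintro _ rfl
      have hE : ∀ s < 2 ^ lev len, v.arr 6 s + pairCount (v.arr 4) g m (m * m) s = y s := fun s hs => by
        rw [hx s hs, hpair ha, ← hy s hs]; simp [matchCount, ha]
      refine (pair_loop (v := v.set 11 (F + m * m)) (N := 2 ^ lev len) (g := g) (m := m) (len := len) (by omega)
        (by omega) (by omega) (by omega) (by simpa using h60) (by simpa using h64) (by simpa using h65) hg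
        (by simpa using hP) (two_mul_le_pow_lev _) hm ?_).imp ?_
      · intro s hs
        simp only [State.set_arr]
        rw [hE s hs]; exact hyW s hs
      · rintro u ⟨hu, hu6⟩
        refine ⟨?_, ?_, fun s hs => ?_⟩
        · refine Frame.trans ?_ (hu.mono (by decide) (by decide))
          simp [Frame.set_iff, mem_groupRegs, Frame.refl]
        · rw [hu.reg 11 (by simp)]; simp
        · rw [hu6 s hs]; exact hE s hs

end

/-- Invariant of the loop over the letters; `v₀` is the state at its start. -/
structure GroupInv (lo len : ℕ) (v₀ w : State) : Prop where
  frame : Frame groupRegs {0, 1, 6} v₀ w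
  le : w.reg 60 ≤ len
  border : Border (fun p => v₀.arr 16 (lo + v₀.arr 4 p)) len (w.reg 60)
  cost : w.reg 11 + ∑ a ∈ rest (fun p => v₀.arr 16 (lo + v₀.arr 4 p)) len (w.reg 60),
    weight (fun i => v₀.arr 16 (lo + i)) len (thr len) a = letterCost (fun i => v₀.arr 16 (lo + i)) len (thr len)
  count : ∀ s < 2 ^ lev len, w.arr 6 s + ∑ a ∈ rest (fun p => v₀.arr 16 (lo + v₀.arr 4 p)) len (w.reg 60),
    matchCount (fun i => v₀.arr 16 (lo + i)) len s a =
      ∑ a ∈ (Finset.range len).image (fun i => v₀.arr 16 (lo + i)), matchCount (fun i => v₀.arr 16 (lo + i)) len s a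

def groupTime : ℕ := groupStart.time + (scanBody.time + scanCond.cost + 1) + scanCond.cost + groupSize.time +
  2 * groupAddTime + 10

/-- The scan costs the number of occurrences and the counting costs the weight. The last clause of
the conclusion is what lets both be paid from a sum over the remaining letters. -/
theorem groupBody_tri {W M n lo len : ℕ} {v₀ v : State} (hR : Ready W n v₀) (hlen : lo + len ≤ n)
    (h7 : v₀.reg 7 = lo) (h8 : v₀.reg 8 = len) (h9 : v₀.reg 9 = 2 ^ lev len) (h10 : v₀.reg 10 = thr len)
    (hP : IsPerm (v₀.arr 4) len)
    (hS : ∀ u w, u ≤ w → w < len → v₀.arr 16 (lo + v₀.arr 4 u) ≤ v₀.arr 16 (lo + v₀.arr 4 w))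
    (hK : ∀ p < len, v₀.arr 10 p = v₀.arr 16 (lo + v₀.arr 4 p)) (hI : GroupInv lo len v₀ v)
    (hg : v.reg 60 < len) :
    Tri W M n groupBody v (groupTime * (cnt (fun i => v₀.arr 16 (lo + i)) len (v₀.arr 10 (v.reg 60)) +
        weight (fun i => v₀.arr 16 (lo + i)) len (thr len) (v₀.arr 10 (v.reg 60)))) fun v' =>
      GroupInv lo len v₀ v' ∧ 1 ≤ cnt (fun i => v₀.arr 16 (lo + i)) len (v₀.arr 10 (v.reg 60)) ∧
      ∀ f : ℕ → ℕ, ∑ a ∈ rest (fun p => v₀.arr 16 (lo + v₀.arr 4 p)) len (v.reg 60), f a =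
        f (v₀.arr 10 (v.reg 60)) + ∑ a ∈ rest (fun p => v₀.arr 16 (lo + v₀.arr 4 p)) len (v'.reg 60), f a := by
  set c := fun i => v₀.arr 16 (lo + i) with hc
  set κ := fun p => v₀.arr 16 (lo + v₀.arr 4 p) with hκ
  set g := v.reg 60 with hgdef
  set a := v₀.arr 10 g with ha
  have haκ : a = κ g := hK g hg
  have hle := hR.le
  have hsq := hR.sq
  have hcnt0 : ∀ b, cnt (v₀.arr 10) len b = cnt c len b := fun b => by
    rw [← hP.cnt (c := c) b]
    exact Finset.sum_congr rfl fun p hp => by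
      beta_reduce; rw [hK p (Finset.mem_range.1 hp)]
  have main : Tri W M n groupBody v (groupStart.time +
      (((scanBody.time + scanCond.cost + 1) * cnt c len a + (scanCond.cost + 1)) + (groupSize.time +
        (groupAddTime * (1 + weight c len (thr len) a) + 2)))) fun v' =>
      GroupInv lo len v₀ v' ∧ 1 ≤ cnt c len a ∧
      ∀ f : ℕ → ℕ, ∑ a ∈ rest κ len g, f a = f a + ∑ a ∈ rest κ len (v'.reg 60), f a := by
    have f0 := hI.frame
    have a10 : v.arr 10 = v₀.arr 10 := f0.arr 10 (by simp)
    have r8 : v.reg 8 = len := by rw [f0.reg 8 (by simp [mem_groupRegs]), h8]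
    refine Tri.seq (Tri.of_wp (Q := fun w => w = (v.set 12 a).set 63 g) ?_) ?_
    · simp [groupStart, Prog.wp, lim, ← hgdef, a10, ← ha]; omega
    rintro _ rfl
    refine Tri.seq ((scan_loop (len := len) (g := g) (a := a) (by omega) (by omega) hg (by simpa using r8) (by simp)
      (by simp) (by simp [a10, ha])).mono (by simp [a10, hcnt0]) fun _ h => h) ?_
    rintro v1 ⟨f1', h1, h2, h3, h4⟩
    simp only [State.set_arr, a10] at h3 h4
    have f1 : Frame groupRegs {0, 1, 6} v v1 :=
      Frame.trans (v' := (v.set 12 a).set 63 g) (by simp [Frame.set_iff, mem_groupRegs, Frame.refl])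
        (f1'.mono (by simp [mem_groupRegs]) (by simp))
    set g' := v1.reg 63 with hg'
    have heq : ∀ p, g ≤ p → p < g' → κ p = κ g := fun p e1 e2 => by
      rw [← haκ, ← h3 p e1 e2, hK p (by omega)]
    have hb' : Border κ len g' := hI.border.next hS h1 h2 heq fun e => by
      rw [← haκ, show κ g' = v₀.arr 10 g' from (hK g' e).symm]; exact h4 e
    have hm : cnt c len a = g' - g := by
      rw [← hP.cnt, haκ]; exact cnt_group hI.border hb' h1 h2 heq
    have hsum := fun f => sum_rest hb' h1 h2 heq f
    rw [← haκ] at hsum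
    have e60 : v1.reg 60 = g := by rw [f1'.reg 60 (by simp)]; simp [hgdef]
    refine Tri.seq (Tri.of_wp (Q := fun w => w = (v1.set 64 (g' - g)).set 65 ((g' - g) * (g' - g))) ?_) ?_
    · have : (g' - g) * (g' - g) ≤ (n + 1) * (n + 1) := Nat.mul_le_mul (by omega) (by omega)
      simp [groupSize, Prog.wp, ← hg', e60]; omega
    rintro _ rfl
    set v2 := (v1.set 64 (g' - g)).set 65 ((g' - g) * (g' - g)) with hv2
    have f2 : Frame groupRegs {0, 1, 6} v v2 := by
      rw [hv2]; simp [Frame.set_iff, mem_groupRegs, f1]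
    have f02 := f0.trans f2
    have a16 : v2.arr 16 = v₀.arr 16 := f02.arr 16 (by simp)
    have a4 : v2.arr 4 = v₀.arr 4 := f02.arr 4 (by simp)
    have a6 : v2.arr 6 = v.arr 6 := by rw [hv2]; simp [f1'.arr 6 (by simp)]
    have e11 : v2.reg 11 = v.reg 11 := by rw [hv2]; simp [f1'.reg 11 (by simp)]
    have e12 : v2.reg 12 = a := by rw [hv2]; simp [f1'.reg 12 (by simp)]
    have hcost := hI.cost
    rw [← hgdef, ← hc, ← hκ, hsum] at hcost
    have hcount := hI.count
    rw [← hgdef, ← hc, ← hκ] at hcount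
    simp_rw [hsum] at hcount
    have hN4 := pow_lev_le len
    refine Tri.seq ((groupAdd_tri (lo := lo) (len := len) (g := g) (m := g' - g) (a := a) (F := v.reg 11)
      (x := v.arr 6) (y := fun s => v.arr 6 s + matchCount c len s a)
      (hR.frame f02 (by simp [mem_groupRegs]) (by simp [mem_groupRegs]) (by simp) (by simp)) hlen
      (by rw [f02.reg 7 (by simp [mem_groupRegs]), h7]) (by rw [f02.reg 8 (by simp [mem_groupRegs]), h8])
      (by rw [f02.reg 9 (by simp [mem_groupRegs]), h9]) (by rw [f02.reg 10 (by simp [mem_groupRegs]), h10])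
      e11 e12 (by rw [hv2]; simp [e60]) (by simp [hv2]) (by simp [hv2]) (by omega) (by omega)
      (by rw [a4]; exact fun p hp => hP.lt hp) ?_ (by rw [a16]; exact hm) ?_ (fun s _ => by rw [a6])
      (fun s _ => by rw [a16]) ?_).mono (by rw [a16]) fun _ h => h) ?_
    · rw [a16, ← hc]
      have := letterCost_le c len (thr len)
      have : len * len ≤ (n + 1) * (n + 1) := Nat.mul_le_mul (by omega) (by omega)
      omega
    · intro h0 s
      rw [a16, a4, haκ]
      exact pairCount_eq (c := c) hP hI.border hb' h1 h2 heq (by rw [haκ] at h0; exact h0) s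
    · intro s hs
      have := hcount s hs
      have := sum_matchCount_le c len s _ (two_mul_le_pow_lev len)
      omega
    · rintro v3 ⟨f3', h11, h6⟩
      rw [a16] at h11
      have e63 : v3.reg 63 = g' := by rw [f3'.reg 63 (by simp), hv2]; simp [hg']
      refine Tri.asg (by norm_num) (by simp) ⟨⟨?_, ?_, ?_, ?_, ?_⟩, by omega, fun f => ?_⟩
      · rw [Frame.set_iff (by simp [mem_groupRegs])]
        exact f02.trans (f3'.mono Finset.sdiff_subset (by simp))
      · simp [e63, h2]
      · simpa [e63] using hb'
      · simp only [State.set_reg, val_reg, e63, if_true]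
        rw [if_neg (by norm_num), h11, ← hcost, add_assoc]
      · intro s hs
        simp only [State.set_reg, val_reg, e63, if_true, State.set_arr]
        rw [h6 s hs, ← hcount s hs, add_assoc]
      · simp [e63, hsum f]
  have key : ∀ t1 t2 c t3 t4 m w : ℕ, 1 ≤ m → t1 + ((t2 + c + 1) * m + (c + 1) + (t3 + (t4 * (1 + w) + 2))) ≤
      (t1 + (t2 + c + 1) + c + t3 + 2 * t4 + 10) * (m + w) := by
    intro t1 t2 c t3 t4 m w hm
    obtain ⟨m, rfl⟩ := Nat.exists_eq_add_of_le hm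
    have : 0 ≤ (t1 + (t2 + c + 1) + c + t3 + 2 * t4 + 10) * (m + w) := Nat.zero_le _
    nlinarith [Nat.zero_le (t1 * m), Nat.zero_le (t1 * w), Nat.zero_le (t2 * m), Nat.zero_le (t2 * w),
      Nat.zero_le (t3 * m), Nat.zero_le (t3 * w), Nat.zero_le (t4 * m), Nat.zero_le (t4 * w),
      Nat.zero_le (c * m), Nat.zero_le (c * w)]
  have hpos : 1 ≤ cnt c len a := by
    rw [← hP.cnt, Nat.one_le_iff_ne_zero, ← mem_image_iff]
    exact Finset.mem_image.2 ⟨g, Finset.mem_range.2 hg, haκ.symm⟩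
  exact main.mono (key _ _ _ _ _ _ _ hpos) fun _ h => h

end VM

namespace VM

open VM.Expr FFT Merge

def scRegs : Finset ℕ := Finset.Icc 9 12 ∪ Finset.Icc 20 65

theorem mem_scRegs {r : ℕ} : r ∈ scRegs ↔ 9 ≤ r ∧ r ≤ 12 ∨ 20 ≤ r ∧ r ≤ 65 := by
  simp [scRegs]

def scArrs : Finset ℕ := {0, 1, 4, 5, 6, 7, 10}

/-- Computes the numbers of mismatching pairs for the factor of length `reg 8` that starts at
`reg 7`. -/
def scProg : Prog :=
  sizeProg ;; 12 ≔ 0 ;; convProg ;; .for 62 (reg 9) copyOutBody ;; sortProg ;; .for 62 (reg 8) keyBody ;;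
  11 ≔ 0 ;; 60 ≔ 0 ;; .while (lt (reg 60) (reg 8)) groupBody ;; .for 62 (reg 9) subBody

theorem groups_tri {W M n lo len : ℕ} {v : State} (hR : Ready W n v) (hlen : lo + len ≤ n)
    (h7 : v.reg 7 = lo) (h8 : v.reg 8 = len) (h9 : v.reg 9 = 2 ^ lev len) (h10 : v.reg 10 = thr len)
    (h11 : v.reg 11 = 0) (h60 : v.reg 60 = 0) (hP : IsPerm (v.arr 4) len)
    (hS : ∀ u w, u ≤ w → w < len → v.arr 16 (lo + v.arr 4 u) ≤ v.arr 16 (lo + v.arr 4 w))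
    (hK : ∀ p < len, v.arr 10 p = v.arr 16 (lo + v.arr 4 p)) (h6 : ∀ s < 2 ^ lev len, v.arr 6 s = 0) :
    Tri W M n (.while (lt (reg 60) (reg 8)) groupBody) v
      ((groupTime + 4) * (len + letterCost (fun i => v.arr 16 (lo + i)) len (thr len)) + 4) fun v' =>
      Frame groupRegs {0, 1, 6} v v' ∧ v'.reg 11 = letterCost (fun i => v.arr 16 (lo + i)) len (thr len) ∧
      ∀ s < 2 ^ lev len, v'.arr 6 s =
        ∑ a ∈ (Finset.range len).image (fun i => v.arr 16 (lo + i)), matchCount (fun i => v.arr 16 (lo + i)) len s a := by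
  set c := fun i => v.arr 16 (lo + i) with hc
  have him : rest (fun p => v.arr 16 (lo + v.arr 4 p)) len 0 = (Finset.range len).image c := by
    rw [rest, Nat.Ico_zero_eq_range]; exact hP.image (c := c)
  have key := Tri.while_pot (W := W) (M := M) (n := n) (p := groupBody) (v := v) (e := lt (reg 60) (reg 8))
    (Q := fun v' => Frame groupRegs {0, 1, 6} v v' ∧ v'.reg 11 = letterCost c len (thr len) ∧
      ∀ s < 2 ^ lev len, v'.arr 6 s = ∑ a ∈ (Finset.range len).image c, matchCount c len s a)
    -- Potential: occurrences plus weights of the letters still to come. At the start it is `len`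
    -- plus the total letter cost.
    (GroupInv lo len v) (fun w => (groupTime + 4) *
      ∑ a ∈ rest (fun p => v.arr 16 (lo + v.arr 4 p)) len (w.reg 60), (cnt c len a + weight c len (thr len) a))
    ⟨Frame.refl _ _ _, by omega, ?_, ?_, ?_⟩ (fun w hw => by simp) ?_ ?_
  · refine key.mono ?_ fun _ h => h
    rw [h60, him, Finset.sum_add_distrib, sum_cnt]
    exact le_rfl
  · rw [h60]; intro p p' h; omega
  · rw [h60, him, h11, zero_add]; rfl
  · intro s hs
    rw [h60, him, h6 s hs, zero_add]
  · intro w hI hlt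
    have r8 : w.reg 8 = len := by rw [hI.frame.reg 8 (by simp [mem_groupRegs]), h8]
    simp [r8] at hlt
    refine ⟨_, (groupBody_tri hR hlen h7 h8 h9 h10 hP hS hK hI hlt).imp ?_⟩
    rintro w' ⟨hI', hpos, hsum⟩
    refine ⟨hI', ?_⟩
    rw [hsum]
    have e : ∀ t a b S c : ℕ, 1 ≤ a → c = 3 →
        (t + 4) * S + t * (a + b) + (c + 1) ≤ (t + 4) * (a + b + S) := by
      rintro t a b S c h rfl; nlinarith
    exact e _ _ _ _ _ hpos rfl
  · intro w hI hge
    have r8 : w.reg 8 = len := by rw [hI.frame.reg 8 (by simp [mem_groupRegs]), h8]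
    simp [r8] at hge
    have h0 : rest (fun p => v.arr 16 (lo + v.arr 4 p)) len (w.reg 60) = ∅ := by
      rw [rest, Finset.Ico_eq_empty (by omega), Finset.image_empty]
    refine ⟨hI.frame, ?_, fun s hs => ?_⟩
    · simpa [h0] using hI.cost
    · simpa [h0] using hI.count s hs

def scTime : ℕ := sizeBody.time + convTime + 2 * copyOutBody.time + sortTime + keyBody.time + groupTime +
  2 * subBody.time + 200

theorem scTime_le (t t₁ t₂ t₃ t₄ t₅ t₆ t₇ N L T len F : ℕ) (hT : N * (L + 1) = T)
    (ht : t = t₁ + t₂ + 2 * t₃ + t₄ + t₅ + t₆ + 2 * t₇ + 200) (hL : 1 ≤ L) (hN : 2 ≤ N) (hl : 2 * len ≤ N) :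
    (t₁ + 20) * (L + 1) + (2 + (t₂ * T + ((t₃ + 13) * (N + 1) + (t₄ * T + ((t₅ + 13) * (len + 1) +
      (2 + (2 + ((t₆ + 4) * (len + F) + 4 + (t₇ + 13) * (N + 1))))))))) ≤ t * (T + F) := by
  have h1 : L + 1 ≤ T := by rw [← hT]; exact Nat.le_mul_of_pos_left _ (by omega)
  have h2 : 2 * N ≤ T := by rw [← hT]; nlinarith
  have h3 : N + 1 ≤ T := by omega
  have h4 : len + 1 ≤ T := by omega
  obtain ⟨X, hX⟩ : ∃ X, X = T + F := ⟨_, rfl⟩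
  have a0 := Nat.mul_le_mul_left (t₁ + 20) (show L + 1 ≤ X by omega)
  have a1 := Nat.mul_le_mul_left t₂ (show T ≤ X by omega)
  have a2 := Nat.mul_le_mul_left (t₃ + 13) (show N + 1 ≤ X by omega)
  have a3 := Nat.mul_le_mul_left t₄ (show T ≤ X by omega)
  have a4 := Nat.mul_le_mul_left (t₅ + 13) (show len + 1 ≤ X by omega)
  have a5 := Nat.mul_le_mul_left (t₆ + 4) (show len + F ≤ X by omega)
  have a6 := Nat.mul_le_mul_left (t₇ + 13) (show N + 1 ≤ X by omega)
  have a7 : (t₁ + 20) * X + (t₂ * X + ((t₃ + 13) * X + (t₄ * X + ((t₅ + 13) * X + ((t₆ + 4) * X +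
      (t₇ + 13) * X + 10 * X))))) = (t₁ + t₂ + t₃ + t₄ + t₅ + t₆ + t₇ + 73) * X := by ring
  have a8 := Nat.mul_le_mul_right X (show t₁ + t₂ + t₃ + t₄ + t₅ + t₆ + t₇ + 73 ≤ t by omega)
  rw [← hX]
  omega

/-- Besides the mismatch counts, registers 10 and 11 return the two parts of the cost. The precise
algorithm chooses its block length from them. -/
theorem scProg_tri {W M n lo len : ℕ} {v : State} (hR : Ready W n v) (hlen : lo + len ≤ n)
    (h7 : v.reg 7 = lo) (h8 : v.reg 8 = len) :
    Tri W M n scProg v (scTime * (thr len + letterCost (fun i => v.arr 16 (lo + i)) len (thr len))) fun v' =>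
      Frame scRegs scArrs v v' ∧ v'.reg 10 = thr len ∧
      v'.reg 11 = letterCost (fun i => v.arr 16 (lo + i)) len (thr len) ∧
      ∀ s < 2 ^ lev len, v'.arr 7 s = mism (fun i => v.arr 16 (lo + i)) len s := by
  set c := fun i => v.arr 16 (lo + i) with hc
  have hle := hR.le
  have hsq := hR.sq
  have hN4 := pow_lev_le len
  have hsub : ∀ {R A : Finset ℕ} {u w : State}, Frame R A u w → (∀ r ∈ R, r ∈ scRegs) → (∀ a ∈ A, a ∈ scArrs) →
      Frame scRegs scArrs u w := fun h h1 h2 => h.mono h1 h2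
  refine Tri.mono (Q := fun v' => Frame scRegs scArrs v v' ∧ v'.reg 10 = thr len ∧
      v'.reg 11 = letterCost c len (thr len) ∧ ∀ s < 2 ^ lev len, v'.arr 7 s = mism c len s) ?_
    (scTime_le scTime sizeBody.time convTime copyOutBody.time sortTime keyBody.time groupTime subBody.time
      _ _ _ len (letterCost c len (thr len)) rfl rfl (one_le_lev len) (two_le_pow_lev len) (two_mul_le_pow_lev len))
    fun _ h => h
  refine Tri.seq (sizeProg_tri (by omega) hsq h8) ?_
  rintro v1 ⟨f1, h9, h10⟩
  have F1 := hsub f1 (by decide) (by simp)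
  refine Tri.seq (R := fun w => w = v1.set 12 0) (Tri.asg (by norm_num) (by simp) rfl) ?_
  rintro _ rfl
  have F2 : Frame scRegs scArrs v (v1.set 12 0) := by simp [Frame.set_iff, mem_scRegs, F1]
  have r : ∀ {w}, Frame scRegs scArrs v w → Ready W n w ∧ w.reg 7 = lo ∧ w.reg 8 = len ∧
      w.arr 16 = v.arr 16 := fun hw =>
    ⟨hR.frame hw (by simp [mem_scRegs]) (by simp [mem_scRegs]) (by decide) (by decide),
      by rw [hw.reg 7 (by simp [mem_scRegs]), h7], by rw [hw.reg 8 (by simp [mem_scRegs]), h8],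
      hw.arr 16 (by decide)⟩
  obtain ⟨q1, q2, q3, q4⟩ := r F2
  refine Tri.seq (q1.conv (lo := lo) (len := len) (a := 0) rfl (two_le_pow_lev len) q2 q3 (by simpa using h9)
    (by simp) hlen (two_mul_le_pow_lev len) (pow_lev_lt len)) ?_
  rintro v3 ⟨f3, h0⟩
  rw [q4, ← hc] at h0
  have F3 := F2.trans (hsub f3 (fun r hr => by rw [mem_fftRegs] at hr; rw [mem_scRegs]; omega) (by decide))
  have e9 : v3.reg 9 = 2 ^ lev len := by rw [f3.reg 9 (by simp [mem_fftRegs])]; simpa using h9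
  have e10 : v3.reg 10 = thr len := by rw [f3.reg 10 (by simp [mem_fftRegs])]; simpa using h10
  refine Tri.seq (copyOut_loop (by omega) (by omega) e9) ?_
  rintro v4 ⟨f4, h67⟩
  have F4 := F3.trans (hsub f4 (by decide) (by decide))
  obtain ⟨q1, q2, q3, q4⟩ := r F4
  refine Tri.seq (sortProg_tri hlen (by omega) rfl (one_le_lev len) (two_mul_le_pow_lev len) q2 q3) ?_
  rintro v5 ⟨f5, hP, hS⟩
  have F5 := F4.trans (hsub f5 (fun r hr => by rw [mem_sortRegs] at hr; rw [mem_scRegs]; omega) (by decide))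
  rw [← f5.arr 16 (by simp)] at hS
  obtain ⟨q1, q2, q3, q4⟩ := r F5
  refine Tri.seq (key_loop hlen (by omega) q2 q3 hP) ?_
  rintro v6 ⟨f6, hK⟩
  have F6 := F5.trans (hsub f6 (by decide) (by decide))
  refine Tri.seq (R := fun w => w = v6.set 11 0) (Tri.asg (by norm_num) (by simp) rfl) ?_
  rintro _ rfl
  refine Tri.seq (R := fun w => w = (v6.set 11 0).set 60 0) (Tri.asg (by norm_num) (by simp) rfl) ?_
  rintro _ rfl
  have F7 : Frame scRegs scArrs v ((v6.set 11 0).set 60 0) := by simp [Frame.set_iff, mem_scRegs, F6]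
  obtain ⟨q1, q2, q3, q4⟩ := r F7
  have a4 : v6.arr 4 = v5.arr 4 := f6.arr 4 (by simp)
  have a16 : v6.arr 16 = v5.arr 16 := f6.arr 16 (by simp)
  have b9 : v6.reg 9 = 2 ^ lev len := by
    rw [f6.reg 9 (by simp), f5.reg 9 (by simp [mem_sortRegs]), f4.reg 9 (by simp), e9]
  have b10 : v6.reg 10 = thr len := by
    rw [f6.reg 10 (by simp), f5.reg 10 (by simp [mem_sortRegs]), f4.reg 10 (by simp), e10]
  have a6 : ∀ s < 2 ^ lev len, v6.arr 6 s = 0 := fun s hs => by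
    rw [f6.arr 6 (by simp), f5.arr 6 (by simp), (h67 s hs).2]
  have a7 : ∀ s < 2 ^ lev len, v6.arr 7 s = FFT.conv (sel c len 0) s := fun s hs => by
    rw [f6.arr 7 (by simp), f5.arr 7 (by simp), (h67 s hs).1, h0 s hs]
  refine Tri.seq ((groups_tri q1 hlen q2 q3 (by simpa using b9) (by simpa using b10) (by simp) (by simp)
    (by simpa [a4] using hP) (by simpa [a4, a16] using hS) (by simpa [a4, a16] using hK) (by simpa using a6)).mono
    (by rw [q4]) fun _ h => h) ?_
  rintro v8 ⟨f8, h11, h6⟩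
  rw [q4, ← hc] at h11 h6
  have F8 := F7.trans (hsub f8 (fun r hr => by rw [mem_groupRegs] at hr; rw [mem_scRegs]; omega) (by decide))
  have c9 : v8.reg 9 = 2 ^ lev len := by rw [f8.reg 9 (by simp [mem_groupRegs])]; simpa using b9
  refine (sub_loop (by omega) (by omega) c9).imp ?_
  rintro w ⟨fw, h7'⟩
  refine ⟨F8.trans (hsub fw (by decide) (by decide)), ?_, ?_, fun s hs => ?_⟩
  · rw [fw.reg 10 (by simp), f8.reg 10 (by simp [mem_groupRegs])]; simpa using b10
  · rw [fw.reg 11 (by simp), h11]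
  · have a7' : v8.arr 7 s = FFT.conv (sel c len 0) s := by rw [f8.arr 7 (by simp)]; simpa using a7 s hs
    rw [h7' s hs, h6 s hs, a7', conv_sel_zero, Nat.add_sub_cancel_left]

end VM

/-! ### The table of the roots of unity -/

namespace FFT

open Complex

/-- The number `X` is `Q ^ 2 * x` rounded down, so both `Nat.sqrt X` and `Q * √x` lie between
`Nat.sqrt X` and its successor. -/
theorem abs_sqrt_div_sub_le {Q X : ℕ} {x : ℝ} (hQ : 0 < Q) (hx : 0 ≤ x) (h1 : (X : ℝ) ≤ Q ^ 2 * x)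
    (h2 : (Q : ℝ) ^ 2 * x < X + 1) : |(Nat.sqrt X : ℝ) / Q - √x| ≤ 1 / Q := by
  have hQ' : (0 : ℝ) < Q := by exact_mod_cast hQ
  have hs := Real.sq_sqrt hx
  have hs0 := Real.sqrt_nonneg x
  have e1 : ((Nat.sqrt X : ℕ) : ℝ) ^ 2 ≤ X := by exact_mod_cast Nat.sqrt_le' X
  have e2 : (X : ℝ) + 1 ≤ ((Nat.sqrt X : ℕ) + 1 : ℝ) ^ 2 := by exact_mod_cast Nat.succ_le_of_lt (Nat.lt_succ_sqrt' X)
  have e3 : (Q : ℝ) ^ 2 * x = (Q * √x) ^ 2 := by rw [mul_pow, hs]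
  have e4 : (Nat.sqrt X : ℝ) ≤ Q * √x := by
    refine le_of_sq_le_sq ?_ (by positivity) 
    linarith
  have e5 : Q * √x ≤ (Nat.sqrt X : ℝ) + 1 := by
    refine le_of_sq_le_sq ?_ (by positivity)
    linarith
  rw [show (Nat.sqrt X : ℝ) / Q - √x = (Nat.sqrt X - Q * √x) / Q by field_simp, abs_div, abs_of_pos hQ']
  gcongr
  rw [abs_le]; constructor <;> linarith

/-- Away from 0 the root is a contraction, because `√x + √y ≥ 1`. -/
theorem abs_sqrt_sub_sqrt_le {x y e : ℝ} (hx : 1 / 4 ≤ x) (hy : 1 / 4 ≤ y) (h : |x - y| ≤ e) : |√x - √y| ≤ e := by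
  have h1 : 1 / 2 ≤ √x := Real.le_sqrt_of_sq_le (by linarith)
  have h2 : 1 / 2 ≤ √y := Real.le_sqrt_of_sq_le (by linarith)
  have h3 : x - y = (√x - √y) * (√x + √y) := by
    nlinarith [Real.sq_sqrt (show 0 ≤ x by linarith), Real.sq_sqrt (show 0 ≤ y by linarith)]
  rw [h3, abs_mul, abs_of_pos (show 0 < √x + √y by linarith)] at h
  nlinarith [abs_nonneg (√x - √y)]

/-- Near 0 only half of the digits survive a square root. This is why `Angle` claims precision `2 /
q` for sines and `2 / Q`, with `Q = q ^ 2`, for cosines. -/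
theorem abs_sqrt_sub_sqrt_le_of_sq {x y e : ℝ} (hx : 0 ≤ x) (hy : 0 ≤ y) (he : 0 ≤ e) (h : |x - y| ≤ e ^ 2) :
    |√x - √y| ≤ e := by
  have h1 := Real.sq_sqrt hx
  have h2 := Real.sq_sqrt hy
  have h3 := Real.sqrt_nonneg x
  have h4 := Real.sqrt_nonneg y
  rw [abs_le] at *
  constructor <;> by_contra hc <;> nlinarith

/-- Fixed point values of the cosine and sine of `π / 2 ^ (j + 1)`. -/
structure Angle (Q q j C S : ℕ) : Prop where
  cos_le : C ≤ Q
  sin_le : S ≤ Q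
  cos : |(C : ℝ) / Q - Real.cos (Real.pi / 2 ^ (j + 1))| ≤ 2 / Q
  sin : |(S : ℝ) / Q - Real.sin (Real.pi / 2 ^ (j + 1))| ≤ 2 / q

theorem angle_zero {Q q : ℕ} (hQ : 0 < Q) : Angle Q q 0 0 Q := by
  have : (Q : ℝ) ≠ 0 := by exact_mod_cast hQ.ne'
  refine ⟨Nat.zero_le _, le_rfl, ?_, ?_⟩ <;> simp [this] <;> positivity

theorem cast_div_two_bounds (m : ℕ) : ((m / 2 : ℕ) : ℝ) ≤ m / 2 ∧ (m : ℝ) / 2 < ((m / 2 : ℕ) : ℝ) + 1 := by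
  have h1 : 2 * (m / 2) ≤ m := by omega
  have h2 : m < 2 * (m / 2) + 2 := by omega
  have h3 : (2 : ℝ) * ((m / 2 : ℕ) : ℝ) ≤ m := by exact_mod_cast h1
  have h4 : (m : ℝ) < 2 * ((m / 2 : ℕ) : ℝ) + 2 := by exact_mod_cast h2
  constructor <;> linarith

/-- Half-angle formulas. For the cosine the radicand is at least `1 / 2`, so the old error `2 / Q`
is halved and rounding adds `1 / Q`: the bound reproduces itself. The sine is computed from the
cosine alone, so its coarser error does not accumulate. -/
theorem Angle.succ {Q q j C S : ℕ} (h : Angle Q q j C S) (hq : 0 < q) (hQ : Q = q ^ 2) :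
    Angle Q q (j + 1) (Nat.sqrt (Q * (Q + C) / 2)) (Nat.sqrt (Q * (Q - C) / 2)) := by
  have hq' : (1 : ℝ) ≤ q := by exact_mod_cast hq
  have hQ0 : 0 < Q := by rw [hQ]; positivity
  have hQq : (Q : ℝ) = q ^ 2 := by rw [hQ]; push_cast; rfl
  have hQ' : (0 : ℝ) < Q := by exact_mod_cast hQ0
  have hC : (C : ℝ) ≤ Q := by exact_mod_cast h.cos_le
  have hC0 : (0 : ℝ) ≤ C := Nat.cast_nonneg _
  have hC1 : (C : ℝ) / Q ≤ 1 := by rw [div_le_one hQ']; exact hC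
  have hC2 : 0 ≤ (C : ℝ) / Q := by positivity
  set θ := Real.pi / 2 ^ (j + 1) with hθ
  have hθ' : Real.pi / 2 ^ (j + 1 + 1) = θ / 2 := by rw [hθ, pow_succ _ (j + 1)]; field_simp
  have hpi := Real.pi_pos
  have hθ0 : 0 ≤ θ := by positivity
  have hθ1 : θ ≤ Real.pi / 2 := by
    rw [hθ, pow_succ]
    exact div_le_div_of_nonneg_left hpi.le (by norm_num) (by nlinarith [one_le_pow₀ (M₀ := ℝ) one_le_two (n := j)])
  have hc0 : 0 ≤ Real.cos θ := Real.cos_nonneg_of_mem_Icc ⟨by linarith, hθ1⟩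
  have hc1 := Real.cos_le_one θ
  have hcos := h.cos
  have e1 : |(1 + (C : ℝ) / Q) / 2 - (1 + Real.cos θ) / 2| ≤ 1 / Q := by
    rw [show (1 + (C : ℝ) / Q) / 2 - (1 + Real.cos θ) / 2 = ((C : ℝ) / Q - Real.cos θ) / 2 by ring, abs_div,
      abs_two, div_le_iff₀ two_pos]
    exact hcos.trans_eq (by ring)
  have e2 : |(1 - (C : ℝ) / Q) / 2 - (1 - Real.cos θ) / 2| ≤ (1 / q) ^ 2 := by
    rw [show (1 - (C : ℝ) / Q) / 2 - (1 - Real.cos θ) / 2 = -(((C : ℝ) / Q - Real.cos θ) / 2) by ring, abs_neg,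
      abs_div, abs_two, div_le_iff₀ two_pos]
    exact hcos.trans_eq (by rw [hQq]; ring)
  have hsub : ((Q - C : ℕ) : ℝ) = Q - C := Nat.cast_sub h.cos_le
  refine ⟨?_, ?_, ?_, ?_⟩
  · have : Q * (Q + C) / 2 ≤ Q * Q := by
      have := h.cos_le
      exact Nat.div_le_of_le_mul (by nlinarith)
    exact (Nat.sqrt_le_sqrt this).trans (Nat.sqrt_eq Q).le
  · have : Q * (Q - C) / 2 ≤ Q * Q := (Nat.div_le_self _ _).trans (Nat.mul_le_mul_left _ (Nat.sub_le _ _))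
    exact (Nat.sqrt_le_sqrt this).trans (Nat.sqrt_eq Q).le
  · rw [hθ', Real.cos_half (by linarith) (by linarith)]
    obtain ⟨b1, b2⟩ := cast_div_two_bounds (Q * (Q + C))
    have ex : (Q : ℝ) ^ 2 * ((1 + (C : ℝ) / Q) / 2) = ((Q * (Q + C) : ℕ) : ℝ) / 2 := by
      push_cast; field_simp
    have := abs_sqrt_div_sub_le (x := (1 + (C : ℝ) / Q) / 2) hQ0 (by positivity) (by rw [ex]; exact b1)
      (by rw [ex]; exact b2)
    have h3 := abs_sqrt_sub_sqrt_le (by linarith) (by linarith) e1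
    calc _ ≤ _ := abs_sub_le _ (√((1 + (C : ℝ) / Q) / 2)) _
      _ ≤ 1 / Q + 1 / Q := add_le_add this h3
      _ = 2 / Q := by ring
  · rw [hθ', Real.sin_half_eq_sqrt (by linarith) (by linarith)]
    obtain ⟨b1, b2⟩ := cast_div_two_bounds (Q * (Q - C))
    have ex : (Q : ℝ) ^ 2 * ((1 - (C : ℝ) / Q) / 2) = ((Q * (Q - C) : ℕ) : ℝ) / 2 := by
      push_cast; rw [hsub]; field_simp
    have := abs_sqrt_div_sub_le (x := (1 - (C : ℝ) / Q) / 2) hQ0 (by linarith) (by rw [ex]; exact b1)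
      (by rw [ex]; exact b2)
    have h3 := abs_sqrt_sub_sqrt_le_of_sq (by linarith) (by linarith) (by positivity) e2
    have h4 : 1 / (Q : ℝ) ≤ 1 / q := by
      rw [hQq]; exact one_div_le_one_div_of_le (by linarith) (by nlinarith)
    calc _ ≤ _ := abs_sub_le _ (√((1 - (C : ℝ) / Q) / 2)) _
      _ ≤ 1 / q + 1 / q := add_le_add (this.trans h4) h3
      _ = 2 / q := by ring

theorem Angle.near {H Q q j C S : ℕ} (h : Angle Q q j C S) (hq : 0 < q) (hQ : Q = q ^ 2) :
    ‖dec H Q (H + C) (H + S) - exp ((Real.pi / 2 ^ (j + 1) : ℝ) * I)‖ ≤ 4 / q := by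
  have hq' : (1 : ℝ) ≤ q := by exact_mod_cast hq
  have hQq : (Q : ℝ) = q ^ 2 := by rw [hQ]; push_cast; rfl
  refine (Complex.norm_le_abs_re_add_abs_im _).trans ?_
  have h1 := h.cos
  have h2 := h.sin
  have h3 : 2 / (Q : ℝ) ≤ 2 / q := by
    rw [hQq]; exact div_le_div_of_nonneg_left (by norm_num) (by linarith) (by nlinarith)
  have e1 : (dec H Q (H + C) (H + S) - exp ((Real.pi / 2 ^ (j + 1) : ℝ) * I)).re =
      (C : ℝ) / Q - Real.cos (Real.pi / 2 ^ (j + 1)) := by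
    rw [sub_re, exp_ofReal_mul_I_re]; simp [dec]
  have e2 : (dec H Q (H + C) (H + S) - exp ((Real.pi / 2 ^ (j + 1) : ℝ) * I)).im =
      (S : ℝ) / Q - Real.sin (Real.pi / 2 ^ (j + 1)) := by
    rw [sub_im, exp_ofReal_mul_I_im]; simp [dec]
  rw [e1, e2]
  calc _ ≤ 2 / (q : ℝ) + 2 / q := add_le_add (h1.trans h3) h2
    _ = 4 / q := by ring

/-- One more block of the table. -/
theorem Angle.table {H Q q j C S k a b : ℕ} {e : ℝ} (h : Angle Q q j C S) (hq : 4 ≤ q) (hQ : Q = q ^ 2)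
    (hH : 8 * Q ≤ H) (he : e ≤ 1) (hk : k < 2 ^ j)
    (hT : ‖dec H Q a b - root k‖ ≤ e) :
    ‖dec H Q (mulRe H Q a b (H + C) (H + S)) (mulIm H Q a b (H + C) (H + S)) - root (2 ^ j + k)‖ ≤
      2 * e + 6 / q := by
  have hq' : (4 : ℝ) ≤ q := by exact_mod_cast hq
  have hQ0 : 0 < Q := by rw [hQ]; positivity
  have hQq : (Q : ℝ) = q ^ 2 := by rw [hQ]; push_cast; rfl
  have he0 : 0 ≤ e := (norm_nonneg _).trans hT
  have h4 : 4 / (q : ℝ) ≤ 1 := by rw [div_le_one (by linarith)]; exact hq'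
  have hHr : (8 * Q : ℝ) ≤ H := by exact_mod_cast hH
  have h2 : 2 / (Q : ℝ) ≤ 2 / q := by
    rw [hQq]; exact div_le_div_of_nonneg_left (by norm_num) (by linarith) (by nlinarith)
  rw [root_two_pow_add j k hk]
  have h0 : 0 ≤ 4 / (q : ℝ) := by positivity
  refine (norm_dec_mul_sub_mul_le (X := 1) (Y := 1) hQ0 hT (h.near (by omega) hQ) (norm_root k).le
    (norm_exp_ofReal_mul_I _).le ?_).trans ?_
  · refine le_trans ?_ hHr
    refine mul_le_mul_of_nonneg_right ?_ (Nat.cast_nonneg _)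
    nlinarith
  · have : (6 : ℝ) / q = 4 / q + 2 / q := by ring
    nlinarith

/-- Here `δ` is above the error `(2 ^ j - 1) * 6 / N ^ 32` of the table. The smallness condition
reads `168 N ^ 8 ≤ N ^ 32`, which holds for `N ≥ 2`. -/
theorem precise_of_pow {H Q N : ℕ} (hN : 2 ≤ N) (hQ : Q = (N ^ 32) ^ 2) (hH : H = Q * Q) :
    Precise H Q N (6 * N / (N ^ 32 : ℕ)) := by
  have hN' : (2 : ℝ) ≤ N := by exact_mod_cast hN
  have hQr : (Q : ℝ) = ((N : ℝ) ^ 32) ^ 2 := by rw [hQ]; push_cast; rfl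
  have h32 : (1 : ℝ) ≤ (N : ℝ) ^ 32 := one_le_pow₀ (by linarith)
  have h24 : (2 : ℝ) ^ 24 ≤ (N : ℝ) ^ 24 := pow_le_pow_left₀ (by norm_num) hN' _
  refine ⟨by rw [hQ]; positivity, hN, ?_, ?_, ?_⟩
  · rw [hQr]; push_cast
    rw [div_le_div_iff₀ (by positivity) (by positivity)]
    have : 2 * (N : ℝ) ^ 32 * 1 ≤ (6 * N) * (N : ℝ) ^ 32 * (N : ℝ) ^ 32 := by
      gcongr; linarith
    nlinarith
  · push_cast
    rw [← mul_div_assoc, div_le_one (by positivity)]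
    have : (N : ℝ) ^ 32 = (N : ℝ) ^ 24 * N ^ 8 := by ring
    rw [this]
    have h8 : (0 : ℝ) ≤ (N : ℝ) ^ 8 := by positivity
    nlinarith
  · rw [hH]; push_cast
    refine mul_le_mul_of_nonneg_right ?_ (Nat.cast_nonneg _)
    rw [hQr, ← pow_mul]
    have h62 : (2 : ℝ) ^ 62 ≤ (N : ℝ) ^ 62 := pow_le_pow_left₀ (by norm_num) hN' _
    have : (N : ℝ) ^ (32 * 2) = (N : ℝ) ^ 62 * N ^ 2 := by ring
    rw [this]
    nlinarith [sq_nonneg (N : ℝ)]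

end FFT

/-! ### Computing the table of roots on the machine -/

namespace VM

open VM.Expr FFT

def sqrtBody : Prog :=
  .ite (lt (reg 104) ((reg 105 + reg 106) * (reg 105 + reg 106))) .skip (105 ≔ reg 105 + reg 106) ;;
  106 ≔ reg 106 / 2

/-- Integer square root of `reg 104`, which is at most the square of `reg 5`, a power of two. -/
def sqrtProg : Prog := 105 ≔ 0 ;; 106 ≔ reg 5 ;; .while (reg 106) sqrtBody

theorem sqrtProg_tri {W M n m X : ℕ} {v : State} (h5 : v.reg 5 = 2 ^ m) (h104 : v.reg 104 = X)
    (hX : X ≤ 2 ^ m * 2 ^ m) (hW : 4 * (2 ^ m * 2 ^ m) < W) :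
    Tri W M n sqrtProg v ((sqrtBody.time + 10) * (m + 2)) fun v' =>
      Frame {105, 106} ∅ v v' ∧ v'.reg 105 = Nat.sqrt X := by
  have hQ : 1 ≤ 2 ^ m := Nat.one_le_two_pow
  have main : Tri W M n sqrtProg v (2 + (2 + (∑ i ∈ Finset.range (m + 1), (sqrtBody.time + ((reg 106).cost + 1)) +
      ((reg 106).cost + 1)))) fun v' => Frame {105, 106} ∅ v v' ∧ v'.reg 105 = Nat.sqrt X := by
    refine Tri.seq (R := fun w => w = v.set 105 0) (Tri.asg (by norm_num) (by simp) rfl) ?_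
    rintro _ rfl
    refine Tri.seq (R := fun w => w = (v.set 105 0).set 106 (2 ^ m)) (Tri.asg (by norm_num) (by simp)
      (by simp [h5])) ?_
    rintro _ rfl
    -- Binary search: the root lies in the interval of length `2 ^ i` that starts at register 105.
    -- Register 106 holds the next bit `2 ^ i / 2`, which is 0 exactly at `i = 0` and so ends the
    -- loop.
    refine Tri.while_le (fun i w => Frame {105, 106} ∅ v w ∧ w.reg 106 = 2 ^ i / 2 ∧ w.reg 105 ≤ 2 ^ m ∧
      w.reg 105 * w.reg 105 ≤ X ∧ X < (w.reg 105 + 2 ^ i) * (w.reg 105 + 2 ^ i)) _ _ ?_ (by simp) ?_ ?_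
    · refine ⟨by simp [Frame.set_iff, Frame.refl], by simp [pow_succ], by simp, by simp, ?_⟩
      simp [pow_succ]
      nlinarith
    · rintro i hi w ⟨hf, h106, hr, h1, h2⟩ hne
      simp [h106] at hne
      obtain ⟨i, rfl⟩ : ∃ l, i = l + 1 := ⟨i - 1, by rcases i with _ | i <;> simp_all⟩
      have e : 2 ^ (i + 1) / 2 = 2 ^ i := by rw [pow_succ]; simp
      rw [e] at h106
      have hi2 : 2 ^ i ≤ 2 ^ m := Nat.pow_le_pow_right (by norm_num) (by omega)
      have e4 : 2 ^ i * 2 ^ i ≤ 2 ^ m * 2 ^ m := Nat.mul_le_mul hi2 hi2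
      have e5 : w.reg 105 * 2 ^ i ≤ 2 ^ m * 2 ^ m := Nat.mul_le_mul hr hi2
      have e6 : w.reg 105 * w.reg 105 ≤ 2 ^ m * 2 ^ m := Nat.mul_le_mul hr hr
      have e7 : (w.reg 105 + 2 ^ i) * (w.reg 105 + 2 ^ i) =
        w.reg 105 * w.reg 105 + 2 * (w.reg 105 * 2 ^ i) + 2 ^ i * 2 ^ i := by ring
      have e8 : w.reg 105 + 2 ^ i < W := by nlinarith
      have r104 : w.reg 104 = X := by rw [hf.reg 104 (by simp), h104]
      refine ⟨by omega, Tri.of_wp ?_⟩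
      simp [sqrtBody, Prog.wp, h106, r104, Frame.set_iff, hf, e8]
      refine ⟨by omega, fun h => ⟨hr, h1, h⟩, fun h => ⟨?_, h, ?_⟩⟩
      · exact Nat.mul_self_le_mul_self_iff.1 (h.trans hX)
      · rw [pow_succ, mul_two, ← add_assoc] at h2; exact h2
    · rintro i hi w ⟨hf, h106, hr, h1, h2⟩ he
      simp [h106] at he
      have : i = 0 := by
        by_contra h0
        obtain ⟨i, rfl⟩ := Nat.exists_eq_succ_of_ne_zero h0
        have : 1 ≤ 2 ^ i := Nat.one_le_two_pow
        rw [pow_succ] at he; omega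
      subst this
      exact ⟨hf, Nat.eq_sqrt.2 ⟨h1, by simpa using h2⟩⟩
  refine main.mono ?_ fun _ h => h
  have key : ∀ t c : ℕ, c = 1 → 2 + (2 + (∑ i ∈ Finset.range (m + 1), (t + (c + 1)) + (c + 1))) ≤
      (t + 10) * (m + 2) := by
    rintro t c rfl
    rw [Finset.sum_const, Finset.card_range, smul_eq_mul]
    nlinarith
  exact key _ _ rfl

/-- The sine is computed first, since it needs the old cosine in register 100. -/
def angleProg : Prog :=
  104 ≔ reg 5 * (reg 5 - reg 100) / 2 ;; sqrtProg ;; 107 ≔ reg 105 ;;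
  104 ≔ reg 5 * (reg 5 + reg 100) / 2 ;; sqrtProg ;; 100 ≔ reg 105 ;; 101 ≔ reg 107

theorem angleProg_tri {W M n m C : ℕ} {v : State} (h5 : v.reg 5 = 2 ^ m) (h100 : v.reg 100 = C) (hC : C ≤ 2 ^ m)
    (hW : 4 * (2 ^ m * 2 ^ m) < W) :
    Tri W M n angleProg v ((2 * sqrtBody.time + 50) * (m + 2)) fun v' =>
      Frame {100, 101, 104, 105, 106, 107} ∅ v v' ∧ v'.reg 100 = Nat.sqrt (2 ^ m * (2 ^ m + C) / 2) ∧
        v'.reg 101 = Nat.sqrt (2 ^ m * (2 ^ m - C) / 2) := by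
  have hQ : 1 ≤ 2 ^ m := Nat.one_le_two_pow
  generalize hQm : 2 ^ m = Q at *
  have e1 : Q * (Q - C) ≤ Q * Q := Nat.mul_le_mul_left _ (Nat.sub_le _ _)
  have e2 : Q * (Q + C) ≤ 2 * (Q * Q) := by nlinarith
  have e3 : Q ≤ Q * Q := Nat.le_mul_of_pos_right _ hQ
  have main : Tri W M n angleProg v (8 + ((sqrtBody.time + 10) * (m + 2) + (2 + (8 +
      ((sqrtBody.time + 10) * (m + 2) + (2 + 2)))))) fun v' =>
      Frame {100, 101, 104, 105, 106, 107} ∅ v v' ∧ v'.reg 100 = Nat.sqrt (Q * (Q + C) / 2) ∧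
        v'.reg 101 = Nat.sqrt (Q * (Q - C) / 2) := by
    refine Tri.seq (R := fun w => w = v.set 104 (Q * (Q - C) / 2))
      (Tri.asg (by norm_num) ?_ ?_) ?_
    · simp [h5, h100]; omega
    · simp [h5, h100]
    rintro _ rfl
    refine Tri.seq (sqrtProg_tri (m := m) (X := Q * (Q - C) / 2) (by simpa [hQm] using h5) (by simp)
      ((Nat.div_le_self _ _).trans (by rw [hQm]; exact e1)) (by rw [hQm]; exact hW)) ?_
    rintro v1 ⟨f1, h105⟩
    refine Tri.seq (R := fun w => w = v1.set 107 (Nat.sqrt (Q * (Q - C) / 2))) (Tri.asg (by norm_num) (by simp)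
      (by simp [h105])) ?_
    rintro _ rfl
    have r5 : v1.reg 5 = Q := by rw [f1.reg 5 (by simp)]; simpa using h5
    have r100 : v1.reg 100 = C := by rw [f1.reg 100 (by simp)]; simpa using h100
    refine Tri.seq (R := fun w => w = (v1.set 107 (Nat.sqrt (Q * (Q - C) / 2))).set 104 (Q * (Q + C) / 2))
      (Tri.asg (by norm_num) ?_ ?_) ?_
    · simp [r5, r100]; omega
    · simp [r5, r100]
    rintro _ rfl
    refine Tri.seq (sqrtProg_tri (m := m) (X := Q * (Q + C) / 2) (by simpa [hQm] using r5) (by simp)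
      (by rw [hQm]; omega) (by rw [hQm]; exact hW)) ?_
    rintro v2 ⟨f2, h105'⟩
    refine Tri.seq (R := fun w => w = v2.set 100 (Nat.sqrt (Q * (Q + C) / 2))) (Tri.asg (by norm_num) (by simp)
      (by simp [h105'])) ?_
    rintro _ rfl
    have r107 : v2.reg 107 = Nat.sqrt (Q * (Q - C) / 2) := by rw [f2.reg 107 (by simp)]; simp
    refine Tri.asg (by norm_num) (by simp) ⟨?_, by simp, by simp [r107]⟩
    have f1' : Frame {100, 101, 104, 105, 106, 107} ∅ v v1 :=
      ((Frame.set_iff (by simp)).2 (Frame.refl _ _ _)).trans (f1.mono (by decide) (by simp))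
    have f2' : Frame {100, 101, 104, 105, 106, 107} ∅ v v2 :=
      ((Frame.set_iff (by simp)).2 ((Frame.set_iff (by simp)).2 f1')).trans (f2.mono (by decide) (by simp))
    rw [Frame.set_iff (by simp), Frame.set_iff (by simp)]
    exact f2'
  refine main.mono ?_ fun _ h => h
  have key : ∀ t : ℕ, 8 + ((t + 10) * (m + 2) + (2 + (8 + ((t + 10) * (m + 2) + (2 + 2))))) ≤
      (2 * t + 50) * (m + 2) := by intro t; nlinarith
  exact key _

def tableBody : Prog :=
  26 ≔ load 2 (reg 103) ;; 27 ≔ load 3 (reg 103) ;; 28 ≔ reg 4 + reg 100 ;; 29 ≔ reg 4 + reg 101 ;;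
  .put 2 (reg 102 + reg 103) mulReE ;; .put 3 (reg 102 + reg 103) mulImE

theorem table_loop {W M n h H Q C S : ℕ} {v : State} (hh : 2 * h ≤ 4 * n + 4) (h4 : v.reg 4 = H)
    (h5 : v.reg 5 = Q) (h100 : v.reg 100 = C) (h101 : v.reg 101 = S) (h102 : v.reg 102 = h)
    (hC : C ≤ Q) (hS : S ≤ Q) (hW : FitsFFT W n H Q)
    (hA : ∀ p < h, v.arr 2 p ≤ 2 * H ∧ v.arr 3 p ≤ 2 * H) :
    Tri W M n (.for 103 (reg 102) tableBody) v ((tableBody.time + 13) * (h + 1)) fun v' =>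
      Frame {26, 27, 28, 29, 103} {2, 3} v v' ∧ (∀ p < h, v'.arr 2 p = v.arr 2 p ∧ v'.arr 3 p = v.arr 3 p) ∧
        ∀ k < h, v'.arr 2 (h + k) = mulRe H Q (v.arr 2 k) (v.arr 3 k) (H + C) (H + S) ∧
          v'.arr 3 (h + k) = mulIm H Q (v.arr 2 k) (v.arr 3 k) (H + C) (H + S) := by
  have hWs := hW.sq
  have hWl := hW.len
  have hWQ := hW.le
  refine array_loop (N := h) (T := tableBody.time) (R := {26, 27, 28, 29, 103}) (A := {2, 3}) (by simp)
    (by norm_num) (by omega) (fun i v' => (∀ p < h, v'.arr 2 p = v.arr 2 p ∧ v'.arr 3 p = v.arr 3 p) ∧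
        ∀ k < i, v'.arr 2 (h + k) = mulRe H Q (v.arr 2 k) (v.arr 3 k) (H + C) (H + S) ∧
          v'.arr 3 (h + k) = mulIm H Q (v.arr 2 k) (v.arr 3 k) (H + C) (H + S)) ?_ (by simp) ?_
  · intro v' hf
    simp [hf.reg, h102]
  · rintro i hi v' hf h103 ⟨h1, h2⟩
    have r4 : v'.reg 4 = H := by rw [hf.reg 4 (by simp), h4]
    have r5 : v'.reg 5 = Q := by rw [hf.reg 5 (by simp), h5]
    have r100 : v'.reg 100 = C := by rw [hf.reg 100 (by simp), h100]
    have r101 : v'.reg 101 = S := by rw [hf.reg 101 (by simp), h101]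
    have r102 : v'.reg 102 = h := by rw [hf.reg 102 (by simp), h102]
    obtain ⟨g1, g2⟩ := h1 i hi
    obtain ⟨b1, b2⟩ := hA i hi
    have b3 : H + C ≤ 2 * H := by omega
    have b4 : H + S ≤ 2 * H := by omega
    apply Tri.of_wp
    simp [tableBody, Prog.wp, h103, r4, r5, r100, r101, r102, g1, g2, b1, b2, b3, b4, lim, mulReE_ok, mulImE_ok,
      hWQ, hWs, hf, Frame.set_iff, Frame.put_iff]
    and_intros
    any_goals omega
    · intro p hp
      simpa [show p ≠ h + i by omega] using h1 p hp
    · intro k hk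
      rcases hk.lt_or_eq with h3 | rfl
      · simpa [h3.ne] using h2 k h3
      · simp

end VM

namespace VM

open VM.Expr FFT

/-- Repeated squaring gives the scale `N ^ 64` and the offset `N ^ 128`. The table starts with `root
0 = 1`, and cosine and sine with the angle `π / 2`. -/
def scaleProg : Prog :=
  5 ≔ reg 9 * reg 9 ;; 5 ≔ reg 5 * reg 5 ;; 5 ≔ reg 5 * reg 5 ;; 5 ≔ reg 5 * reg 5 ;;
  5 ≔ reg 5 * reg 5 ;; 5 ≔ reg 5 * reg 5 ;; 4 ≔ reg 5 * reg 5 ;;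
  .put 2 0 (reg 4 + reg 5) ;; .put 3 0 (reg 4) ;; 100 ≔ 0 ;; 101 ≔ reg 5 ;; 102 ≔ 1

def rootBody : Prog := .for 103 (reg 102) tableBody ;; angleProg ;; 102 ≔ reg 102 + reg 102

/-- Prepares the machine for convolutions. -/
def preProg : Prog :=
  8 ≔ reg 0 ;; sizeProg ;; scaleProg ;; .while (lt (reg 102) (reg 9)) rootBody

def preRegs : Finset ℕ := {4, 5, 8, 9, 10, 26, 27, 28, 29, 61} ∪ Finset.Icc 100 107

theorem mem_preRegs {r : ℕ} : r ∈ preRegs ↔ r ∈ ({4, 5, 8, 9, 10, 26, 27, 28, 29, 61} : Finset ℕ) ∨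
    100 ≤ r ∧ r ≤ 107 := by simp [preRegs, or_assoc]

/-- Invariant of the construction of the table; `N` is its size. -/
structure TableInv (N : ℕ) (v₀ : State) (j : ℕ) (w : State) : Prop where
  frame : Frame preRegs {2, 3} v₀ w
  size : w.reg 9 = N
  scale : w.reg 5 = (N ^ 32) ^ 2
  offset : w.reg 4 = (N ^ 32) ^ 2 * (N ^ 32) ^ 2
  block : w.reg 102 = 2 ^ j
  angle : Angle ((N ^ 32) ^ 2) (N ^ 32) j (w.reg 100) (w.reg 101)
  near : ∀ k < 2 ^ j, ‖dec ((N ^ 32) ^ 2 * (N ^ 32) ^ 2) ((N ^ 32) ^ 2) (w.arr 2 k) (w.arr 3 k) - root k‖ ≤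
    (2 ^ j - 1) * (6 / (N ^ 32 : ℕ))

theorem scaleProg_tri {W M n N : ℕ} {v₀ v : State} (h9 : v.reg 9 = N) (hN : 2 ≤ N)
    (hW : 2 * N ^ 128 < W) (hf : Frame preRegs {2, 3} v₀ v) :
    Tri W M n scaleProg v scaleProg.time (TableInv N v₀ 0) := by
  have hp : ∀ k ≤ 128, N ^ k < W := fun k hk => by
    have := Nat.pow_le_pow_right (show 0 < N by omega) hk
    omega
  have hp' : N ^ 128 + N ^ 64 < W := by
    have := Nat.pow_le_pow_right (show 0 < N by omega) (show 64 ≤ 128 by norm_num)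
    omega
  apply Tri.of_wp
  simp [scaleProg, Prog.wp, h9, ← pow_two, ← pow_mul, hp, hp', lim]
  refine ⟨?_, ?_, ?_, ?_, ?_, ?_, ?_⟩
  · simp [Frame.set_iff, Frame.put_iff, mem_preRegs, hf]
  · simp [h9]
  · simp; ring
  · simp; ring
  · simp
  · simp only [State.set_reg, State.put_reg]
    norm_num
    convert angle_zero (Q := (N ^ 32) ^ 2) (q := N ^ 32) (by positivity) using 1
    ring
  · intro k hk
    have hk0 : k = 0 := by simpa using hk
    subst hk0
    have h0 : ((N : ℝ) ^ 32) ≠ 0 := by positivity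
    simp [root_zero]
    have : dec ((N ^ 32) ^ 2 * (N ^ 32) ^ 2) ((N ^ 32) ^ 2) (N ^ 128 + N ^ 64) (N ^ 128) = 1 := by
      apply Complex.ext <;> simp [dec]
      · field_simp; ring
      · left; ring
    rw [this]; simp

theorem rootBody_tri {W M n N L j : ℕ} {v₀ v : State} (hNL : N = 2 ^ L) (hj : j < L) (hN4 : N ≤ 4 * n + 4)
    (hW : 32 * N ^ 256 < W) (hWn : 66 * n + 64 ≤ W) (hI : TableInv N v₀ j v) :
    Tri W M n rootBody v ((tableBody.time + 13) * (2 ^ j + 1) + ((2 * sqrtBody.time + 50) * (64 * L + 2) + 4))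
      (TableInv N v₀ (j + 1)) := by
  have hN : 2 ≤ N := by rw [hNL]; exact (pow_one 2).ge.trans (Nat.pow_le_pow_right (by norm_num) (by omega))
  have hP := precise_of_pow (H := (N ^ 32) ^ 2 * (N ^ 32) ^ 2) hN rfl rfl
  have hQm : (N ^ 32) ^ 2 = 2 ^ (64 * L) := by rw [hNL, ← pow_mul, ← pow_mul]; congr 1; ring
  have hjN : 2 * 2 ^ j ≤ N := by
    rw [hNL, ← pow_succ']; exact Nat.pow_le_pow_right (by norm_num) hj
  have hpw : N ^ 128 ≤ N ^ 256 := Nat.pow_le_pow_right (by omega) (by norm_num)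
  have hQ8 : 8 * (N ^ 32) ^ 2 ≤ (N ^ 32) ^ 2 * (N ^ 32) ^ 2 := by
    refine Nat.mul_le_mul_right _ ?_
    rw [← pow_mul]
    calc 8 = 2 ^ 3 := rfl
      _ ≤ N ^ 3 := Nat.pow_le_pow_left hN _
      _ ≤ _ := Nat.pow_le_pow_right (by omega) (by norm_num)
  have hfit : FitsFFT W n ((N ^ 32) ^ 2 * (N ^ 32) ^ 2) ((N ^ 32) ^ 2) := by
    refine ⟨by omega, ?_, hWn⟩
    rw [show (N ^ 32) ^ 2 * (N ^ 32) ^ 2 * ((N ^ 32) ^ 2 * (N ^ 32) ^ 2) = N ^ 256 by ring,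
      show (N ^ 32) ^ 2 * (N ^ 32) ^ 2 = N ^ 128 by ring]
    omega
  have hδ : ∀ {i : ℕ}, 2 ^ i ≤ N → ((2 : ℝ) ^ i - 1) * (6 / (N ^ 32 : ℕ)) ≤ 6 * N / (N ^ 32 : ℕ) := by
    intro i hi
    have : (2 : ℝ) ^ i ≤ N := by exact_mod_cast hi
    rw [mul_div_assoc', mul_comm _ (6 : ℝ)]
    gcongr; linarith
  have h1 := hP.delta_le_one
  set q := N ^ 32 with hq
  set Q := q ^ 2 with hQ
  have hq4 : 4 ≤ q := by
    calc 4 = 2 ^ 2 := rfl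
      _ ≤ N ^ 2 := Nat.pow_le_pow_left hN _
      _ ≤ _ := Nat.pow_le_pow_right (by omega) (by norm_num)
  have hb : ∀ p < 2 ^ j, v.arr 2 p ≤ 2 * (Q * Q) ∧ v.arr 3 p ≤ 2 * (Q * Q) := by
    intro p hp
    have hr := hP.two_le'
    have := hP.near (hI.near p hp) (norm_root p).le (by
      have := (hδ (i := j) (by omega)).trans h1
      nlinarith)
    omega
  refine Tri.seq (table_loop (by omega) hI.offset hI.scale rfl rfl hI.block hI.angle.cos_le hI.angle.sin_le
    hfit hb) ?_
  rintro v1 ⟨f1, hlow, hhigh⟩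
  have r : ∀ r, r = 5 ∨ r = 4 ∨ r = 9 ∨ r = 100 ∨ r = 101 ∨ r = 102 → v1.reg r = v.reg r := by
    intro r hr
    exact f1.reg r (by simp; omega)
  refine Tri.seq (angleProg_tri (m := 64 * L) (C := v.reg 100) (by rw [r 5 (by simp), hI.scale]; exact hQm)
    (by rw [r 100 (by simp)]) (by rw [← hQm]; exact hI.angle.cos_le) (by rw [← hQm]; have := hfit.sq; nlinarith)) ?_
  rintro v2 ⟨f2, hc, hs⟩
  rw [← hQm] at hc hs
  have r' : ∀ r, r = 5 ∨ r = 4 ∨ r = 9 ∨ r = 102 → v2.reg r = v.reg r := by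
    intro x hx
    rw [f2.reg x (by simp; omega), r x (by omega)]
  have a2 : v2.arr 2 = v1.arr 2 := f2.arr 2 (by simp)
  have a3 : v2.arr 3 = v1.arr 3 := f2.arr 3 (by simp)
  refine Tri.asg (by norm_num) ?_ ⟨?_, ?_, ?_, ?_, ?_, ?_, ?_⟩
  · simp [r' 102, hI.block]; omega
  · rw [Frame.set_iff (by simp [mem_preRegs])]
    exact (hI.frame.trans (f1.mono (by decide) (by simp))).trans (f2.mono (by decide) (by simp))
  · simp [r' 9, hI.size]
  · simp [r' 5, hI.scale]
  · simp [r' 4, hI.offset]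
  · simp [r' 102, hI.block, pow_succ, mul_two]
  · simp only [State.set_reg]
    norm_num
    rw [hc, hs]
    exact hI.angle.succ (by omega) rfl
  · intro k hk
    rw [State.set_arr, a2, a3]
    have e0 : (2 : ℝ) ^ j * (6 / (q : ℕ)) ≥ 0 := by positivity
    rcases lt_or_ge k (2 ^ j) with h | h
    · rw [(hlow k h).1, (hlow k h).2]
      refine (hI.near k h).trans ?_
      rw [pow_succ (2 : ℝ) j]
      have : (0 : ℝ) ≤ 6 / (q : ℕ) := by positivity
      have : (1 : ℝ) ≤ 2 ^ j := one_le_pow₀ (by norm_num)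
      exact mul_le_mul_of_nonneg_right (by linarith) ‹_›
    · obtain ⟨k, rfl⟩ := Nat.exists_eq_add_of_le h
      have hk' : k < 2 ^ j := by rw [pow_succ] at hk; omega
      rw [(hhigh k hk').1, (hhigh k hk').2]
      -- The error recursion is `e ↦ 2 e + 6 / q`, and `2 (2 ^ j - 1) + 1 = 2 ^ (j + 1) - 1`.
      refine (hI.angle.table hq4 rfl hQ8 ((hδ (i := j) (by omega)).trans h1) hk' (hI.near k hk')).trans_eq ?_
      rw [pow_succ (2 : ℝ) j]; ring

theorem sum_two_pow_lt (k : ℕ) : ∑ i ∈ Finset.range k, 2 ^ i < 2 ^ k := by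
  induction k with
  | zero => simp
  | succ k ih => rw [Finset.sum_range_succ, pow_succ]; omega

/-- Each of the `L` levels takes square roots by `O(L)` halvings; the total `L ^ 2` thus stays
linear in `N = 2 ^ L`. -/
theorem sq_le_two_pow (k : ℕ) : k * k ≤ 2 * 2 ^ k := by
  induction k with
  | zero => simp
  | succ k ih =>
    rcases lt_or_ge k 3 with h | h
    · interval_cases k <;> norm_num
    · rw [pow_succ]; nlinarith

def preTime : ℕ := sizeBody.time + scaleProg.time + 2 * tableBody.time + 1000 * sqrtBody.time + 100000

theorem preTime_le (t t₁ t₂ t₃ t₄ L N n c : ℕ) (hN : N = 2 ^ L) (hL : 1 ≤ L) (hn : N ≤ 4 * n + 2) (hc : c = 3)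
    (ht : t = t₁ + t₂ + 2 * t₃ + 1000 * t₄ + 100000) :
    2 + ((t₁ + 20) * (L + 1) + (t₂ + (∑ i ∈ Finset.range L, ((t₃ + 13) * (2 ^ i + 1) +
      ((2 * t₄ + 50) * (64 * L + 2) + 4) + (c + 1)) + (c + 1)))) ≤ 4 * t * (n + 1) := by
  subst hc
  have h1 : L < N := by rw [hN]; exact Nat.lt_two_pow_self
  have h2 : L * L ≤ 2 * N := by rw [hN]; exact sq_le_two_pow L
  have h3 : ∑ i ∈ Finset.range L, 2 ^ i ≤ N := by rw [hN]; exact (sum_two_pow_lt L).le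
  rw [Finset.sum_add_distrib, Finset.sum_add_distrib, ← Finset.mul_sum, Finset.sum_add_distrib]
  simp only [Finset.sum_const, Finset.card_range, smul_eq_mul, mul_one]
  have a0 := Nat.mul_le_mul_left (t₁ + 20) (show L + 1 ≤ N by omega)
  have a1 := Nat.mul_le_mul_left (t₃ + 13) (show ∑ i ∈ Finset.range L, 2 ^ i + L ≤ 2 * N by omega)
  have a2 : L * ((2 * t₄ + 50) * (64 * L + 2) + 4) = (2 * t₄ + 50) * (64 * (L * L) + 2 * L) + 4 * L := by ring
  have a3 := Nat.mul_le_mul_left (2 * t₄ + 50) (show 64 * (L * L) + 2 * L ≤ 130 * N by omega)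
  have a4 := Nat.mul_le_mul_left t₂ (show 1 ≤ N by omega)
  have a5 : (t₁ + 20) * N + t₂ * N + (t₃ + 13) * (2 * N) + (2 * t₄ + 50) * (130 * N) + 20 * N =
      (t₁ + t₂ + 2 * t₃ + 260 * t₄ + 6566) * N := by ring
  have a6 : t * N ≤ t * (4 * n + 4) := Nat.mul_le_mul_left _ (by omega)
  have a7 : t * (4 * n + 4) = 4 * t * (n + 1) := by ring
  have a8 := Nat.mul_le_mul_right N (show t₁ + t₂ + 2 * t₃ + 260 * t₄ + 6566 ≤ t by omega)
  omega

set_option exponentiation.threshold 600 in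
theorem preProg_tri {W M n : ℕ} {v : State} (hW : (n + 2) ^ 520 ≤ W) :
    Tri W M n preProg v (4 * preTime * (n + 1)) fun v' => Frame preRegs {2, 3} v v' ∧ Ready W n v' := by
  refine Tri.of_bounds fun hF h0 _ _ => ?_
  have hN4 := pow_lev_le n
  have hN2 := two_le_pow_lev n
  -- The square of the offset is `N ^ 256`, and `N ≤ 4 n + 2 ≤ (n + 2) ^ 2`. Together with the
  -- factor `2 ^ 5` this gives the exponent 517, whence words of capacity `(n + 2) ^ 520`.
  have hpow : 32 * (2 ^ lev n) ^ 256 < W := by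
    refine lt_of_lt_of_le ?_ hW
    calc 32 * (2 ^ lev n) ^ 256 ≤ 2 ^ 5 * ((n + 2) ^ 2) ^ 256 := by
          refine Nat.mul_le_mul_left _ (Nat.pow_le_pow_left ?_ _)
          nlinarith
      _ ≤ (n + 2) ^ 5 * ((n + 2) ^ 2) ^ 256 := Nat.mul_le_mul_right _ (Nat.pow_le_pow_left (by omega) _)
      _ = (n + 2) ^ 517 := by rw [← pow_mul, ← pow_add]
      _ < _ := Nat.pow_lt_pow_right (by omega) (by norm_num)
  have hsq : 512 * ((n + 1) * (n + 1)) < W := by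
    refine lt_of_lt_of_le ?_ hW
    calc 512 * ((n + 1) * (n + 1)) ≤ 2 ^ 9 * ((n + 2) * (n + 2)) := by
          exact Nat.mul_le_mul_left _ (Nat.mul_le_mul (by omega) (by omega))
      _ ≤ (n + 2) ^ 9 * ((n + 2) * (n + 2)) := Nat.mul_le_mul_right _ (Nat.pow_le_pow_left (by omega) _)
      _ = (n + 2) ^ 11 := by ring
      _ < _ := Nat.pow_lt_pow_right (by omega) (by norm_num)
  refine Tri.mono (Q := fun v' => Frame preRegs {2, 3} v v' ∧ Ready W n v') ?_
    (preTime_le preTime sizeBody.time scaleProg.time tableBody.time sqrtBody.time (lev n) _ n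
    (lt (reg 102) (reg 9)).cost rfl (one_le_lev n) hN4 rfl rfl) fun _ h => h
  refine Tri.seq (R := fun w => w = v.set 8 n) (Tri.asg (by norm_num) (by simp) (by simp [h0])) ?_
  rintro _ rfl
  refine Tri.seq (sizeProg_tri le_rfl hsq (by simp)) ?_
  rintro v1 ⟨f1, h9, -⟩
  have F1 : Frame preRegs {2, 3} v v1 :=
    ((Frame.set_iff (by simp [mem_preRegs])).2 (Frame.refl _ _ _)).trans (f1.mono (by decide) (by simp))
  have h128 : (2 ^ lev n) ^ 128 ≤ (2 ^ lev n) ^ 256 := Nat.pow_le_pow_right (by omega) (by norm_num)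
  refine Tri.seq (scaleProg_tri h9 hN2 (by omega) F1) ?_
  intro v2 hI
  refine Tri.while_eq (TableInv (2 ^ lev n) v) _ (lev n) hI ?_ ?_
  · intro j hj w hw
    refine ⟨by simp, ?_, rootBody_tri rfl hj (by omega) hpow hF.word hw⟩
    have : 2 ^ j < 2 ^ lev n := Nat.pow_lt_pow_right (by norm_num) hj
    simp [hw.block, hw.size, this]
  · intro w hw
    refine ⟨by simp, by simp [hw.block, hw.size], hw.frame, lev n, _, two_mul_le_pow_lev n, by omega,
      by rw [hw.offset, hw.scale]; exact precise_of_pow hN2 rfl rfl, ?_, ?_⟩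
    · rw [hw.offset, hw.scale]
      refine ⟨Nat.le_mul_of_pos_right _ (by positivity), ?_, hF.word⟩
      rw [show ((2 ^ lev n) ^ 32) ^ 2 * ((2 ^ lev n) ^ 32) ^ 2 * (((2 ^ lev n) ^ 32) ^ 2 * ((2 ^ lev n) ^ 32) ^ 2) =
        (2 ^ lev n) ^ 256 by ring, show ((2 ^ lev n) ^ 32) ^ 2 * ((2 ^ lev n) ^ 32) ^ 2 = (2 ^ lev n) ^ 128 by ring]
      omega
    · rw [hw.offset, hw.scale]
      intro k hk
      refine (hw.near k hk).trans ?_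
      rw [mul_div_assoc', mul_comm _ (6 : ℝ)]
      push_cast
      gcongr; linarith

end VM

/-! ### Strings, mismatching pairs and palindromes -/

namespace Pal

open Merge

/-- The code of the character at position `i`. -/
def code (S : WString) (i : ℕ) : ℕ := RAM.encode (S.getD i none)

/-- The letters with the codes `x` and `y` mismatch. -/
def Bad (x y : ℕ) : Prop := x ≠ 0 ∧ y ≠ 0 ∧ x ≠ y

instance (x y : ℕ) : Decidable (Bad x y) := inferInstanceAs (Decidable (_ ∧ _))

theorem Bad.comm {x y : ℕ} : Bad x y ↔ Bad y x := by unfold Bad; tauto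

theorem not_bad_self (x : ℕ) : ¬ Bad x x := fun h => h.2.2 rfl

theorem mismatch_iff (a b : Option ℕ) : mismatch a b = true ↔ Bad (RAM.encode a) (RAM.encode b) := by
  cases a <;> cases b <;> simp [mismatch, Bad, RAM.encode]

/-- Beyond the end of a string `code` is 0, the wildcard, which never mismatches; hence no
assumption on the lengths. -/
theorem hamming_eq_sum (X Y : WString) :
    hamming X Y = ∑ t ∈ Finset.range X.length, if Bad (code X t) (code Y t) then 1 else 0 := by
  induction X generalizing Y with
  | nil => simp [hamming]
  | cons x X ih =>
    cases Y with
    | nil => simp [hamming, Bad, code, RAM.encode]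
    | cons y Y =>
      rw [List.length_cons, Finset.sum_range_succ']
      have h1 : hamming (x :: X) (y :: Y) = hamming X Y + if mismatch x y then 1 else 0 := by
        simp [hamming, List.countP_cons]
      rw [h1, ih]
      congr 1
      · simp [code, mismatch_iff]

theorem code_reverse (X : WString) {t : ℕ} (ht : t < X.length) : code X.reverse t = code X (X.length - 1 - t) := by
  simp only [code, List.getD_eq_getElem?_getD, List.getElem?_reverse ht]

theorem code_drop (X : WString) (a t : ℕ) : code (X.drop a) t = code X (a + t) := by
  simp only [code, List.getD_eq_getElem?_getD, List.getElem?_drop]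

theorem code_take (X : WString) {m t : ℕ} (ht : t < m) : code (X.take m) t = code X t := by
  simp only [code, List.getD_eq_getElem?_getD, List.getElem?_take, if_pos ht]

theorem mism_eq_sum (c : ℕ → ℕ) (len s : ℕ) :
    mism c len s = ∑ i ∈ Finset.range (s + 1), if i < len ∧ s - i < len ∧ Bad (c i) (c (s - i)) then 1 else 0 := by
  rw [mism, Finset.Nat.sum_antidiagonal_eq_sum_range_succ_mk]
  rfl

/-- Reversal turns the position of `S.reverse` that is aligned with `t` into `i - 1 - t`, in 0-based
positions. The three cases are a prefix, the whole string and a suffix of `S`. -/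
theorem cconv_reverse (S : WString) {i : ℕ} (h1 : 1 ≤ i) (h2 : i ≤ 2 * S.length - 1) :
    cconv S S.reverse i = mism (code S) S.length (i - 1) := by
  rw [mism_eq_sum, Nat.sub_add_cancel h1]
  rw [cconv, List.length_reverse]
  split_ifs with h3 h4
  · rw [hamming_eq_sum, List.length_take, min_eq_left h3.le]
    refine Finset.sum_congr rfl fun t ht => ?_
    rw [Finset.mem_range] at ht
    rw [code_take _ ht, code_drop, code_reverse _ (by omega),
      show S.length - 1 - (S.length - i + t) = i - 1 - t by omega]
    simp only [show t < S.length by omega, show i - 1 - t < S.length by omega, true_and]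
  · have h5 : i = S.length := by omega
    subst h5
    rw [Nat.sub_self, List.drop_zero, List.take_length, hamming_eq_sum]
    refine Finset.sum_congr rfl fun t ht => ?_
    rw [Finset.mem_range] at ht
    rw [code_reverse _ ht]
    simp only [ht, show S.length - 1 - t < S.length by omega, true_and]
  · rw [hamming_eq_sum, List.length_drop]
    have h5 : ∀ t ∈ Finset.range i, (if t < S.length ∧ i - 1 - t < S.length ∧ Bad (code S t) (code S (i - 1 - t))
        then 1 else 0) = if i - S.length ≤ t ∧ t < S.length ∧ Bad (code S t) (code S (i - 1 - t)) then 1 else 0 := by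
      intro t ht
      rw [Finset.mem_range] at ht
      by_cases h : i - S.length ≤ t
      · simp only [h, show i - 1 - t < S.length by omega, true_and]
      · simp only [h, show ¬ (i - 1 - t < S.length) by omega, false_and, and_false]
    rw [Finset.sum_congr rfl h5, ← Finset.sum_filter (s := Finset.range i)]
    have h6 : (Finset.range i).filter (fun t => i - S.length ≤ t ∧ t < S.length ∧ Bad (code S t) (code S (i - 1 - t))) =
        (Finset.Ico (i - S.length) S.length).filter fun t => Bad (code S t) (code S (i - 1 - t)) := by
      ext t; simp only [Finset.mem_filter, Finset.mem_range, Finset.mem_Ico]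
      constructor
      · rintro ⟨a, b, c, d⟩; exact ⟨⟨b, c⟩, d⟩
      · rintro ⟨⟨b, c⟩, d⟩; exact ⟨by omega, b, c, d⟩
    rw [h6, Finset.sum_filter, Finset.sum_Ico_eq_sum_range]
    refine Finset.sum_congr rfl fun t ht => ?_
    rw [Finset.mem_range] at ht
    rw [code_drop, code_take _ (by omega), code_reverse _ (by omega),
      show i - 1 - (i - S.length + t) = S.length - 1 - t by omega]

/-- The number of mismatching pairs around the center `s`, up to the radius `ρ`. -/
def half (c : ℕ → ℕ) (s ρ : ℕ) : ℕ :=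
  ∑ d ∈ Finset.range ρ, if Bad (c ((s + 1) / 2 - 1 - d)) (c (s / 2 + 1 + d)) then 1 else 0

theorem half_mono (c : ℕ → ℕ) (s : ℕ) {ρ ρ' : ℕ} (h : ρ ≤ ρ') : half c s ρ ≤ half c s ρ' :=
  Finset.sum_le_sum_of_subset (Finset.range_subset_range.2 h)

theorem half_succ (c : ℕ → ℕ) (s ρ : ℕ) : half c s (ρ + 1) =
    half c s ρ + if Bad (c ((s + 1) / 2 - 1 - ρ)) (c (s / 2 + 1 + ρ)) then 1 else 0 :=
  Finset.sum_range_succ _ _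

theorem half_le (c : ℕ → ℕ) (s ρ : ℕ) : half c s ρ ≤ ρ := by
  refine (Finset.sum_le_card_nsmul _ _ 1 fun i _ => by split_ifs <;> simp).trans (by simp)

/-- A symmetric sum over the pairs with sum `s`. -/
theorem sum_symm (g : ℕ → ℕ → ℕ) (hg : ∀ i j, g i j = g j i) (hg0 : ∀ i, g i i = 0) (s : ℕ) :
    ∑ i ∈ Finset.range (s + 1), g i (s - i) =
      2 * ∑ d ∈ Finset.range ((s + 1) / 2), g ((s + 1) / 2 - 1 - d) (s / 2 + 1 + d) := by
  have h1 : ∑ i ∈ Finset.Ico ((s + 1) / 2) (s + 1), g i (s - i) =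
      ∑ d ∈ Finset.range ((s + 1) / 2), g ((s + 1) / 2 - 1 - d) (s / 2 + 1 + d) := by
    have h2 : ∑ i ∈ Finset.Ico ((s + 1) / 2) (s + 1), g i (s - i) =
        ∑ i ∈ Finset.Ico (s / 2 + 1) (s + 1), g i (s - i) := by
      rcases Nat.even_or_odd' s with ⟨m, rfl | rfl⟩
      · rw [Finset.sum_eq_sum_Ico_succ_bot (by omega), show 2 * m - (2 * m + 1) / 2 = (2 * m + 1) / 2 by omega, hg0,
          zero_add]
        congr 2; omega
      · congr 2; omega
    rw [h2, Finset.sum_Ico_eq_sum_range, show s + 1 - (s / 2 + 1) = (s + 1) / 2 by omega]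
    refine Finset.sum_congr rfl fun d hd => ?_
    rw [Finset.mem_range] at hd
    rw [hg, show s - (s / 2 + 1 + d) = (s + 1) / 2 - 1 - d by omega]
  rw [← Finset.sum_range_add_sum_Ico _ (show (s + 1) / 2 ≤ s + 1 by omega), h1, two_mul]
  congr 1
  rw [← Finset.sum_range_reflect]
  refine Finset.sum_congr rfl fun d hd => ?_
  rw [Finset.mem_range] at hd
  rw [show s - ((s + 1) / 2 - 1 - d) = s / 2 + 1 + d by omega]

/-- Each mismatching pair occurs in both orders, and equal positions never mismatch. Pairs that
leave the factor on either side contribute nothing, which cuts the radius down to the stated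
minimum. -/
theorem mism_eq_half (c : ℕ → ℕ) (lo len s : ℕ) :
    mism (fun i => c (lo + i)) len s = 2 * half c (s + 2 * lo) (min (s + 1) (2 * len - 1 - s) / 2) := by
  rw [mism_eq_sum, sum_symm (fun i j => if i < len ∧ j < len ∧ Bad (c (lo + i)) (c (lo + j)) then 1 else 0)
    (fun i j => by simp only [Bad.comm (x := c (lo + i))]; congr 1; rw [eq_iff_iff]; tauto)
    (fun i => by simp [not_bad_self])]
  congr 1
  rw [half]
  symm
  have h1 : min (s + 1) (2 * len - 1 - s) / 2 ≤ (s + 1) / 2 := by omega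
  refine Finset.sum_subset_zero_on_sdiff (Finset.range_subset_range.2 h1) ?_ ?_
  · intro d hd
    simp only [Finset.mem_sdiff, Finset.mem_range] at hd
    rw [if_neg]
    rintro ⟨h2, h3, -⟩
    omega
  · intro d hd
    rw [Finset.mem_range] at hd
    rw [show (s + 2 * lo + 1) / 2 - 1 - d = lo + ((s + 1) / 2 - 1 - d) by omega,
      show (s + 2 * lo) / 2 + 1 + d = lo + (s / 2 + 1 + d) by omega]
    simp only [show (s + 1) / 2 - 1 - d < len by omega, show s / 2 + 1 + d < len by omega, true_and]

/-- The factor `1 / 2` in the palindromic mismatch count cancels the doubling in `mism_eq_half`. The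
empty interval, with `s` odd and `r = 0`, is separate because its length has no predecessor. -/
theorem isKPalindrome_iff (S : WString) (k : ℕ) {s r : ℕ} (h1 : r ≤ (s + 1) / 2) (h2 : s / 2 + r + 1 ≤ S.length) :
    IsKPalindrome k (S.factor ((s + 1) / 2 - r) (s / 2 + r + 1)) ↔ half (code S) s r ≤ k := by
  set a := (s + 1) / 2 - r with ha
  set b := s / 2 + r + 1 with hb
  have hlen : (S.factor a b).length = b - a := by
    rw [WString.factor, List.length_take, List.length_drop]; omega
  have hcode : ∀ t < b - a, code (S.factor a b) t = code S (a + t) := fun t ht => by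
    rw [WString.factor, code_take _ ht, code_drop]
  by_cases hab : b - a = 0
  · have hr0 : r = 0 := by omega
    have h0 : hamming (S.factor a b) (S.factor a b).reverse = 0 := by rw [hamming_eq_sum, hlen, hab]; rfl
    simp [IsKPalindrome, palMismatchCount, h0, hr0, half]
  have h3 : hamming (S.factor a b) (S.factor a b).reverse = mism (fun i => code S (a + i)) (b - a) (b - a - 1) := by
    rw [hamming_eq_sum, hlen, mism_eq_sum, Nat.sub_add_cancel (by omega)]
    refine Finset.sum_congr rfl fun t ht => ?_
    rw [Finset.mem_range] at ht
    rw [code_reverse _ (by omega), hlen, hcode t ht, hcode _ (by omega)]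
    simp only [show t < b - a by omega, show b - a - 1 - t < b - a by omega, true_and]
  rw [IsKPalindrome, palMismatchCount, h3, mism_eq_half,
    show b - a - 1 + 2 * a = s by omega, show min (b - a - 1 + 1) (2 * (b - a) - 1 - (b - a - 1)) / 2 = r by omega]
  push_cast
  rw [mul_div_cancel_left₀ _ (by norm_num)]
  exact_mod_cast Iff.rfl

/-- The largest radius of an interval with center `s`. -/
def maxRad (n s : ℕ) : ℕ := min ((s + 1) / 2) (n - 1 - s / 2)

theorem isMaxRadius_of (S : WString) (k : ℕ) {s r : ℕ} (hs : s < 2 * S.length - 1) (hr : r ≤ maxRad S.length s)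
    (h1 : half (code S) s r ≤ k) (h2 : r < maxRad S.length s → k < half (code S) s (r + 1)) :
    IsMaxRadius S k s r := by
  unfold maxRad at *
  refine ⟨(s + 1) / 2 - r, s / 2 + r + 1, by omega, ⟨by omega, by omega, ?_, ?_⟩, by omega⟩
  · rwa [isKPalindrome_iff S k (by omega) (by omega)]
  · rintro ⟨h3, h4, h5⟩
    rw [show (s + 1) / 2 - r - 1 = (s + 1) / 2 - (r + 1) by omega,
      show s / 2 + r + 1 + 1 = s / 2 + (r + 1) + 1 by omega, isKPalindrome_iff S k (by omega) (by omega)] at h5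
    have := h2 (by omega)
    omega

/-- The largest radius of a `k`-palindrome with center `s`. -/
noncomputable def best (c : ℕ → ℕ) (n k s : ℕ) : ℕ := Nat.findGreatest (fun r => half c s r ≤ k) (maxRad n s)

theorem best_le (c : ℕ → ℕ) (n k s : ℕ) : best c n k s ≤ maxRad n s := Nat.findGreatest_le _

theorem half_best (c : ℕ → ℕ) (n k s : ℕ) : half c s (best c n k s) ≤ k :=
  Nat.findGreatest_spec (P := fun r => half c s r ≤ k) (m := 0) (Nat.zero_le _) (by simp [half])

theorem le_best {c : ℕ → ℕ} {n k s r : ℕ} (hr : r ≤ maxRad n s) (h : half c s r ≤ k) : r ≤ best c n k s :=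
  Nat.le_findGreatest hr h

theorem isMaxRadius_best (S : WString) (k : ℕ) {s : ℕ} (hs : s < 2 * S.length - 1) :
    IsMaxRadius S k s (best (code S) S.length k s) := by
  refine isMaxRadius_of S k hs (best_le _ _ _ _) (half_best _ _ _ _) fun h => ?_
  by_contra hc
  have := le_best (Nat.succ_le_of_lt h) (not_lt.1 hc)
  omega

/-- The function `half` is monotone in the radius, so a radius that cannot be extended once is the
largest. -/
theorem eq_best {c : ℕ → ℕ} {n k s r : ℕ} (hr : r ≤ maxRad n s) (h : half c s r ≤ k)
    (h2 : r < maxRad n s → k < half c s (r + 1)) : r = best c n k s := by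
  refine le_antisymm (le_best hr h) ?_
  by_contra hc
  have h3 := h2 (by have := best_le c n k s; omega)
  have h4 := half_mono c s (show r + 1 ≤ best c n k s by omega)
  have := half_best c n k s
  omega

end Pal

/-! ### Sweeping over factors of the string -/

namespace VM

open VM.Expr Merge Pal

/-- Register 84 is the largest radius inside the factor, 85 its palindromic mismatch count, 86 the
center in the whole string. Arrays `8` and `9` keep the best radius so far with its mismatch count.
-/
def sweepBody : Prog :=
  84 ≔ reg 83 + 1 ;; 85 ≔ 2 * reg 8 - 1 - reg 83 ;;
  .ite (lt (reg 85) (reg 84)) (84 ≔ reg 85) .skip ;; 84 ≔ reg 84 / 2 ;;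
  85 ≔ load 7 (reg 83) / 2 ;; 86 ≔ reg 83 + 2 * reg 7 ;;
  .ite (lt (reg 1) (reg 85)) .skip
    (.ite (lt (load 8 (reg 86)) (reg 84))
      (.put 8 (reg 86) (reg 84) ;; .put 9 (reg 86) (reg 85)) .skip)

def sweepStep : Prog :=
  7 ≔ reg 82 - reg 81 ;; 8 ≔ reg 82 - reg 7 ;; scProg ;; .for 83 (2 * reg 8 - 1) sweepBody ;;
  82 ≔ reg 82 + reg 80

/-- Finds radii of `k`-palindromes from the factors of length `reg 81` that end at the multiples of
`reg 80`. -/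
def sweepProg : Prog := 82 ≔ reg 80 ;; .while (lt (reg 82) (reg 0 + 1)) sweepStep

/-- The arrays `8` and `9` hold radii of `k`-palindromes and their numbers of mismatches. -/
def Good (n k : ℕ) (v : State) : Prop :=
  ∀ s < 2 * n - 1, v.arr 8 s ≤ maxRad n s ∧ half (v.arr 16) s (v.arr 8 s) ≤ k ∧
    v.arr 9 s = half (v.arr 16) s (v.arr 8 s)

/-- The largest radius at the center `s` within the positions `lo, …, e - 1`. -/
def radIn (lo e s : ℕ) : ℕ := min (s + 1 - 2 * lo) (2 * e - 1 - s) / 2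

/-- The `k`-palindromes of the factor `lo, …, e - 1` are taken into account. -/
def Covered (k lo e : ℕ) (v : State) : Prop :=
  ∀ s, 2 * lo ≤ s → s < 2 * e - 1 → half (v.arr 16) s (radIn lo e s) ≤ k → radIn lo e s ≤ v.arr 8 s

theorem Covered.mono {k lo e : ℕ} {v v' : State} (h : Covered k lo e v) (h16 : v'.arr 16 = v.arr 16)
    (h8 : ∀ s, v.arr 8 s ≤ v'.arr 8 s) : Covered k lo e v' := by
  intro s h1 h2 h3
  rw [h16] at h3
  exact (h s h1 h2 h3).trans (h8 s)

theorem sweep_loop {W M n lo len k : ℕ} {v : State} (hlen : lo + len ≤ n) (hW : 66 * n + 64 ≤ W)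
    (h1 : v.reg 1 = k) (h7 : v.reg 7 = lo) (h8 : v.reg 8 = len) (hG : Good n k v)
    (hout : ∀ s < 2 * len - 1, v.arr 7 s = mism (fun i => v.arr 16 (lo + i)) len s) :
    Tri W M n (.for 83 (2 * reg 8 - 1) sweepBody) v ((sweepBody.time + (2 * reg 8 - 1 : VM.Expr).cost + 12) * (2 * len - 1 + 1))
      fun v' => Frame {83, 84, 85, 86} {8, 9} v v' ∧ Good n k v' ∧ (∀ s, v.arr 8 s ≤ v'.arr 8 s) ∧
        Covered k lo (lo + len) v' := by
  refine (array_loop (N := 2 * len - 1) (T := sweepBody.time) (R := {83, 84, 85, 86}) (A := {8, 9}) (by simp)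
    (by norm_num) (by omega) (fun i v' => Good n k v' ∧ (∀ s, v.arr 8 s ≤ v'.arr 8 s) ∧
      ∀ s < i, half (v.arr 16) (s + 2 * lo) (min (s + 1) (2 * len - 1 - s) / 2) ≤ k →
        min (s + 1) (2 * len - 1 - s) / 2 ≤ v'.arr 8 (s + 2 * lo)) ?_ ⟨hG, by simp, by simp⟩ ?_).mono le_rfl ?_
  · intro v' hf
    simp [hf.reg, h8]; omega
  · rintro i hi v' hf h83 ⟨hG', hm, hc⟩
    have r1 : v'.reg 1 = k := by rw [hf.reg 1 (by simp), h1]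
    have r7 : v'.reg 7 = lo := by rw [hf.reg 7 (by simp), h7]
    have r8 : v'.reg 8 = len := by rw [hf.reg 8 (by simp), h8]
    have a7 : v'.arr 7 = v.arr 7 := hf.arr 7 (by simp)
    have a16 : v'.arr 16 = v.arr 16 := hf.arr 16 (by simp)
    have ho := hout i hi
    rw [mism_eq_half (v.arr 16)] at ho
    set ρ := min (i + 1) (2 * len - 1 - i) / 2 with hρ
    have hρm : ρ ≤ maxRad n (i + 2 * lo) := by unfold maxRad; omega
    have hstep : Prog.wp W n sweepBody (fun w => Frame {83, 84, 85, 86} {8, 9} v' w ∧ w.reg 83 = i ∧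
        ((¬ k < half (v.arr 16) (i + 2 * lo) ρ ∧ v'.arr 8 (i + 2 * lo) < ρ ∧
          (∀ s, w.arr 8 s = if s = i + 2 * lo then ρ else v'.arr 8 s) ∧
          ∀ s, w.arr 9 s = if s = i + 2 * lo then half (v.arr 16) (i + 2 * lo) ρ else v'.arr 9 s) ∨
        (¬ (¬ k < half (v.arr 16) (i + 2 * lo) ρ ∧ v'.arr 8 (i + 2 * lo) < ρ) ∧ w.arr 8 = v'.arr 8 ∧
          w.arr 9 = v'.arr 9))) v' := by
      have e1 : 2 * half (v.arr 16) (i + 2 * lo) ρ / 2 = half (v.arr 16) (i + 2 * lo) ρ := by omega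
      by_cases hl : 2 * len - 1 - i < i + 1
      · have eρ : (2 * len - 1 - i) / 2 = ρ := by omega
        simp [sweepBody, Prog.wp, r1, r7, r8, a7, h83, ho, lim, Frame.set_iff, Frame.put_iff, Frame.refl, hl, eρ]
        exact ⟨by omega, by omega, by omega, by omega, fun a b => absurd a (by omega),
          fun a => ⟨by omega, fun b => ⟨by omega, Or.inl ⟨a, b⟩⟩, fun b _ => Or.inr b⟩⟩
      · have eρ : (i + 1) / 2 = ρ := by omega
        simp [sweepBody, Prog.wp, r1, r7, r8, a7, h83, ho, lim, Frame.set_iff, Frame.put_iff, Frame.refl, hl, eρ]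
        exact ⟨by omega, by omega, by omega, by omega, fun a b => absurd a (by omega),
          fun a => ⟨by omega, fun b => ⟨by omega, Or.inl ⟨a, b⟩⟩, fun b _ => Or.inr b⟩⟩
    refine (Tri.of_wp hstep).imp ?_
    rintro w ⟨hf', w83, hw⟩
    have w16 : w.arr 16 = v.arr 16 := by rw [hf'.arr 16 (by simp), a16]
    have hmono : ∀ s, v'.arr 8 s ≤ w.arr 8 s := by
      intro s
      rcases hw with ⟨-, b1, b2, -⟩ | ⟨-, b2, -⟩
      · rw [b2]; split_ifs with h
        · rw [h]; omega
        · exact le_rfl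
      · rw [b2]
    refine ⟨hf.trans hf', w83, ?_, fun s => (hm s).trans (by simpa using hmono s), fun s hs hk => ?_⟩
    · intro s hs
      obtain ⟨g1, g2, g3⟩ := hG' s hs
      rw [a16] at g2 g3
      simp only [State.set_arr, w16]
      rcases hw with ⟨b0, b1, b2, b3⟩ | ⟨-, b2, b3⟩
      · rw [b2, b3]; split_ifs with h
        · rw [h]; exact ⟨hρm, by omega, rfl⟩
        · exact ⟨g1, g2, g3⟩
      · rw [b2, b3]; exact ⟨g1, g2, g3⟩
    · simp only [State.set_arr]
      rcases Nat.lt_succ_iff_lt_or_eq.1 hs with h | rfl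
      · exact (hc s h hk).trans (hmono _)
      · rcases hw with ⟨-, b1, b2, -⟩ | ⟨b0, b2, -⟩
        · rw [b2, if_pos rfl]
        · rw [b2, ← hρ]; rw [← hρ] at hk; omega
  · rintro v' ⟨hf, hG', hm, hc⟩
    refine ⟨hf, hG', hm, fun s e1 e2 e3 => ?_⟩
    rw [hf.arr 16 (by simp)] at e3
    have e4 := hc (s - 2 * lo) (by omega)
    rw [Nat.sub_add_cancel e1] at e4
    have e5 : radIn lo (lo + len) s = min (s - 2 * lo + 1) (2 * len - 1 - (s - 2 * lo)) / 2 := by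
      unfold radIn; omega
    rw [e5] at e3 ⊢
    exact e4 e3

end VM

namespace VM

open VM.Expr Merge Pal

def sweepRegs : Finset ℕ := {7, 8} ∪ scRegs ∪ Finset.Icc 82 86

theorem mem_sweepRegs {r : ℕ} : r ∈ sweepRegs ↔ r = 7 ∨ r = 8 ∨ r ∈ scRegs ∨ 82 ≤ r ∧ r ≤ 86 := by
  simp [sweepRegs]

def sweepArrs : Finset ℕ := {0, 1, 4, 5, 6, 7, 8, 9, 10}

/-- Cost of the factor of length `len` at `lo`. -/
def factorCost (c : ℕ → ℕ) (lo len : ℕ) : ℕ :=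
  thr len + letterCost (fun i => c (lo + i)) len (thr len)

def sweepTime : ℕ := scTime + 2 * (sweepBody.time + (2 * reg 8 - 1 : VM.Expr).cost + 12) + 100

theorem sweepTime_le (t t₁ t₂ c c' G F len : ℕ) (hc : c' = 5) (hF : F ≤ G) (hl : 2 * len ≤ F) (h1 : 1 ≤ len)
    (ht : t = t₁ + 2 * (t₂ + c + 12) + 100) :
    4 + (4 + (t₁ * F + ((t₂ + c + 12) * (2 * len - 1 + 1) + 4))) + (c' + 1) ≤ t * G := by
  subst ht hc
  have a1 := Nat.mul_le_mul_left t₁ hF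
  have a2 := Nat.mul_le_mul_left (t₂ + c + 12) (show 2 * len - 1 + 1 ≤ G by omega)
  have a3 : (t₁ + 2 * (t₂ + c + 12) + 100) * G = t₁ * G + (t₂ + c + 12) * G + (t₂ + c + 12) * G + 100 * G := by
    ring
  omega

theorem two_mul_le_thr (len : ℕ) : 2 * len ≤ thr len :=
  (two_mul_le_pow_lev len).trans (Nat.le_mul_of_pos_right _ (by omega))

/-- The start `e - Y` is truncated at 0, so near the beginning of the string the window is a prefix
of length `e`. -/
theorem sweepStep_tri {W M n k B Y e : ℕ} {v : State} (hR : Ready W n v) (h1 : v.reg 1 = k) (h80 : v.reg 80 = B)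
    (h81 : v.reg 81 = Y) (h82 : v.reg 82 = e) (he : 1 ≤ e) (hen : e ≤ n) (hY : 1 ≤ Y) (hB : n + B < W) (hG : Good n k v) :
    Tri W M n sweepStep v (4 + (4 + (scTime * factorCost (v.arr 16) (e - Y) (e - (e - Y)) +
      ((sweepBody.time + (2 * reg 8 - 1 : VM.Expr).cost + 12) * (2 * (e - (e - Y)) - 1 + 1) + 4)))) fun v' =>
      Frame sweepRegs sweepArrs v v' ∧ v'.reg 82 = e + B ∧ Good n k v' ∧ (∀ s, v.arr 8 s ≤ v'.arr 8 s) ∧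
        Covered k (e - Y) e v' := by
  have hle := hR.le
  set lo := e - Y with hlo
  set len := e - lo with hlen
  have hlen1 : lo + len = e := by omega
  refine Tri.seq (R := fun w => w = v.set 7 lo) (Tri.asg (by norm_num) (by simp) (by simp [h82, h81, hlo])) ?_
  rintro _ rfl
  refine Tri.seq (R := fun w => w = (v.set 7 lo).set 8 len) (Tri.asg (by norm_num) (by simp)
    (by simp [h82, hlen])) ?_
  rintro _ rfl
  refine Tri.seq (scProg_tri (lo := lo) (len := len) (hR.of_eq (by simp) (by simp) (by simp) (by simp)) (by omega)
    (by simp) (by simp)) ?_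
  rintro v1 ⟨f1, -, -, h7⟩
  simp only [State.set_arr] at h7
  have f1' : Frame sweepRegs sweepArrs v v1 :=
    Frame.trans (v' := (v.set 7 lo).set 8 len) (by simp [Frame.set_iff, mem_sweepRegs, Frame.refl])
      (f1.mono (fun r hr => by rw [mem_sweepRegs]; exact Or.inr (Or.inr (Or.inl hr))) (by decide))
  have a16 : v1.arr 16 = v.arr 16 := f1'.arr 16 (by decide)
  have a8 : v1.arr 8 = v.arr 8 := by rw [f1.arr 8 (by decide)]; simp
  have a9 : v1.arr 9 = v.arr 9 := by rw [f1.arr 9 (by decide)]; simp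
  have r1 : v1.reg 1 = k := by rw [f1'.reg 1 (by simp [mem_sweepRegs, mem_scRegs]), h1]
  have r7 : v1.reg 7 = lo := by rw [f1.reg 7 (by simp [mem_scRegs])]; simp
  have r8 : v1.reg 8 = len := by rw [f1.reg 8 (by simp [mem_scRegs])]; simp
  have hG1 : Good n k v1 := by intro s hs; rw [a8, a9, a16]; exact hG s hs
  refine Tri.seq (sweep_loop (lo := lo) (len := len) (by omega) hle r1 r7 r8 hG1 ?_) ?_
  · intro s hs
    rw [a16]
    have := two_mul_le_pow_lev len
    exact h7 s (by omega)
  rintro v2 ⟨f2, hG2, hm, hc⟩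
  have e80 : v2.reg 80 = B := by
    rw [f2.reg 80 (by simp), f1'.reg 80 (by simp [mem_sweepRegs, mem_scRegs]), h80]
  have e82 : v2.reg 82 = e := by
    rw [f2.reg 82 (by simp), f1.reg 82 (by simp [mem_scRegs])]; simp [h82]
  refine Tri.asg (by norm_num) ?_ ⟨?_, ?_, ?_, ?_, ?_⟩
  · simp [e80, e82]; omega
  · rw [Frame.set_iff (by simp [mem_sweepRegs])]
    exact f1'.trans (f2.mono (fun r hr => by rw [mem_sweepRegs]; simp at hr; omega) (by decide))
  · simp [e80, e82]
  · exact hG2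
  · intro s; rw [← a8]; exact hm s
  · rw [hlen1] at hc; exact hc

theorem sweepProg_tri {W M n k B Y G : ℕ} {v : State} (hR : Ready W n v) (h1 : v.reg 1 = k) (h80 : v.reg 80 = B)
    (h81 : v.reg 81 = Y) (hB1 : 1 ≤ B) (hY : 1 ≤ Y) (hB : n + B < W) (hG : Good n k v)
    (hcost : ∀ e, 1 ≤ e → e ≤ n → factorCost (v.arr 16) (e - Y) (e - (e - Y)) ≤ G) :
    Tri W M n sweepProg v (sweepTime * (n / B * G + 1)) fun v' =>
      Frame sweepRegs sweepArrs v v' ∧ Good n k v' ∧ (∀ s, v.arr 8 s ≤ v'.arr 8 s) ∧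
        ∀ e, B ∣ e → 1 ≤ e → e ≤ n → Covered k (e - Y) e v' := by
  refine Tri.of_bounds fun hF h0 _ _ => ?_
  have hle := hR.le
  set T := sweepTime * G with hT
  -- Each iteration has the budget `T`, loop test included. The subtraction is exact whenever there
  -- is an iteration at all, as shown at the end.
  have main : Tri W M n sweepProg v (2 + (∑ i ∈ Finset.range (n / B), (T - ((lt (reg 82) (reg 0 + 1)).cost + 1) +
      ((lt (reg 82) (reg 0 + 1)).cost + 1)) + ((lt (reg 82) (reg 0 + 1)).cost + 1))) fun v' =>
      Frame sweepRegs sweepArrs v v' ∧ Good n k v' ∧ (∀ s, v.arr 8 s ≤ v'.arr 8 s) ∧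
        ∀ e, B ∣ e → 1 ≤ e → e ≤ n → Covered k (e - Y) e v' := by
    refine Tri.seq (R := fun w => w = v.set 82 B) (Tri.asg (by norm_num) (by simp) (by simp [h80])) ?_
    rintro _ rfl
    refine Tri.while_eq (fun i w => Frame sweepRegs sweepArrs v w ∧ w.reg 82 = B * (i + 1) ∧ Good n k w ∧
      (∀ s, v.arr 8 s ≤ w.arr 8 s) ∧ ∀ t, 1 ≤ t → t ≤ i → Covered k (B * t - Y) (B * t) w) _ (n / B) ?_ ?_ ?_
    · refine ⟨by simp [Frame.set_iff, mem_sweepRegs, Frame.refl], by simp, hG, by simp, fun t h1 h2 => by omega⟩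
    · rintro i hi w ⟨hf, h82, hGw, hm, hc⟩
      have r0 : w.reg 0 = n := by rw [hf.reg 0 (by simp [mem_sweepRegs, mem_scRegs]), h0]
      have hen : B * (i + 1) ≤ n := (Nat.mul_le_mul_left B hi).trans (Nat.mul_div_le n B)
      have he1 : 1 ≤ B * (i + 1) := Nat.mul_pos hB1 (by omega)
      have a16 : w.arr 16 = v.arr 16 := hf.arr 16 (by decide)
      refine ⟨by simp [r0]; omega, by simp [r0, h82]; omega, ?_⟩
      refine (sweepStep_tri (k := k) (B := B) (Y := Y) (e := B * (i + 1))
        (hR.frame hf (by simp [mem_sweepRegs, mem_scRegs]) (by simp [mem_sweepRegs, mem_scRegs]) (by decide) (by decide))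
        (by rw [hf.reg 1 (by simp [mem_sweepRegs, mem_scRegs]), h1])
        (by rw [hf.reg 80 (by simp [mem_sweepRegs, mem_scRegs]), h80])
        (by rw [hf.reg 81 (by simp [mem_sweepRegs, mem_scRegs]), h81]) h82 he1 hen hY hB hGw).mono ?_ ?_
      · have := hcost _ he1 hen
        rw [a16]
        refine Nat.le_sub_of_add_le ?_
        rw [hT]
        refine sweepTime_le sweepTime scTime sweepBody.time _ _ G _ (B * (i + 1) - (B * (i + 1) - Y)) rfl this
          ((two_mul_le_thr _).trans (Nat.le_add_right _ _)) (by omega) rfl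
      · rintro w' ⟨hf', h82', hG', hm', hc'⟩
        refine ⟨hf.trans hf', by rw [h82']; ring, hG', fun s => (hm s).trans (hm' s), fun t t1 t2 => ?_⟩
        rcases Nat.lt_succ_iff_lt_or_eq.1 (Nat.lt_succ_of_le t2) with h | rfl
        · exact (hc t t1 (by omega)).mono (hf'.arr 16 (by decide)) hm'
        · exact hc'
    · rintro w ⟨hf, h82, hGw, hm, hc⟩
      have r0 : w.reg 0 = n := by rw [hf.reg 0 (by simp [mem_sweepRegs, mem_scRegs]), h0]
      have : n < B * (n / B + 1) := Nat.lt_mul_div_succ n hB1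
      refine ⟨by simp [r0]; omega, by simp [r0, h82]; omega, hf, hGw, hm, ?_⟩
      rintro e ⟨t, rfl⟩ e1 e2
      exact hc t (Nat.pos_of_mul_pos_left e1) ((Nat.le_div_iff_mul_le hB1).2 (by rw [mul_comm]; exact e2))
  refine main.mono ?_ fun _ h => h
  rw [Finset.sum_const, Finset.card_range, smul_eq_mul]
  have key : ∀ t c m : ℕ, c = 5 → 100 ≤ t → (m = 0 ∨ c + 1 ≤ t * G) → 2 + (m * (t * G - (c + 1) + (c + 1)) + (c + 1)) ≤
      t * (m * G + 1) := by
    rintro t c m rfl ht (rfl | hm)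
    · simp; omega
    · rw [Nat.sub_add_cancel hm]
      have : t * (m * G + 1) = m * (t * G) + t := by ring
      omega
  refine key sweepTime _ _ rfl (by unfold sweepTime; exact Nat.le_add_left _ _) ?_
  by_cases hn : n / B = 0
  · exact Or.inl hn
  · right
    have hn1 : 1 ≤ n := by by_contra h; exact hn (by rw [show n = 0 by omega, Nat.zero_div])
    have h2 := hcost 1 le_rfl hn1
    have h3 : 2 * 1 ≤ thr (1 - (1 - Y)) := le_trans (by omega) (two_mul_le_thr _)
    have h4 : 1 ≤ G := le_trans (by omega) (le_trans (Nat.le_add_right _ _) h2)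
    have h5 : 100 ≤ sweepTime := by unfold sweepTime; exact Nat.le_add_left _ _
    calc _ ≤ 100 * 1 := by decide
      _ ≤ _ := Nat.mul_le_mul h5 h4

end VM

/-! ### Bounds for the cost of a factor -/

namespace VM

open Merge Pal

theorem weight_le (c : ℕ → ℕ) (len T a : ℕ) : weight c len T a ≤ T := by
  unfold weight; split_ifs <;> simp

/-- Wildcards cost nothing, and the other codes are successors of letters, so at most `A.card` codes
contribute. -/
theorem letterCost_le_card_mul {S : WString} {A : Finset ℕ} (hS : S.Over A) (lo len T : ℕ) :
    letterCost (fun i => code S (lo + i)) len T ≤ A.card * T := by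
  have h1 : ∀ a ∈ (Finset.range len).image (fun i => code S (lo + i)), a ≠ 0 → a ∈ A.image (· + 1) := by
    intro a ha h0
    obtain ⟨i, -, rfl⟩ := Finset.mem_image.1 ha
    simp only [code, List.getD_eq_getElem?_getD] at h0 ⊢
    rcases h : S[lo + i]? with _ | (_ | x)
    · simp [h, RAM.encode] at h0
    · simp [h, RAM.encode] at h0
    · simpa [RAM.encode] using hS x (List.mem_of_getElem? h)
  rw [letterCost, ← Finset.sum_filter_add_sum_filter_not _ (· ≠ 0)]
  have h2 : ∑ a ∈ ((Finset.range len).image (fun i => code S (lo + i))).filter (fun a => ¬ a ≠ 0),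
      weight (fun i => code S (lo + i)) len T a = 0 :=
    Finset.sum_eq_zero fun a ha => by
      have := (Finset.mem_filter.1 ha).2
      simp only [not_not] at this
      simp [weight, this]
  rw [h2, add_zero]
  calc _ ≤ ∑ a ∈ A.image (· + 1), T := by
        refine (Finset.sum_le_sum fun a _ => weight_le _ _ _ a).trans
          (Finset.sum_le_sum_of_subset fun a ha => ?_)
        rw [Finset.mem_filter] at ha
        exact h1 a ha.1 ha.2
    _ = A.card * T := by
        rw [Finset.sum_const, Finset.card_image_of_injective _ (add_left_injective 1), smul_eq_mul]

/-- The minimum of `x ^ 2` and `T` is at most their geometric mean `x √T`, and the counts `x` add up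
to `len`. -/
theorem letterCost_le_mul_sqrt (c : ℕ → ℕ) (len T : ℕ) : (letterCost c len T : ℝ) ≤ len * √T := by
  rw [letterCost, Nat.cast_sum]
  have h1 : ∀ a, (weight c len T a : ℝ) ≤ cnt c len a * √T := by
    intro a
    unfold weight
    split_ifs with h
    · simp only [Nat.cast_zero]; positivity
    · refine abs_le_of_sq_le_sq' ?_ (by positivity) |>.2
      rw [mul_pow, Real.sq_sqrt (by positivity), sq]
      exact_mod_cast Nat.mul_le_mul ((min_le_left _ _).trans_eq (by ring)) (min_le_right _ _)
  refine (Finset.sum_le_sum fun a _ => h1 a).trans_eq ?_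
  rw [← Finset.sum_mul, ← Nat.cast_sum, sum_cnt]

theorem lev_add_one_le {n len : ℕ} (hn : 2 ≤ n) (hl : len ≤ n) : ((lev len + 1 : ℕ) : ℝ) ≤ 8 * Real.log n := by
  -- For `n ≥ 2` both `2 ^ (lev len + 1) ≤ 16 n` and `16 ≤ n ^ 4` hold; the constant 8 then exceeds
  -- `5 / log 2`.
  have h1 : 2 ^ (lev len + 1) ≤ n ^ 5 := by
    have := pow_lev_le len
    have h16 : 16 ≤ n ^ 4 := le_trans (by norm_num) (Nat.pow_le_pow_left hn 4)
    calc 2 ^ (lev len + 1) = 2 ^ lev len * 2 := pow_succ _ _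
      _ ≤ 16 * n := by omega
      _ ≤ n ^ 4 * n := Nat.mul_le_mul_right _ h16
      _ = n ^ 5 := (pow_succ _ _).symm
  have h2 : ((lev len + 1 : ℕ) : ℝ) * Real.log 2 ≤ 5 * Real.log n := by
    rw [← Real.log_pow, show (5 : ℝ) = (5 : ℕ) by norm_num, ← Real.log_pow]
    exact Real.log_le_log (by positivity) (by exact_mod_cast h1)
  have h3 := Real.log_two_gt_d9
  have h4 : (0 : ℝ) ≤ ((lev len + 1 : ℕ) : ℝ) := by positivity
  nlinarith

theorem thr_le {n len : ℕ} (hn : 2 ≤ n) (h1 : 1 ≤ len) (hl : len ≤ n) : (thr len : ℝ) ≤ 48 * (len * Real.log n) := by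
  have h2 := lev_add_one_le hn hl
  have h3 : ((2 ^ lev len : ℕ) : ℝ) ≤ 6 * len := by
    have := pow_lev_le len
    exact_mod_cast (show 2 ^ lev len ≤ 6 * len by omega)
  rw [thr, Nat.cast_mul]
  refine (mul_le_mul h3 h2 (by positivity) (by positivity)).trans_eq (by ring)

/-- With `T` of order `len * log n` the two estimates of the letter cost give the two terms of the
minimum. The cost of the first convolution is absorbed because `log n` is below both terms. The
factor `len` in front makes the cost per character uniform over all windows. -/
theorem factorCost_le {S : WString} {A : Finset ℕ} (hA : A.Nonempty) (hS : S.Over A) {n len : ℕ} (hn : 2 ≤ n)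
    (h1 : 1 ≤ len) (hl : len ≤ n) (lo : ℕ) :
    (factorCost (code S) lo len : ℝ) ≤ 100 * (len * min (A.card * Real.log n) √(n * Real.log n)) := by
  have hT := thr_le hn h1 hl
  have hn' : (2 : ℝ) ≤ n := by exact_mod_cast hn
  have hlog : 0 ≤ Real.log n := Real.log_nonneg (by linarith)
  have hA1 : (1 : ℝ) ≤ A.card := by exact_mod_cast hA.card_pos
  have hl' : (len : ℝ) ≤ n := by exact_mod_cast hl
  have hlogn : Real.log n ≤ n := (Real.log_le_sub_one_of_pos (by linarith)).trans (by linarith)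
  have hsq : Real.log n ≤ √(n * Real.log n) := Real.le_sqrt_of_sq_le (by nlinarith)
  have hlg : Real.log n ≤ min (A.card * Real.log n) √(n * Real.log n) := le_min (by nlinarith) hsq
  have hL : (letterCost (fun i => code S (lo + i)) len (thr len) : ℝ) ≤
      48 * (len * min (A.card * Real.log n) √(n * Real.log n)) := by
    rw [mul_min_of_nonneg _ _ (by positivity), mul_min_of_nonneg _ _ (by norm_num)]
    refine le_min ?_ ?_
    · calc _ ≤ ((A.card * thr len : ℕ) : ℝ) := by exact_mod_cast letterCost_le_card_mul hS lo len _
        _ = A.card * (thr len : ℝ) := by push_cast; ring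
        _ ≤ A.card * (48 * (len * Real.log n)) := by gcongr
        _ = _ := by ring
    · calc _ ≤ len * √(thr len) := letterCost_le_mul_sqrt _ _ _
        _ ≤ len * √(48 ^ 2 * (n * Real.log n)) := by
            gcongr
            refine hT.trans ?_
            have : (len : ℝ) * Real.log n ≤ n * Real.log n := by gcongr
            have h0 : 0 ≤ n * Real.log n := by positivity
            linarith
        _ = _ := by rw [Real.sqrt_mul (by norm_num), Real.sqrt_sq (by norm_num)]; ring
  have h2 : len * Real.log n ≤ len * min (A.card * Real.log n) √(n * Real.log n) := by gcongr
  rw [factorCost, Nat.cast_add]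
  have h0 : 0 ≤ len * Real.log n := by positivity
  linarith

theorem one_half_le_min {σ n : ℕ} (hσ : 1 ≤ σ) (hn : 2 ≤ n) :
    (1 / 2 : ℝ) ≤ min (σ * Real.log n) √(n * Real.log n) := by
  have hn' : (2 : ℝ) ≤ n := by exact_mod_cast hn
  have h3 := Real.log_two_gt_d9
  have hlog : Real.log 2 ≤ Real.log n := Real.log_le_log (by norm_num) hn'
  have hσ' : (1 : ℝ) ≤ σ := by exact_mod_cast hσ
  exact le_min (by nlinarith) (Real.le_sqrt_of_sq_le (by nlinarith))

theorem one_le_fS {σ n : ℕ} (hσ : 1 ≤ σ) (hn : 2 ≤ n) : 1 ≤ fS σ n := by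
  have hn' : (2 : ℝ) ≤ n := by exact_mod_cast hn
  have h := one_half_le_min hσ hn
  rw [fS]
  nlinarith

theorem fS_nonneg (σ n : ℕ) : 0 ≤ fS σ n := by
  have := Real.log_natCast_nonneg n
  unfold fS; positivity

theorem factorCost_zero_le {S : WString} {A : Finset ℕ} (hA : A.Nonempty) (hS : S.Over A) :
    (factorCost (code S) 0 S.length : ℝ) ≤ 100 * (1 + fS A.card S.length) := by
  rcases le_or_gt 2 S.length with h | h
  · have := factorCost_le hA hS h (by omega) le_rfl 0
    rw [fS]; linarith
  · have h2 := fS_nonneg A.card S.length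
    have h3 : factorCost (code S) 0 S.length ≤ 100 := by
      have h4 := letterCost_le (fun i => code S (0 + i)) S.length (thr S.length)
      have h5 := pow_lev_le S.length
      have h6 := lev_le S.length
      have h7 : thr S.length ≤ 6 * 7 := Nat.mul_le_mul (by omega) (by omega)
      have h8 : S.length * S.length ≤ 1 * 1 := Nat.mul_le_mul (by omega) (by omega)
      unfold factorCost; omega
    have : (factorCost (code S) 0 S.length : ℝ) ≤ 100 := by exact_mod_cast h3
    linarith

theorem factorCost_le_sq (c : ℕ → ℕ) (lo len : ℕ) : factorCost c lo len ≤ 17 * ((len + 1) * (len + 1)) := by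
  have h2 := letterCost_le (fun i => c (lo + i)) len (thr len)
  have h3 := pow_lev_le len
  have h4 := lev_le len
  have h5 : thr len ≤ (4 * (len + 1)) * (4 * (len + 1)) := Nat.mul_le_mul (by omega) (by omega)
  have h6 : (4 * (len + 1)) * (4 * (len + 1)) = 16 * ((len + 1) * (len + 1)) := by ring
  have h7 : len * len ≤ (len + 1) * (len + 1) := Nat.mul_le_mul (by omega) (by omega)
  unfold factorCost; omega

end VM

/-! ### Programs for the word RAM -/

namespace VM

open VM.Expr Merge Pal

/-- The initial state for the input `S` with the numbers `args`. -/
def start (S : WString) (args : List ℕ) : State where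
  reg := (RAM.input S args).reg
  arr := fun a i => if a = 16 then code S i else 0

set_option exponentiation.threshold 600 in
-- The input occupies the first `n` cells and all others are 0. Hence the work arrays start at 0,
-- and array `16`, of `2 n` cells, is `code S`, which is 0 beyond the string.
theorem runsOn_of_tri {p : Prog} {C : ℕ} {S : WString} {args : List ℕ} {post : (ℕ → ℕ) → ℕ → Prop} (hC : 520 ≤ C)
    {T : ℕ} {Q : State → Prop}
    (h : ∀ W M, (S.length + 2) ^ 520 ≤ W → Tri W M S.length p (start S args) T Q)
    (hQ : ∀ v t out, Q v → t ≤ T → (∀ i < 2 * S.length, out i = v.arr 16 i) → post out t) :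
    p.compile.RunsOn C S args post := by
  intro W hW hS hargs
  have hW' : (S.length + 2) ^ 520 ≤ W := (Nat.pow_le_pow_right (by omega) hC).trans hW
  have hbig : (S.length + 2) * 1024 ≤ W := by
    refine le_trans ?_ hW'
    calc (S.length + 2) * 1024 = (S.length + 2) * 2 ^ 10 := by norm_num
      _ ≤ (S.length + 2) * (S.length + 2) ^ 10 := Nat.mul_le_mul_left _ (Nat.pow_le_pow_left (by omega) _)
      _ = (S.length + 2) ^ 11 := (pow_succ' _ _).symm
      _ ≤ _ := Nat.pow_le_pow_right (by omega) (by norm_num)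
  have hcode : ∀ i, code S i < W := by
    intro i
    simp only [code, List.getD_eq_getElem?_getD]
    rcases hi : S[i]? with _ | x
    · simp [RAM.encode]; omega
    · exact hS x (List.mem_of_getElem? hi)
  have hrel : Rel W (C * (S.length + 1)) S.length (start S args) (RAM.input S args) := by
    refine ⟨⟨?_, by omega, by omega⟩, rfl, rfl, ?_, ?_, ?_⟩
    · have := Nat.mul_le_mul_right (S.length + 1) hC
      omega
    · intro i
      simp only [start, RAM.input, List.getD_eq_getElem?_getD]
      rcases hi : (S.length :: args)[i]? with _ | x
      · simp; omega
      · rcases List.mem_cons.1 (List.mem_of_getElem? hi) with rfl | hx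
        · simp; omega
        · exact hargs x hx
    · intro a i
      simp only [start]
      split_ifs
      · exact hcode i
      · omega
    · intro a ha i hi
      unfold addr lim at *
      by_cases h16 : a < 16
      · rw [if_pos h16] at *
        have : S.length ≤ S.length + S.length + (16 * i + a) := by omega
        simp [start, RAM.input, show a ≠ 16 by omega, List.getElem?_eq_none this, RAM.encode]
      · rw [if_neg h16] at *
        simp [start, RAM.input, show a = 16 by omega, code]
  obtain ⟨t, s', v', h1, h2, h3, h4⟩ := h W (C * (S.length + 1)) hW' _ hrel
  refine ⟨t, s', h1, hQ v' t s'.mem h4 h2 fun i hi => ?_⟩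
  have := h3.mem 16 le_rfl i (by simpa [lim] using hi)
  simpa [addr] using this

/-- Moves the array `a` to the start of the memory. -/
def outProg (a : ℕ) : Prog := .for 90 (2 * reg 0 - 1) (.put 16 (reg 90) (load a (reg 90)))

theorem outProg_tri {W M n a : ℕ} {v : State} (ha : a < 16) :
    Tri W M n (outProg a) v (100 * (n + 1)) fun v' => ∀ s < 2 * n - 1, v'.arr 16 s = v.arr a s := by
  refine Tri.of_bounds fun hF h0 _ _ => ?_
  have hw := hF.word
  have hc : (load a (reg 90)).cost ≤ 10 := by
    simp only [Expr.cost, Expr.compile, if_pos ha, RAM.Expr.cost]; norm_num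
  refine (array_loop (N := 2 * n - 1) (T := 20) (R := {90}) (A := {16}) (by simp)
    (by norm_num) (by omega) (fun i v' => ∀ s < i, v'.arr 16 s = v.arr a s) ?_ (by simp) ?_).mono ?_ ?_
  · intro v' hf
    simp [hf.reg, h0]; omega
  · rintro i hi v' hf h90 h
    have ha16 := hf.arr a (by simp; omega)
    have ht : (Prog.put 16 (reg 90) (load a (reg 90))).time ≤ 20 := by
      show 1 + (load a (reg 90)).cost + 9 ≤ 20
      omega
    refine Tri.mono (Tri.of_wp ?_) ht fun _ h => h
    simp [Prog.wp, lim, h90, ha.le, ha, ha16, Frame.put_iff, hf]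
    refine ⟨by omega, by omega, fun s hs => ?_⟩
    split_ifs with h1
    · rw [h1]
    · exact h s (by omega)
  · have : (2 * reg 0 - 1 : VM.Expr).cost = 5 := rfl
    rw [this]
    omega
  · rintro v' ⟨-, h⟩; exact h

/-- Self-convolution of the input, into the array `7`. -/
def fullProg : Prog := preProg ;; 7 ≔ 0 ;; 8 ≔ reg 0 ;; scProg

def fullRegs : Finset ℕ := {7, 8} ∪ preRegs ∪ scRegs

theorem mem_fullRegs {r : ℕ} : r ∈ fullRegs ↔ r = 7 ∨ r = 8 ∨ r ∈ preRegs ∨ r ∈ scRegs := by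
  simp [fullRegs]

def fullTime : ℕ := 4 * preTime + scTime + 4

theorem fullTime_le (t p s n F : ℕ) (hF : n + 1 ≤ F) (ht : t = 4 * p + s + 4) :
    4 * p * (n + 1) + (2 + (2 + s * F)) ≤ t * F := by
  have := Nat.mul_le_mul_left (4 * p) hF
  rw [ht]
  linarith

theorem lt_factorCost (c : ℕ → ℕ) (lo len : ℕ) : len + 1 ≤ factorCost c lo len := by
  have h1 := two_mul_le_pow_lev len
  have h2 : 2 ≤ 2 ^ lev len := Nat.le_self_pow (by have := one_le_lev len; omega) 2
  have h3 : 2 ^ lev len * 2 ≤ thr len := Nat.mul_le_mul_left _ (by have := one_le_lev len; omega)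
  unfold factorCost
  omega

theorem fullProg_tri {W M : ℕ} (S : WString) (args : List ℕ) (hW : (S.length + 2) ^ 520 ≤ W) :
    Tri W M S.length fullProg (start S args) (fullTime * factorCost (code S) 0 S.length) fun v' =>
      Frame fullRegs (insert 2 (insert 3 scArrs)) (start S args) v' ∧ Ready W S.length v' ∧
      v'.reg 10 + v'.reg 11 = factorCost (code S) 0 S.length ∧
      ∀ s < 2 * S.length - 1, v'.arr 7 s = mism (code S) S.length s := by
  refine Tri.of_bounds fun hF h0 _ _ => ?_
  refine Tri.mono (Q := fun v' =>
      Frame fullRegs (insert 2 (insert 3 scArrs)) (start S args) v' ∧ Ready W S.length v' ∧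
      v'.reg 10 + v'.reg 11 = factorCost (code S) 0 S.length ∧
      ∀ s < 2 * S.length - 1, v'.arr 7 s = mism (code S) S.length s) ?_
    (fullTime_le fullTime preTime scTime S.length _ (lt_factorCost (code S) 0 S.length) rfl) fun _ h => h
  refine Tri.seq (preProg_tri hW) ?_
  rintro v1 ⟨f1, hR⟩
  have r0 : v1.reg 0 = S.length := by rw [f1.reg 0 (by simp [mem_preRegs]), h0]
  refine Tri.seq (R := fun w => w = v1.set 7 0) (Tri.asg (by norm_num) (by simp) (by simp)) ?_
  rintro _ rfl
  refine Tri.seq (R := fun w => w = (v1.set 7 0).set 8 S.length) (Tri.asg (by norm_num) (by simp) (by simp [r0])) ?_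
  rintro _ rfl
  have a16 : v1.arr 16 = code S := by
    rw [f1.arr 16 (by decide)]; simp [start]
  have key := scProg_tri (M := M) (lo := 0) (len := S.length) (v := (v1.set 7 0).set 8 S.length)
    (hR.of_eq (by simp) (by simp) (by simp) (by simp)) (by omega) (by simp) (by simp)
  simp only [State.set_arr, a16, zero_add] at key
  refine key.mono (by simp only [factorCost, zero_add]; exact le_rfl) ?_
  rintro v2 ⟨f2, h10, h11, h7⟩
  have f2' : Frame fullRegs (insert 2 (insert 3 scArrs)) v1 v2 :=
    Frame.trans (v' := (v1.set 7 0).set 8 S.length) (by simp [Frame.set_iff, mem_fullRegs, Frame.refl])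
      (f2.mono (fun r hr => by rw [mem_fullRegs]; exact Or.inr (Or.inr (Or.inr hr))) (by decide))
  refine ⟨(f1.mono (fun r hr => by rw [mem_fullRegs]; exact Or.inr (Or.inr (Or.inl hr))) (by decide)).trans f2',
    (hR.of_eq (v' := (v1.set 7 0).set 8 S.length) (by simp) (by simp) (by simp) (by simp)).frame f2 (by simp [mem_scRegs]) (by simp [mem_scRegs])
      (by decide) (by decide), by rw [h10, h11]; simp only [factorCost, zero_add], fun s hs => ?_⟩
  have := two_mul_le_pow_lev S.length
  exact h7 s (by omega)

/-- Counting self-convolution. -/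
def selfConvProg : Prog := fullProg ;; outProg 7

theorem selfConvProg_tri {W M : ℕ} (S : WString) (args : List ℕ) (hW : (S.length + 2) ^ 520 ≤ W) :
    Tri W M S.length selfConvProg (start S args) ((fullTime + 100) * factorCost (code S) 0 S.length) fun v' =>
      ∀ s < 2 * S.length - 1, v'.arr 16 s = mism (code S) S.length s := by
  have main : Tri W M S.length selfConvProg (start S args)
      (fullTime * factorCost (code S) 0 S.length + 100 * (S.length + 1)) fun v' =>
      ∀ s < 2 * S.length - 1, v'.arr 16 s = mism (code S) S.length s := by
    refine Tri.seq (fullProg_tri S args hW) ?_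
    rintro v1 ⟨-, -, -, h7⟩
    exact (outProg_tri (by norm_num)).imp fun v2 h s hs => (h s hs).trans (h7 s hs)
  refine main.mono ?_ fun _ h => h
  rw [add_mul]
  exact Nat.add_le_add_left (Nat.mul_le_mul_left _ (lt_factorCost _ _ _)) _

theorem selfConvProg_runsOn : ∃ C : ℕ, ∀ S : WString, selfConvProg.compile.RunsOn C S [] fun out t =>
    (∀ i : ℕ, 1 ≤ i → i ≤ 2 * S.length - 1 → out (i - 1) = cconv S S.reverse i) ∧
    (∀ A : Finset ℕ, A.Nonempty → S.Over A → (t : ℝ) ≤ C * (1 + fS A.card S.length)) := by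
  obtain ⟨K, hK⟩ : ∃ K, K = fullTime + 100 := ⟨_, rfl⟩
  refine ⟨100 * K + 520, fun S => runsOn_of_tri (by omega) (fun W M hW => selfConvProg_tri S [] hW) ?_⟩
  rw [← hK]
  intro v t out h ht ho
  refine ⟨fun i h1 h2 => ?_, fun A hA hS => ?_⟩
  · rw [cconv_reverse S h1 h2, ho _ (by omega), h _ (by omega)]
  · have h1 := factorCost_zero_le hA hS
    have h2 : (t : ℝ) ≤ K * (factorCost (code S) 0 S.length : ℝ) := by exact_mod_cast ht
    have h3 := fS_nonneg A.card S.length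
    calc (t : ℝ) ≤ K * (100 * (1 + fS A.card S.length)) := h2.trans (by gcongr)
      _ ≤ _ := by push_cast; nlinarith

end VM

/-! ### All maximal palindromes -/

namespace VM

open VM.Expr Merge Pal

/-- Root of `reg 10 + reg 11`, rounded up. -/
def rootProg : Prog := 80 ≔ 1 ;; .while (lt (reg 80 * reg 80) (reg 10 + reg 11)) (80 ≔ reg 80 + 1)

/-- The linear search takes `O(√G)` steps, negligible in the end. Since `G` is a measured cost and
not a formula in the size of the alphabet, the block length adapts to the letters that occur. -/
theorem rootProg_tri {W M n G : ℕ} {v : State} (hG : v.reg 10 + v.reg 11 = G) (hGn : G ≤ 17 * ((n + 1) * (n + 1)))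
    (hW : 512 * ((n + 1) * (n + 1)) < W) :
    Tri W M n rootProg v (20 * (Nat.sqrt G + 1)) fun v' =>
      Frame {80} ∅ v v' ∧ 1 ≤ v'.reg 80 ∧ v'.reg 80 ≤ Nat.sqrt G + 1 ∧ G ≤ v'.reg 80 * v'.reg 80 := by
  have hs : Nat.sqrt G * Nat.sqrt G ≤ G := Nat.sqrt_le G
  have hs1 : Nat.sqrt G ≤ G := Nat.sqrt_le_self G
  have hsq : (Nat.sqrt G + 1) * (Nat.sqrt G + 1) < W := by
    have : (Nat.sqrt G + 1) * (Nat.sqrt G + 1) = Nat.sqrt G * Nat.sqrt G + 2 * Nat.sqrt G + 1 := by ring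
    have h1 : 1 * 1 ≤ (n + 1) * (n + 1) := Nat.mul_le_mul (by omega) (by omega)
    omega
  have hl : Nat.sqrt G + 1 < W := lt_of_le_of_lt (Nat.le_mul_self _) hsq
  have main : Tri W M n rootProg v (2 + (∑ i ∈ Finset.range (Nat.sqrt G), (4 + (7 + 1)) + (7 + 1))) fun v' =>
      Frame {80} ∅ v v' ∧ 1 ≤ v'.reg 80 ∧ v'.reg 80 ≤ Nat.sqrt G + 1 ∧ G ≤ v'.reg 80 * v'.reg 80 := by
    refine Tri.seq (R := fun w => w = v.set 80 1) (Tri.asg (by norm_num) (by simp) (by simp)) ?_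
    rintro _ rfl
    refine Tri.while_le (e := lt (reg 80 * reg 80) (reg 10 + reg 11)) (fun i w => Frame {80} ∅ v w ∧ 1 ≤ w.reg 80 ∧ w.reg 80 + i = Nat.sqrt G + 1)
      (fun _ => 4) (Nat.sqrt G) ?_ ?_ ?_ ?_
    · exact ⟨by simp [Frame.set_iff, Frame.refl], by simp, by simp; omega⟩
    · rintro i hi w ⟨hf, h1, h2⟩
      have h3 : w.reg 80 * w.reg 80 ≤ (Nat.sqrt G + 1) * (Nat.sqrt G + 1) := Nat.mul_le_mul (by omega) (by omega)
      simp [hf.reg, hG]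
      omega
    · rintro i hi w ⟨hf, h1, h2⟩ he
      have h3 : w.reg 80 * w.reg 80 < G := by
        by_contra h; simp [hf.reg, hG] at he; exact h he
      have h4 : w.reg 80 ≤ Nat.sqrt G := Nat.le_sqrt.2 h3.le
      refine ⟨by omega, Tri.asg (by norm_num) (by simp; omega) ⟨(Frame.set_iff (by simp)).2 hf, by simp, by simp; omega⟩⟩
    · rintro i hi w ⟨hf, h1, h2⟩ he
      have h3 : ¬ (w.reg 80 * w.reg 80 < G) := by
        intro h; simp [hf.reg, hG] at he; omega
      exact ⟨hf, h1, by omega, by omega⟩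
  refine main.mono ?_ fun _ h => h
  rw [Finset.sum_const, Finset.card_range, smul_eq_mul]
  omega

/-- Register 92 counts the mismatches. As soon as there are more than `k`, the limit in register 93
is set to 0, which stops the loop. -/
def extStep : Prog :=
  95 ≔ load 16 ((reg 90 + 1) / 2 - 1 - reg 91) ;; 96 ≔ load 16 (reg 90 / 2 + 1 + reg 91) ;;
  97 ≔ (1 - eq (reg 95) 0) * ((1 - eq (reg 96) 0) * (1 - eq (reg 95) (reg 96))) ;;
  92 ≔ reg 92 + reg 97 ;; .ite (lt (reg 1) (reg 92)) (93 ≔ 0) (91 ≔ reg 91 + 1)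

def extInit : Prog :=
  91 ≔ load 8 (reg 90) ;; 92 ≔ load 9 (reg 90) ;; 93 ≔ (reg 90 + 1) / 2 ;; 94 ≔ reg 0 - 1 - reg 90 / 2 ;;
  .ite (lt (reg 94) (reg 93)) (93 ≔ reg 94) .skip

/-- Extends the palindrome with center `reg 90` step by step. -/
def extBody : Prog := extInit ;; .while (lt (reg 91) (reg 93)) extStep ;; .put 8 (reg 90) (reg 91)

def extRegs : Finset ℕ := {91, 92, 93, 94, 95, 96, 97}

theorem bad_bit (x y : ℕ) : (1 - (if x = 0 then 1 else 0)) * ((1 - (if y = 0 then 1 else 0)) *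
    (1 - if x = y then 1 else 0)) = if Bad x y then 1 else 0 := by
  by_cases hx : x = 0 <;> by_cases hy : y = 0 <;> by_cases hxy : x = y <;> simp [Bad, hx, hy, hxy]

theorem extStep_tri {W M n k s r : ℕ} {v : State} (hW : 66 * n + 64 ≤ W) (h1 : v.reg 1 = k) (h90 : v.reg 90 = s)
    (h91 : v.reg 91 = r) (h92 : v.reg 92 = half (v.arr 16) s r) (hr : r < maxRad n s) :
    Tri W M n extStep v extStep.time fun v' => Frame extRegs ∅ v v' ∧
      if k < half (v.arr 16) s (r + 1) then v'.reg 91 = r ∧ v'.reg 93 = 0 else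
        v'.reg 91 = r + 1 ∧ v'.reg 93 = v.reg 93 ∧ v'.reg 92 = half (v.arr 16) s (r + 1) := by
  have hle := half_le (v.arr 16) s r
  unfold maxRad at hr
  apply Tri.of_wp
  have hb := half_succ (v.arr 16) s r
  set x := v.arr 16 ((s + 1) / 2 - 1 - r) with hx
  set y := v.arr 16 (s / 2 + 1 + r) with hy
  have hbit := bad_bit x y
  have hbit1 : (if Bad x y then 1 else 0) ≤ 1 := by split_ifs <;> simp
  simp only [extStep, Prog.wp]
  simp [h1, h90, h91, h92, ← hx, ← hy, hbit, ← hb, lim, Frame.set_iff, extRegs, Frame.refl]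
  have hbit2 : (1 - if y = 0 then 1 else 0) * (1 - if x = y then 1 else 0) ≤ 1 := by split_ifs <;> simp
  generalize (1 - if y = 0 then 1 else 0) * (1 - if x = y then 1 else 0) = z at *
  omega

theorem extBody_tri {W M n k s D : ℕ} {v : State} (hW : 66 * n + 64 ≤ W) (h0 : v.reg 0 = n) (h1 : v.reg 1 = k)
    (h90 : v.reg 90 = s) (hs : s < 2 * n - 1) (h8 : v.arr 8 s ≤ maxRad n s)
    (h8' : half (v.arr 16) s (v.arr 8 s) ≤ k) (h9 : v.arr 9 s = half (v.arr 16) s (v.arr 8 s))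
    (hD : best (v.arr 16) n k s ≤ v.arr 8 s + D) :
    Tri W M n extBody v (extInit.time + ((D + 1) * (extStep.time + 4) + 4 + 11)) fun v' => Frame extRegs {8} v v' ∧
      v'.arr 8 s = best (v.arr 16) n k s ∧ ∀ s' ≠ s, v'.arr 8 s' = v.arr 8 s' := by
  set c := v.arr 16 with hc
  have hbest := best_le c n k s
  have hm : maxRad n s = min ((s + 1) / 2) (n - 1 - s / 2) := rfl
  refine Tri.seq (R := fun w => Frame extRegs ∅ v w ∧ w.reg 91 = v.arr 8 s ∧ w.reg 92 = v.arr 9 s ∧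
    w.reg 93 = maxRad n s) ?_ ?_
  · apply Tri.of_wp
    simp [extInit, Prog.wp, h0, h90, lim, extRegs, Frame.set_iff, Frame.refl]
    omega
  rintro w ⟨hf, h91, h92, h93⟩
  refine Tri.seq (R := fun w => Frame extRegs ∅ v w ∧ w.reg 91 = best c n k s) ?_ ?_
  -- Either the loop is still running with a valid radius, or it was stopped with the optimal one.
  -- The limit `D + 1` includes the attempt that fails.
  · refine (Tri.while_le (e := lt (reg 91) (reg 93)) (fun i w => Frame extRegs ∅ v w ∧
      ((w.reg 93 = maxRad n s ∧ w.reg 91 ≤ maxRad n s ∧ half c s (w.reg 91) ≤ k ∧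
        w.reg 92 = half c s (w.reg 91) ∧ best c n k s + 1 ≤ w.reg 91 + i) ∨
        (w.reg 93 = 0 ∧ w.reg 91 = best c n k s))) (fun _ => extStep.time) (D + 1) ?_ ?_ ?_ ?_).mono ?_ fun _ h => h
    · refine ⟨hf, Or.inl ⟨h93, by rw [h91]; exact h8, by rw [h91]; exact h8', by rw [h92, h91, h9], by omega⟩⟩
    · intro i _ w _
      simp
    · rintro i hi w ⟨hf, ⟨g1, g2, g3, g4, g5⟩ | ⟨g1, g2⟩⟩ he
      · have hlt : w.reg 91 < maxRad n s := by by_contra h; simp [g1] at he; exact h he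
        have hle := le_best g2 g3
        refine ⟨by omega, ?_⟩
        have a16 : w.arr 16 = c := hf.arr 16 (by simp)
        refine (extStep_tri (k := k) (s := s) (r := w.reg 91) hW (by rw [hf.reg 1 (by simp [extRegs]), h1])
          (by rw [hf.reg 90 (by simp [extRegs]), h90]) rfl (by rw [a16]; exact g4) hlt).imp ?_
        rintro w' ⟨hf', h⟩
        refine ⟨hf.trans hf', ?_⟩
        rw [a16] at h
        split_ifs at h with hk
        · right
          refine ⟨h.2, ?_⟩
          rw [h.1]
          exact eq_best g2 g3 fun _ => hk
        · left
          obtain ⟨h3, h4, h5⟩ := h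
          exact ⟨by rw [h4, g1], by omega, by rw [h3]; omega, by rw [h5, h3], by omega⟩
      · simp [g1] at he
    · rintro i hi w ⟨hf, ⟨g1, g2, g3, g4, g5⟩ | ⟨g1, g2⟩⟩ he
      · refine ⟨hf, eq_best g2 g3 fun h => ?_⟩
        simp [g1] at he; omega
      · exact ⟨hf, g2⟩
    · rw [Finset.sum_const, Finset.card_range, smul_eq_mul]
      exact le_rfl
  rintro w ⟨hf, h91⟩
  refine Tri.put (e := reg 90) (f := reg 91) (by simp) (by simp) (by norm_num) ?_ ?_
  · simp [lim, hf.reg, extRegs, h90]; omega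
  · refine ⟨(Frame.put_iff (by simp)).2 (hf.mono le_rfl (by simp)), by simp [hf.reg, extRegs, h90, h91], fun s' hs' => ?_⟩
    simp [hf.reg, extRegs, h90, hs', hf.arr]

def extProg : Prog := .for 90 (2 * reg 0 - 1) extBody

def extTime : ℕ := 2 * (extInit.time + extStep.time + 40)

theorem extTime_le (t a b n D : ℕ) (ht : t = 2 * (a + b + 40)) :
    (a + ((D + 1) * (b + 4) + 4 + 11) + 5 + 12) * (2 * n - 1 + 1) ≤ t * ((n + 1) * (D + 1)) := by
  have h1 : a + ((D + 1) * (b + 4) + 4 + 11) + 5 + 12 ≤ (a + b + 40) * (D + 1) := by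
    have : (a + b + 40) * (D + 1) = a * D + a + (D + 1) * (b + 4) + 36 * D + 36 := by ring
    omega
  calc _ ≤ (a + b + 40) * (D + 1) * (2 * (n + 1)) := Nat.mul_le_mul h1 (by omega)
    _ = _ := by rw [ht]; ring

theorem extProg_tri {W M n k D : ℕ} {v : State} (h1 : v.reg 1 = k) (hG : Good n k v)
    (hD : ∀ s < 2 * n - 1, best (v.arr 16) n k s ≤ v.arr 8 s + D) :
    Tri W M n extProg v (extTime * ((n + 1) * (D + 1))) fun v' => ∀ s < 2 * n - 1, v'.arr 8 s = best (v.arr 16) n k s := by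
  refine Tri.of_bounds fun hF h0 _ _ => ?_
  have hw := hF.word
  refine (array_loop (N := 2 * n - 1) (T := extInit.time + ((D + 1) * (extStep.time + 4) + 4 + 11))
    (R := insert 90 extRegs) (A := {8}) (by simp)
    (by norm_num) (by omega) (fun i v' => (∀ s < i, v'.arr 8 s = best (v.arr 16) n k s) ∧
      ∀ s, i ≤ s → v'.arr 8 s = v.arr 8 s) ?_ (by simp) ?_).mono ?_ ?_
  · intro v' hf
    simp [hf.reg, extRegs, h0]; omega
  · rintro i hi v' hf h90 ⟨h, h'⟩
    have a16 : v'.arr 16 = v.arr 16 := hf.arr 16 (by simp)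
    have a9 : v'.arr 9 = v.arr 9 := hf.arr 9 (by simp)
    have a8 := h' i le_rfl
    obtain ⟨g1, g2, g3⟩ := hG i hi
    refine (extBody_tri (D := D) (k := k) (s := i) hw (by rw [hf.reg 0 (by simp [extRegs]), h0]) (by rw [hf.reg 1 (by simp [extRegs]), h1]) h90 hi
      (by rw [a8]; exact g1) (by rw [a16, a8]; exact g2) (by rw [a16, a8, a9]; exact g3)
      (by rw [a16, a8]; exact hD i hi)).imp ?_
    rintro w ⟨fw, w8, w8'⟩
    rw [a16] at w8
    refine ⟨hf.trans (fw.mono (Finset.subset_insert _ _) le_rfl), ?_, ?_, ?_⟩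
    · rw [fw.reg 90 (by simp [extRegs]), h90]
    · intro s hs
      rw [State.set_arr]
      rcases Nat.lt_succ_iff_lt_or_eq.1 hs with h2 | rfl
      · rw [w8' s (by omega), h s h2]
      · exact w8
    · intro s hs
      rw [State.set_arr, w8' s (by omega), h' s (by omega)]
  · exact extTime_le extTime _ _ n D rfl
  · rintro v' ⟨-, h, -⟩; exact h

/-- Let `e` be the last multiple of `B` not beyond the right end of an optimal palindrome. Shrunk
around its center to end within the prefix of length `e`, it remains a `k`-palindrome and loses at
most `B`; the prefix has recorded at least this radius. -/
theorem best_le_of_covered {n k B : ℕ} {v : State} (hB : 1 ≤ B)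
    (hc : ∀ e, B ∣ e → 1 ≤ e → e ≤ n → Covered k 0 e v) (s : ℕ) :
    best (v.arr 16) n k s ≤ v.arr 8 s + B := by
  by_contra h
  have h1 := best_le (v.arr 16) n k s
  have h2 := half_best (v.arr 16) n k s
  set r := best (v.arr 16) n k s with hr
  unfold maxRad at h1
  have h3 := Nat.div_mul_le_self (s / 2 + r + 1) B
  have h4 := Nat.lt_div_mul_add (a := s / 2 + r + 1) hB
  set e := (s / 2 + r + 1) / B * B with he
  have h5 : radIn 0 e s ≤ r ∧ r ≤ radIn 0 e s + B := by unfold radIn; omega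
  have := hc e (Dvd.intro_left _ rfl) (by omega) (by omega) s (by omega) (by omega) ((half_mono _ _ h5.1).trans h2)
  omega

end VM

namespace VM

open VM.Expr Merge Pal

theorem thr_mono {a b : ℕ} (h : a ≤ b) : thr a ≤ thr b := by
  have h1 : lev a ≤ lev b := max_le_max le_rfl (Nat.clog_mono_right 2 (by omega))
  exact Nat.mul_le_mul (Nat.pow_le_pow_right (by norm_num) h1) (by omega)

theorem letterCost_mono (c : ℕ → ℕ) {a b T T' : ℕ} (h : a ≤ b) (hT : T ≤ T') : letterCost c a T ≤ letterCost c b T' := by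
  refine (Finset.sum_le_sum fun x _ => ?_).trans
    (Finset.sum_le_sum_of_subset (Finset.image_subset_image (Finset.range_subset_range.2 h)))
  unfold weight
  split_ifs
  · exact le_rfl
  · refine min_le_min (Nat.pow_le_pow_left ?_ 2) hT
    exact Finset.sum_le_sum_of_subset (Finset.range_subset_range.2 h)

/-- No prefix costs more than the whole string, so the measured `G` bounds every iteration of the
sweep. -/
theorem factorCost_mono (c : ℕ → ℕ) (lo : ℕ) {a b : ℕ} (h : a ≤ b) : factorCost c lo a ≤ factorCost c lo b :=
  Nat.add_le_add (thr_mono h) (letterCost_mono _ h (thr_mono h))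

/-- The zero arrays stand for the radius 0 without mismatches, which is valid at every center. -/
theorem good_start {S : WString} {args : List ℕ} {k : ℕ} {v : State} (h8 : v.arr 8 = (start S args).arr 8)
    (h9 : v.arr 9 = (start S args).arr 9) : Good S.length k v := by
  intro s _
  rw [h8, h9]
  simp [start, half]

/-- All maximal palindromes. -/
def radiusProg : Prog := fullProg ;; rootProg ;; 81 ≔ reg 0 + 1 ;; sweepProg ;; extProg ;; outProg 8

def radiusTime : ℕ := 5 * fullTime + 2 * sweepTime + 2 * extTime + 124

theorem sqrt_le_of_le_sq {n G : ℕ} (h : G ≤ 17 * ((n + 1) * (n + 1))) : Nat.sqrt G + 1 ≤ 5 * (n + 1) := by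
  by_contra hc
  have h1 : 5 * (n + 1) * (5 * (n + 1)) ≤ Nat.sqrt G * Nat.sqrt G := Nat.mul_le_mul (by omega) (by omega)
  have h2 : 5 * (n + 1) * (5 * (n + 1)) = 25 * ((n + 1) * (n + 1)) := by ring
  have h3 := Nat.sqrt_le G
  have h4 : 1 * 1 ≤ (n + 1) * (n + 1) := Nat.mul_le_mul (by omega) (by omega)
  omega

theorem radiusTime_le (t f s x n q G : ℕ) (hG : G ≤ (n + 1) * (n + 1) * 17) (hq : q = Nat.sqrt G)
    (ht : t = 5 * f + 2 * s + 2 * x + 124) :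
    f * G + (20 * (q + 1) + (4 + (s * ((n + 1) * (q + 1) + 1) + (x * ((n + 1) * (q + 2)) + 100 * (n + 1))))) ≤
      t * ((n + 1) * (q + 1)) := by
  have h1 := sqrt_le_of_le_sq (n := n) (G := G) (by omega)
  -- As `√G` is `O(n)`, the first convolution of cost `G` is itself within the bound `O(n √G)`.
  have h3 : G ≤ 5 * ((n + 1) * (q + 1)) := by
    have h4 : G < (Nat.sqrt G + 1) * (Nat.sqrt G + 1) := Nat.lt_succ_sqrt G
    have h5 := Nat.mul_le_mul_right (Nat.sqrt G + 1) h1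
    rw [hq]; linarith
  have e1 : 1 * (q + 1) ≤ (n + 1) * (q + 1) := Nat.mul_le_mul_right _ (by omega)
  have e2 : (n + 1) * 1 ≤ (n + 1) * (q + 1) := Nat.mul_le_mul_left _ (by omega)
  have e3 : (n + 1) * (q + 2) ≤ 2 * ((n + 1) * (q + 1)) := by linarith
  have a1 := Nat.mul_le_mul_left f h3
  have a2 := Nat.mul_le_mul_left s (show (n + 1) * (q + 1) + 1 ≤ 2 * ((n + 1) * (q + 1)) by omega)
  have a3 := Nat.mul_le_mul_left x e3
  have e4 : t * ((n + 1) * (q + 1)) = f * (5 * ((n + 1) * (q + 1))) + s * (2 * ((n + 1) * (q + 1))) +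
    x * (2 * ((n + 1) * (q + 1))) + 124 * ((n + 1) * (q + 1)) := by rw [ht]; ring
  omega

set_option exponentiation.threshold 600 in
theorem radiusProg_tri {W M : ℕ} (S : WString) (k : ℕ) (hW : (S.length + 2) ^ 520 ≤ W) :
    Tri W M S.length radiusProg (start S [k])
      (radiusTime * ((S.length + 1) * (Nat.sqrt (factorCost (code S) 0 S.length) + 1))) fun v' =>
      ∀ s < 2 * S.length - 1, v'.arr 16 s = best (code S) S.length k s := by
  set n := S.length with hn
  set G := factorCost (code S) 0 n with hG
  have hGn : G ≤ 17 * ((n + 1) * (n + 1)) := factorCost_le_sq _ _ _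
  have hq := sqrt_le_of_le_sq hGn
  refine Tri.mono (Q := fun v' => ∀ s < 2 * S.length - 1, v'.arr 16 s = best (code S) S.length k s) ?_
    (radiusTime_le radiusTime fullTime sweepTime extTime n (Nat.sqrt G) G (by omega) rfl rfl) fun _ h => h
  refine Tri.seq (fullProg_tri S [k] hW) ?_
  rintro v1 ⟨f1, hR, hG1, -⟩
  have hle := hR.le
  refine Tri.seq (rootProg_tri hG1 hGn hR.sq) ?_
  rintro v2 ⟨f2, b1, b2, b3⟩
  set B := v2.reg 80 with hB
  have f2' : Frame (insert 80 fullRegs) (insert 2 (insert 3 scArrs)) (start S [k]) v2 :=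
    (f1.mono (Finset.subset_insert _ _) le_rfl).trans (f2.mono (by simp) (by simp))
  have r0 : v2.reg 0 = n := by
    rw [f2'.reg 0 (by simp [mem_fullRegs, mem_scRegs, mem_preRegs])]; simp [start, RAM.input, hn]
  have r1 : v2.reg 1 = k := by
    rw [f2'.reg 1 (by simp [mem_fullRegs, mem_scRegs, mem_preRegs])]; simp [start, RAM.input]
  have a16 : v2.arr 16 = code S := by rw [f2'.arr 16 (by decide)]; simp [start]
  -- The window length `n + 1` makes every factor a prefix.
  refine Tri.seq (R := fun w => w = v2.set 81 (n + 1)) (Tri.asg (by norm_num) (by simp [r0]; omega) (by simp [r0])) ?_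
  rintro _ rfl
  have hR2 : Ready W n (v2.set 81 (n + 1)) := (hR.frame f2 (by simp) (by simp) (by simp) (by simp)).of_eq
    (by simp) (by simp) (by simp) (by simp)
  have hgood : Good n k (v2.set 81 (n + 1)) := good_start (args := [k]) (f2'.arr 8 (by decide)) (f2'.arr 9 (by decide))
  refine Tri.seq ((sweepProg_tri (k := k) (B := B) (Y := n + 1) (G := G) hR2 (by simp [r1]) (by simp [hB]) (by simp)
    b1 (by omega) (by omega) hgood ?_).mono ?_ fun _ h => h) ?_
  · intro e _ he
    rw [State.set_arr, a16, show e - (n + 1) = 0 by omega]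
    exact factorCost_mono _ _ (by omega)
  · refine Nat.mul_le_mul_left _ (Nat.add_le_add_right ?_ 1)
    -- Balance: `G ≤ B ^ 2` turns the cost of the sweep into `n B`, the same order as that of the
    -- extensions.
    calc n / B * G ≤ n / B * (B * B) := Nat.mul_le_mul_left _ b3
      _ = n / B * B * B := by ring
      _ ≤ (n + 1) * (Nat.sqrt G + 1) := Nat.mul_le_mul ((Nat.div_mul_le_self _ _).trans (by omega)) b2
  rintro v3 ⟨f3, hG3, -, hc⟩
  have a16' : v3.arr 16 = code S := by rw [f3.arr 16 (by decide), State.set_arr, a16]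
  have r1' : v3.reg 1 = k := by rw [f3.reg 1 (by simp [mem_sweepRegs, mem_scRegs])]; simp [r1]
  refine Tri.seq (R := fun w => ∀ s < 2 * n - 1, w.arr 8 s = best (code S) n k s) ?_ ?_
  · have := extProg_tri (W := W) (M := M) (D := Nat.sqrt G + 1) r1' hG3 fun s _ =>
      (best_le_of_covered b1 (fun e h1 h2 h3 => by have := hc e h1 h2 h3; rwa [show e - (n + 1) = 0 by omega] at this) s).trans
        (by omega)
    rw [a16'] at this
    exact this
  · intro w hw
    exact (outProg_tri (by norm_num)).imp fun v h s hs => (h s hs).trans (hw s hs)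

end VM

/-! ### Approximation of the maximal palindromes -/

namespace VM

open VM.Expr Merge Pal

/-- Register 98 becomes `q = 2 (min (b / a) n + 1)`. The cap at `n` keeps `q` a word however small
the fraction is; at the cap the output is exact, as a relative error below `1 / n` leaves no room
for an integer. -/
def approxInit : Prog :=
  98 ≔ reg 3 / reg 2 ;; .ite (lt (reg 0) (reg 98)) (98 ≔ reg 0) .skip ;; 98 ≔ 2 * (reg 98 + 1) ;; 99 ≔ 1

def approxStepInit : Prog :=
  80 ≔ reg 99 / reg 98 ;; .ite (reg 80) .skip (80 ≔ 1) ;; 81 ≔ 4 * reg 99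

def approxStep : Prog := approxStepInit ;; sweepProg ;; 99 ≔ reg 99 + reg 99

/-- Radii within a factor `1 + 1 / (reg 98 - 1)` of the largest ones. -/
def approxProg : Prog :=
  preProg ;; approxInit ;; .while (lt (reg 99) (reg 0 + 1)) approxStep ;; outProg 8

def approxRegs : Finset ℕ := {80, 81, 99} ∪ sweepRegs

theorem mem_approxRegs {r : ℕ} : r ∈ approxRegs ↔ r = 80 ∨ r = 81 ∨ r = 99 ∨ r ∈ sweepRegs := by
  simp [approxRegs]

/-- A palindrome of radius below `2 m` has length at most `4 m - 1`, so its shrunken copy fits into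
the window ending at `e`. The loss is at most `B - 1`, hence none for `B = 1`. -/
theorem best_le_of_covered_scale {n k B m : ℕ} {v : State} (hB : 1 ≤ B)
    (hc : ∀ e, B ∣ e → 1 ≤ e → e ≤ n → Covered k (e - 4 * m) e v) (s : ℕ)
    (h2 : best (v.arr 16) n k s < 2 * m) : best (v.arr 16) n k s + 1 ≤ v.arr 8 s + B := by
  by_contra h
  have h3 := best_le (v.arr 16) n k s
  have h4 := half_best (v.arr 16) n k s
  set r := best (v.arr 16) n k s with hr
  unfold maxRad at h3
  have h5 := Nat.div_mul_le_self (s / 2 + r + 1) B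
  have h6 := Nat.lt_div_mul_add (a := s / 2 + r + 1) hB
  set e := (s / 2 + r + 1) / B * B with he
  have h7 : radIn (e - 4 * m) e s ≤ r ∧ r + 1 ≤ radIn (e - 4 * m) e s + B := by unfold radIn; omega
  have := hc e (Dvd.intro_left _ rfl) (by omega) (by omega) s (by omega) (by omega) ((half_mono _ _ h7.1).trans h4)
  omega

/-- A bound for the cost per character of the factors. -/
def unitCost (c : ℕ → ℕ) (n : ℕ) : ℕ :=
  (Finset.range n ×ˢ Finset.Icc 1 n).sup (fun p => factorCost c p.1 p.2 / p.2) + 1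

theorem factorCost_le_unitCost (c : ℕ → ℕ) {n lo len : ℕ} (h : lo < n) (h1 : 1 ≤ len) (h2 : len ≤ n) :
    factorCost c lo len ≤ len * unitCost c n := by
  have h3 : factorCost c lo len / len ≤ (Finset.range n ×ˢ Finset.Icc 1 n).sup (fun p => factorCost c p.1 p.2 / p.2) :=
    Finset.le_sup (f := fun p : ℕ × ℕ => factorCost c p.1 p.2 / p.2) (b := (lo, len)) (by simp; omega)
  exact ((Nat.lt_mul_div_succ _ h1).le).trans (Nat.mul_le_mul_left _ (Nat.succ_le_succ h3))

/-- The factor `q` bounds the relative error of the array `8` from `2 ^ j` on. -/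
def Near (n k q j : ℕ) (v : State) : Prop :=
  ∀ s, best (v.arr 16) n k s < 2 ^ j → q * best (v.arr 16) n k s ≤ q * v.arr 8 s + best (v.arr 16) n k s

/-- Radii from `m` to `2 m` lose at most `B - 1 ≤ m / q`, a relative error of at most `1 / q`.
Smaller radii were served by earlier scales and recorded radii never decrease. As `m ≤ 2 q B`, the
`n / B` windows of length `4 m` have total length at most `8 q n`. -/
theorem approxStep_tri {W M n k q j H : ℕ} {v : State} (hR : Ready W n v) (h1 : v.reg 1 = k) (h98 : v.reg 98 = q)
    (h99 : v.reg 99 = 2 ^ j) (hj : 2 ^ j ≤ n) (hq : 1 ≤ q) (hG : Good n k v) (hN : Near n k q j v)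
    (hH : unitCost (v.arr 16) n = H) :
    Tri W M n approxStep v (approxStepInit.time + (sweepTime * (8 * (q * (n * H)) + 1) + 4)) fun v' =>
      Frame approxRegs sweepArrs v v' ∧ v'.reg 99 = 2 ^ (j + 1) ∧ Good n k v' ∧ Near n k q (j + 1) v' := by
  have hle := hR.le
  set m := 2 ^ j with hm
  have hm1 : 1 ≤ m := Nat.one_le_two_pow
  obtain ⟨B, hB⟩ : ∃ B, B = if m / q = 0 then 1 else m / q := ⟨_, rfl⟩
  have hmq : m / q ≤ m := Nat.div_le_self _ _
  have hB1 : 1 ≤ B := by rw [hB]; generalize m / q = z; split_ifs <;> omega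
  have hBm : B ≤ m := by rw [hB]; split_ifs <;> omega
  have hqB : q * (B - 1) ≤ m := by
    have := Nat.mul_div_le m q
    rw [hB]; split_ifs
    · simp
    · exact (Nat.mul_le_mul_left q (Nat.sub_le _ _)).trans this
  have hmB : m ≤ 2 * (q * B) := by
    have h1 : m < q * (m / q + 1) := Nat.lt_mul_div_succ m hq
    have h2 : q * (m / q + 1) ≤ q * (2 * B) := Nat.mul_le_mul_left _ (by rw [hB]; generalize m / q = z; split_ifs <;> omega)
    have h3 : q * (2 * B) = 2 * (q * B) := by ring
    omega
  refine Tri.seq (R := fun w => w = (v.set 80 B).set 81 (4 * m) ∨ w = ((v.set 80 (m / q)).set 80 B).set 81 (4 * m)) ?_ ?_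
  · apply Tri.of_wp
    by_cases h0 : m / q = 0
    · simp [approxStepInit, Prog.wp, h98, h99, h0, hB]
      omega
    · simp [approxStepInit, Prog.wp, h98, h99, h0, hB]
      omega
  intro w hw
  have hw' : w = (v.set 80 B).set 81 (4 * m) := by
    rcases hw with h | h
    · exact h
    · rw [h]; simp [State.set]
  subst hw'
  refine Tri.seq ((sweepProg_tri (v := (v.set 80 B).set 81 (4 * m)) (k := k) (B := B) (Y := 4 * m) (G := 4 * m * H) (hR.of_eq (by simp) (by simp) (by simp) (by simp))
    (by simp [h1]) (by simp) (by simp) hB1 (by omega) (by omega) hG ?_).mono ?_ fun _ h => h) ?_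
  · intro e h2 h3
    rw [State.set_arr, State.set_arr]
    refine (factorCost_le_unitCost (v.arr 16) (n := n) (by omega) (by omega) (by omega)).trans ?_
    rw [hH]
    exact Nat.mul_le_mul_right _ (by omega)
  · refine Nat.mul_le_mul_left _ (Nat.add_le_add_right ?_ 1)
    calc n / B * (4 * m * H) ≤ n / B * (4 * (2 * (q * B)) * H) :=
          Nat.mul_le_mul_left _ (Nat.mul_le_mul_right _ (Nat.mul_le_mul_left _ hmB))
      _ = 8 * (q * (n / B * B * H)) := by ring
      _ ≤ 8 * (q * (n * H)) :=
          Nat.mul_le_mul_left _ (Nat.mul_le_mul_left _ (Nat.mul_le_mul_right _ (Nat.div_mul_le_self _ _)))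
  rintro w ⟨hf, hGw, hm8, hc⟩
  have a16 : w.arr 16 = v.arr 16 := by rw [hf.arr 16 (by decide)]; simp
  have w99 : w.reg 99 = m := by rw [hf.reg 99 (by simp [mem_sweepRegs, mem_scRegs])]; simp [h99]
  have hf' : Frame approxRegs sweepArrs v w :=
    Frame.trans (v' := (v.set 80 B).set 81 (4 * m)) (by simp [Frame.set_iff, mem_approxRegs, Frame.refl])
      (hf.mono (fun r hr => by rw [mem_approxRegs]; exact Or.inr (Or.inr (Or.inr hr))) le_rfl)
  have hNw : Near n k q (j + 1) w := by
    intro s hs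
    rcases lt_or_ge (best (w.arr 16) n k s) m with h | h
    · rw [a16] at h ⊢
      exact (hN s h).trans (Nat.add_le_add_right (Nat.mul_le_mul_left _ (hm8 s)) _)
    · have h5 := best_le_of_covered_scale hB1 hc s (by rw [pow_succ] at hs; omega)
      calc q * best (w.arr 16) n k s ≤ q * (w.arr 8 s + (B - 1)) := Nat.mul_le_mul_left _ (by omega)
        _ = q * w.arr 8 s + q * (B - 1) := by ring
        _ ≤ _ := Nat.add_le_add_left (hqB.trans h) _
  refine Tri.asg (e := reg 99 + reg 99) (by norm_num) ?_ ⟨?_, ?_, hGw, hNw⟩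
  · simp [w99]; omega
  · exact (Frame.set_iff (by simp [mem_approxRegs])).2 hf'
  · simp [w99, hm]; ring

def approxTime : ℕ := 4 * preTime + approxInit.time + approxStepInit.time + 9 * sweepTime + 200

theorem approxTime_le (t p i c s l q n H : ℕ) (hq : 1 ≤ q) (hH : 1 ≤ H) (ht : t = 4 * p + i + c + 9 * s + 200) :
    4 * p * (n + 1) + (i + ((l + 1) * (c + (s * (8 * (q * (n * H)) + 1) + 4) + (5 + 1)) + (5 + 1) + 100 * (n + 1))) ≤
      t * ((l + 1) * (q * ((n + 1) * H))) := by
  set Z := q * ((n + 1) * H) with hZ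
  have h1 : n + 1 ≤ Z := by
    calc n + 1 = 1 * ((n + 1) * 1) := by ring
      _ ≤ Z := Nat.mul_le_mul hq (Nat.mul_le_mul_left _ hH)
  have h2 : Z ≤ (l + 1) * Z := Nat.le_mul_of_pos_left _ (by omega)
  have h3 : q * (n * H) ≤ Z := Nat.mul_le_mul_left _ (Nat.mul_le_mul_right _ (by omega))
  have h4 : c + (s * (8 * (q * (n * H)) + 1) + 4) + (5 + 1) ≤ (c + 9 * s + 10) * Z := by
    have a1 := Nat.mul_le_mul_left s (show 8 * (q * (n * H)) + 1 ≤ 9 * Z by omega)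
    have a2 : (c + 9 * s + 10) * Z = c * Z + s * (9 * Z) + 10 * Z := by ring
    have a3 : c * 1 ≤ c * Z := Nat.mul_le_mul_left _ (by omega)
    omega
  have h5 := Nat.mul_le_mul_left (l + 1) h4
  have h6 : (l + 1) * ((c + 9 * s + 10) * Z) = (c + 9 * s + 10) * ((l + 1) * Z) := by ring
  have h7 := Nat.mul_le_mul_left (4 * p) (h1.trans h2)
  have h8 : i * 1 ≤ i * ((l + 1) * Z) := Nat.mul_le_mul_left _ (by omega)
  have h9 : t * ((l + 1) * Z) = 4 * p * ((l + 1) * Z) + i * ((l + 1) * Z) + (c + 9 * s + 10) * ((l + 1) * Z) +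
    190 * ((l + 1) * Z) := by rw [ht]; ring
  omega

set_option exponentiation.threshold 600 in
theorem approxProg_tri {W M : ℕ} (S : WString) (k a b : ℕ) (hW : (S.length + 2) ^ 520 ≤ W) {q : ℕ}
    (hq : q = 2 * (min (b / a) S.length + 1)) :
    Tri W M S.length approxProg (start S [k, a, b])
      (approxTime * ((Nat.log 2 S.length + 1) * (q * ((S.length + 1) * unitCost (code S) S.length)))) fun v' =>
      ∀ s < 2 * S.length - 1, v'.arr 16 s ≤ best (code S) S.length k s ∧
        q * best (code S) S.length k s ≤ q * v'.arr 16 s + best (code S) S.length k s := by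
  set n := S.length with hn
  set H := unitCost (code S) n with hH
  have hq1 : 1 ≤ q := by rw [hq]; exact Nat.mul_pos (by norm_num) (Nat.succ_pos _)
  refine Tri.mono (Q := fun v' => ∀ s < 2 * n - 1, v'.arr 16 s ≤ best (code S) n k s ∧
        q * best (code S) n k s ≤ q * v'.arr 16 s + best (code S) n k s) ?_
    (approxTime_le approxTime preTime approxInit.time approxStepInit.time sweepTime (Nat.log 2 n) q n H hq1
      (by rw [hH]; exact Nat.le_add_left _ _) rfl) fun _ h => h
  refine Tri.seq (preProg_tri hW) ?_
  rintro v1 ⟨f1, hR⟩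
  have hle := hR.le
  have r0 : v1.reg 0 = n := by rw [f1.reg 0 (by simp [mem_preRegs])]; simp [start, RAM.input, hn]
  have r1 : v1.reg 1 = k := by rw [f1.reg 1 (by simp [mem_preRegs])]; simp [start, RAM.input]
  have r2 : v1.reg 2 = a := by rw [f1.reg 2 (by simp [mem_preRegs])]; simp [start, RAM.input]
  have r3 : v1.reg 3 = b := by rw [f1.reg 3 (by simp [mem_preRegs])]; simp [start, RAM.input]
  have a16 : v1.arr 16 = code S := by rw [f1.arr 16 (by decide)]; simp [start]
  have hgood : Good n k v1 := good_start (args := [k, a, b]) (f1.arr 8 (by decide)) (f1.arr 9 (by decide))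
  refine Tri.seq (R := fun w => Frame {98, 99} ∅ v1 w ∧ w.reg 98 = q ∧ w.reg 99 = 1) ?_ ?_
  · apply Tri.of_wp
    simp [approxInit, Prog.wp, r0, r2, r3, Frame.set_iff, Frame.refl, hq]
    constructor
    · intro h; omega
    · intro h; generalize b / a = z at *; omega
  rintro v2 ⟨f2, h98, h99⟩
  refine Tri.seq (R := fun w => w.arr 16 = code S ∧ Good n k w ∧ ∀ s, q * best (code S) n k s ≤ q * w.arr 8 s + best (code S) n k s) ?_ ?_
  · refine (Tri.while_le (e := lt (reg 99) (reg 0 + 1)) (fun i w => ∃ j, j + i = Nat.log 2 n + 1 ∧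
      Frame approxRegs sweepArrs v2 w ∧ w.reg 99 = 2 ^ j ∧ Good n k w ∧ Near n k q j w)
      (fun _ => approxStepInit.time + (sweepTime * (8 * (q * (n * H)) + 1) + 4)) (Nat.log 2 n + 1) ?_ ?_ ?_ ?_).mono ?_ fun _ h => h
    -- The scales start at `j = 0`, where only the radius 0 is concerned and nothing has to be
    -- found.
    · refine ⟨0, by omega, Frame.refl _ _ _, by simp [h99], ?_, ?_⟩
      · intro s hs
        rw [f2.arr 8 (by simp), f2.arr 9 (by simp), f2.arr 16 (by simp)]; exact hgood s hs
      · intro s hs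
        rw [show best (v2.arr 16) n k s = 0 by simpa using hs]; simp
    · rintro i hi w ⟨j, hj, hf, -⟩
      simp [hf.reg, mem_approxRegs, mem_sweepRegs, mem_scRegs, f2.reg, r0]
      omega
    · rintro i hi w ⟨j, hj, hf, w99, hG, hN⟩ he
      have w0 : w.reg 0 = n := by
        rw [hf.reg 0 (by simp [mem_approxRegs, mem_sweepRegs, mem_scRegs]), f2.reg 0 (by simp), r0]
      have hjn : 2 ^ j ≤ n := by by_contra h; simp [w0, w99] at he; omega
      have hjl : j ≤ Nat.log 2 n := Nat.le_log_of_pow_le (by norm_num) hjn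
      refine ⟨by omega, (approxStep_tri (q := q) (H := H) ((hR.frame f2 (by simp) (by simp) (by simp) (by simp)).frame hf
        (by simp [mem_approxRegs, mem_sweepRegs, mem_scRegs]) (by simp [mem_approxRegs, mem_sweepRegs, mem_scRegs])
        (by decide) (by decide)) ?_ ?_ w99 hjn hq1 hG hN ?_).imp ?_⟩
      · rw [hf.reg 1 (by simp [mem_approxRegs, mem_sweepRegs, mem_scRegs]), f2.reg 1 (by simp), r1]
      · rw [hf.reg 98 (by simp [mem_approxRegs, mem_sweepRegs, mem_scRegs]), h98]
      · rw [hf.arr 16 (by decide), f2.arr 16 (by simp), a16]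
      · rintro w' ⟨g1, g2, g3, g4⟩
        exact ⟨j + 1, by omega, hf.trans g1, g2, g3, g4⟩
    · rintro i hi w ⟨j, hj, hf, w99, hG, hN⟩ he
      have w0 : w.reg 0 = n := by
        rw [hf.reg 0 (by simp [mem_approxRegs, mem_sweepRegs, mem_scRegs]), f2.reg 0 (by simp), r0]
      have hjn : n < 2 ^ j := by by_contra h; simp [w0, w99] at he; omega
      have w16 : w.arr 16 = code S := by rw [hf.arr 16 (by decide), f2.arr 16 (by simp), a16]
      refine ⟨w16, hG, fun s => ?_⟩
      have := hN s
      rw [w16] at this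
      refine this ?_
      have := best_le (code S) n k s
      unfold maxRad at this
      omega
    · rw [Finset.sum_const, Finset.card_range, smul_eq_mul]
      exact le_rfl
  · rintro w ⟨w16, hG, hN⟩
    refine (outProg_tri (by norm_num)).imp fun v h s hs => ?_
    obtain ⟨g1, g2, -⟩ := hG s hs
    rw [w16] at g2
    rw [h s hs]
    exact ⟨le_best g1 g2, hN s⟩

end VM

/-! ### Running times -/

namespace VM

open Merge Pal

theorem sqrt_factorCost_le {S : WString} {A : Finset ℕ} (hA : A.Nonempty) (hS : S.Over A) (hn : 2 ≤ S.length) :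
    (((S.length + 1) * (Nat.sqrt (factorCost (code S) 0 S.length) + 1) : ℕ) : ℝ) ≤
      22 * (S.length * √(fS A.card S.length)) := by
  set n := S.length
  have h1 := one_le_fS hA.card_pos hn
  have h2 : (factorCost (code S) 0 n : ℝ) ≤ 10 ^ 2 * fS A.card n := by
    refine (factorCost_le hA hS hn (by omega) le_rfl 0).trans_eq ?_
    rw [fS]; norm_num
  have h3 : (Nat.sqrt (factorCost (code S) 0 n) : ℝ) ≤ 10 * √(fS A.card n) := by
    refine Real.nat_sqrt_le_real_sqrt.trans ((Real.sqrt_le_sqrt h2).trans_eq ?_)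
    rw [Real.sqrt_mul (by norm_num), Real.sqrt_sq (by norm_num)]
  have h4 : 1 ≤ √(fS A.card n) := Real.one_le_sqrt.2 h1
  have hn' : (2 : ℝ) ≤ n := by exact_mod_cast hn
  push_cast
  calc ((n : ℝ) + 1) * (Nat.sqrt (factorCost (code S) 0 n) + 1) ≤ (2 * n) * (11 * √(fS A.card n)) := by
        gcongr <;> linarith
    _ = _ := by ring

theorem sqrt_factorCost_le_of_lt {S : WString} (hn : S.length < 2) :
    (S.length + 1) * (Nat.sqrt (factorCost (code S) 0 S.length) + 1) ≤ 20 := by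
  have h := sqrt_le_of_le_sq (factorCost_le_sq (code S) 0 S.length)
  calc _ ≤ 2 * 10 := Nat.mul_le_mul (by omega) (by omega)
    _ = 20 := rfl

/-- The letters of a string, and the letter `0`. -/
def letters (S : WString) : Finset ℕ := insert 0 (S.reduceOption).toFinset

theorem letters_nonempty (S : WString) : (letters S).Nonempty := Finset.insert_nonempty _ _

theorem over_letters (S : WString) : S.Over (letters S) := fun a ha => by
  simp [letters, List.reduceOption_mem_iff, ha]

theorem fS_le_mul_sqrt (σ n : ℕ) : fS σ n ≤ n * √(n * Real.log n) := by
  unfold fS; gcongr; exact min_le_right _ _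

theorem fS_le_mul_log (σ n : ℕ) : fS σ n ≤ σ * (n * Real.log n) := by
  have : fS σ n ≤ n * (σ * Real.log n) := by unfold fS; gcongr; exact min_le_left _ _
  linarith

theorem mul_sqrt_sqrt {x y : ℝ} (hx : 0 ≤ x) (hy : 0 ≤ y) :
    x * √(x * √(x * y)) = x ^ (7 / 4 : ℝ) * y ^ (1 / 4 : ℝ) := by
  have h1 : √(x * √(x * y)) = x ^ (3 / 4 : ℝ) * y ^ (1 / 4 : ℝ) := by
    rw [Real.sqrt_eq_rpow, Real.sqrt_eq_rpow, Real.mul_rpow hx (by positivity), Real.mul_rpow hx hy,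
      Real.mul_rpow (by positivity) (by positivity), ← Real.rpow_mul hx, ← Real.rpow_mul hy, ← mul_assoc,
      ← Real.rpow_add_of_nonneg hx (by norm_num) (by norm_num)]
    norm_num
  rw [h1, ← mul_assoc]
  congr 1
  nth_rewrite 1 [← Real.rpow_one x]
  rw [← Real.rpow_add_of_nonneg hx (by norm_num) (by norm_num)]
  norm_num

theorem radiusProg_runsOn : ∃ (C : ℕ) (D : ℕ → ℕ), ∀ (S : WString) (k : ℕ),
    radiusProg.compile.RunsOn C S [k] fun out t =>
      (∀ c : ℕ, c < 2 * S.length - 1 → IsMaxRadius S k c (out c)) ∧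
      (∀ A : Finset ℕ, A.Nonempty → S.Over A →
        (t : ℝ) ≤ C * (1 + S.length * Real.sqrt (fS A.card S.length))) ∧
      (t : ℝ) ≤ C * (1 + (S.length : ℝ) ^ (7 / 4 : ℝ) *
        Real.log S.length ^ (1 / 4 : ℝ)) ∧
      (∀ A : Finset ℕ, A.Nonempty → S.Over A →
        (t : ℝ) ≤ D A.card *
          (1 + S.length * Real.sqrt (S.length * Real.log S.length))) := by
  obtain ⟨K, hK⟩ : ∃ K, K = radiusTime := ⟨_, rfl⟩
  -- The 22 comes from `sqrt_factorCost_le` and the 520 from the word size. For a fixed alphabet,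
  -- `√σ ≤ σ + 1` is taken out of the root.
  refine ⟨22 * K + 520, fun σ => 22 * K * (σ + 1), fun S k =>
    runsOn_of_tri (by omega) (fun W M hW => radiusProg_tri S k hW) ?_⟩
  rw [← hK]
  intro v t out h ht ho
  set n := S.length with hn
  have hlog := Real.log_natCast_nonneg n
  have key : ∀ A : Finset ℕ, A.Nonempty → S.Over A → (t : ℝ) ≤ 22 * K * (1 + n * √(fS A.card n)) := by
    intro A hA hS
    have h1 : (((n + 1) * (Nat.sqrt (factorCost (code S) 0 n) + 1) : ℕ) : ℝ) ≤ 22 * (1 + n * √(fS A.card n)) := by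
      have h0 : 0 ≤ n * √(fS A.card n) := by positivity
      rcases lt_or_ge n 2 with h | h
      · have : (((n + 1) * (Nat.sqrt (factorCost (code S) 0 n) + 1) : ℕ) : ℝ) ≤ 20 := by
          exact_mod_cast sqrt_factorCost_le_of_lt h
        linarith
      · have := sqrt_factorCost_le hA hS h
        linarith
    calc (t : ℝ) ≤ K * (((n + 1) * (Nat.sqrt (factorCost (code S) 0 n) + 1) : ℕ) : ℝ) := by exact_mod_cast ht
      _ ≤ K * (22 * (1 + n * √(fS A.card n))) := by gcongr
      _ = _ := by ring
  have hC : ∀ x : ℝ, 0 ≤ x → 22 * K * (1 + x) ≤ ((22 * K + 520 : ℕ) : ℝ) * (1 + x) := fun x hx => by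
    push_cast; nlinarith
  refine ⟨fun c hc => ?_, fun A hA hS => ?_, ?_, fun A hA hS => ?_⟩
  · rw [ho c (by omega), h c hc]
    exact isMaxRadius_best S k hc
  · exact (key A hA hS).trans (hC _ (by positivity))
  -- For a bound free of the alphabet, the set of letters that occur is used, with the square root
  -- branch of the minimum.
  · refine ((key _ (letters_nonempty S) (over_letters S)).trans ?_).trans (hC _ (by positivity))
    rw [← mul_sqrt_sqrt (by positivity) hlog]
    gcongr
    exact fS_le_mul_sqrt _ _
  · refine (key A hA hS).trans ?_
    have h1 : √(fS A.card n) ≤ (A.card + 1) * √(n * Real.log n) := by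
      rw [Real.sqrt_le_left (by positivity), mul_pow, Real.sq_sqrt (by positivity)]
      refine (fS_le_mul_log _ _).trans ?_
      have h0 : 0 ≤ n * Real.log n := by positivity
      have : (A.card : ℝ) ≤ (A.card + 1) ^ 2 := by nlinarith [(Nat.cast_nonneg A.card : (0 : ℝ) ≤ A.card)]
      gcongr
    have h2 : 1 + n * √(fS A.card n) ≤ (A.card + 1) * (1 + n * √(n * Real.log n)) := by
      have h3 : n * √(fS A.card n) ≤ n * ((A.card + 1) * √(n * Real.log n)) := by gcongr
      have h4 : (0 : ℝ) ≤ A.card := by positivity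
      linarith
    calc 22 * K * (1 + n * √(fS A.card n)) ≤ 22 * K * ((A.card + 1) * (1 + n * √(n * Real.log n))) := by gcongr
      _ = _ := by push_cast; ring

/-- By `factorCost_le` the cost per character is at most `100 g` for every window. Rounding up is
absorbed because `g ≥ 1 / 2`. -/
theorem unitCost_le {S : WString} {A : Finset ℕ} (hA : A.Nonempty) (hS : S.Over A) (hn : 2 ≤ S.length) :
    (((S.length + 1) * unitCost (code S) S.length : ℕ) : ℝ) ≤ 204 * fS A.card S.length := by
  set n := S.length
  set g := min (A.card * Real.log n) √(n * Real.log n) with hg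
  have h1 := one_le_fS hA.card_pos hn
  have hn' : (2 : ℝ) ≤ n := by exact_mod_cast hn
  have hlog := Real.log_natCast_nonneg n
  have hg0 : 0 ≤ g := by positivity
  have h2 : (Finset.range n ×ˢ Finset.Icc 1 n).sup (fun p => factorCost (code S) p.1 p.2 / p.2) ≤ ⌊100 * g⌋₊ := by
    refine Finset.sup_le fun p hp => ?_
    simp only [Finset.mem_product, Finset.mem_range, Finset.mem_Icc] at hp
    refine Nat.le_floor (Nat.cast_div_le.trans ?_)
    have h0 : (0 : ℝ) < p.2 := by exact_mod_cast hp.2.1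
    rw [div_le_iff₀ h0]
    refine (factorCost_le hA hS hn hp.2.1 hp.2.2 p.1).trans_eq ?_
    rw [← hg]; ring
  have h3 : (unitCost (code S) n : ℝ) ≤ 100 * g + 1 := by
    unfold unitCost
    push_cast
    have : (((Finset.range n ×ˢ Finset.Icc 1 n).sup (fun p => factorCost (code S) p.1 p.2 / p.2) : ℕ) : ℝ) ≤ ⌊100 * g⌋₊ := by
      exact_mod_cast h2
    have := Nat.floor_le (show 0 ≤ 100 * g by positivity)
    linarith
  have h4 : fS A.card n = n * g := rfl
  push_cast
  calc ((n : ℝ) + 1) * unitCost (code S) n ≤ (2 * n) * (100 * g + 1) := by gcongr; linarith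
    _ ≤ (2 * n) * (102 * g) := by
        have := one_half_le_min hA.card_pos hn
        gcongr; linarith
    _ = 204 * fS A.card n := by rw [h4]; ring

theorem unitCost_le_of_lt {S : WString} (hn : S.length < 2) : (S.length + 1) * unitCost (code S) S.length ≤ 138 := by
  have h : unitCost (code S) S.length ≤ 69 := by
    refine Nat.succ_le_succ (Finset.sup_le fun p hp => ?_)
    simp only [Finset.mem_product, Finset.mem_range, Finset.mem_Icc] at hp
    have h1 := factorCost_le_sq (code S) p.1 p.2
    have h2 : p.2 = 1 := by omega
    rw [h2] at h1 ⊢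
    omega
  calc _ ≤ 2 * 69 := Nat.mul_le_mul (by omega) h
    _ = 138 := rfl

theorem log_succ_le {n : ℕ} (hn : 2 ≤ n) : ((Nat.log 2 n + 1 : ℕ) : ℝ) ≤ 3 * Real.log n := by
  have h1 : 2 ^ (Nat.log 2 n + 1) ≤ n ^ 2 := by
    have h2 : 2 ^ Nat.log 2 n ≤ n := Nat.pow_log_le_self 2 (by omega)
    calc 2 ^ (Nat.log 2 n + 1) = 2 ^ Nat.log 2 n * 2 := pow_succ _ _
      _ ≤ n * n := Nat.mul_le_mul h2 hn
      _ = n ^ 2 := (sq n).symm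
  have h2 : ((Nat.log 2 n + 1 : ℕ) : ℝ) * Real.log 2 ≤ 2 * Real.log n := by
    rw [← Real.log_pow, show (2 : ℝ) * Real.log n = (2 : ℕ) * Real.log n by norm_num, ← Real.log_pow]
    exact Real.log_le_log (by positivity) (by exact_mod_cast h1)
  have h3 := Real.log_two_gt_d9
  have h4 : (0 : ℝ) ≤ ((Nat.log 2 n + 1 : ℕ) : ℝ) := by positivity
  nlinarith

/-- The relative error of the approximation. -/
theorem le_of_near {a b n q r o : ℕ} (ha : 0 < a) (hb : 0 < b) (hq : q = 2 * (min (b / a) n + 1)) (hr : r ≤ n)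
    (h : q * r ≤ q * o + r) (ho : o ≤ r) : (r : ℝ) ≤ (1 + (a : ℝ) / b) * o := by
  have ho' : (0 : ℝ) ≤ o := by positivity
  rcases le_total (b / a) n with hn | hn
  · rw [min_eq_left hn] at hq
    have h1 : (b : ℝ) < a * ((b / a : ℕ) + 1) := by exact_mod_cast Nat.lt_mul_div_succ b ha
    have h2 : (q : ℝ) = 2 * ((b / a : ℕ) + 1) := by rw [hq]; push_cast; ring
    have h3 : (q : ℝ) * r ≤ q * o + r := by exact_mod_cast h
    have h4 : (0 : ℝ) ≤ (b / a : ℕ) := by positivity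
    have h5 : (0 : ℝ) ≤ r - o := by
      have : (o : ℝ) ≤ r := by exact_mod_cast ho
      linarith
    have hb' : (0 : ℝ) < b := by exact_mod_cast hb
    have ha' : (0 : ℝ) < a := by exact_mod_cast ha
    rw [h2] at h3
    -- The hypothesis says `(q - 1) (r - o) ≤ o`, where `q - 1 = 2 ⌊b / a⌋ + 1` is at least `b / a`.
    have h6 : (b : ℝ) * (r - o) ≤ a * o := by
      calc (b : ℝ) * (r - o) ≤ (a * (2 * (b / a : ℕ) + 1)) * (r - o) :=
            mul_le_mul_of_nonneg_right (by nlinarith) h5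
        _ = a * ((2 * (b / a : ℕ) + 1) * (r - o)) := by ring
        _ ≤ a * o := by gcongr; linarith
    have h7 : (r : ℝ) - o ≤ a * o / b := by rw [le_div_iff₀ hb']; linarith
    calc (r : ℝ) ≤ o + a * o / b := by linarith
      _ = _ := by ring
  · rw [min_eq_right hn] at hq
    -- Here `q = 2 (n + 1) > r`, so a difference of one unit would already violate the hypothesis.
    have : r = o := by
      by_contra hne
      have h1 : q * (o + 1) ≤ q * r := Nat.mul_le_mul_left _ (by omega)
      rw [mul_add, mul_one] at h1
      omega
    rw [this]
    have : (0 : ℝ) ≤ (a : ℝ) / b * o := by positivity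
    linarith

theorem approxProg_runsOn : ∃ (C : ℕ) (D : ℕ → ℕ), ∀ (S : WString) (k a b : ℕ),
    0 < a → 2 * a ≤ b →
    approxProg.compile.RunsOn C S [k, a, b] fun out t =>
      (∀ c : ℕ, c < 2 * S.length - 1 → ∃ r : ℕ, IsMaxRadius S k c r ∧
        out c ≤ r ∧ (r : ℝ) ≤ (1 + (a : ℝ) / b) * out c) ∧
      (∀ A : Finset ℕ, A.Nonempty → S.Over A →
        (t : ℝ) ≤ C * (1 + 1 / ((a : ℝ) / b) *
          fS A.card S.length * Real.log S.length)) ∧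
      (∀ A : Finset ℕ, A.Nonempty → S.Over A →
        (t : ℝ) ≤ D A.card * (1 + 1 / ((a : ℝ) / b) *
          (S.length * Real.log S.length ^ 2))) := by
  obtain ⟨K, hK⟩ : ∃ K, K = approxTime := ⟨_, rfl⟩
  -- The constant is `3 * 4 * 204`, from `log_succ_le`, from `q ≤ 4 b / a` and from `unitCost_le`.
  refine ⟨2448 * K + 520, fun σ => 2448 * K * (σ + 1), fun S k a b ha hab =>
    runsOn_of_tri (by omega) (fun W M hW => approxProg_tri S k a b hW rfl) ?_⟩
  rw [← hK]
  intro v t out h ht ho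
  set n := S.length with hn
  set q := 2 * (min (b / a) n + 1) with hq
  have hlog := Real.log_natCast_nonneg n
  have ha' : (0 : ℝ) < a := by exact_mod_cast ha
  have hab' : 2 * (a : ℝ) ≤ b := by exact_mod_cast hab
  have hba : 2 ≤ (b : ℝ) / a := by rw [le_div_iff₀ ha']; exact hab'
  rw [one_div_div]
  have key : ∀ A : Finset ℕ, A.Nonempty → S.Over A →
      (t : ℝ) ≤ 2448 * K * (1 + b / a * fS A.card n * Real.log n) := by
    intro A hA hS
    have hf := fS_nonneg A.card n
    have h1 : (((Nat.log 2 n + 1) * (q * ((n + 1) * unitCost (code S) n)) : ℕ) : ℝ) ≤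
        2448 * (1 + b / a * fS A.card n * Real.log n) := by
      have h0 : 0 ≤ b / a * fS A.card n * Real.log n := by positivity
      rcases lt_or_ge n 2 with h | h
      · have : (Nat.log 2 n + 1) * (q * ((n + 1) * unitCost (code S) n)) ≤ 1 * (4 * 138) :=
          Nat.mul_le_mul (by rw [Nat.log_of_lt h]) (Nat.mul_le_mul (by omega) (unitCost_le_of_lt h))
        have : (((Nat.log 2 n + 1) * (q * ((n + 1) * unitCost (code S) n)) : ℕ) : ℝ) ≤ (1 * (4 * 138) : ℕ) := by
          exact_mod_cast this
        push_cast at this ⊢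
        linarith
      · have h2 : (q : ℝ) ≤ 4 * (b / a) := by
          have : (q : ℝ) ≤ 2 * ((b / a : ℕ) + 1) := by
            exact_mod_cast Nat.mul_le_mul_left 2 (Nat.succ_le_succ (min_le_left (b / a) n))
          have : ((b / a : ℕ) : ℝ) ≤ b / a := Nat.cast_div_le
          linarith
        rw [Nat.cast_mul, Nat.cast_mul]
        calc _ ≤ (3 * Real.log n) * ((4 * (b / a)) * (204 * fS A.card n)) :=
              mul_le_mul (log_succ_le h) (mul_le_mul h2 (unitCost_le hA hS h) (by positivity) (by positivity))
                (by positivity) (by positivity)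
          _ = 2448 * (b / a * fS A.card n * Real.log n) := by ring
          _ ≤ _ := by linarith
    calc (t : ℝ) ≤ K * (((Nat.log 2 n + 1) * (q * ((n + 1) * unitCost (code S) n)) : ℕ) : ℝ) := by exact_mod_cast ht
      _ ≤ K * (2448 * (1 + b / a * fS A.card n * Real.log n)) := by gcongr
      _ = _ := by ring
  refine ⟨fun c hc => ⟨_, isMaxRadius_best S k hc, ?_⟩, fun A hA hS => ?_, fun A hA hS => ?_⟩
  · obtain ⟨h1, h2⟩ := h c hc
    rw [ho c (by omega)]
    refine ⟨h1, le_of_near ha (by omega) hq ((best_le _ _ _ _).trans ?_) h2 h1⟩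
    unfold maxRad
    omega
  · refine (key A hA hS).trans ?_
    have hf := fS_nonneg A.card n
    have h0 : 0 ≤ b / a * fS A.card n * Real.log n := by positivity
    push_cast
    nlinarith
  · refine (key A hA hS).trans ?_
    have h1 : b / a * fS A.card n * Real.log n ≤ b / a * (A.card * (n * Real.log n)) * Real.log n := by
      gcongr; exact fS_le_mul_log _ _
    have h2 : 1 + b / a * fS A.card n * Real.log n ≤ (A.card + 1) * (1 + b / a * (n * Real.log n ^ 2)) := by
      have h3 : (0 : ℝ) ≤ A.card := by positivity
      have h4 : 0 ≤ b / a * (n * Real.log n ^ 2) := by positivity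
      linarith
    calc _ ≤ 2448 * K * ((A.card + 1) * (1 + b / a * (n * Real.log n ^ 2))) := by gcongr
      _ = _ := by push_cast; ring

end VM

theorem mainTheorem5 :
    -- counting convolution of a string with its reverse: time `O(f_S(n))`, linear space
    (∃ (p : RAM.Prog) (C : ℕ), ∀ S : WString,
      p.RunsOn C S [] fun out t =>
        (∀ i : ℕ, 1 ≤ i → i ≤ 2 * S.length - 1 → out (i - 1) = cconv S S.reverse i) ∧
        (∀ A : Finset ℕ, A.Nonempty → S.Over A →
          (t : ℝ) ≤ C * (1 + fS A.card S.length))) ∧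
    -- precise algorithm: all maximal `k`-palindromes
    (∃ (p : RAM.Prog) (C : ℕ) (D : ℕ → ℕ), ∀ (S : WString) (k : ℕ),
      p.RunsOn C S [k] fun out t =>
        (∀ c : ℕ, c < 2 * S.length - 1 → IsMaxRadius S k c (out c)) ∧
        (∀ A : Finset ℕ, A.Nonempty → S.Over A →
          (t : ℝ) ≤ C * (1 + S.length * Real.sqrt (fS A.card S.length))) ∧
        (t : ℝ) ≤ C * (1 + (S.length : ℝ) ^ (7 / 4 : ℝ) *
          Real.log S.length ^ (1 / 4 : ℝ)) ∧
        (∀ A : Finset ℕ, A.Nonempty → S.Over A →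
          (t : ℝ) ≤ D A.card *
            (1 + S.length * Real.sqrt (S.length * Real.log S.length)))) ∧
    -- approximation algorithm, with `ε = a / b` and `0 < ε ≤ 1 / 2`
    (∃ (p : RAM.Prog) (C : ℕ) (D : ℕ → ℕ), ∀ (S : WString) (k a b : ℕ),
      0 < a → 2 * a ≤ b →
      p.RunsOn C S [k, a, b] fun out t =>
        (∀ c : ℕ, c < 2 * S.length - 1 → ∃ r : ℕ, IsMaxRadius S k c r ∧
          out c ≤ r ∧ (r : ℝ) ≤ (1 + (a : ℝ) / b) * out c) ∧
        (∀ A : Finset ℕ, A.Nonempty → S.Over A →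
          (t : ℝ) ≤ C * (1 + 1 / ((a : ℝ) / b) *
            fS A.card S.length * Real.log S.length)) ∧
        (∀ A : Finset ℕ, A.Nonempty → S.Over A →
          (t : ℝ) ≤ D A.card * (1 + 1 / ((a : ℝ) / b) *
            (S.length * Real.log S.length ^ 2)))) := by
  obtain ⟨C₁, h₁⟩ := VM.selfConvProg_runsOn
  obtain ⟨C₂, D₂, h₂⟩ := VM.radiusProg_runsOn
  obtain ⟨C₃, D₃, h₃⟩ := VM.approxProg_runsOn
  exact ⟨⟨_, C₁, h₁⟩, ⟨_, C₂, D₂, h₂⟩, ⟨_, C₃, D₃, h₃⟩⟩
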